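/- **Setting.** Let $n\ge 1$, $T>0$, $s>0$, and let $\Omega\subset\mathbb R^n$ be a bounded Lipschitz domain (nonempty, open, connected) with exterior $\Omega_e=\mathbb R^n\setminus\overline\Omega$; write $A_T=A\times(0,T)$. All functions are real-valued. $H^s(\mathbb R^n)$ has the norm $\|u\|_{H^s}=\|\langle D\rangle^s u\|_{L^2(\mathbb R^n)}$, where $\langle D\rangle^s$ has Fourier symbol $(1+|\xi|^2)^{s/2}$; $\widetilde H^s(\Omega)$ is the closure of $C_c^\infty(\Omega)$ in $H^s(\mathbb R^n)$, with dual $H^{-s}(\Omega)$; and $(-\Delta)^{s/2}$ has Fourier symbol $|\xi|^s$. For $(V,H)=(\widetilde H^s(\Omega),L^2(\Omega))$ or $(H^s(\mathbb R^n),L^2(\mathbb R^n))$, with $H\hookrightarrow V'$ by identifying $H$ with its dual, put $$\widetilde W(0,T;V)=\{u\in L^2(0,T;V):\ \partial_t u\in L^2(0,T;V),\ \partial_t^2u\in L^2(0,T;V')\},$$ $$\|u\|_{\widetilde W(0,T;V)}=\big(\|u\|_{L^2(0,T;V)}^2+\|\partial_tu\|_{L^2(0,T;V)}^2+\|\partial_t^2u\|_{L^2(0,T;V')}^2\big)^{1/2},$$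 where for such $u$ the initial values $u(0)\in V$ and $\partial_tu(0)\in H$ are those of the representatives in $C([0,T];V)$ and $C([0,T];H)$. Put further - $\widetilde W_*(0,T;H^s(\mathbb R^n))=\{v\in\widetilde W(0,T;H^s(\mathbb R^n)):\ v(0)\in\widetilde H^s(\Omega),\ \partial_tv(0)\in L^2(\Omega)\}$, where $L^2(\Omega)\subset L^2(\mathbb R^n)$ by extension by zero; - $\widetilde W_{ext}(0,T;\widetilde H^s(\Omega))=\widetilde W(0,T;\widetilde H^s(\Omega))+\widetilde W_*(0,T;H^s(\mathbb R^n))\subset H^1(0,T;H^s(\mathbb R^n))$, with norm $\inf\{\|v\|_{\widetilde W(0,T;\widetilde H^s(\Omega))}+\|\psi\|_{\widetilde W(0,T;H^s(\mathbb R^n))}:\ u=v+\psi\}$; - $\widetilde W^s_{rest}((\Omega_e)_T)=\{v|_{(\Omega_e)_T}:\ v\in\widetilde W_*(0,T;H^s(\mathbb R^n))\}$, with the quotient norm. Let $f:\Omega\times\mathbb R\to\mathbb R$ be a Carathéodory function (continuous in $\tau$ for a.e. $x$, measurable in $x$ for all $\tau$) with a partial derivative $\partial_\tau f$ that is again a Carathéodory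 function. Suppose that $f(x,0)=0$ for a.e. $x\in\Omega$, and that there are $C>0$, $a\in L^\infty(\Omega)$ and $r>0$ with $$|\partial_\tau f(x,\tau)|\le C\,(a(x)+|\tau|^r)\quad\text{for all }\tau\in\mathbb R\text{ and a.e. }x\in\Omega,\qquad r\le\tfrac{2s}{n-2s}\ \text{ if }2s<n.$$ **Theorem.** There exist open neighborhoods $U_0$ of $0$ in $\widetilde W^s_{rest}((\Omega_e)_T)$ and $U_1$ of $0$ in $\widetilde W_{ext}(0,T;\widetilde H^s(\Omega))$ such that for every $\varphi\in U_0$ the problem $$\begin{cases}\partial_t^2u+(-\Delta)^s\partial_tu+(-\Delta)^su+f(u)=0&\text{in }\Omega_T,\\ u=\varphi&\text{in }(\Omega_e)_T,\\ u(0)=0,\ \partial_tu(0)=0&\text{in }\Omega\end{cases}$$ has exactly one solution $u=S(\varphi)$ in $U_1$. Here a solution is a $u\in\widetilde W_{ext}(0,T;\widetilde H^s(\Omega))$ such that 1. for all $v\in\widetilde H^s(\Omega)$, in the sense of $\mathscr D'((0,T))$, $$\frac{d}{dt}\langle\partial_tu,v\rangle_{L^2(\Omega)}+\langle(-\Delta)^{s/2}\partial_tu,(-\Delta)^{s/2}v\rangle_{L^2(\mathbb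 R^n)}+\langle(-\Delta)^{s/2}u,(-\Delta)^{s/2}v\rangle_{L^2(\mathbb R^n)}+\langle f(u),v\rangle_{L^2(\Omega)}=0,$$ where $f(u)(x,t)=f(x,u(x,t))$; 2. $u=\varphi$ in $(\Omega_e)_T$; 3. $u(0)=0$ in $\widetilde H^s(\Omega)$ and $\partial_tu(0)=0$ in $L^2(\Omega)$. Moreover, the solution map $U_0\ni\varphi\mapsto S(\varphi)\in U_1$ is $C^1$ in the Fréchet sense. -/

import Mathlib

open MeasureTheory Set Topology
open scoped NNReal ENNReal ContDiff FourierTransform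

noncomputable section

namespace ViscousWave

/-! ### Bounded Lipschitz domains -/

/-- `Ω ⊆ ℝⁿ` is a bounded Lipschitz domain: a bounded, nonempty, connected open set which, near each
of its boundary points and in suitable orthonormal coordinates, is the strict subgraph of a
Lipschitz function. Here `ν` is the vertical direction, the graph lives over `νᗮ`. -/
structure IsBoundedLipschitzDomain {n : ℕ} (Ω : Set (EuclideanSpace ℝ (Fin n))) : Prop where
  isOpen : IsOpen Ω
  isConnected : IsConnected Ω
  isBounded : Bornology.IsBounded Ω
  lipschitz_boundary : ∀ x₀ ∈ frontier Ω,
    ∃ (ν : EuclideanSpace ℝ (Fin n)) (U : Set (EuclideanSpace ℝ (Fin n)))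
      (K : ℝ≥0) (γ : (ℝ ∙ ν)ᗮ → ℝ),
      ‖ν‖ = 1 ∧ IsOpen U ∧ x₀ ∈ U ∧ LipschitzWith K γ ∧
        Ω ∩ U = {x ∈ U | inner ℝ x ν < γ ((ℝ ∙ ν)ᗮ.orthogonalProjectionOnto x)}

/-! ### Fractional Sobolev spaces of real-valued functions -/

/-- Real-valued `L²(ℝⁿ)`. -/
abbrev L2R (n : ℕ) : Type := Lp ℝ 2 (volume : Measure (EuclideanSpace ℝ (Fin n)))

/-- Complex-valued `L²(ℝⁿ)`. -/
abbrev L2C (n : ℕ) : Type := Lp ℂ 2 (volume : Measure (EuclideanSpace ℝ (Fin n)))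

/-- Real-valued `L²(Ω)`. -/
abbrev L2On {n : ℕ} (Ω : Set (EuclideanSpace ℝ (Fin n))) : Type :=
  Lp ℝ 2 ((volume : Measure (EuclideanSpace ℝ (Fin n))).restrict Ω)

/-- The Fourier transform on `L²(ℝⁿ; ℂ)`, with Mathlib's normalization
`∫ u(x) exp(-2πi x·ξ) dx`. The frequency variable of the normalization `∫ u(x) exp(-i x·ξ) dx` is
`2π` times the present one, which is why the symbols below are evaluated at `2π‖ξ‖`. -/
def fourierC (n : ℕ) : L2C n ≃ₗᵢ[ℂ] L2C n :=
  Lp.fourierTransformₗᵢ (EuclideanSpace ℝ (Fin n)) ℂ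

/-- The Fourier transform of a real-valued `L²` function. -/
def fourierR (n : ℕ) : L2R n →L[ℝ] L2C n :=
  ((fourierC n).toContinuousLinearEquiv.toContinuousLinearMap.restrictScalars ℝ).comp
    (Complex.ofRealCLM.compLpL 2 volume)

theorem norm_fourierR {n : ℕ} (u : L2R n) : ‖fourierR n u‖ = ‖u‖ := by
  have h : ‖fourierR n u‖ = ‖Complex.ofRealCLM.compLpL 2 volume u‖ :=
    (fourierC n).norm_map _
  rw [h]
  apply le_antisymm
  · apply Lp.norm_le_norm_of_ae_le
    filter_upwards [Complex.ofRealCLM.coeFn_compLpL (p := 2) (μ := volume) u] with x hx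
    rw [hx]; simp
  · apply Lp.norm_le_norm_of_ae_le
    filter_upwards [Complex.ofRealCLM.coeFn_compLpL (p := 2) (μ := volume) u] with x hx
    rw [hx]; simp

/-- The symbol `⟨ξ⟩ˢ = (1 + |ξ|²)^{s/2}` of the Bessel potential operator `⟨D⟩ˢ`. -/
def besselSymbol (n : ℕ) (s : ℝ≥0) (ξ : EuclideanSpace ℝ (Fin n)) : ℝ :=
  (1 + (2 * Real.pi * ‖ξ‖) ^ 2) ^ ((s : ℝ) / 2)

/-- The symbol `|ξ|ˢ` of `(-Δ)^{s/2}`. -/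
def fracSymbol (n : ℕ) (s : ℝ≥0) (ξ : EuclideanSpace ℝ (Fin n)) : ℝ :=
  (2 * Real.pi * ‖ξ‖) ^ (s : ℝ)

theorem one_le_besselSymbol (n : ℕ) (s : ℝ≥0) (ξ : EuclideanSpace ℝ (Fin n)) :
    1 ≤ besselSymbol n s ξ :=
  Real.one_le_rpow (by nlinarith [sq_nonneg (2 * Real.pi * ‖ξ‖)]) (by positivity)

theorem continuous_besselSymbol (n : ℕ) (s : ℝ≥0) : Continuous (besselSymbol n s) := by
  unfold besselSymbol
  exact Continuous.rpow_const (by fun_prop) fun ξ => Or.inr (by positivity)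

theorem continuous_fracSymbol (n : ℕ) (s : ℝ≥0) : Continuous (fracSymbol n s) := by
  unfold fracSymbol
  exact Continuous.rpow_const (by fun_prop) fun ξ => Or.inr (by positivity)

theorem abs_besselSymbol_le (n : ℕ) (s : ℝ≥0) (ξ : EuclideanSpace ℝ (Fin n)) :
    |besselSymbol n s ξ| ≤ besselSymbol n s ξ :=
  (abs_of_nonneg (zero_le_one.trans (one_le_besselSymbol n s ξ))).le

theorem abs_fracSymbol_le (n : ℕ) (s : ℝ≥0) (ξ : EuclideanSpace ℝ (Fin n)) :
    |fracSymbol n s ξ| ≤ besselSymbol n s ξ := by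
  have h0 : 0 ≤ 2 * Real.pi * ‖ξ‖ := by positivity
  unfold fracSymbol besselSymbol
  rw [abs_of_nonneg (Real.rpow_nonneg h0 _)]
  have h1 : (2 * Real.pi * ‖ξ‖) ^ (s : ℝ) = ((2 * Real.pi * ‖ξ‖) ^ 2) ^ ((s : ℝ) / 2) := by
    rw [← Real.rpow_natCast, ← Real.rpow_mul h0]
    congr 1
    push_cast
    ring
  rw [h1]
  exact Real.rpow_le_rpow (by positivity) (by linarith) (by positivity)

/-- `Hˢ(ℝⁿ)`, `s ≥ 0`, as a set of real-valued `L²` functions: `⟨ξ⟩ˢ û ∈ L²`. -/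
def HsSubmodule (n : ℕ) (s : ℝ≥0) : Submodule ℝ (L2R n) where
  carrier := {u | MemLp (fun ξ => besselSymbol n s ξ • fourierR n u ξ) 2 volume}
  zero_mem' := by
    have h : (fun ξ => besselSymbol n s ξ • fourierR n 0 ξ) =ᵐ[volume] 0 := by
      rw [map_zero]
      filter_upwards [Lp.coeFn_zero ℂ 2 (volume : Measure (EuclideanSpace ℝ (Fin n)))] with ξ hξ
      rw [hξ]; simp
    exact (memLp_congr_ae h).2 MemLp.zero
  add_mem' := by
    intro u v hu hv
    refine (memLp_congr_ae ?_).2 (hu.add hv)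
    rw [map_add]
    filter_upwards [Lp.coeFn_add (fourierR n u) (fourierR n v)] with ξ hξ
    rw [hξ]; simp
  smul_mem' := by
    intro c u hu
    refine (memLp_congr_ae ?_).2 (hu.const_smul c)
    rw [map_smul]
    filter_upwards [Lp.coeFn_smul c (fourierR n u)] with ξ hξ
    rw [hξ]; simp [mul_left_comm]

/-- The real Sobolev space `Hˢ(ℝⁿ)`; it carries the norm `‖⟨D⟩ˢ u‖_{L²}` defined below. -/
def Hs (n : ℕ) (s : ℝ≥0) : Type := HsSubmodule n s

instance (n : ℕ) (s : ℝ≥0) : AddCommGroup (Hs n s) := inferInstanceAs (AddCommGroup (HsSubmodule n s))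

instance (n : ℕ) (s : ℝ≥0) : Module ℝ (Hs n s) := inferInstanceAs (Module ℝ (HsSubmodule n s))

/-- The inclusion `Hˢ(ℝⁿ) → L²(ℝⁿ)` as a linear map. -/
def Hs.incl (n : ℕ) (s : ℝ≥0) : Hs n s →ₗ[ℝ] L2R n := (HsSubmodule n s).subtype

theorem memLp_symbol {n : ℕ} {s : ℝ≥0} {m : EuclideanSpace ℝ (Fin n) → ℝ} (hm : Continuous m)
    (hle : ∀ ξ, |m ξ| ≤ besselSymbol n s ξ) (u : Hs n s) :
    MemLp (fun ξ => m ξ • fourierR n (Hs.incl n s u) ξ) 2 volume := by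
  have hu : MemLp (fun ξ => besselSymbol n s ξ • fourierR n (Hs.incl n s u) ξ) 2 volume := u.2
  refine hu.mono (hm.aestronglyMeasurable.smul (Lp.aestronglyMeasurable _)) ?_
  filter_upwards with ξ
  rw [norm_smul, norm_smul]
  exact mul_le_mul_of_nonneg_right ((hle ξ).trans (le_abs_self _)) (norm_nonneg _)

/-- The Fourier multiplier `u ↦ 𝓕⁻¹(m û)` on `Hˢ(ℝⁿ)` with values in `L²`, for a continuous symbol
dominated by `⟨ξ⟩ˢ`. -/
def multiplier {n : ℕ} {s : ℝ≥0} (m : EuclideanSpace ℝ (Fin n) → ℝ) (hm : Continuous m)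
    (hle : ∀ ξ, |m ξ| ≤ besselSymbol n s ξ) : Hs n s →ₗ[ℝ] L2C n where
  toFun u := (fourierC n).symm ((memLp_symbol hm hle u).toLp _)
  map_add' u v := by
    rw [← map_add]
    congr 1
    rw [← MemLp.toLp_add, MemLp.toLp_eq_toLp_iff]
    simp only [map_add]
    filter_upwards [Lp.coeFn_add (fourierR n (Hs.incl n s u)) (fourierR n (Hs.incl n s v))]
      with ξ hξ
    rw [hξ]; simp
  map_smul' c u := by
    have h : ((memLp_symbol hm hle (c • u)).toLp _) = (c : ℂ) • ((memLp_symbol hm hle u).toLp _) := by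
      rw [← MemLp.toLp_const_smul, MemLp.toLp_eq_toLp_iff]
      simp only [map_smul]
      filter_upwards [Lp.coeFn_smul c (fourierR n (Hs.incl n s u))] with ξ hξ
      rw [hξ]; simp [mul_left_comm]
    rw [h, map_smul]
    rfl

/-- The Bessel potential operator `⟨D⟩ˢ : Hˢ(ℝⁿ) → L²(ℝⁿ)`. -/
def bessel (n : ℕ) (s : ℝ≥0) : Hs n s →ₗ[ℝ] L2C n :=
  multiplier (besselSymbol n s) (continuous_besselSymbol n s) (abs_besselSymbol_le n s)

/-- The operator `(-Δ)^{s/2} : Hˢ(ℝⁿ) → L²(ℝⁿ)`. -/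
def fracLapHalf (n : ℕ) (s : ℝ≥0) : Hs n s →ₗ[ℝ] L2C n :=
  multiplier (fracSymbol n s) (continuous_fracSymbol n s) (abs_fracSymbol_le n s)

theorem norm_incl_le_bessel {n : ℕ} {s : ℝ≥0} (u : Hs n s) :
    ‖Hs.incl n s u‖ ≤ ‖bessel n s u‖ := by
  have h : ‖bessel n s u‖ = ‖(memLp_symbol (continuous_besselSymbol n s)
      (abs_besselSymbol_le n s) u).toLp _‖ := (fourierC n).symm.norm_map _
  rw [h, ← norm_fourierR]
  apply Lp.norm_le_norm_of_ae_le
  filter_upwards [MemLp.coeFn_toLp (memLp_symbol (continuous_besselSymbol n s)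
      (abs_besselSymbol_le n s) u)] with ξ hξ
  rw [hξ, norm_smul]
  have h1 := (one_le_besselSymbol n s ξ).trans (le_abs_self _)
  exact le_mul_of_one_le_left (norm_nonneg _) h1

theorem incl_injective (n : ℕ) (s : ℝ≥0) : Function.Injective (Hs.incl n s) :=
  Subtype.val_injective

theorem bessel_injective (n : ℕ) (s : ℝ≥0) : Function.Injective (bessel n s) := by
  rw [injective_iff_map_eq_zero]
  intro u hu
  have h := norm_incl_le_bessel u
  rw [hu, norm_zero] at h
  exact incl_injective n s ((norm_le_zero_iff.1 h).trans (map_zero _).symm)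

/-- The norm `‖u‖_{Hˢ} = ‖⟨D⟩ˢ u‖_{L²}`. -/
instance (n : ℕ) (s : ℝ≥0) : NormedAddCommGroup (Hs n s) :=
  NormedAddCommGroup.induced _ _ (bessel n s) (bessel_injective n s)

instance (n : ℕ) (s : ℝ≥0) : NormedSpace ℝ (Hs n s) := NormedSpace.induced ℝ _ _ (bessel n s)

theorem Hs.norm_eq {n : ℕ} {s : ℝ≥0} (u : Hs n s) : ‖u‖ = ‖bessel n s u‖ := rfl

/-- The continuous inclusion `Hˢ(ℝⁿ) → L²(ℝⁿ)`. -/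
def Hs.toL2 (n : ℕ) (s : ℝ≥0) : Hs n s →L[ℝ] L2R n :=
  (Hs.incl n s).mkContinuous 1 fun u => by rw [one_mul]; exact norm_incl_le_bessel u

theorem memLp_besselInv {n : ℕ} {s : ℝ≥0} (g : L2C n) :
    MemLp (fun ξ => (besselSymbol n s ξ)⁻¹ • g ξ) 2 volume := by
  refine (Lp.memLp g).mono
    (((continuous_besselSymbol n s).inv₀
      fun ξ => (zero_lt_one.trans_le (one_le_besselSymbol n s ξ)).ne').aestronglyMeasurable.smul
      (Lp.aestronglyMeasurable _)) ?_
  filter_upwards with ξ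
  have h1 := one_le_besselSymbol n s ξ
  rw [norm_smul, norm_inv, Real.norm_of_nonneg (zero_le_one.trans h1)]
  exact mul_le_of_le_one_left (norm_nonneg _) (inv_le_one_of_one_le₀ h1)

/-- Division by `⟨ξ⟩ˢ`, a bounded operator of `L²`. -/
def besselInv (n : ℕ) (s : ℝ≥0) : L2C n →L[ℝ] L2C n :=
  LinearMap.mkContinuous
    { toFun := fun g => (memLp_besselInv (s := s) g).toLp _
      map_add' := fun g h => by
        rw [← MemLp.toLp_add, MemLp.toLp_eq_toLp_iff]
        filter_upwards [Lp.coeFn_add g h] with ξ hξ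
        rw [hξ]; simp
      map_smul' := fun c g => by
        rw [RingHom.id_apply, ← MemLp.toLp_const_smul, MemLp.toLp_eq_toLp_iff]
        filter_upwards [Lp.coeFn_smul c g] with ξ hξ
        rw [hξ]; simp [mul_left_comm] }
    1 fun g => by
      rw [one_mul]
      apply Lp.norm_le_norm_of_ae_le
      change ∀ᵐ x, ‖((memLp_besselInv (s := s) g).toLp _) x‖ ≤ _
      filter_upwards [(memLp_besselInv (s := s) g).coeFn_toLp] with ξ hξ
      have h1 := one_le_besselSymbol n s ξ
      rw [hξ, norm_smul, norm_inv, Real.norm_of_nonneg (zero_le_one.trans h1)]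
      exact mul_le_of_le_one_left (norm_nonneg _) (inv_le_one_of_one_le₀ h1)

theorem coeFn_besselInv {n : ℕ} {s : ℝ≥0} (g : L2C n) :
    besselInv n s g =ᵐ[volume] fun ξ => (besselSymbol n s ξ)⁻¹ • g ξ :=
  MemLp.coeFn_toLp (memLp_besselInv g)

theorem mem_range_bessel_iff {n : ℕ} {s : ℝ≥0} (g : L2C n) :
    g ∈ range (bessel n s) ↔ besselInv n s (fourierC n g) ∈ range (fourierR n) := by
  constructor
  · rintro ⟨u, rfl⟩
    refine ⟨Hs.incl n s u, ?_⟩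
    have h : fourierC n (bessel n s u) = (memLp_symbol (continuous_besselSymbol n s)
      (abs_besselSymbol_le n s) u).toLp _ := (fourierC n).apply_symm_apply _
    rw [h]
    apply Lp.ext
    filter_upwards [coeFn_besselInv (s := s) ((memLp_symbol (continuous_besselSymbol n s)
      (abs_besselSymbol_le n s) u).toLp _), MemLp.coeFn_toLp (memLp_symbol
      (continuous_besselSymbol n s) (abs_besselSymbol_le n s) u)] with ξ h1 h2
    rw [h1, h2, inv_smul_smul₀ (zero_lt_one.trans_le (one_le_besselSymbol n s ξ)).ne']
  · rintro ⟨u, hu⟩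
    have hae : (fun ξ => besselSymbol n s ξ • fourierR n u ξ) =ᵐ[volume] fourierC n g := by
      rw [hu]
      filter_upwards [coeFn_besselInv (s := s) (fourierC n g)] with ξ hξ
      rw [hξ, smul_inv_smul₀ (zero_lt_one.trans_le (one_le_besselSymbol n s ξ)).ne']
    have hmem : u ∈ HsSubmodule n s := (memLp_congr_ae hae).2 (Lp.memLp _)
    refine ⟨(⟨u, hmem⟩ : HsSubmodule n s), ?_⟩
    apply (fourierC n).injective
    refine ((fourierC n).apply_symm_apply _).trans ?_
    apply Lp.ext
    exact (MemLp.coeFn_toLp _).trans hae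

instance (n : ℕ) (s : ℝ≥0) : CompleteSpace (Hs n s) := by
  have hiso : Isometry (bessel n s) := AddMonoidHomClass.isometry_of_norm _ fun u => rfl
  rw [completeSpace_iff_isComplete_range hiso.isUniformInducing]
  have hF : IsClosed (range (fourierR n)) :=
    (AddMonoidHomClass.isometry_of_norm (fourierR n)
      norm_fourierR).isClosedEmbedding.isClosed_range
  have h : range (bessel n s) = (fun g => besselInv n s (fourierC n g)) ⁻¹' range (fourierR n) := by
    ext g
    exact mem_range_bessel_iff g
  rw [h]
  exact (hF.preimage ((besselInv n s).continuous.comp (fourierC n).continuous)).isComplete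

/-- The bilinear form `⟨(-Δ)^{s/2} u, (-Δ)^{s/2} v⟩_{L²(ℝⁿ)}`. As `u` and `v` are real-valued, so
are the two functions, and the complex scalar product is real. -/
def fracForm {n : ℕ} {s : ℝ≥0} (u v : Hs n s) : ℝ :=
  (inner ℂ (fracLapHalf n s u) (fracLapHalf n s v)).re

/-- The elements of `Hˢ(ℝⁿ)` that are (represented by) functions in `C_c^∞(Ω)`. -/
def testHs {n : ℕ} (s : ℝ≥0) (Ω : Set (EuclideanSpace ℝ (Fin n))) : Submodule ℝ (Hs n s) where
  carrier := {u | ∃ φ : EuclideanSpace ℝ (Fin n) → ℝ, ContDiff ℝ ∞ φ ∧ HasCompactSupport φ ∧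
    tsupport φ ⊆ Ω ∧ Hs.toL2 n s u =ᵐ[volume] φ}
  zero_mem' := ⟨0, contDiff_const, HasCompactSupport.zero, by simp [tsupport],
    by rw [map_zero]; exact Lp.coeFn_zero _ _ _⟩
  add_mem' := by
    rintro u v ⟨φ, h1, h2, h3, h4⟩ ⟨ψ, k1, k2, k3, k4⟩
    refine ⟨φ + ψ, h1.add k1, h2.add k2, (tsupport_add φ ψ).trans (union_subset h3 k3), ?_⟩
    rw [map_add]
    exact (Lp.coeFn_add _ _).trans (h4.add k4)
  smul_mem' := by
    rintro c u ⟨φ, h1, h2, h3, h4⟩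
    refine ⟨c • φ, contDiff_const.smul h1, h2.smul_left (f := fun _ => c),
      (closure_mono (Function.support_const_smul_subset c φ)).trans h3, ?_⟩
    rw [map_smul]
    exact (Lp.coeFn_smul _ _).trans (h4.const_smul c)

/-- `H̃ˢ(Ω)`: the closure of `C_c^∞(Ω)` in `Hˢ(ℝⁿ)`, with the norm of `Hˢ(ℝⁿ)`. -/
def HsTilde {n : ℕ} (s : ℝ≥0) (Ω : Set (EuclideanSpace ℝ (Fin n))) : Submodule ℝ (Hs n s) :=
  (testHs s Ω).topologicalClosure

instance {n : ℕ} (s : ℝ≥0) (Ω : Set (EuclideanSpace ℝ (Fin n))) : CompleteSpace (HsTilde s Ω) :=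
  (Submodule.isClosed_topologicalClosure (testHs s Ω)).completeSpace_coe

/-- Restriction `Hˢ(ℝⁿ) → L²(A)`. -/
def Hs.restrict {n : ℕ} (s : ℝ≥0) (A : Set (EuclideanSpace ℝ (Fin n))) : Hs n s →L[ℝ] L2On A :=
  (LpToLpRestrictCLM (EuclideanSpace ℝ (Fin n)) ℝ ℝ volume 2 A).comp (Hs.toL2 n s)

/-- The embedding `H̃ˢ(Ω) → L²(Ω)`. -/
def HsTilde.toL2 {n : ℕ} (s : ℝ≥0) (Ω : Set (EuclideanSpace ℝ (Fin n))) :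
    HsTilde s Ω →L[ℝ] L2On Ω :=
  (Hs.restrict s Ω).comp (HsTilde s Ω).subtypeL

/-! ### Images of continuous linear maps with the quotient norm -/

/-- The image of `A : X → Y`, with the quotient norm `inf {‖x‖ ; A x = y}`. An element `y` is
represented by the class of all `x` with `A x = y`. -/
def ImageSpace {X Y : Type} [NormedAddCommGroup X] [NormedSpace ℝ X] [NormedAddCommGroup Y]
    [NormedSpace ℝ Y] (A : X →L[ℝ] Y) : Type :=
  X ⧸ LinearMap.ker A.toLinearMap

section ImageSpace

variable {X Y : Type} [NormedAddCommGroup X] [NormedSpace ℝ X] [NormedAddCommGroup Y]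
  [NormedSpace ℝ Y] (A : X →L[ℝ] Y)

instance : NormedAddCommGroup (ImageSpace A) :=
  haveI : IsClosed (LinearMap.ker A.toLinearMap : Set X) := A.isClosed_ker
  inferInstanceAs (NormedAddCommGroup (X ⧸ LinearMap.ker A.toLinearMap))

instance : NormedSpace ℝ (ImageSpace A) :=
  haveI : IsClosed (LinearMap.ker A.toLinearMap : Set X) := A.isClosed_ker
  inferInstanceAs (NormedSpace ℝ (X ⧸ LinearMap.ker A.toLinearMap))

/-- The inclusion of the image of `A` into `Y`. -/
def ImageSpace.val : ImageSpace A →ₗ[ℝ] Y :=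
  (LinearMap.ker A.toLinearMap).liftQ A.toLinearMap le_rfl

/-- The map `X → ImageSpace A` given by `A`. -/
def ImageSpace.mk : X →ₗ[ℝ] ImageSpace A := (LinearMap.ker A.toLinearMap).mkQ

theorem ImageSpace.val_mk (x : X) : ImageSpace.val A (ImageSpace.mk A x) = A x := rfl

theorem ImageSpace.val_injective : Function.Injective (ImageSpace.val A) :=
  LinearMap.ker_eq_bot.1 (Submodule.ker_liftQ_eq_bot _ _ _ le_rfl)

end ImageSpace

/-! ### Time-dependent functions -/

/-- Lebesgue measure on `(0,T)`. -/
abbrev timeMeasure (T : ℝ) : Measure ℝ := volume.restrict (Ioo 0 T)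

/-- The Bochner space `L²(0,T;X)`. -/
abbrev L2T (T : ℝ) (X : Type) [NormedAddCommGroup X] : Type := Lp X 2 (timeMeasure T)

/-- `η ∈ C_c^∞((0,T))`. -/
def IsTimeTest (T : ℝ) (η : ℝ → ℝ) : Prop :=
  ContDiff ℝ ∞ η ∧ HasCompactSupport η ∧ tsupport η ⊆ Ioo 0 T

/-- `w` is the derivative of `u` in the sense of `X`-valued distributions on `(0,T)`. -/
def IsWeakTimeDeriv (T : ℝ) {X : Type} [NormedAddCommGroup X] [NormedSpace ℝ X]
    (u w : ℝ → X) : Prop :=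
  ∀ η : ℝ → ℝ, IsTimeTest T η →
    ∫ t, deriv η t • u t ∂(timeMeasure T) = -∫ t, η t • w t ∂(timeMeasure T)

theorem IsTimeTest.integrable_smul {T : ℝ} {X : Type} [NormedAddCommGroup X] [NormedSpace ℝ X]
    {η : ℝ → ℝ} (hη : IsTimeTest T η) (u : L2T T X) :
    Integrable (fun t => η t • u t) (timeMeasure T) := by
  obtain ⟨C, hC⟩ := hη.1.continuous.bounded_above_of_compact_support hη.2.1
  exact ((Lp.memLp u).integrable (by norm_num)).bdd_smul C
    hη.1.continuous.aestronglyMeasurable (Filter.Eventually.of_forall hC)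

theorem IsTimeTest.integrable_deriv_smul {T : ℝ} {X : Type} [NormedAddCommGroup X]
    [NormedSpace ℝ X] {η : ℝ → ℝ} (hη : IsTimeTest T η) (u : L2T T X) :
    Integrable (fun t => deriv η t • u t) (timeMeasure T) := by
  have hc : Continuous (deriv η) := hη.1.continuous_deriv (by simp)
  obtain ⟨C, hC⟩ := hc.bounded_above_of_compact_support hη.2.1.deriv
  exact ((Lp.memLp u).integrable (by norm_num)).bdd_smul C
    hc.aestronglyMeasurable (Filter.Eventually.of_forall hC)

theorem IsWeakTimeDeriv.congr {T : ℝ} {X : Type} [NormedAddCommGroup X] [NormedSpace ℝ X]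
    {u w u' w' : ℝ → X} (h : IsWeakTimeDeriv T u w) (hu : u' =ᵐ[timeMeasure T] u)
    (hw : w' =ᵐ[timeMeasure T] w) : IsWeakTimeDeriv T u' w' := by
  intro η hη
  have h1 : ∫ t, deriv η t • u' t ∂(timeMeasure T) = ∫ t, deriv η t • u t ∂(timeMeasure T) :=
    integral_congr_ae (by filter_upwards [hu] with t ht; rw [ht])
  have h2 : ∫ t, η t • w' t ∂(timeMeasure T) = ∫ t, η t • w t ∂(timeMeasure T) :=
    integral_congr_ae (by filter_upwards [hw] with t ht; rw [ht])
  rw [h1, h2]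
  exact h η hη

/-- The pairs `(u, w)` in `L²(0,T;X)²` with `w = ∂ₜu`. -/
def weakDerivPairs (T : ℝ) (X : Type) [NormedAddCommGroup X] [NormedSpace ℝ X] :
    Submodule ℝ (L2T T X × L2T T X) where
  carrier := {p | IsWeakTimeDeriv T p.1 p.2}
  zero_mem' := by
    intro η _
    have h : ∀ ζ : ℝ → ℝ,
        ∫ t, ζ t • ((0 : L2T T X) : ℝ → X) t ∂(timeMeasure T) = 0 := by
      intro ζ
      rw [← integral_zero ℝ X (μ := timeMeasure T)]
      apply integral_congr_ae
      filter_upwards [Lp.coeFn_zero X 2 (timeMeasure T)] with t ht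
      rw [ht]; simp
    change ∫ t, deriv η t • ((0 : L2T T X) : ℝ → X) t ∂(timeMeasure T)
      = -∫ t, η t • ((0 : L2T T X) : ℝ → X) t ∂(timeMeasure T)
    rw [h, h, neg_zero]
  add_mem' := by
    rintro ⟨u, w⟩ ⟨u', w'⟩ h h'
    refine IsWeakTimeDeriv.congr (u := fun t => u t + u' t) (w := fun t => w t + w' t) ?_
      (Lp.coeFn_add u u') (Lp.coeFn_add w w')
    intro η hη
    simp only [smul_add]
    rw [integral_add (hη.integrable_deriv_smul u) (hη.integrable_deriv_smul u'),
      integral_add (hη.integrable_smul w) (hη.integrable_smul w'), h η hη, h' η hη]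
    abel
  smul_mem' := by
    rintro c ⟨u, w⟩ h
    refine IsWeakTimeDeriv.congr (u := fun t => c • u t) (w := fun t => c • w t) ?_
      (Lp.coeFn_smul c u) (Lp.coeFn_smul c w)
    intro η hη
    simp only [smul_comm _ c]
    rw [integral_smul, integral_smul, h η hη, smul_neg]

/-- The map `V → V'`, `u ↦ ⟨ι u, ι ·⟩_H`, that comes from an embedding `ι : V → H` when `H` is
identified with its dual. -/
def gelfandMap {V H : Type} [NormedAddCommGroup V] [NormedSpace ℝ V] [NormedAddCommGroup H]
    [InnerProductSpace ℝ H] (ι : V →L[ℝ] H) : V →L[ℝ] StrongDual ℝ V :=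
  (innerSL ℝ (E := H)).bilinearComp ι ι

/-- `W̃(0,T;V) = {u ∈ L²(0,T;V) ; ∂ₜu ∈ L²(0,T;V), ∂ₜ²u ∈ L²(0,T;V')}` for `ι : V → H`. An element
`u` is stored as the triple `(u, ∂ₜu, ∂ₜ²u)`, whose last two entries are determined by the first.
The norm is `(‖u‖²_{L²(V)} + ‖∂ₜu‖²_{L²(V)} + ‖∂ₜ²u‖²_{L²(V')})^{1/2}`. -/
def WTildeSubmodule (T : ℝ) {V H : Type} [NormedAddCommGroup V] [NormedSpace ℝ V] [NormedAddCommGroup H]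
    [InnerProductSpace ℝ H] (ι : V →L[ℝ] H) :
    Submodule ℝ (WithLp 2 (L2T T V × WithLp 2 (L2T T V × L2T T (StrongDual ℝ V)))) where
  carrier := {p | (p.fst, p.snd.fst) ∈ weakDerivPairs T V ∧
    ((gelfandMap ι).compLpL 2 (timeMeasure T) p.snd.fst, p.snd.snd) ∈
      weakDerivPairs T (StrongDual ℝ V)}
  zero_mem' := by
    constructor
    · exact (weakDerivPairs T V).zero_mem
    · have h0 : (gelfandMap ι).compLpL 2 (timeMeasure T) (0 : L2T T V) = 0 := map_zero _
      have h : ((gelfandMap ι).compLpL 2 (timeMeasure T) (0 : L2T T V),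
          (0 : L2T T (StrongDual ℝ V))) ∈ weakDerivPairs T (StrongDual ℝ V) := by
        rw [h0]
        exact (weakDerivPairs T (StrongDual ℝ V)).zero_mem
      exact h
  add_mem' := by
    rintro p q ⟨h1, h2⟩ ⟨k1, k2⟩
    refine ⟨(weakDerivPairs T V).add_mem h1 k1, ?_⟩
    have h := (weakDerivPairs T (StrongDual ℝ V)).add_mem h2 k2
    rw [Prod.mk_add_mk, ← map_add] at h
    exact h
  smul_mem' := by
    rintro c p ⟨h1, h2⟩
    refine ⟨(weakDerivPairs T V).smul_mem c h1, ?_⟩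
    have h := (weakDerivPairs T (StrongDual ℝ V)).smul_mem c h2
    rw [Prod.smul_mk, ← map_smul] at h
    exact h

/-- The space `W̃(0,T;V)`. -/
def WTilde (T : ℝ) {V H : Type} [NormedAddCommGroup V] [NormedSpace ℝ V] [NormedAddCommGroup H]
    [InnerProductSpace ℝ H] (ι : V →L[ℝ] H) : Type :=
  WTildeSubmodule T ι

section WTilde

variable (T : ℝ) {V H : Type} [NormedAddCommGroup V] [NormedSpace ℝ V] [NormedAddCommGroup H]
  [InnerProductSpace ℝ H] (ι : V →L[ℝ] H)

instance : NormedAddCommGroup (WTilde T ι) :=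
  inferInstanceAs (NormedAddCommGroup (WTildeSubmodule T ι))

instance : NormedSpace ℝ (WTilde T ι) := inferInstanceAs (NormedSpace ℝ (WTildeSubmodule T ι))

/-- `u`, as an element of `L²(0,T;V)`. -/
def WTilde.fn : WTilde T ι →L[ℝ] L2T T V :=
  (WithLp.fstL 2 ℝ _ _).comp (WTildeSubmodule T ι).subtypeL

/-- `∂ₜu`, as an element of `L²(0,T;V)`. -/
def WTilde.dt : WTilde T ι →L[ℝ] L2T T V :=
  ((WithLp.fstL 2 ℝ _ _).comp (WithLp.sndL 2 ℝ _ _)).comp (WTildeSubmodule T ι).subtypeL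

end WTilde

/-- `u(0) = x₀` in `X`: the function `u`, given up to null sets of times in `(0,T)`, has a
representative that is continuous on `[0,T]` with values in `X` and equals `x₀` at time `0`. -/
def HasInitialValue (T : ℝ) {X : Type} [NormedAddCommGroup X] (u : ℝ → X) (x₀ : X) : Prop :=
  ∃ c : ℝ → X, ContinuousOn c (Icc 0 T) ∧ u =ᵐ[timeMeasure T] c ∧ c 0 = x₀

/-- The `u ∈ L²(0,T;X)` that have an initial value `u(0)` in the subspace `S` of `X`. -/
def initialIn (T : ℝ) {X : Type} [NormedAddCommGroup X] [NormedSpace ℝ X] (S : Submodule ℝ X) :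
    Submodule ℝ (L2T T X) where
  carrier := {u | ∃ x₀ ∈ S, HasInitialValue T u x₀}
  zero_mem' := ⟨0, S.zero_mem, 0, continuousOn_const, Lp.coeFn_zero _ _ _, rfl⟩
  add_mem' := by
    rintro u v ⟨x, hx, c, h1, h2, h3⟩ ⟨y, hy, d, k1, k2, k3⟩
    exact ⟨x + y, S.add_mem hx hy, c + d, h1.add k1, (Lp.coeFn_add u v).trans (h2.add k2),
      by simp [h3, k3]⟩
  smul_mem' := by
    rintro a u ⟨x, hx, c, h1, h2, h3⟩
    exact ⟨a • x, S.smul_mem a hx, a • c, h1.const_smul a,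
      (Lp.coeFn_smul a u).trans (h2.const_smul a), by simp [h3]⟩

/-- `L²(Ω)` as a subspace of `L²(ℝⁿ)`: the functions that vanish a.e. outside `Ω`. -/
def L2Supported {n : ℕ} (Ω : Set (EuclideanSpace ℝ (Fin n))) : Submodule ℝ (L2R n) :=
  LinearMap.ker (LpToLpRestrictCLM (EuclideanSpace ℝ (Fin n)) ℝ ℝ volume 2 Ωᶜ).toLinearMap

/-- `W̃(0,T;Hˢ(ℝⁿ))`, with respect to the embedding `Hˢ(ℝⁿ) → L²(ℝⁿ)`. -/
abbrev WRn (T : ℝ) (n : ℕ) (s : ℝ≥0) : Type := WTilde T (Hs.toL2 n s)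

/-- `W̃(0,T;H̃ˢ(Ω))`, with respect to the embedding `H̃ˢ(Ω) → L²(Ω)`; the dual of `H̃ˢ(Ω)` is
`H⁻ˢ(Ω)`. -/
abbrev WOmega (T : ℝ) {n : ℕ} (s : ℝ≥0) (Ω : Set (EuclideanSpace ℝ (Fin n))) : Type :=
  WTilde T (HsTilde.toL2 s Ω)

section Spaces

variable (T : ℝ) {n : ℕ} (s : ℝ≥0) (Ω : Set (EuclideanSpace ℝ (Fin n)))

/-- `W̃_*(0,T;Hˢ(ℝⁿ)) = {v ∈ W̃(0,T;Hˢ(ℝⁿ)) ; v(0) ∈ H̃ˢ(Ω), ∂ₜv(0) ∈ L²(Ω)}`. Here `v` is continuous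
in time with values in `Hˢ(ℝⁿ)`, and `∂ₜv` with values in `L²(ℝⁿ)`. -/
def WStarSubmodule : Submodule ℝ (WRn T n s) :=
  (initialIn T (HsTilde s Ω)).comap (WTilde.fn T (Hs.toL2 n s)).toLinearMap ⊓
    (initialIn T (L2Supported Ω)).comap
      (((Hs.toL2 n s).compLpL 2 (timeMeasure T)).comp (WTilde.dt T (Hs.toL2 n s))).toLinearMap

/-- The space `W̃_*(0,T;Hˢ(ℝⁿ))`, with the norm of `W̃(0,T;Hˢ(ℝⁿ))`. -/
def WStar : Type := WStarSubmodule T s Ω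

instance : NormedAddCommGroup (WStar T s Ω) :=
  inferInstanceAs (NormedAddCommGroup (WStarSubmodule T s Ω))

instance : NormedSpace ℝ (WStar T s Ω) := inferInstanceAs (NormedSpace ℝ (WStarSubmodule T s Ω))

/-- The inclusion of `W̃_*(0,T;Hˢ(ℝⁿ))` into `W̃(0,T;Hˢ(ℝⁿ))`. -/
def WStar.incl : WStar T s Ω →L[ℝ] WRn T n s := (WStarSubmodule T s Ω).subtypeL

/-- The exterior `Ω_e = ℝⁿ \ closure Ω`. -/
def exterior : Set (EuclideanSpace ℝ (Fin n)) := (closure Ω)ᶜ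

/-- The restriction `u ↦ u|_{Ω_e × (0,T)}` on `L²(0,T;Hˢ(ℝⁿ))`. -/
def restrictExt : L2T T (Hs n s) →L[ℝ] L2T T (L2On (exterior Ω)) :=
  (Hs.restrict s (exterior Ω)).compLpL 2 (timeMeasure T)

/-- The restriction `v ↦ v|_{Ω_e × (0,T)}` on `W̃_*(0,T;Hˢ(ℝⁿ))`. -/
def WStar.restrictExt : WStar T s Ω →L[ℝ] L2T T (L2On (exterior Ω)) :=
  (ViscousWave.restrictExt T s Ω).comp ((WTilde.fn T (Hs.toL2 n s)).comp (WStar.incl T s Ω))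

/-- The space `W̃ˢ_rest((Ω_e)_T)` of the restrictions to `Ω_e × (0,T)` of the elements of
`W̃_*(0,T;Hˢ(ℝⁿ))`, with the quotient norm. -/
abbrev WRest : Type := ImageSpace (WStar.restrictExt T s Ω)

/-- The inclusion `L²(0,T;H̃ˢ(Ω)) → L²(0,T;Hˢ(ℝⁿ))`. -/
def inclT : L2T T (HsTilde s Ω) →L[ℝ] L2T T (Hs n s) :=
  (HsTilde s Ω).subtypeL.compLpL 2 (timeMeasure T)

/-- The map `(v, ψ) ↦ v + ψ` from `W̃(0,T;H̃ˢ(Ω)) × W̃_*(0,T;Hˢ(ℝⁿ))` to `H¹(0,T;Hˢ(ℝⁿ))`, whose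
elements `u` are represented as pairs `(u, ∂ₜu)`. The product carries the norm `‖v‖ + ‖ψ‖`. -/
def sumMap : WithLp 1 (WOmega T s Ω × WStar T s Ω) →L[ℝ] L2T T (Hs n s) × L2T T (Hs n s) :=
  (((inclT T s Ω).comp (WTilde.fn T (HsTilde.toL2 s Ω))).prod
      ((inclT T s Ω).comp (WTilde.dt T (HsTilde.toL2 s Ω)))).comp (WithLp.fstL 1 ℝ _ _) +
    (((WTilde.fn T (Hs.toL2 n s)).comp (WStar.incl T s Ω)).prod
      ((WTilde.dt T (Hs.toL2 n s)).comp (WStar.incl T s Ω))).comp (WithLp.sndL 1 ℝ _ _)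

/-- The sum space `W̃_ext(0,T;H̃ˢ(Ω)) = W̃(0,T;H̃ˢ(Ω)) + W̃_*(0,T;Hˢ(ℝⁿ)) ⊆ H¹(0,T;Hˢ(ℝⁿ))`, with the
norm `inf (‖v‖ + ‖ψ‖)` over all decompositions `u = v + ψ`. -/
abbrev WExt : Type := ImageSpace (sumMap T s Ω)

variable {T s Ω}

/-- An element of `W̃ˢ_rest((Ω_e)_T)` as a function on `Ω_e × (0,T)`. -/
def WRest.fn (φ : WRest T s Ω) : L2T T (L2On (exterior Ω)) := ImageSpace.val _ φ

/-- `u`, as an element of `L²(0,T;Hˢ(ℝⁿ))`. -/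
def WExt.fn (u : WExt T s Ω) : L2T T (Hs n s) := (ImageSpace.val _ u).1

/-- `∂ₜu`, as an element of `L²(0,T;Hˢ(ℝⁿ))`. -/
def WExt.dt (u : WExt T s Ω) : L2T T (Hs n s) := (ImageSpace.val _ u).2

end Spaces

/-! ### The nonlinearity and the equation -/

/-- Carathéodory functions on `Ω × ℝ`. -/
structure IsCaratheodory {n : ℕ} (Ω : Set (EuclideanSpace ℝ (Fin n)))
    (g : EuclideanSpace ℝ (Fin n) → ℝ → ℝ) : Prop where
  continuous : ∀ᵐ x ∂(volume.restrict Ω), Continuous (g x)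
  measurable : ∀ τ : ℝ, AEMeasurable (fun x => g x τ) (volume.restrict Ω)

/-- The growth assumption on `f : Ω × ℝ → ℝ` with exponent `r` and `a ∈ L^∞(Ω)`: the functions `f`
and `∂_τ f` are Carathéodory functions, `|∂_τ f(x,τ)| ≤ C (a(x) + |τ|^r)`, and
`r ≤ 2s/(n-2s)` if `2s < n`. -/
structure GrowthAssumption {n : ℕ} (s : ℝ≥0) (Ω : Set (EuclideanSpace ℝ (Fin n)))
    (f : EuclideanSpace ℝ (Fin n) → ℝ → ℝ) (a : EuclideanSpace ℝ (Fin n) → ℝ) (r : ℝ) : Prop where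
  caratheodory : IsCaratheodory Ω f
  differentiable : ∀ᵐ x ∂(volume.restrict Ω), Differentiable ℝ (f x)
  caratheodory_deriv : IsCaratheodory Ω (fun x τ => deriv (f x) τ)
  memLp : MemLp a ∞ (volume.restrict Ω)
  growth : ∃ C : ℝ, 0 < C ∧ ∀ᵐ x ∂(volume.restrict Ω), ∀ τ : ℝ,
    |deriv (f x) τ| ≤ C * (a x + |τ| ^ r)
  exponent_nonneg : 0 ≤ r
  exponent_le : 2 * (s : ℝ) < n → r ≤ 2 * (s : ℝ) / (n - 2 * (s : ℝ))

/-- `u ∈ W̃_ext(0,T;H̃ˢ(Ω))` solves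
`∂ₜ²u + (-Δ)ˢ∂ₜu + (-Δ)ˢu + f(u) = 0` in `Ω × (0,T)`, `u = φ` in `Ω_e × (0,T)`,
`u(0) = 0` and `∂ₜu(0) = 0`. -/
structure IsSolution {T : ℝ} {n : ℕ} {s : ℝ≥0} {Ω : Set (EuclideanSpace ℝ (Fin n))}
    (f : EuclideanSpace ℝ (Fin n) → ℝ → ℝ) (φ : WRest T s Ω) (u : WExt T s Ω) : Prop where
  /-- For all `v ∈ H̃ˢ(Ω)`, in the sense of distributions on `(0,T)`,
  `d/dt ⟨∂ₜu,v⟩_{L²(Ω)} + ⟨(-Δ)^{s/2}∂ₜu,(-Δ)^{s/2}v⟩ + ⟨(-Δ)^{s/2}u,(-Δ)^{s/2}v⟩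
  + ⟨f(u),v⟩_{L²(Ω)} = 0`. -/
  equation : ∀ v ∈ HsTilde s Ω, ∀ η : ℝ → ℝ, IsTimeTest T η →
    -(∫ t in Ioo 0 T, deriv η t * ∫ x in Ω, Hs.toL2 n s (WExt.dt u t) x * Hs.toL2 n s v x) +
      ∫ t in Ioo 0 T, η t * (fracForm (WExt.dt u t) v + fracForm (WExt.fn u t) v +
        ∫ x in Ω, f x (Hs.toL2 n s (WExt.fn u t) x) * Hs.toL2 n s v x) = 0
  exterior_value : restrictExt T s Ω (WExt.fn u) = WRest.fn φ
  initial_value : HasInitialValue T (WExt.fn u) 0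
  initial_velocity : HasInitialValue T (fun t => Hs.toL2 n s (WExt.dt u t)) 0

end ViscousWave

end

open MeasureTheory Set Topology
open scoped NNReal ENNReal ContDiff FourierTransform

noncomputable section

set_option linter.unusedSectionVars false

namespace ViscousWave

/-! ### Locally absolutely continuous functions of time -/

/-! The problem is a small perturbation, near u = 0, of a uniquely solvable linear one. Split f(u) =
Qu + N(u), where Q is multiplication by ∂_τ f(x,0) and N vanishes to first order at 0. On `WExt` let
Φu = (u(0), ∂ₜu(0), ∂ₜ²u + (-Δ)ˢ∂ₜu + (-Δ)ˢu + Qu). Then u is a solution if and only if Φu + (0, 0,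
N(u)) = 0 and u has the exterior value φ. Let K invert Φ with zero exterior values, and let Lφ be
the solution of Φu = 0 with exterior value φ. By uniqueness for the linear problem, the nonlinear
one is equivalent to u + K(0, 0, N(u)) = Lφ. The left side is a C¹ map of the Banach space `WExt`
into itself whose derivative at 0 is the identity, so the inverse function theorem gives U₀, U₁ and
a C¹ solution map (`exists_local_solution_map`, `exists_solution_map`).

Three ingredients carry this.

The linear equation: `waveOp_bijective` says that u ↦ (u(0), ∂ₜu(0), ∂ₜ²u + a∂ₜu + bu) is a
bijection from W̃(0,T;V) onto V × H × L²(0,T;V') when a satisfies a Gårding inequality. Integrated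
once in time, the equation becomes a Volterra equation for ∂ₜu. It is solved by bounding the adjoint
operator from below, and an exponential weight in time absorbs both the Gårding constant and b. That
initial velocities exist in H is the Lions–Magenes embedding `exists_continuous_rep`, proved by
regularizing with resolvents of ι†ι.

The exterior condition: a difference of two candidates vanishes in the exterior and has to lie in
W̃(0,T;H̃ˢ(Ω)) (`WExt.exists_eq_toExt`). For fixed time this is `mem_HsTilde_of_ae_eq_zero`. A
partition of unity localizes, and mollifiers supported in a cone pointing into Ω push the support
into Ω; the Lipschitz boundary provides the cone.

The nonlinearity: the bound on r is the condition for Hˢ(ℝⁿ) to embed into L^p with p = 2(r+1)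
(`Hs.memLp_of_le`, by splitting frequencies at each level of |u|). Superposition with f is C¹ from
L^p(Ω) to L²(Ω) (`exists_contDiff_superposition`), hence C¹ on C([0,T];Hˢ), and elements of `WExt`
lie in that space (`WExt.exists_superposition`). -/

theorem absolutelyContinuousOnInterval_of_dist_le {X Y : Type*} [PseudoMetricSpace X]
    [PseudoMetricSpace Y] {f : ℝ → X} {G : ℝ → Y} {a b C : ℝ}
    (hG : AbsolutelyContinuousOnInterval G a b)
    (h : ∀ x ∈ uIcc a b, ∀ y ∈ uIcc a b, dist (f x) (f y) ≤ C * dist (G x) (G y)) :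
    AbsolutelyContinuousOnInterval f a b := by
  unfold AbsolutelyContinuousOnInterval at *
  refine squeeze_zero' (Filter.Eventually.of_forall fun _ => Finset.sum_nonneg fun _ _ => dist_nonneg)
    ?_ (by simpa using hG.const_mul C)
  rw [Filter.eventually_inf_principal]
  filter_upwards with E hE
  rw [Finset.mul_sum]
  exact Finset.sum_le_sum fun i hi => h _ (hE.1 i hi).1 _ (hE.1 i hi).2

theorem _root_.MeasureTheory.LocallyIntegrable.intervalIntegrable_real {X : Type*}
    [NormedAddCommGroup X] {w : ℝ → X} (hw : LocallyIntegrable w volume) (a b : ℝ) :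
    IntervalIntegrable w volume a b :=
  intervalIntegrable_iff.mpr ((hw.integrableOn_isCompact isCompact_uIcc).mono_set uIoc_subset_uIcc)

theorem _root_.MeasureTheory.LocallyIntegrable.norm_real {X : Type*}
    [NormedAddCommGroup X] {w : ℝ → X} (hw : LocallyIntegrable w volume) :
    LocallyIntegrable (fun t => ‖w t‖) volume := fun t =>
  let ⟨s, hs, hi⟩ := hw t
  ⟨s, hs, hi.norm⟩

section Primitive

variable {X Y Z : Type*} [NormedAddCommGroup X] [NormedSpace ℝ X]
  [NormedAddCommGroup Y] [NormedSpace ℝ Y] [NormedAddCommGroup Z] [NormedSpace ℝ Z]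

/-- `y` is a primitive of the locally integrable function `w`. -/
structure IsPrimitive (y w : ℝ → X) : Prop where
  locallyIntegrable : LocallyIntegrable w volume
  sub_eq : ∀ a b : ℝ, y b - y a = ∫ t in a..b, w t

theorem isPrimitive_integral {w : ℝ → X} (hw : LocallyIntegrable w volume) (x₀ : X) (c : ℝ) :
    IsPrimitive (fun t => x₀ + ∫ s in c..t, w s) w := by
  refine ⟨hw, fun a b => ?_⟩
  rw [add_sub_add_left_eq_sub, intervalIntegral.integral_interval_sub_left
    (hw.intervalIntegrable_real _ _) (hw.intervalIntegrable_real _ _)]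

namespace IsPrimitive

variable {y w : ℝ → X} {z v : ℝ → Y}

theorem eq_add (h : IsPrimitive y w) (a b : ℝ) : y b = y a + ∫ t in a..b, w t := by
  rw [← h.sub_eq]; abel

theorem continuous (h : IsPrimitive y w) : Continuous y := by
  have : y = fun t => y 0 + ∫ s in (0 : ℝ)..t, w s := funext fun t => h.eq_add 0 t
  rw [this]
  exact continuous_const.add
    (intervalIntegral.continuous_primitive (fun a b => h.1.intervalIntegrable_real a b) 0)

theorem ae_hasDerivAt [CompleteSpace X] (h : IsPrimitive y w) :
    ∀ᵐ t, HasDerivAt y (w t) t := by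
  filter_upwards [_root_.LocallyIntegrable.ae_hasDerivAt_integral h.1] with t ht
  have : y = fun t => y 0 + ∫ s in (0 : ℝ)..t, w s := funext fun t => h.eq_add 0 t
  rw [this]
  simpa using (ht 0).const_add (y 0)

/-- Reduces the absolute continuity of a vector-valued primitive to that of the scalar function t ↦
∫₀ᵗ ‖w‖. -/
theorem dist_le (h : IsPrimitive y w) (a b : ℝ) :
    dist (y a) (y b) ≤ dist (∫ t in (0 : ℝ)..a, ‖w t‖) (∫ t in (0 : ℝ)..b, ‖w t‖) := by
  have hn : LocallyIntegrable (fun t => ‖w t‖) volume := h.1.norm_real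
  rw [dist_comm, dist_comm (∫ t in (0 : ℝ)..a, ‖w t‖), dist_eq_norm, dist_eq_norm, h.sub_eq,
    intervalIntegral.integral_interval_sub_left
    (hn.intervalIntegrable_real _ _) (hn.intervalIntegrable_real _ _)]
  exact intervalIntegral.norm_integral_le_abs_integral_norm

theorem absolutelyContinuous (h : IsPrimitive y w) (a b : ℝ) :
    AbsolutelyContinuousOnInterval y a b := by
  have hn : LocallyIntegrable (fun t => ‖w t‖) volume := h.1.norm_real
  have h0 : AbsolutelyContinuousOnInterval (fun t => ∫ s in a..t, ‖w s‖) a b :=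
    (hn.intervalIntegrable_real a b).absolutelyContinuousOnInterval_intervalIntegral left_mem_uIcc
  refine absolutelyContinuousOnInterval_of_dist_le (C := 1) h0 fun x _ y _ => ?_
  rw [one_mul]
  refine (h.dist_le x y).trans (le_of_eq ?_)
  rw [dist_eq_norm, dist_eq_norm, intervalIntegral.integral_interval_sub_left
    (hn.intervalIntegrable_real _ _) (hn.intervalIntegrable_real _ _),
    intervalIntegral.integral_interval_sub_left
    (hn.intervalIntegrable_real _ _) (hn.intervalIntegrable_real _ _)]

/-- The difference of y and ∫w is absolutely continuous with derivative zero almost everywhere,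
hence constant. -/
theorem of_ae_hasDerivAt [CompleteSpace X] (hw : LocallyIntegrable w volume)
    (hac : ∀ a b, AbsolutelyContinuousOnInterval y a b) (hd : ∀ᵐ t, HasDerivAt y (w t) t) :
    IsPrimitive y w := by
  refine ⟨hw, fun a b => ?_⟩
  have hp := isPrimitive_integral hw (0 : X) a
  obtain ⟨C, hC⟩ := ((hac a b).sub (hp.absolutelyContinuous a b)).const_of_ae_hasDerivAt_zero (by
    filter_upwards [hd, hp.ae_hasDerivAt] with t h1 h2 _
    simpa using h1.sub h2)
  have h1 := hC a left_mem_uIcc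
  have h2 := hC b right_mem_uIcc
  simp only [Pi.sub_apply, zero_add, intervalIntegral.integral_same, sub_zero] at h1 h2
  rw [h1, ← h2]; abel

theorem of_hasDerivAt [CompleteSpace X] (hw : Continuous w) (hd : ∀ t, HasDerivAt y (w t) t) :
    IsPrimitive y w :=
  ⟨hw.locallyIntegrable, fun a b => (intervalIntegral.integral_eq_sub_of_hasDerivAt
    (fun t _ => hd t) (hw.intervalIntegrable a b)).symm⟩

theorem add {y' w' : ℝ → X} (h : IsPrimitive y w) (h' : IsPrimitive y' w') :
    IsPrimitive (fun t => y t + y' t) (fun t => w t + w' t) := by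
  refine ⟨h.1.add h'.1, fun a b => ?_⟩
  rw [intervalIntegral.integral_add (h.1.intervalIntegrable_real a b)
    (h'.1.intervalIntegrable_real a b), ← h.sub_eq, ← h'.sub_eq]
  abel

theorem sub {y' w' : ℝ → X} (h : IsPrimitive y w) (h' : IsPrimitive y' w') :
    IsPrimitive (fun t => y t - y' t) (fun t => w t - w' t) := by
  refine ⟨h.1.sub h'.1, fun a b => ?_⟩
  rw [intervalIntegral.integral_sub (h.1.intervalIntegrable_real a b)
    (h'.1.intervalIntegrable_real a b), ← h.sub_eq, ← h'.sub_eq]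
  abel

theorem locallyIntegrable_bilin (B : X →L[ℝ] Y →L[ℝ] Z) (hw : LocallyIntegrable w volume)
    (hz : Continuous z) : LocallyIntegrable (fun t => B (w t) (z t)) volume := by
  rw [locallyIntegrable_iff]
  intro K hK
  obtain ⟨M, hM⟩ := hK.exists_bound_of_continuousOn hz.continuousOn
  have hwK := hw.integrableOn_isCompact hK
  refine Integrable.mono' (hwK.norm.const_mul (‖B‖ * M))
    (B.aestronglyMeasurable_comp₂ hwK.1 hz.aestronglyMeasurable) ?_
  filter_upwards [ae_restrict_mem hK.measurableSet] with t ht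
  calc ‖B (w t) (z t)‖ ≤ ‖B‖ * ‖w t‖ * ‖z t‖ := B.le_opNorm₂ _ _
    _ ≤ ‖B‖ * ‖w t‖ * M := by gcongr; exact hM t ht
    _ = _ := by ring

/-- The product rule behind all integrations by parts and energy identities below. On a compact
interval the increments of B(y,z) are bounded by those of ∫(‖w‖ + ‖v‖), so B(y,z) is absolutely
continuous, and the classical product rule gives its derivative almost everywhere. -/
theorem bilin [CompleteSpace X] [CompleteSpace Y] [CompleteSpace Z] (B : X →L[ℝ] Y →L[ℝ] Z)
    (h : IsPrimitive y w) (h' : IsPrimitive z v) :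
    IsPrimitive (fun t => B (y t) (z t)) (fun t => B (w t) (z t) + B (y t) (v t)) := by
  refine of_ae_hasDerivAt ((locallyIntegrable_bilin B h.1 h'.continuous).add
    (locallyIntegrable_bilin B.flip h'.1 h.continuous)) (fun a b => ?_) ?_
  · have hg : LocallyIntegrable (fun t => ‖w t‖ + ‖v t‖) volume := h.1.norm_real.add h'.1.norm_real
    have hG := (hg.intervalIntegrable_real a b).absolutelyContinuousOnInterval_intervalIntegral
      (left_mem_uIcc)
    obtain ⟨M, hM⟩ := isCompact_uIcc.exists_bound_of_continuousOn h.continuous.continuousOn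
      (s := uIcc a b)
    obtain ⟨N, hN⟩ := isCompact_uIcc.exists_bound_of_continuousOn h'.continuous.continuousOn
      (s := uIcc a b)
    have hM0 : 0 ≤ M := (norm_nonneg _).trans (hM a left_mem_uIcc)
    have hN0 : 0 ≤ N := (norm_nonneg _).trans (hN a left_mem_uIcc)
    refine absolutelyContinuousOnInterval_of_dist_le (C := ‖B‖ * (M + N)) hG fun p hp q hq => ?_
    have key : ∀ p ∈ uIcc a b, ∀ q ∈ uIcc a b, p ≤ q → dist (B (y p) (z p)) (B (y q) (z q)) ≤
        ‖B‖ * (M + N) * dist (∫ s in a..p, (‖w s‖ + ‖v s‖)) (∫ s in a..q, (‖w s‖ + ‖v s‖)) := by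
      intro p hp q hq hpq
      have e1 : ‖y q - y p‖ ≤ ∫ s in p..q, ‖w s‖ := by
        rw [h.sub_eq]; exact intervalIntegral.norm_integral_le_integral_norm hpq
      have e2 : ‖z q - z p‖ ≤ ∫ s in p..q, ‖v s‖ := by
        rw [h'.sub_eq]; exact intervalIntegral.norm_integral_le_integral_norm hpq
      have hsum : (∫ s in p..q, (‖w s‖ + ‖v s‖)) =
          (∫ s in p..q, ‖w s‖) + ∫ s in p..q, ‖v s‖ :=
        intervalIntegral.integral_add (h.1.norm_real.intervalIntegrable_real p q)
          (h'.1.norm_real.intervalIntegrable_real p q)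
      have p1 : 0 ≤ ∫ s in p..q, ‖w s‖ :=
        intervalIntegral.integral_nonneg hpq fun _ _ => norm_nonneg _
      have p2 : 0 ≤ ∫ s in p..q, ‖v s‖ :=
        intervalIntegral.integral_nonneg hpq fun _ _ => norm_nonneg _
      rw [dist_comm, dist_comm (∫ s in a..p, (‖w s‖ + ‖v s‖)), dist_eq_norm, dist_eq_norm,
        intervalIntegral.integral_interval_sub_left
          (hg.intervalIntegrable_real _ _) (hg.intervalIntegrable_real _ _), hsum,
        Real.norm_of_nonneg (add_nonneg p1 p2)]
      have e3 : B (y q) (z q) - B (y p) (z p) = B (y q - y p) (z q) + B (y p) (z q - z p) := by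
        simp
      rw [e3]
      calc _ ≤ ‖B‖ * ‖y q - y p‖ * ‖z q‖ + ‖B‖ * ‖y p‖ * ‖z q - z p‖ :=
            (norm_add_le _ _).trans (add_le_add (B.le_opNorm₂ _ _) (B.le_opNorm₂ _ _))
        _ ≤ ‖B‖ * (∫ s in p..q, ‖w s‖) * N + ‖B‖ * M * (∫ s in p..q, ‖v s‖) := by
            gcongr
            · exact hN q hq
            · exact hM p hp
        _ ≤ _ := by
            have hB := norm_nonneg B
            have t1 := mul_nonneg (mul_nonneg hB hM0) p1
            have t2 := mul_nonneg (mul_nonneg hB hN0) p2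
            linarith
    rcases le_total p q with hpq | hpq
    · exact key p hp q hq hpq
    · rw [dist_comm, dist_comm (∫ s in a..p, (‖w s‖ + ‖v s‖))]
      exact key q hq p hp hpq
  · filter_upwards [h.ae_hasDerivAt, h'.ae_hasDerivAt] with t h1 h2
    have h3 := B.hasFDerivAt_of_bilinear h1.hasFDerivAt h2.hasFDerivAt
    have h4 := h3.hasDerivAt
    convert h4 using 1
    simp [add_comm]

end IsPrimitive

end Primitive

/-! ### Weak derivatives in time -/

section WeakDeriv

variable {T : ℝ} {X Y : Type} [NormedAddCommGroup X] [NormedSpace ℝ X]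
  [NormedAddCommGroup Y] [NormedSpace ℝ Y]

theorem IsTimeTest.eq_zero_left {η : ℝ → ℝ} (hη : IsTimeTest T η) : η 0 = 0 :=
  image_eq_zero_of_notMem_tsupport fun h => (lt_irrefl _ (hη.2.2 h).1)

theorem IsTimeTest.eq_zero_right {η : ℝ → ℝ} (hη : IsTimeTest T η) : η T = 0 :=
  image_eq_zero_of_notMem_tsupport fun h => (lt_irrefl _ (hη.2.2 h).2)

theorem IsTimeTest.integrable_smul' {η : ℝ → ℝ} (hη : IsTimeTest T η) {u : ℝ → X}
    (hu : Integrable u (timeMeasure T)) : Integrable (fun t => η t • u t) (timeMeasure T) := by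
  obtain ⟨C, hC⟩ := hη.1.continuous.bounded_above_of_compact_support hη.2.1
  exact hu.bdd_smul C hη.1.continuous.aestronglyMeasurable (Filter.Eventually.of_forall hC)

theorem IsTimeTest.integrable_deriv_smul' {η : ℝ → ℝ} (hη : IsTimeTest T η) {u : ℝ → X}
    (hu : Integrable u (timeMeasure T)) :
    Integrable (fun t => deriv η t • u t) (timeMeasure T) := by
  have hc : Continuous (deriv η) := hη.1.continuous_deriv (by simp)
  obtain ⟨C, hC⟩ := hc.bounded_above_of_compact_support hη.2.1.deriv
  exact hu.bdd_smul C hc.aestronglyMeasurable (Filter.Eventually.of_forall hC)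

theorem integrable_L2T (u : L2T T X) : Integrable u (timeMeasure T) :=
  (Lp.memLp u).integrable (by norm_num)

theorem integral_norm_L2T_le (u : L2T T X) :
    ∫ t, ‖u t‖ ∂(timeMeasure T) ≤ ((timeMeasure T).real univ) ^ (1 / 2 : ℝ) * ‖u‖ := by
  have h := eLpNorm_le_eLpNorm_mul_rpow_measure_univ (μ := timeMeasure T) (p := 1) (q := 2)
    (by norm_num) (Lp.aestronglyMeasurable u)
  rw [integral_norm_eq_lintegral_enorm (Lp.aestronglyMeasurable u), ← eLpNorm_one_eq_lintegral_enorm,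
    Lp.norm_def, mul_comm, measureReal_def, ENNReal.toReal_rpow, ← ENNReal.toReal_mul]
  refine ENNReal.toReal_mono (ENNReal.mul_ne_top (Lp.eLpNorm_ne_top u)
    (ENNReal.rpow_ne_top_of_nonneg (by norm_num) (measure_ne_top _ _))) ?_
  convert h using 3
  norm_num

theorem timeMeasure_integral_eq (hT : 0 ≤ T) (g : ℝ → X) :
    ∫ t, g t ∂(timeMeasure T) = ∫ t in (0 : ℝ)..T, g t := by
  rw [intervalIntegral.integral_of_le hT, integral_Ioc_eq_integral_Ioo]

/-- The primitive `t ↦ ∫₀ᵗ w` of a function on `(0,T)`. -/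
def prim (T : ℝ) (w : ℝ → X) (t : ℝ) : X := ∫ s in (0 : ℝ)..t, (Ioo 0 T).indicator w s

theorem locallyIntegrable_indicator {w : ℝ → X} (hw : Integrable w (timeMeasure T)) :
    LocallyIntegrable ((Ioo 0 T).indicator w) volume :=
  ((integrable_indicator_iff measurableSet_Ioo).2 hw).locallyIntegrable

theorem isPrimitive_prim {w : ℝ → X} (hw : Integrable w (timeMeasure T)) :
    IsPrimitive (prim T w) ((Ioo 0 T).indicator w) := by
  simpa using! isPrimitive_integral (locallyIntegrable_indicator hw) (0 : X) 0

theorem isPrimitive_const [CompleteSpace X] (x₀ : X) :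
    IsPrimitive (fun _ : ℝ => x₀) (fun _ => 0) :=
  IsPrimitive.of_hasDerivAt continuous_const fun t => hasDerivAt_const t x₀

@[simp] theorem prim_zero (w : ℝ → X) : prim T w 0 = 0 := by simp [prim]

theorem indicator_ae_eq_of_ae_eq {w w' : ℝ → X} (h : w =ᵐ[timeMeasure T] w') :
    (Ioo 0 T).indicator w =ᵐ[volume] (Ioo 0 T).indicator w' := by
  have := (ae_restrict_iff' measurableSet_Ioo).1 h
  filter_upwards [this] with t ht
  by_cases h : t ∈ Ioo 0 T
  · simp [h, ht h]
  · simp [h]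

theorem prim_congr {w w' : ℝ → X} (h : w =ᵐ[timeMeasure T] w') : prim T w = prim T w' := by
  funext t
  apply intervalIntegral.integral_congr_ae
  filter_upwards [indicator_ae_eq_of_ae_eq h] with s hs _ using hs

theorem norm_prim_le {w : ℝ → X} (hw : Integrable w (timeMeasure T)) (t : ℝ) :
    ‖prim T w t‖ ≤ ∫ s, ‖w s‖ ∂(timeMeasure T) := by
  have hi : Integrable ((Ioo 0 T).indicator w) volume :=
    (integrable_indicator_iff measurableSet_Ioo).2 hw
  refine (intervalIntegral.norm_integral_le_integral_norm_uIoc).trans ?_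
  rw [← integral_indicator measurableSet_Ioo]
  have e : (Ioo 0 T).indicator (fun s => ‖w s‖) = fun s => ‖(Ioo 0 T).indicator w s‖ := by
    funext s; rw [norm_indicator_eq_indicator_norm]
  rw [e]
  exact setIntegral_le_integral hi.norm (Filter.Eventually.of_forall fun _ => norm_nonneg _)

theorem prim_add {w w' : ℝ → X} (hw : Integrable w (timeMeasure T))
    (hw' : Integrable w' (timeMeasure T)) (t : ℝ) :
    prim T (fun s => w s + w' s) t = prim T w t + prim T w' t := by
  unfold prim
  rw [← intervalIntegral.integral_add
    ((locallyIntegrable_indicator hw).intervalIntegrable_real _ _)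
    ((locallyIntegrable_indicator hw').intervalIntegrable_real _ _)]
  congr 1
  funext s
  by_cases h : s ∈ Ioo 0 T <;> simp [h]

theorem prim_smul (c : ℝ) (w : ℝ → X) (t : ℝ) :
    prim T (fun s => c • w s) t = c • prim T w t := by
  unfold prim
  rw [← intervalIntegral.integral_smul]
  congr 1
  funext s
  by_cases h : s ∈ Ioo 0 T <;> simp [h]

theorem prim_clm [CompleteSpace X] [CompleteSpace Y] (A : X →L[ℝ] Y) {w : ℝ → X}
    (hw : Integrable w (timeMeasure T)) (t : ℝ) :
    prim T (fun s => A (w s)) t = A (prim T w t) := by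
  unfold prim
  rw [← A.intervalIntegral_comp_comm ((locallyIntegrable_indicator hw).intervalIntegrable_real _ _)]
  congr 1
  funext s
  by_cases h : s ∈ Ioo 0 T <;> simp [h]

/-- The product rule for η y on [0,T]; the boundary terms drop out because η vanishes at 0 and T. -/
theorem IsPrimitive.isWeakTimeDeriv [CompleteSpace X] (hT : 0 < T) {y w : ℝ → X}
    (h : IsPrimitive y w) : IsWeakTimeDeriv T y w := by
  intro η hη
  have hη' : IsPrimitive η (deriv η) := IsPrimitive.of_hasDerivAt
    (hη.1.continuous_deriv (by simp)) fun t => (hη.1.differentiable (by simp) t).hasDerivAt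
  have hp := (hη'.bilin (ContinuousLinearMap.lsmul ℝ ℝ) h).sub_eq 0 T
  simp only [ContinuousLinearMap.lsmul_apply, hη.eq_zero_left, hη.eq_zero_right, zero_smul,
    sub_zero] at hp
  rw [timeMeasure_integral_eq hT.le, timeMeasure_integral_eq hT.le, eq_neg_iff_add_eq_zero,
    ← intervalIntegral.integral_add, ← hp]
  · exact (IsPrimitive.locallyIntegrable_bilin (ContinuousLinearMap.lsmul ℝ ℝ) hη'.1
      h.continuous).intervalIntegrable_real _ _
  · exact (IsPrimitive.locallyIntegrable_bilin (ContinuousLinearMap.lsmul ℝ ℝ).flip h.1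
      hη.1.continuous).intervalIntegrable_real _ _

theorem isWeakTimeDeriv_prim [CompleteSpace X] (hT : 0 < T) {w : ℝ → X}
    (hw : Integrable w (timeMeasure T)) (x₀ : X) :
    IsWeakTimeDeriv T (fun t => x₀ + prim T w t) w := by
  refine (((isPrimitive_const x₀).add (isPrimitive_prim hw)).isWeakTimeDeriv hT).congr
    (Filter.EventuallyEq.refl _ _) ?_
  filter_upwards [ae_restrict_mem measurableSet_Ioo] with t ht
  simp [ht]

theorem ae_eq_zero_of_forall_timeTest [CompleteSpace X] {g : ℝ → X}
    (hg : Integrable g (timeMeasure T))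
    (h : ∀ η, IsTimeTest T η → ∫ t, η t • g t ∂(timeMeasure T) = 0) :
    g =ᵐ[timeMeasure T] 0 := by
  have hl : LocallyIntegrableOn g (Ioo 0 T) volume :=
    IntegrableOn.locallyIntegrableOn hg
  have := isOpen_Ioo.ae_eq_zero_of_integral_contDiff_smul_eq_zero hl (fun η h1 h2 h3 => by
    rw [← h η ⟨h1, h2, h3⟩, ← integral_indicator measurableSet_Ioo]
    congr 1
    funext t
    by_cases ht : t ∈ Ioo 0 T
    · simp [ht]
    · have : η t = 0 := image_eq_zero_of_notMem_tsupport fun hh => ht (h3 hh)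
      simp [ht, this])
  exact (ae_restrict_iff' measurableSet_Ioo).2 this

theorem exists_isTimeTest_integral_eq_one (hT : 0 < T) :
    ∃ η, IsTimeTest T η ∧ ∫ t, η t ∂(timeMeasure T) = 1 := by
  -- The outer radius T/4 keeps the support in [T/4, 3T/4], away from the end points.
  let b : ContDiffBump (T / 2) := ⟨T / 8, T / 4, by positivity, by linarith⟩
  have hsub : tsupport (b.normed volume) ⊆ Ioo 0 T := by
    rw [b.tsupport_normed_eq]
    intro t ht
    rw [Real.closedBall_eq_Icc] at ht
    constructor
    · have := ht.1; simp only [b] at this; linarith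
    · have := ht.2; simp only [b] at this; linarith
  refine ⟨b.normed volume, ⟨b.contDiff_normed, b.hasCompactSupport_normed, hsub⟩, ?_⟩
  rw [← b.integral_normed (μ := volume), ← integral_indicator measurableSet_Ioo]
  congr 1
  funext t
  by_cases ht : t ∈ Ioo 0 T
  · simp [ht]
  · have : b.normed volume t = 0 := image_eq_zero_of_notMem_tsupport fun hh => ht (hsub hh)
    rw [Set.indicator_of_notMem ht, this]

/-- The primitive from 0 vanishes to the left of the support of η, and to the right of it because η
has mean zero. So it is itself a test function. -/
theorem IsTimeTest.exists_primitive (hT : 0 < T) {η : ℝ → ℝ} (hη : IsTimeTest T η)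
    (h0 : ∫ t, η t ∂(timeMeasure T) = 0) : ∃ θ, IsTimeTest T θ ∧ deriv θ = η := by
  obtain ⟨h1, h2, h3⟩ := hη
  have hd : ∀ t, HasDerivAt (fun t => ∫ s in (0 : ℝ)..t, η s) (η t) t := fun t =>
    intervalIntegral.integral_hasDerivAt_right (h1.continuous.intervalIntegrable _ _)
      (h1.continuous.stronglyMeasurableAtFilter _ _) h1.continuous.continuousAt
  have hderiv : deriv (fun t => ∫ s in (0 : ℝ)..t, η s) = η := funext fun t => (hd t).deriv
  rcases (tsupport η).eq_empty_or_nonempty with he | hne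
  · refine ⟨0, ⟨contDiff_const, HasCompactSupport.zero, by simp [tsupport]⟩, ?_⟩
    rw [tsupport_eq_empty_iff.1 he]
    funext t
    simp
  obtain ⟨a, ha, hamin⟩ := h2.isCompact.exists_isMinOn hne continuousOn_id
  obtain ⟨b, hb, hbmax⟩ := h2.isCompact.exists_isMaxOn hne continuousOn_id
  have hz : ∀ t, t ∉ Icc a b → η t = 0 := fun t ht =>
    image_eq_zero_of_notMem_tsupport fun hh => ht ⟨hamin hh, hbmax hh⟩
  have hsupp : ∀ t, t ∉ Icc a b → ∫ s in (0 : ℝ)..t, η s = 0 := by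
    intro t ht
    rw [mem_Icc, not_and_or, not_le, not_le] at ht
    rcases ht with ht | ht
    · refine intervalIntegral.integral_zero_ae (Filter.Eventually.of_forall fun s hs => hz s ?_)
      have h0a := (h3 ha).1
      intro hs'
      rcases le_total 0 t with h | h
      · rw [uIoc_of_le h] at hs; linarith [hs.2, hs'.1]
      · rw [uIoc_of_ge h] at hs; linarith [hs.2, hs'.1]
    · rw [timeMeasure_integral_eq hT.le] at h0
      rw [← intervalIntegral.integral_add_adjacent_intervals (b := T)
        (h1.continuous.intervalIntegrable _ _) (h1.continuous.intervalIntegrable _ _), h0, zero_add]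
      refine intervalIntegral.integral_zero_ae (Filter.Eventually.of_forall fun s hs => hz s ?_)
      have h0a := (h3 hb).2
      intro hs'
      rcases le_total T t with h | h
      · rw [uIoc_of_le h] at hs; linarith [hs.1, hs'.2]
      · rw [uIoc_of_ge h] at hs; linarith [hs.1, hs'.2]
  have hts : tsupport (fun t => ∫ s in (0 : ℝ)..t, η s) ⊆ Icc a b :=
    closure_minimal (fun t ht => by_contra fun h => ht (hsupp t h)) isClosed_Icc
  refine ⟨fun t => ∫ s in (0 : ℝ)..t, η s, ⟨?_, ?_, hts.trans ?_⟩, hderiv⟩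
  · rw [contDiff_infty_iff_deriv, hderiv]
    exact ⟨fun t => (hd t).differentiableAt, h1⟩
  · exact HasCompactSupport.of_support_subset_isCompact isCompact_Icc
      (subset_closure.trans hts)
  · exact fun t ht => ⟨(h3 ha).1.trans_le ht.1, ht.2.trans_lt (h3 hb).2⟩

/-- The du Bois-Reymond argument. With ∫η₀ = 1, the function η − (∫η)η₀ is the derivative of a test
function for every η. Hence z − c is orthogonal to all test functions, where c = ∫η₀z. -/
theorem exists_const_of_isWeakTimeDeriv_zero [CompleteSpace X] (hT : 0 < T) {z : ℝ → X}
    (hz : Integrable z (timeMeasure T)) (h : IsWeakTimeDeriv T z 0) :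
    ∃ c : X, z =ᵐ[timeMeasure T] fun _ => c := by
  obtain ⟨η₀, hη₀, hint⟩ := exists_isTimeTest_integral_eq_one hT
  set c := ∫ t, η₀ t • z t ∂(timeMeasure T) with hc
  refine ⟨c, ?_⟩
  have hi : ∀ η, IsTimeTest T η → Integrable η (timeMeasure T) := fun η hη =>
    (hη.1.continuous.integrable_of_hasCompactSupport hη.2.1).restrict
  have key : (fun t => z t - c) =ᵐ[timeMeasure T] 0 := by
    refine ae_eq_zero_of_forall_timeTest (hz.sub (integrable_const c)) fun η hη => ?_
    set m := ∫ t, η t ∂(timeMeasure T) with hm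
    have htest : IsTimeTest T (fun t => η t - m * η₀ t) :=
      ⟨hη.1.sub (contDiff_const.mul hη₀.1), hη.2.1.sub (hη₀.2.1.mul_left (f := fun _ => m)), by
        refine (tsupport_sub _ _).trans (union_subset hη.2.2 ?_)
        refine (closure_mono ?_).trans hη₀.2.2
        exact Function.support_mul_subset_right (fun _ => m) η₀⟩
    obtain ⟨θ, hθ, hd⟩ := htest.exists_primitive hT (by
      rw [integral_sub (hi η hη) ((hi η₀ hη₀).const_mul m), integral_const_mul, hint]; simp [hm])
    have := h θ hθ
    simp only [hd, Pi.zero_apply, smul_zero, integral_zero, neg_zero, sub_smul, mul_smul] at this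
    rw [integral_sub (hη.integrable_smul' hz)
      (show Integrable (fun t => m • η₀ t • z t) _ from (hη₀.integrable_smul' hz).smul m),
      integral_smul, ← hc, sub_eq_zero] at this
    simp only [smul_sub]
    rw [integral_sub (hη.integrable_smul' hz) (hη.integrable_smul' (integrable_const c)), this,
      integral_smul_const, sub_self]
  filter_upwards [key] with t ht
  exact sub_eq_zero.1 ht

theorem IsWeakTimeDeriv.sub {u w u' w' : ℝ → X} (hu : Integrable u (timeMeasure T))
    (hw : Integrable w (timeMeasure T)) (hu' : Integrable u' (timeMeasure T))
    (hw' : Integrable w' (timeMeasure T)) (h : IsWeakTimeDeriv T u w)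
    (h' : IsWeakTimeDeriv T u' w') :
    IsWeakTimeDeriv T (fun t => u t - u' t) (fun t => w t - w' t) := by
  intro η hη
  simp only [smul_sub]
  rw [integral_sub (hη.integrable_deriv_smul' hu) (hη.integrable_deriv_smul' hu'),
    integral_sub (hη.integrable_smul' hw) (hη.integrable_smul' hw'), h η hη, h' η hη]
  abel

theorem integrable_prim [CompleteSpace X] {w : ℝ → X} (hw : Integrable w (timeMeasure T)) :
    Integrable (prim T w) (timeMeasure T) :=
  ((isPrimitive_prim hw).continuous.integrableOn_Icc).mono_set Ioo_subset_Icc_self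

/-- Since u − ∫₀ᵗw has weak derivative zero, it is constant. This is how weak equations in time are
turned into integrated ones. -/
theorem IsWeakTimeDeriv.exists_eq_prim [CompleteSpace X] (hT : 0 < T) {u w : ℝ → X}
    (hu : Integrable u (timeMeasure T)) (hw : Integrable w (timeMeasure T))
    (h : IsWeakTimeDeriv T u w) :
    ∃ x₀ : X, u =ᵐ[timeMeasure T] fun t => x₀ + prim T w t := by
  have hp : IsWeakTimeDeriv T (prim T w) w := by simpa using! isWeakTimeDeriv_prim hT hw (0 : X)
  have hz := h.sub hu hw (integrable_prim hw) hw hp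
  obtain ⟨c, hc⟩ := exists_const_of_isWeakTimeDeriv_zero hT (hu.sub (integrable_prim hw))
    (hz.congr (Filter.EventuallyEq.refl _ _) (by simp; rfl))
  refine ⟨c, ?_⟩
  filter_upwards [hc] with t ht
  exact sub_eq_iff_eq_add.1 ht

theorem IsWeakTimeDeriv.unique [CompleteSpace X] {u w w' : ℝ → X}
    (hw : Integrable w (timeMeasure T))
    (hw' : Integrable w' (timeMeasure T)) (h : IsWeakTimeDeriv T u w)
    (h' : IsWeakTimeDeriv T u w') : w =ᵐ[timeMeasure T] w' := by
  have : (fun t => w t - w' t) =ᵐ[timeMeasure T] 0 := by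
    refine ae_eq_zero_of_forall_timeTest (hw.sub hw') fun η hη => ?_
    simp only [smul_sub]
    rw [integral_sub (hη.integrable_smul' hw) (hη.integrable_smul' hw'), sub_eq_zero,
      ← neg_inj, ← h η hη, ← h' η hη]
  filter_upwards [this] with t ht
  exact sub_eq_zero.1 ht

theorem IsWeakTimeDeriv.clm [CompleteSpace X] [CompleteSpace Y] (A : X →L[ℝ] Y) {u w : ℝ → X}
    (hu : Integrable u (timeMeasure T)) (hw : Integrable w (timeMeasure T))
    (h : IsWeakTimeDeriv T u w) : IsWeakTimeDeriv T (fun t => A (u t)) (fun t => A (w t)) := by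
  intro η hη
  simp only [← map_smul]
  rw [A.integral_comp_comm (hη.integrable_deriv_smul' hu),
    A.integral_comp_comm (hη.integrable_smul' hw), h η hη, map_neg]

/-- Two functions which are continuous on `[0,T]` and agree almost everywhere agree. -/
theorem eqOn_of_ae_eq (hT : 0 < T) {c d : ℝ → X} (hc : ContinuousOn c (Icc 0 T))
    (hd : ContinuousOn d (Icc 0 T)) (h : c =ᵐ[timeMeasure T] d) : EqOn c d (Icc 0 T) := by
  have h1 : EqOn c d (Ioo 0 T) :=
    Measure.eqOn_Ioo_of_ae_eq volume h (hc.mono Ioo_subset_Icc_self) (hd.mono Ioo_subset_Icc_self)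
  exact h1.of_subset_closure hc hd Ioo_subset_Icc_self (by rw [closure_Ioo hT.ne])

theorem HasInitialValue.unique (hT : 0 < T) {u : ℝ → X} {x y : X} (hx : HasInitialValue T u x)
    (hy : HasInitialValue T u y) : x = y := by
  obtain ⟨c, h1, h2, rfl⟩ := hx
  obtain ⟨d, k1, k2, rfl⟩ := hy
  exact eqOn_of_ae_eq hT h1 k1 (h2.symm.trans k2) ⟨le_rfl, hT.le⟩

theorem HasInitialValue.congr {u v : ℝ → X} {x : X} (hx : HasInitialValue T u x)
    (h : v =ᵐ[timeMeasure T] u) : HasInitialValue T v x := by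
  obtain ⟨c, h1, h2, h3⟩ := hx
  exact ⟨c, h1, h.trans h2, h3⟩

theorem HasInitialValue.add {u v : ℝ → X} {x y : X} (hx : HasInitialValue T u x)
    (hy : HasInitialValue T v y) : HasInitialValue T (fun t => u t + v t) (x + y) := by
  obtain ⟨c, h1, h2, rfl⟩ := hx
  obtain ⟨d, k1, k2, rfl⟩ := hy
  exact ⟨fun t => c t + d t, h1.add k1, h2.add k2, rfl⟩

theorem HasInitialValue.clm (A : X →L[ℝ] Y) {u : ℝ → X} {x : X} (hx : HasInitialValue T u x) :
    HasInitialValue T (fun t => A (u t)) (A x) := by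
  obtain ⟨c, h1, h2, rfl⟩ := hx
  exact ⟨fun t => A (c t), A.continuous.comp_continuousOn h1, h2.fun_comp A, rfl⟩

end WeakDeriv

/-! ### Continuous representatives -/

theorem norm_sq_Lp_two {α E : Type*} [MeasurableSpace α] {μ : Measure α} [NormedAddCommGroup E]
    (u : Lp E 2 μ) : ‖u‖ ^ 2 = ∫ t, ‖u t‖ ^ 2 ∂μ := by
  have h := (Lp.memLp u).eLpNorm_eq_integral_rpow_norm (by norm_num) (by norm_num)
  simp only [ENNReal.toReal_ofNat, Real.rpow_ofNat] at h
  have h0 : 0 ≤ ∫ t, ‖u t‖ ^ 2 ∂μ := integral_nonneg fun _ => by positivity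
  rw [Lp.norm_def, h, ENNReal.toReal_ofReal (by positivity), ← Real.rpow_natCast,
    ← Real.rpow_mul h0]
  norm_num

section Representatives

variable {T : ℝ} {X Y : Type} [NormedAddCommGroup X] [NormedSpace ℝ X]
  [NormedAddCommGroup Y] [NormedSpace ℝ Y]

theorem integrable_norm_sq_L2T (u : L2T T X) :
    Integrable (fun t => ‖u t‖ ^ 2) (timeMeasure T) :=
  (memLp_two_iff_integrable_sq_norm (Lp.aestronglyMeasurable u)).1 (Lp.memLp u)

/-- The integral over `(0,T)` as a continuous linear map on `L²(0,T;X)`. -/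
def intT (T : ℝ) (X : Type) [NormedAddCommGroup X] [NormedSpace ℝ X] : L2T T X →L[ℝ] X :=
  LinearMap.mkContinuous
    { toFun := fun u => ∫ t, u t ∂(timeMeasure T)
      map_add' := fun u v => by
        rw [← integral_add (integrable_L2T u) (integrable_L2T v)]
        exact integral_congr_ae (Lp.coeFn_add u v)
      map_smul' := fun c u => by
        rw [RingHom.id_apply, ← integral_smul]
        exact integral_congr_ae (Lp.coeFn_smul c u) }
    (((timeMeasure T).real univ) ^ (1 / 2 : ℝ)) fun u =>
      (norm_integral_le_integral_norm _).trans (integral_norm_L2T_le u)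

theorem intT_apply (u : L2T T X) : intT T X u = ∫ t, u t ∂(timeMeasure T) := rfl

/-- `w ↦ ∫₀ᵗ w` from `L²(0,T;X)` to `C([0,T];X)`. -/
def primC (T : ℝ) (X : Type) [NormedAddCommGroup X] [NormedSpace ℝ X] :
    L2T T X →L[ℝ] C(Icc 0 T, X) :=
  LinearMap.mkContinuous
    { toFun := fun w => ⟨fun t => prim T w t,
        (isPrimitive_prim (integrable_L2T w)).continuous.comp continuous_subtype_val⟩
      map_add' := fun u v => by
        ext t
        simp only [ContinuousMap.coe_mk, ContinuousMap.add_apply]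
        rw [← prim_add (integrable_L2T u) (integrable_L2T v), prim_congr (Lp.coeFn_add u v)]
        rfl
      map_smul' := fun c u => by
        ext t
        simp only [ContinuousMap.coe_mk, ContinuousMap.smul_apply, RingHom.id_apply]
        rw [← prim_smul, prim_congr (Lp.coeFn_smul c u)]
        rfl }
    (((timeMeasure T).real univ) ^ (1 / 2 : ℝ)) fun w => by
      rw [ContinuousMap.norm_le _ (by positivity)]
      exact fun t => (norm_prim_le (integrable_L2T w) t).trans (integral_norm_L2T_le w)

theorem primC_apply (w : L2T T X) (t : Icc 0 T) : primC T X w t = prim T w t := rfl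

theorem memLp_projIcc (hT : 0 < T) (c : C(Icc 0 T, X)) :
    MemLp (fun t => c (projIcc 0 T hT.le t)) 2 (timeMeasure T) :=
  MemLp.of_bound (c.continuous.comp continuous_projIcc).aestronglyMeasurable ‖c‖
    (Filter.Eventually.of_forall fun _ => c.norm_coe_le_norm _)

/-- The embedding of `C([0,T];X)` into `L²(0,T;X)`. -/
def toL2T (hT : 0 < T) (X : Type) [NormedAddCommGroup X] [NormedSpace ℝ X] :
    C(Icc 0 T, X) →L[ℝ] L2T T X :=
  LinearMap.mkContinuous
    { toFun := fun c => (memLp_projIcc hT c).toLp _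
      map_add' := fun c d => rfl
      map_smul' := fun a c => rfl }
    (((timeMeasure T).real univ) ^ (2 : ℝ≥0∞).toReal⁻¹) fun c => by
      refine Lp.norm_le_of_ae_bound (norm_nonneg c) ?_
      filter_upwards [(memLp_projIcc hT c).coeFn_toLp] with t ht
      change ‖((memLp_projIcc hT c).toLp _ : ℝ → X) t‖ ≤ _
      rw [ht]
      exact c.norm_coe_le_norm _

theorem toL2T_coe (hT : 0 < T) (c : C(Icc 0 T, X)) :
    toL2T hT X c =ᵐ[timeMeasure T] fun t => c (projIcc 0 T hT.le t) :=
  (memLp_projIcc hT c).coeFn_toLp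

theorem toL2T_primC (hT : 0 < T) (w : L2T T X) :
    toL2T hT X (primC T X w) =ᵐ[timeMeasure T] prim T w := by
  filter_upwards [toL2T_coe hT (primC T X w), ae_restrict_mem measurableSet_Ioo] with t h1 h2
  rw [h1, projIcc_of_mem hT.le (Ioo_subset_Icc_self h2), primC_apply]

theorem toL2T_injective (hT : 0 < T) : Function.Injective (toL2T hT X) := by
  intro c d h
  have h1 := (toL2T_coe hT c).symm.trans (h ▸ toL2T_coe hT d)
  have h2 := eqOn_of_ae_eq hT (c.continuous.comp continuous_projIcc).continuousOn
    (d.continuous.comp continuous_projIcc).continuousOn h1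
  ext t
  simpa using h2 t.2

theorem hasInitialValue_toL2T (hT : 0 < T) (c : C(Icc 0 T, X)) :
    HasInitialValue T (toL2T hT X c) (c ⟨0, left_mem_Icc.2 hT.le⟩) :=
  ⟨fun t => c (projIcc 0 T hT.le t), (c.continuous.comp continuous_projIcc).continuousOn,
    toL2T_coe hT c, congrArg c (projIcc_left hT.le)⟩

/-- The continuous representative of `u`, in terms of `u` and its weak derivative. -/
def repC (hT : 0 < T) (X : Type) [NormedAddCommGroup X] [NormedSpace ℝ X] :
    L2T T X × L2T T X →L[ℝ] C(Icc 0 T, X) :=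
  -- The constant of integration is the mean over (0,T) of u − ∫₀ᵗ∂ₜu. This makes the representative
  -- a bounded linear expression in the pair.
  (ContinuousLinearMap.const ℝ (Icc 0 T)).comp (T⁻¹ • (intT T X).comp
    (ContinuousLinearMap.fst ℝ _ _ -
      ((toL2T hT X).comp (primC T X)).comp (ContinuousLinearMap.snd ℝ _ _))) +
    (primC T X).comp (ContinuousLinearMap.snd ℝ _ _)

theorem repC_spec [CompleteSpace X] (hT : 0 < T) {p : L2T T X × L2T T X}
    (hp : p ∈ weakDerivPairs T X) : ∃ x₀ : X,
      (p.1 =ᵐ[timeMeasure T] fun t => x₀ + prim T p.2 t) ∧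
      ∀ t : Icc 0 T, repC hT X p t = x₀ + prim T p.2 t := by
  obtain ⟨x₀, h⟩ := IsWeakTimeDeriv.exists_eq_prim hT (integrable_L2T p.1) (integrable_L2T p.2) hp
  refine ⟨x₀, h, fun t => ?_⟩
  have h1 : intT T X (p.1 - toL2T hT X (primC T X p.2)) = T • x₀ := by
    rw [intT_apply]
    have : (p.1 - toL2T hT X (primC T X p.2) : L2T T X) =ᵐ[timeMeasure T] fun _ => x₀ := by
      filter_upwards [h, toL2T_primC hT p.2, Lp.coeFn_sub p.1 (toL2T hT X (primC T X p.2))]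
        with s h1 h2 h3
      rw [h3, Pi.sub_apply, h1, h2, add_sub_cancel_right]
    rw [integral_congr_ae this, integral_const]
    simp [measureReal_def, hT.le]
  have h2 : repC hT X p t = T⁻¹ • intT T X (p.1 - toL2T hT X (primC T X p.2))
    + prim T p.2 t := rfl
  rw [h2, h1, smul_smul, inv_mul_cancel₀ hT.ne', one_smul]

theorem toL2T_repC [CompleteSpace X] (hT : 0 < T) {p : L2T T X × L2T T X}
    (hp : p ∈ weakDerivPairs T X) : toL2T hT X (repC hT X p) = p.1 := by
  obtain ⟨x₀, h1, h2⟩ := repC_spec hT hp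
  apply Lp.ext
  filter_upwards [toL2T_coe hT (repC hT X p), h1, ae_restrict_mem measurableSet_Ioo] with t k1 k2 k3
  rw [k1, h2, k2, projIcc_of_mem hT.le (Ioo_subset_Icc_self k3)]

theorem mem_weakDerivPairs_of_ae_eq [CompleteSpace X] (hT : 0 < T) {u w : L2T T X} {x₀ : X}
    (h : u =ᵐ[timeMeasure T] fun t => x₀ + prim T w t) : (u, w) ∈ weakDerivPairs T X :=
  (isWeakTimeDeriv_prim hT (integrable_L2T w) x₀).congr h (Filter.EventuallyEq.refl _ _)

/-- Each test function contributes one equation between functions continuous on L²(0,T;X)².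
Completeness of W̃(0,T;V) rests on this. -/
theorem isClosed_weakDerivPairs : IsClosed (weakDerivPairs T X : Set (L2T T X × L2T T X)) := by
  have hc : ∀ ζ : ℝ → ℝ, Continuous ζ → HasCompactSupport ζ →
      Continuous fun u : L2T T X => ∫ t, ζ t • u t ∂(timeMeasure T) := by
    intro ζ h1 h2
    obtain ⟨C, hC⟩ := h1.bounded_above_of_compact_support h2
    have hi : ∀ u : L2T T X, Integrable (fun t => ζ t • u t) (timeMeasure T) := fun u =>
      (integrable_L2T u).bdd_smul C h1.aestronglyMeasurable (Filter.Eventually.of_forall hC)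
    have hC0 : 0 ≤ C := (norm_nonneg _).trans (hC 0)
    let A : L2T T X →L[ℝ] X := LinearMap.mkContinuous
      { toFun := fun u => ∫ t, ζ t • u t ∂(timeMeasure T)
        map_add' := fun u v => by
          rw [← integral_add (hi u) (hi v)]
          apply integral_congr_ae
          filter_upwards [Lp.coeFn_add u v] with t ht
          rw [ht, Pi.add_apply, smul_add]
        map_smul' := fun c u => by
          rw [RingHom.id_apply, ← integral_smul]
          apply integral_congr_ae
          filter_upwards [Lp.coeFn_smul c u] with t ht
          rw [ht, Pi.smul_apply, smul_comm] }
      (C * ((timeMeasure T).real univ) ^ (1 / 2 : ℝ)) fun u => by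
        refine (norm_integral_le_integral_norm _).trans ?_
        rw [mul_assoc]
        refine le_trans ?_ (mul_le_mul_of_nonneg_left (integral_norm_L2T_le u) hC0)
        rw [← integral_const_mul]
        refine integral_mono (hi u).norm ((integrable_L2T u).norm.const_mul C) fun t => ?_
        simp only [norm_smul]
        gcongr
        exact hC t
    exact A.continuous
  have : (weakDerivPairs T X : Set (L2T T X × L2T T X)) = ⋂ η : {η : ℝ → ℝ // IsTimeTest T η},
      {p | ∫ t, deriv η.1 t • p.1 t ∂(timeMeasure T) = -∫ t, η.1 t • p.2 t ∂(timeMeasure T)} := by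
    ext p
    simp only [mem_iInter, Subtype.forall]
    rfl
  rw [this]
  refine isClosed_iInter fun η => isClosed_eq ?_ ?_
  · exact (hc _ (η.2.1.continuous_deriv (by simp)) η.2.2.1.deriv).comp continuous_fst
  · exact ((hc _ η.2.1.continuous η.2.2.1).comp continuous_snd).neg

/-- Strong convergence of uniformly bounded operators carries over to `L²(0,T;·)`. -/
theorem tendsto_compLpL_zero {A : ℕ → X →L[ℝ] Y} {C : ℝ} (hC : ∀ k x, ‖A k x‖ ≤ C * ‖x‖)
    (hA : ∀ x, Filter.Tendsto (fun k => A k x) Filter.atTop (𝓝 0)) (u : L2T T X) :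
    Filter.Tendsto (fun k => (A k).compLpL 2 (timeMeasure T) u) Filter.atTop (𝓝 0) := by
  rw [tendsto_zero_iff_norm_tendsto_zero]
  have h : Filter.Tendsto (fun k => ‖(A k).compLpL 2 (timeMeasure T) u‖ ^ 2) Filter.atTop
      (𝓝 0) := by
    have e : ∀ k, ‖(A k).compLpL 2 (timeMeasure T) u‖ ^ 2 =
        ∫ t, ‖A k (u t)‖ ^ 2 ∂(timeMeasure T) := fun k => by
      rw [norm_sq_Lp_two]
      apply integral_congr_ae
      filter_upwards [(A k).coeFn_compLpL u] with t ht
      rw [ht]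
    simp only [e]
    have e0 : (0 : ℝ) = ∫ t, (0 : ℝ) ∂(timeMeasure T) := by simp
    rw [e0]
    -- The uniform operator bound supplies the majorant C²‖u(t)‖².
    refine tendsto_integral_of_dominated_convergence (fun t => C ^ 2 * ‖u t‖ ^ 2)
      (fun k => (((A k).continuous.comp_aestronglyMeasurable (Lp.aestronglyMeasurable u)).norm.pow 2))
      ((integrable_norm_sq_L2T u).const_mul _) (fun k => Filter.Eventually.of_forall fun t => ?_)
      (Filter.Eventually.of_forall fun t => ?_)
    · rw [Real.norm_of_nonneg (by positivity), ← mul_pow]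
      exact pow_le_pow_left₀ (norm_nonneg _) (hC k _) 2
    · simpa using ((hA (u t)).norm.pow 2)
  have := h.sqrt
  simpa [Real.sqrt_sq (norm_nonneg _)] using this

end Representatives

/-! ### The Lions–Magenes embedding -/

section Hilbert

variable {V H : Type} [NormedAddCommGroup V] [InnerProductSpace ℝ V] [CompleteSpace V]
  [NormedAddCommGroup H] [InnerProductSpace ℝ H]

/-- The Riesz isomorphism `V' → V`. -/
def riesz (V : Type) [NormedAddCommGroup V] [InnerProductSpace ℝ V] [CompleteSpace V] :
    StrongDual ℝ V →L[ℝ] V :=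
  LinearMap.mkContinuous
    { toFun := fun f => (InnerProductSpace.toDual ℝ V).symm f
      map_add' := fun f g => map_add _ f g
      map_smul' := fun c f => by simp } 1 fun f => by
      rw [one_mul]
      exact ((InnerProductSpace.toDual ℝ V).symm.norm_map f).le

theorem inner_riesz (f : StrongDual ℝ V) (v : V) : inner ℝ (riesz V f) v = f v :=
  InnerProductSpace.toDual_symm_apply

theorem innerSL_riesz (f : StrongDual ℝ V) : innerSL ℝ (riesz V f) = f := by
  ext w
  rw [innerSL_apply_apply, inner_riesz]

theorem norm_riesz (f : StrongDual ℝ V) : ‖riesz V f‖ = ‖f‖ :=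
  (InnerProductSpace.toDual ℝ V).symm.norm_map f

theorem gelfandMap_apply (ι : V →L[ℝ] H) (v w : V) : gelfandMap ι v w = inner ℝ (ι v) (ι w) := rfl

/-- The operator `ι†ι` of a Gelfand triple. -/
def gram (ι : V →L[ℝ] H) : V →L[ℝ] V := (riesz V).comp (gelfandMap ι)

theorem inner_gram (ι : V →L[ℝ] H) (v w : V) :
    inner ℝ (gram ι v) w = inner ℝ (ι v) (ι w) := inner_riesz _ _

/-- Lax–Milgram for ⟨ιv, ιw⟩ + ε⟨v, w⟩, which is coercive with constant ε. Pairing the equation for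
Rx with Rx gives the bound. -/
theorem exists_gram_resolvent (ι : V →L[ℝ] H) {ε : ℝ} (hε : 0 < ε) :
    ∃ R : V →L[ℝ] V, (∀ x, gram ι (R x) + ε • R x = x) ∧ (∀ x, R (gram ι x) + ε • R x = x) ∧
      ∀ x, ε * ‖R x‖ ≤ ‖x‖ := by
  let B : V →L[ℝ] V →L[ℝ] ℝ := gelfandMap ι + ε • gelfandMap (ContinuousLinearMap.id ℝ V)
  have hB : ∀ v w, B v w = inner ℝ (gram ι v + ε • v) w := fun v w => by
    rw [inner_add_left, inner_gram, real_inner_smul_left]; rfl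
  have hc : IsCoercive B := ⟨ε, hε, fun u => by
    rw [hB, inner_add_left, inner_gram, real_inner_smul_left, real_inner_self_eq_norm_sq,
      real_inner_self_eq_norm_sq]
    nlinarith [sq_nonneg ‖ι u‖]⟩
  have hA : ∀ v, hc.continuousLinearEquivOfBilin v = gram ι v + ε • v := fun v =>
    (hc.unique_continuousLinearEquivOfBilin fun w => (hB v w).symm).symm
  refine ⟨hc.continuousLinearEquivOfBilin.symm, fun x => ?_, fun x => ?_, fun x => ?_⟩
  · rw [ContinuousLinearEquiv.coe_coe, ← hA, ContinuousLinearEquiv.apply_symm_apply]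
  · rw [ContinuousLinearEquiv.coe_coe, ← map_smul, ← map_add, ← hA,
      ContinuousLinearEquiv.symm_apply_apply]
  · set y := hc.continuousLinearEquivOfBilin.symm x with hy
    have hx : x = gram ι y + ε • y := by
      rw [← hA, hy, ContinuousLinearEquiv.apply_symm_apply]
    have h1 : ε * ‖y‖ ^ 2 ≤ inner ℝ x y := by
      rw [hx, inner_add_left, inner_gram, real_inner_smul_left, real_inner_self_eq_norm_sq,
        real_inner_self_eq_norm_sq]
      nlinarith [sq_nonneg ‖ι y‖]
    have h2 := real_inner_le_norm x y
    rw [ContinuousLinearEquiv.coe_coe, ← hy]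
    rcases (norm_nonneg y).eq_or_lt with h | h
    · rw [← h]; simp
    · have h3 : (ε * ‖y‖) * ‖y‖ ≤ ‖x‖ * ‖y‖ := by nlinarith
      exact le_of_mul_le_mul_right h3 h

/-- If x is orthogonal to the range of ι†ι, then pairing x with ι†ιx gives ‖ιx‖² = 0. -/
theorem denseRange_gram {ι : V →L[ℝ] H} (hι : Function.Injective ι) :
    Dense (range (gram ι)) := by
  have h : (gram ι).range.topologicalClosure = ⊤ := by
    rw [Submodule.topologicalClosure_eq_top_iff, Submodule.eq_bot_iff]
    intro x hx
    have h1 := (Submodule.mem_orthogonal _ _).1 hx (gram ι x) ⟨x, rfl⟩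
    rw [inner_gram, real_inner_self_eq_norm_sq] at h1
    have h2 : ι x = 0 := by simpa using h1
    exact hι (h2.trans (map_zero ι).symm)
  have h2 := (gram ι).range.dense_iff_topologicalClosure_eq_top.2 h
  exact h2

/-- Write G = ι†ι and R_k = (G + ε_k)⁻¹ with ε_k = 1/(k+1). The error x − R_kGx equals ε_kR_kx; it
is bounded by ‖x‖ and is O(ε_k) on the range of G, which is dense. Through the Riesz map, R_k turns
V'-valued functions into V-valued ones. It thereby regularizes time derivatives that exist only in
V'. -/
theorem exists_approximate_inverse {ι : V →L[ℝ] H} (hι : Function.Injective ι) :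
    ∃ R : ℕ → V →L[ℝ] V, (∀ k x, gram ι (R k x) = R k (gram ι x)) ∧
      (∀ k x, ‖x - R k (gram ι x)‖ ≤ 1 * ‖x‖) ∧
      ∀ x, Filter.Tendsto (fun k => x - R k (gram ι x)) Filter.atTop (𝓝 0) := by
  have hpos : ∀ k : ℕ, (0 : ℝ) < 1 / ((k : ℝ) + 1) := fun k => by positivity
  choose R h1 h2 h3 using fun k : ℕ => exists_gram_resolvent ι (hpos k)
  have e : ∀ k x, x - R k (gram ι x) = (1 / ((k : ℝ) + 1)) • R k x := fun k x => by
    nth_rewrite 1 [← h2 k x]; abel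
  have hb : ∀ k x, ‖x - R k (gram ι x)‖ ≤ 1 * ‖x‖ := fun k x => by
    rw [e, norm_smul, Real.norm_of_nonneg (hpos k).le, one_mul]; exact h3 k x
  refine ⟨R, fun k x => ?_, hb, fun x => ?_⟩
  · exact add_right_cancel ((h1 k x).trans (h2 k x).symm)
  · rw [Metric.tendsto_atTop]
    intro δ hδ
    obtain ⟨_, hz, ⟨z, rfl⟩⟩ := Metric.dense_iff.1 (denseRange_gram hι) x (δ / 2) (by positivity)
    rw [Metric.mem_ball, dist_eq_norm] at hz
    have hlim : Filter.Tendsto (fun k : ℕ => 2 * ‖z‖ * (1 / ((k : ℝ) + 1))) Filter.atTop (𝓝 0) := by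
      simpa using tendsto_one_div_add_atTop_nhds_zero_nat.const_mul (2 * ‖z‖)
    obtain ⟨N, hN⟩ := (Metric.tendsto_atTop.1 hlim) (δ / 2) (by positivity)
    refine ⟨N, fun k hk => ?_⟩
    have hk1 := hN k hk
    rw [Real.dist_eq, sub_zero, abs_of_nonneg (by positivity)] at hk1
    rw [dist_zero_right]
    -- On the range of G the error is ε_kR_kGz = ε_k(z − ε_kR_kz), where ‖ε_kR_kz‖ ≤ ‖z‖.
    have hg : ‖gram ι z - R k (gram ι (gram ι z))‖ ≤ 2 * ‖z‖ * (1 / ((k : ℝ) + 1)) := by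
      have h4 : R k (gram ι z) = z - (1 / ((k : ℝ) + 1)) • R k z := by
        rw [← e]; abel
      rw [e, norm_smul, Real.norm_of_nonneg (hpos k).le, mul_comm, h4]
      gcongr
      calc _ ≤ ‖z‖ + ‖(1 / ((k : ℝ) + 1)) • R k z‖ := norm_sub_le _ _
        _ ≤ ‖z‖ + ‖z‖ := by
          gcongr
          rw [norm_smul, Real.norm_of_nonneg (hpos k).le]; exact h3 k z
        _ = _ := by ring
    have hsplit : x - R k (gram ι x) = ((x - gram ι z) - R k (gram ι (x - gram ι z))) +
        (gram ι z - R k (gram ι (gram ι z))) := by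
      simp only [map_sub]; abel
    rw [hsplit]
    calc _ ≤ ‖x - gram ι z‖ + 2 * ‖z‖ * (1 / ((k : ℝ) + 1)) := by
          refine (norm_add_le _ _).trans (add_le_add ?_ hg)
          simpa using hb k (x - gram ι z)
      _ < δ / 2 + δ / 2 := by
          refine add_lt_add ?_ hk1
          rw [norm_sub_rev]; exact hz
      _ = δ := by ring

variable {T : ℝ}

/-- The a priori estimate of Lions–Magenes for functions with V-valued derivative: (d/dt)‖ιy‖² is
twice the pairing of w, viewed in V', with y. Only the V'-norm of the derivative enters on the
right, so the estimate survives the limit in `exists_continuous_rep`. -/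
theorem norm_sq_rep_le (hT : 0 < T) (ι : V →L[ℝ] H) {y w : L2T T V}
    (h : (y, w) ∈ weakDerivPairs T V) (t : Icc 0 T) :
    ‖ι (repC hT V (y, w) t)‖ ^ 2 ≤ (‖ι‖ ^ 2 / T + 1) *
      (‖y‖ ^ 2 + ‖(gelfandMap ι).compLpL 2 (timeMeasure T) w‖ ^ 2) := by
  obtain ⟨x₀, h1, h2⟩ := repC_spec hT h
  set z : ℝ → V := fun t => x₀ + prim T w t with hz
  set v : ℝ → V := fun t => 0 + (Ioo 0 T).indicator w t with hv
  have hp : IsPrimitive z v := (isPrimitive_const x₀).add (isPrimitive_prim (integrable_L2T w))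
  have hq := hp.bilin (gelfandMap ι) hp
  have hcs : Continuous z := hp.continuous
  set g := (gelfandMap ι).compLpL 2 (timeMeasure T) w with hg
  have hgae : ∀ᵐ τ ∂(timeMeasure T), g τ = gelfandMap ι (v τ) := by
    filter_upwards [(gelfandMap ι).coeFn_compLpL (p := 2) (μ := timeMeasure T) w,
      ae_restrict_mem measurableSet_Ioo] with τ k1 k2
    rw [k1]; simp [hv, k2]
  have hbound : ∀ s ∈ Icc 0 T, ‖ι (z t)‖ ^ 2 ≤ ‖ι (z s)‖ ^ 2 + (‖y‖ ^ 2 + ‖g‖ ^ 2) := by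
    intro s hs
    have e := hq.sub_eq s t
    simp only [gelfandMap_apply, real_inner_self_eq_norm_sq] at e
    have hsymm : ∀ τ, inner ℝ (ι (z τ)) (ι (v τ)) = inner ℝ (ι (v τ)) (ι (z τ)) := fun τ =>
      real_inner_comm _ _
    have hle : ‖∫ τ in s..t, (inner ℝ (ι (v τ)) (ι (z τ)) + inner ℝ (ι (z τ)) (ι (v τ)) : ℝ)‖
        ≤ ∫ τ, (‖y τ‖ ^ 2 + ‖g τ‖ ^ 2) ∂(timeMeasure T) := by
      refine (intervalIntegral.norm_integral_le_integral_norm_uIoc).trans ?_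
      have hint : Integrable (fun τ => ‖(inner ℝ (ι (v τ)) (ι (z τ)) +
          inner ℝ (ι (z τ)) (ι (v τ)) : ℝ)‖) (timeMeasure T) :=
        ((hq.1.integrableOn_isCompact isCompact_Icc).mono_set Ioo_subset_Icc_self).norm
      have hsub : uIoc s t ⊆ Ioc 0 T := by
        intro τ hτ
        have h3 : uIoc s (t : ℝ) ⊆ uIoc 0 T := uIoc_subset_uIoc_of_uIcc_subset_uIcc
          (by rw [uIcc_of_le hT.le]; exact uIcc_subset_Icc hs t.2)
        rw [uIoc_of_le hT.le] at h3
        exact h3 hτ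
      calc _ ≤ ∫ τ in Ioc 0 T, ‖(inner ℝ (ι (v τ)) (ι (z τ)) +
            inner ℝ (ι (z τ)) (ι (v τ)) : ℝ)‖ := by
            refine setIntegral_mono_set ?_ (Filter.Eventually.of_forall fun _ => norm_nonneg _)
              (Filter.Eventually.of_forall hsub)
            exact ((hq.1.integrableOn_isCompact isCompact_Icc).mono_set Ioc_subset_Icc_self).norm
        _ = ∫ τ, ‖(inner ℝ (ι (v τ)) (ι (z τ)) +
            inner ℝ (ι (z τ)) (ι (v τ)) : ℝ)‖ ∂(timeMeasure T) := integral_Ioc_eq_integral_Ioo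
        _ ≤ _ := by
            refine integral_mono_ae hint ((integrable_norm_sq_L2T y).add
              (integrable_norm_sq_L2T g)) ?_
            filter_upwards [h1, hgae] with τ k1 k2
            rw [hsymm, ← two_mul, norm_mul, Real.norm_ofNat, k1, k2]
            have := (gelfandMap ι (v τ)).le_opNorm (z τ)
            rw [gelfandMap_apply] at this
            nlinarith [sq_nonneg (‖gelfandMap ι (v τ)‖ - ‖z τ‖)]
    rw [integral_add (integrable_norm_sq_L2T y) (integrable_norm_sq_L2T g),
      ← norm_sq_Lp_two, ← norm_sq_Lp_two, ← e] at hle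
    have := (le_abs_self _).trans hle
    linarith
  have hrep : repC hT V (y, w) t = z t := h2 t
  rw [hrep]
  -- Averaging over the comparison time s replaces a pointwise value by the L² norm of y; this
  -- produces ‖ι‖²/T in the constant.
  have hint : ∫ s, ‖ι (z t)‖ ^ 2 ∂(timeMeasure T) ≤
      ∫ s, (‖ι‖ ^ 2 * ‖y s‖ ^ 2 + (‖y‖ ^ 2 + ‖g‖ ^ 2)) ∂(timeMeasure T) := by
    refine integral_mono_ae (integrable_const _)
      (((integrable_norm_sq_L2T y).const_mul _).add (integrable_const _)) ?_
    filter_upwards [h1, ae_restrict_mem measurableSet_Ioo] with s k1 k2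
    refine (hbound s (Ioo_subset_Icc_self k2)).trans ?_
    rw [k1, ← mul_pow]
    gcongr
    exact ι.le_opNorm _
  rw [integral_add ((integrable_norm_sq_L2T y).const_mul _) (integrable_const _),
    integral_const_mul, integral_const, integral_const, ← norm_sq_Lp_two] at hint
  simp only [measureReal_def, Measure.restrict_apply_univ, Real.volume_Ioo, sub_zero,
    ENNReal.toReal_ofReal hT.le, smul_eq_mul] at hint
  have h5 : (‖ι‖ ^ 2 / T + 1) * (‖y‖ ^ 2 + ‖g‖ ^ 2) =
    (‖ι‖ ^ 2 * ‖y‖ ^ 2 + T * (‖y‖ ^ 2 + ‖g‖ ^ 2) + ‖ι‖ ^ 2 * ‖g‖ ^ 2) / T := by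
    field_simp; ring
  rw [h5, le_div_iff₀ hT]
  nlinarith [mul_nonneg (sq_nonneg ‖ι‖) (sq_nonneg ‖g‖)]

variable [CompleteSpace H]

/-- Lions–Magenes: if `u ∈ L²(0,T;V)` and `∂ₜu ∈ L²(0,T;V')`, then `u ∈ C([0,T];H)`. -/
theorem exists_continuous_rep (hT : 0 < T) {ι : V →L[ℝ] H} (hι : Function.Injective ι)
    {u : L2T T V} {g : L2T T (StrongDual ℝ V)}
    (h : ((gelfandMap ι).compLpL 2 (timeMeasure T) u, g) ∈ weakDerivPairs T (StrongDual ℝ V)) :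
    ∃ c : C(Icc 0 T, H), toL2T hT H c = ι.compLpL 2 (timeMeasure T) u ∧
      ‖c‖ ^ 2 ≤ (‖ι‖ ^ 2 / T + 1) * (‖u‖ ^ 2 + ‖g‖ ^ 2) := by
  obtain ⟨R, hR1, hR2, hR3⟩ := exists_approximate_inverse hι
  obtain ⟨h₀, hh⟩ := IsWeakTimeDeriv.exists_eq_prim hT
    (integrable_L2T ((gelfandMap ι).compLpL 2 (timeMeasure T) u)) (integrable_L2T g) h
  set K : ℝ := ‖ι‖ ^ 2 / T + 1 with hK
  have hK0 : 0 ≤ K := by positivity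
  -- The regularization R_kGu has the V-valued derivative obtained by applying R_k and the Riesz map
  -- to g.
  let y : ℕ → L2T T V := fun k => ((R k).comp (gram ι)).compLpL 2 (timeMeasure T) u
  let w : ℕ → L2T T V := fun k => ((R k).comp (riesz V)).compLpL 2 (timeMeasure T) g
  let f : ℕ → L2T T (StrongDual ℝ V) := fun k =>
    (gelfandMap ι).compLpL 2 (timeMeasure T) (w k)
  have hpair : ∀ k, (y k, w k) ∈ weakDerivPairs T V := by
    intro k
    refine mem_weakDerivPairs_of_ae_eq (x₀ := R k (riesz V h₀)) hT ?_
    filter_upwards [((R k).comp (gram ι)).coeFn_compLpL (p := 2) (μ := timeMeasure T) u, hh,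
      (gelfandMap ι).coeFn_compLpL (p := 2) (μ := timeMeasure T) u] with t k1 k2 k3
    rw [k1, prim_congr (((R k).comp (riesz V)).coeFn_compLpL (p := 2) (μ := timeMeasure T) g),
      prim_clm ((R k).comp (riesz V)) (integrable_L2T g)]
    rw [k3] at k2
    simp only [ContinuousLinearMap.comp_apply, gram]
    rw [k2, map_add, map_add]
  have hy : Filter.Tendsto y Filter.atTop (𝓝 u) := by
    have := tendsto_compLpL_zero (T := T)
      (A := fun k => ContinuousLinearMap.id ℝ V - (R k).comp (gram ι)) hR2 hR3 u
    have e : ∀ k, (ContinuousLinearMap.id ℝ V - (R k).comp (gram ι)).compLpL 2 (timeMeasure T) u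
        = u - y k := fun k => by
      apply Lp.ext
      filter_upwards [(ContinuousLinearMap.id ℝ V - (R k).comp (gram ι)).coeFn_compLpL (p := 2)
        (μ := timeMeasure T) u, Lp.coeFn_sub u (y k),
        ((R k).comp (gram ι)).coeFn_compLpL (p := 2) (μ := timeMeasure T) u] with t k1 k2 k3
      rw [k1, k2, Pi.sub_apply, k3]; rfl
    simp only [e] at this
    simpa using this.const_sub u
  have hf : Filter.Tendsto f Filter.atTop (𝓝 g) := by
    -- Because R_k commutes with G, viewing the regularized derivative in V' amounts, under the
    -- Riesz map, to applying R_kG. So it converges to g in L²(0,T;V').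
    have e0 : ∀ (k : ℕ) (φ : StrongDual ℝ V), gelfandMap ι (R k (riesz V φ)) =
        innerSL ℝ (R k (gram ι (riesz V φ))) := fun k φ => by
      rw [← hR1]
      ext v
      rw [innerSL_apply_apply, inner_gram, gelfandMap_apply]
    let A : ℕ → StrongDual ℝ V →L[ℝ] StrongDual ℝ V := fun k =>
      ContinuousLinearMap.id ℝ _ - (gelfandMap ι).comp ((R k).comp (riesz V))
    have hA : ∀ k φ, A k φ = innerSL ℝ (riesz V φ - R k (gram ι (riesz V φ))) := fun k φ => by
      rw [map_sub, innerSL_riesz, ← e0]; rfl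
    have := tendsto_compLpL_zero (T := T) (A := A) (C := 1) (fun k φ => by
      rw [hA, innerSL_apply_norm, ← norm_riesz φ]; exact hR2 k _) (fun φ => by
      have h1 := ((innerSL ℝ (E := V)).continuous.tendsto 0).comp (hR3 (riesz V φ))
      rw [map_zero] at h1
      exact h1.congr fun k => (hA k φ).symm) g
    have e : ∀ k, (A k).compLpL 2 (timeMeasure T) g = g - f k := fun k => by
      apply Lp.ext
      filter_upwards [(A k).coeFn_compLpL (p := 2) (μ := timeMeasure T) g, Lp.coeFn_sub g (f k),
        (gelfandMap ι).coeFn_compLpL (p := 2) (μ := timeMeasure T) (w k),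
        ((R k).comp (riesz V)).coeFn_compLpL (p := 2) (μ := timeMeasure T) g] with t k1 k2 k3 k4
      rw [k1, k2, Pi.sub_apply, k3, k4]; rfl
    simp only [e] at this
    simpa using this.const_sub g
  let ιC : C(Icc 0 T, V) →L[ℝ] C(Icc 0 T, H) := ι.compLeftContinuous ℝ (Icc 0 T)
  let φ : ℕ → C(Icc 0 T, H) := fun k => ιC (repC hT V (y k, w k))
  have hest : ∀ p ∈ weakDerivPairs T V, ‖ιC (repC hT V p)‖ ≤
      √(K * (‖p.1‖ ^ 2 + ‖(gelfandMap ι).compLpL 2 (timeMeasure T) p.2‖ ^ 2)) := by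
    intro p hp
    rw [ContinuousMap.norm_le _ (Real.sqrt_nonneg _)]
    exact fun t => Real.le_sqrt_of_sq_le (norm_sq_rep_le hT ι hp t)
  -- The a priori estimate applied to differences of regularizations gives a Cauchy sequence in
  -- C([0,T];H).
  have hcauchy : CauchySeq φ := by
    rw [Metric.cauchySeq_iff]
    have hcont : Filter.Tendsto (fun p : ℕ × ℕ => √(K * (‖y p.1 - y p.2‖ ^ 2 +
        ‖f p.1 - f p.2‖ ^ 2))) (Filter.atTop ×ˢ Filter.atTop) (𝓝 0) := by
      have a1 : Filter.Tendsto (Prod.fst : ℕ × ℕ → ℕ) (Filter.atTop ×ˢ Filter.atTop)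
        Filter.atTop := Filter.tendsto_fst
      have a2 : Filter.Tendsto (Prod.snd : ℕ × ℕ → ℕ) (Filter.atTop ×ˢ Filter.atTop)
        Filter.atTop := Filter.tendsto_snd
      have t1 := (hy.comp a1).sub (hy.comp a2)
      have t2 := (hf.comp a1).sub (hf.comp a2)
      have := (((t1.norm.pow 2).add (t2.norm.pow 2)).const_mul K).sqrt
      simpa using this
    intro ε hε
    rw [Filter.prod_atTop_atTop_eq, Metric.tendsto_atTop] at hcont
    obtain ⟨N, hN⟩ := hcont ε hε
    refine ⟨max N.1 N.2, fun m hm k hk => ?_⟩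
    have := hN (m, k) ⟨(le_max_left _ _).trans hm, (le_max_right _ _).trans hk⟩
    rw [dist_zero_right, Real.norm_of_nonneg (Real.sqrt_nonneg _)] at this
    refine lt_of_le_of_lt ?_ this
    have e : φ m - φ k = ιC (repC hT V ((y m, w m) - (y k, w k))) := by
      rw [map_sub, map_sub]
    rw [dist_eq_norm, e]
    refine (hest _ ((weakDerivPairs T V).sub_mem (hpair m) (hpair k))).trans (le_of_eq ?_)
    simp only [Prod.fst_sub, Prod.snd_sub, map_sub, f]
  obtain ⟨c, hc⟩ := cauchySeq_tendsto_of_complete hcauchy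
  refine ⟨c, ?_, ?_⟩
  · have t1 := ((toL2T hT H).continuous.tendsto c).comp hc
    have t2 := ((ι.compLpL 2 (timeMeasure T)).continuous.tendsto u).comp hy
    refine tendsto_nhds_unique t1 (t2.congr fun k => ?_)
    apply Lp.ext
    have hk := toL2T_repC hT (hpair k)
    have hk2 := toL2T_coe hT (repC hT V (y k, w k))
    rw [hk] at hk2
    filter_upwards [ι.coeFn_compLpL (p := 2) (μ := timeMeasure T) (y k), toL2T_coe hT (φ k), hk2]
      with t k1 k2 k3
    simp only [Function.comp_apply]
    rw [k1, k2, k3]; rfl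
  · have t1 := hc.norm.pow 2
    have t2 : Filter.Tendsto (fun k => K * (‖y k‖ ^ 2 + ‖f k‖ ^ 2)) Filter.atTop
        (𝓝 (K * (‖u‖ ^ 2 + ‖g‖ ^ 2))) :=
      ((hy.norm.pow 2).add (hf.norm.pow 2)).const_mul K
    refine le_of_tendsto_of_tendsto' t1 t2 fun k => ?_
    have := hest _ (hpair k)
    calc _ ≤ √(K * (‖y k‖ ^ 2 + ‖f k‖ ^ 2)) ^ 2 := pow_le_pow_left₀ (norm_nonneg _) this 2
      _ = _ := Real.sq_sqrt (by positivity)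

end Hilbert

/-! ### The spaces `W̃(0,T;V)`: completeness and traces -/

section WTilde

variable {T : ℝ} {V H : Type} [NormedAddCommGroup V] [NormedSpace ℝ V] [NormedAddCommGroup H]
  [InnerProductSpace ℝ H] {ι : V →L[ℝ] H}

/-- `∂ₜ²u`, as an element of `L²(0,T;V')`. -/
def WTilde.dtt (T : ℝ) (ι : V →L[ℝ] H) : WTilde T ι →L[ℝ] L2T T (StrongDual ℝ V) :=
  ((WithLp.sndL 2 ℝ _ _).comp (WithLp.sndL 2 ℝ _ _)).comp (WTildeSubmodule T ι).subtypeL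

theorem WTilde.mem_fn_dt (u : WTilde T ι) :
    (WTilde.fn T ι u, WTilde.dt T ι u) ∈ weakDerivPairs T V := u.2.1

theorem WTilde.mem_dt_dtt (u : WTilde T ι) :
    ((gelfandMap ι).compLpL 2 (timeMeasure T) (WTilde.dt T ι u), WTilde.dtt T ι u) ∈
      weakDerivPairs T (StrongDual ℝ V) := u.2.2

/-- The element of `W̃(0,T;V)` with given derivatives. -/
def WTilde.mk {u v : L2T T V} {g : L2T T (StrongDual ℝ V)} (h1 : (u, v) ∈ weakDerivPairs T V)
    (h2 : ((gelfandMap ι).compLpL 2 (timeMeasure T) v, g) ∈ weakDerivPairs T (StrongDual ℝ V)) :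
    WTilde T ι :=
  (⟨WithLp.toLp 2 (u, WithLp.toLp 2 (v, g)), h1, h2⟩ : WTildeSubmodule T ι)

section mk

variable {u v : L2T T V} {g : L2T T (StrongDual ℝ V)} (h1 : (u, v) ∈ weakDerivPairs T V)
    (h2 : ((gelfandMap ι).compLpL 2 (timeMeasure T) v, g) ∈ weakDerivPairs T (StrongDual ℝ V))

@[simp] theorem WTilde.fn_mk : WTilde.fn T ι (WTilde.mk h1 h2) = u := rfl
@[simp] theorem WTilde.dt_mk : WTilde.dt T ι (WTilde.mk h1 h2) = v := rfl

end mk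

theorem weakDerivPairs_unique {X : Type} [NormedAddCommGroup X] [NormedSpace ℝ X]
    [CompleteSpace X] {u w w' : L2T T X}
    (h : (u, w) ∈ weakDerivPairs T X) (h' : (u, w') ∈ weakDerivPairs T X) : w = w' :=
  Lp.ext (IsWeakTimeDeriv.unique (integrable_L2T w) (integrable_L2T w') h h')

theorem WTilde.ext [CompleteSpace V] {u w : WTilde T ι}
    (h : WTilde.fn T ι u = WTilde.fn T ι w) : u = w := by
  have h1 : WTilde.dt T ι u = WTilde.dt T ι w :=
    weakDerivPairs_unique u.mem_fn_dt (h ▸ w.mem_fn_dt)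
  have h2 : WTilde.dtt T ι u = WTilde.dtt T ι w :=
    weakDerivPairs_unique u.mem_dt_dtt (h1 ▸ w.mem_dt_dtt)
  exact Subtype.ext (WithLp.ofLp_injective 2 (Prod.ext h (WithLp.ofLp_injective 2 (Prod.ext h1 h2))))

instance [CompleteSpace V] : CompleteSpace (WTilde T ι) := by
  have hcl : IsClosed (WTildeSubmodule T ι :
      Set (WithLp 2 (L2T T V × WithLp 2 (L2T T V × L2T T (StrongDual ℝ V))))) := by
    have c1 := (WithLp.fstL 2 ℝ (L2T T V) (WithLp 2 (L2T T V × L2T T (StrongDual ℝ V)))).continuous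
    have c2 := (WithLp.sndL 2 ℝ (L2T T V) (WithLp 2 (L2T T V × L2T T (StrongDual ℝ V)))).continuous
    have c3 := (WithLp.fstL 2 ℝ (L2T T V) (L2T T (StrongDual ℝ V))).continuous.comp c2
    have c4 := (WithLp.sndL 2 ℝ (L2T T V) (L2T T (StrongDual ℝ V))).continuous.comp c2
    exact (isClosed_weakDerivPairs.preimage (c1.prodMk c3)).inter
      (isClosed_weakDerivPairs.preimage
        ((((gelfandMap ι).compLpL 2 (timeMeasure T)).continuous.comp c3).prodMk c4))
  exact hcl.completeSpace_coe

/-- The continuous representative `u ∈ C([0,T];V)` of `u ∈ W̃(0,T;V)`. -/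
def WTilde.repC (hT : 0 < T) (ι : V →L[ℝ] H) : WTilde T ι →L[ℝ] C(Icc 0 T, V) :=
  (ViscousWave.repC hT V).comp ((WTilde.fn T ι).prod (WTilde.dt T ι))

/-- The initial value `u(0) ∈ V`. -/
def WTilde.trace (hT : 0 < T) (ι : V →L[ℝ] H) : WTilde T ι →L[ℝ] V :=
  (ContinuousMap.evalCLM ℝ (⟨0, left_mem_Icc.2 hT.le⟩ : Icc 0 T)).comp (WTilde.repC hT ι)

theorem WTilde.hasInitialValue [CompleteSpace V] (hT : 0 < T) (u : WTilde T ι) :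
    HasInitialValue T (WTilde.fn T ι u) (WTilde.trace hT ι u) := by
  have := hasInitialValue_toL2T hT (WTilde.repC hT ι u)
  rw [WTilde.repC, ContinuousLinearMap.comp_apply, ContinuousLinearMap.prod_apply,
    toL2T_repC hT u.mem_fn_dt] at this
  exact this

end WTilde

/-! ### Initial velocities in the Gelfand triple -/

section WTildeHilbert

variable {T : ℝ} {V H : Type} [NormedAddCommGroup V] [InnerProductSpace ℝ V] [CompleteSpace V]
  [NormedAddCommGroup H] [InnerProductSpace ℝ H] [CompleteSpace H] {ι : V →L[ℝ] H}

theorem WTilde.exists_velocity (hT : 0 < T) (hι : Function.Injective ι) (u : WTilde T ι) :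
    ∃ c : C(Icc 0 T, H), toL2T hT H c = ι.compLpL 2 (timeMeasure T) (WTilde.dt T ι u) ∧
      ‖c‖ ^ 2 ≤ (‖ι‖ ^ 2 / T + 1) * (‖WTilde.dt T ι u‖ ^ 2 + ‖WTilde.dtt T ι u‖ ^ 2) :=
  exists_continuous_rep hT hι u.mem_dt_dtt

/-- The continuous representative `∂ₜu ∈ C([0,T];H)` for `u ∈ W̃(0,T;V)`. -/
def WTilde.velC (hT : 0 < T) (hι : Function.Injective ι) : WTilde T ι →L[ℝ] C(Icc 0 T, H) :=
  LinearMap.mkContinuous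
    { toFun := fun u => (WTilde.exists_velocity hT hι u).choose
      -- Linearity of the choice comes from uniqueness: a continuous function on [0,T] is determined
      -- by its class in L².
      map_add' := fun u v => by
        apply toL2T_injective hT
        refine (WTilde.exists_velocity hT hι (u + v)).choose_spec.1.trans ?_
        rw [map_add, map_add, map_add, (WTilde.exists_velocity hT hι u).choose_spec.1,
          (WTilde.exists_velocity hT hι v).choose_spec.1]
      map_smul' := fun c u => by
        apply toL2T_injective hT
        refine (WTilde.exists_velocity hT hι (c • u)).choose_spec.1.trans ?_
        rw [map_smul, map_smul, map_smul, (WTilde.exists_velocity hT hι u).choose_spec.1,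
          RingHom.id_apply] }
    √((‖ι‖ ^ 2 / T + 1) * (‖WTilde.dt T ι‖ ^ 2 + ‖WTilde.dtt T ι‖ ^ 2)) fun u => by
      refine (Real.le_sqrt_of_sq_le
        (WTilde.exists_velocity hT hι u).choose_spec.2).trans ?_
      have h : √((‖ι‖ ^ 2 / T + 1) * (‖WTilde.dt T ι‖ ^ 2 + ‖WTilde.dtt T ι‖ ^ 2)) * ‖u‖ =
          √((‖ι‖ ^ 2 / T + 1) * ((‖WTilde.dt T ι‖ * ‖u‖) ^ 2 + (‖WTilde.dtt T ι‖ * ‖u‖) ^ 2)) := by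
        nth_rewrite 1 [← Real.sqrt_sq (norm_nonneg u)]
        rw [← Real.sqrt_mul (by positivity)]
        congr 1; ring
      rw [h]
      gcongr
      · exact (WTilde.dt T ι).le_opNorm u
      · exact (WTilde.dtt T ι).le_opNorm u

theorem WTilde.toL2T_velC (hT : 0 < T) (hι : Function.Injective ι) (u : WTilde T ι) :
    toL2T hT H (WTilde.velC hT hι u) = ι.compLpL 2 (timeMeasure T) (WTilde.dt T ι u) :=
  (WTilde.exists_velocity hT hι u).choose_spec.1

/-- The initial velocity `∂ₜu(0) ∈ H`. -/
def WTilde.velTrace (hT : 0 < T) (hι : Function.Injective ι) : WTilde T ι →L[ℝ] H :=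
  (ContinuousMap.evalCLM ℝ (⟨0, left_mem_Icc.2 hT.le⟩ : Icc 0 T)).comp (WTilde.velC hT hι)

theorem WTilde.hasInitialValue_velocity (hT : 0 < T) (hι : Function.Injective ι)
    (u : WTilde T ι) : HasInitialValue T (fun t => ι (WTilde.dt T ι u t))
      (WTilde.velTrace hT hι u) := by
  have := hasInitialValue_toL2T hT (WTilde.velC hT hι u)
  rw [WTilde.toL2T_velC] at this
  exact this.congr (ι.coeFn_compLpL _).symm

end WTildeHilbert

/-! ### The linear strongly damped wave equation -/

section LinearTheory

variable {T : ℝ} {X Y Z : Type} [NormedAddCommGroup X] [NormedSpace ℝ X]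
  [NormedAddCommGroup Y] [NormedSpace ℝ Y] [NormedAddCommGroup Z] [NormedSpace ℝ Z]

theorem integrable_exp_mul (c : ℝ) {h : ℝ → ℝ} (hh : Integrable h (timeMeasure T)) :
    Integrable (fun t => Real.exp (c * t) * h t) (timeMeasure T) := by
  refine hh.bdd_mul (c := Real.exp (|c| * T)) (by fun_prop) ?_
  filter_upwards [ae_restrict_mem measurableSet_Ioo] with t ht
  rw [Real.norm_of_nonneg (Real.exp_pos _).le, Real.exp_le_exp]
  calc c * t ≤ |c| * t := by gcongr; exacts [ht.1.le, le_abs_self c]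
    _ ≤ _ := by gcongr; exact ht.2.le

theorem integrable_bilin (B : X →L[ℝ] Y →L[ℝ] Z) {f : ℝ → X} {g : ℝ → Y}
    (hf : MemLp f 2 (timeMeasure T)) (hg : MemLp g 2 (timeMeasure T)) :
    Integrable (fun t => B (f t) (g t)) (timeMeasure T) := by
  have h1 := (memLp_two_iff_integrable_sq_norm hf.1).1 hf
  have h2 := (memLp_two_iff_integrable_sq_norm hg.1).1 hg
  refine Integrable.mono' ((h1.add h2).const_mul ‖B‖) (B.aestronglyMeasurable_comp₂ hf.1 hg.1)
    (Filter.Eventually.of_forall fun t => ?_)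
  calc _ ≤ ‖B‖ * ‖f t‖ * ‖g t‖ := B.le_opNorm₂ _ _
    _ = ‖B‖ * (‖f t‖ * ‖g t‖) := mul_assoc _ _ _
    _ ≤ _ := by
      gcongr
      simp only [Pi.add_apply]
      nlinarith [sq_nonneg (‖f t‖ - ‖g t‖), sq_nonneg (‖f t‖ + ‖g t‖)]

theorem memLp_of_continuous {f : ℝ → X} (hf : Continuous f) : MemLp f 2 (timeMeasure T) := by
  obtain ⟨M, hM⟩ := isCompact_Icc.exists_bound_of_continuousOn hf.continuousOn (s := Icc 0 T)
  refine MemLp.of_bound hf.aestronglyMeasurable M ?_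
  filter_upwards [ae_restrict_mem measurableSet_Ioo] with t ht
  exact hM t (Ioo_subset_Icc_self ht)

variable {V H : Type} [NormedAddCommGroup V] [InnerProductSpace ℝ V] [CompleteSpace V]
  [NormedAddCommGroup H] [InnerProductSpace ℝ H] {ι : V →L[ℝ] H}

/-- The fundamental theorem of calculus for e^{ct}‖ιy‖². The weight produces the extra term c‖ιy‖²,
whose size and sign are at our disposal. -/
theorem weighted_energy (hT : 0 < T) (ι : V →L[ℝ] H) (c : ℝ) {y w : ℝ → V} (h : IsPrimitive y w) :
    Real.exp (c * T) * ‖ι (y T)‖ ^ 2 - ‖ι (y 0)‖ ^ 2 =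
      ∫ t, Real.exp (c * t) * (c * ‖ι (y t)‖ ^ 2 + 2 * inner ℝ (ι (w t)) (ι (y t)))
        ∂(timeMeasure T) := by
  have he : IsPrimitive (fun t => Real.exp (c * t)) (fun t => c * Real.exp (c * t)) :=
    IsPrimitive.of_hasDerivAt (by fun_prop) fun t => by
      have := (hasDerivAt_id t).const_mul c |>.exp
      simpa [mul_comm] using this
  have h1 := (he.bilin (ContinuousLinearMap.lsmul ℝ ℝ) (h.bilin (gelfandMap ι) h)).sub_eq 0 T
  simp only [ContinuousLinearMap.lsmul_apply, gelfandMap_apply, real_inner_self_eq_norm_sq,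
    mul_zero, Real.exp_zero, smul_eq_mul, one_mul] at h1
  rw [h1, timeMeasure_integral_eq hT.le]
  congr 1
  funext t
  rw [real_inner_comm (ι (w t)) (ι (y t))]
  ring

/-- The Volterra operator `w ↦ ∫₀ᵗ w` on `L²(0,T;X)`. -/
def volterra (hT : 0 < T) (X : Type) [NormedAddCommGroup X] [NormedSpace ℝ X] :
    L2T T X →L[ℝ] L2T T X := (toL2T hT X).comp (primC T X)

theorem volterra_coe (hT : 0 < T) (w : L2T T X) :
    volterra hT X w =ᵐ[timeMeasure T] prim T w := toL2T_primC hT w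

theorem integrable_exp_norm_sq (c : ℝ) {f : ℝ → X} (hf : MemLp f 2 (timeMeasure T)) :
    Integrable (fun t => Real.exp (c * t) * ‖f t‖ ^ 2) (timeMeasure T) :=
  integrable_exp_mul c ((memLp_two_iff_integrable_sq_norm hf.1).1 hf)

theorem memLp_prim [CompleteSpace X] {w : ℝ → X} (hw : Integrable w (timeMeasure T)) :
    MemLp (prim T w) 2 (timeMeasure T) :=
  memLp_of_continuous (isPrimitive_prim hw).continuous

/-- In L² with weight e^{-2lt}, integration in time has norm at most 1/l. It follows from the energy
identity with c = −2l and Young's inequality. For large l the memory terms are thus small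
perturbations. -/
theorem weighted_prim_le (hT : 0 < T) {l : ℝ} (hl : 0 < l) {w : ℝ → V}
    (hw : MemLp w 2 (timeMeasure T)) :
    l ^ 2 * ∫ t, Real.exp (-(2 * l) * t) * ‖prim T w t‖ ^ 2 ∂(timeMeasure T) ≤
      ∫ t, Real.exp (-(2 * l) * t) * ‖w t‖ ^ 2 ∂(timeMeasure T) := by
  have hwi : Integrable w (timeMeasure T) := hw.integrable (by norm_num)
  have h := weighted_energy hT (ContinuousLinearMap.id ℝ V) (-(2 * l)) (isPrimitive_prim hwi)
  simp only [ContinuousLinearMap.id_apply, prim_zero, norm_zero] at h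
  have i1 := integrable_exp_norm_sq (-(2 * l)) hw
  have i2 := integrable_exp_norm_sq (-(2 * l)) (memLp_prim hwi)
  have hle : ∫ t, Real.exp (-(2 * l) * t) * (-(2 * l) * ‖prim T w t‖ ^ 2 +
      2 * inner ℝ ((Ioo 0 T).indicator w t) (prim T w t)) ∂(timeMeasure T) ≤
      ∫ t, (l⁻¹ * (Real.exp (-(2 * l) * t) * ‖w t‖ ^ 2) -
        l * (Real.exp (-(2 * l) * t) * ‖prim T w t‖ ^ 2)) ∂(timeMeasure T) := by
    refine integral_mono_ae ?_ ((i1.const_mul _).sub (i2.const_mul _)) ?_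
    · refine integrable_exp_mul _ (((memLp_two_iff_integrable_sq_norm (memLp_prim hwi).1).1
        (memLp_prim hwi)).const_mul _ |>.add ?_)
      refine (integrable_bilin (innerSL ℝ (E := V)) ?_ (memLp_prim hwi)).const_mul 2
      refine (memLp_congr_ae ?_).2 hw
      filter_upwards [ae_restrict_mem measurableSet_Ioo] with t ht
      simp [ht]
    · filter_upwards [ae_restrict_mem measurableSet_Ioo] with t ht
      rw [Set.indicator_of_mem ht]
      have h1 := real_inner_le_norm (w t) (prim T w t)
      have h2 : 2 * (‖w t‖ * ‖prim T w t‖) ≤ l⁻¹ * ‖w t‖ ^ 2 + l * ‖prim T w t‖ ^ 2 := by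
        have := mul_nonneg (inv_nonneg.2 hl.le) (sq_nonneg (‖w t‖ - l * ‖prim T w t‖))
        have e : l⁻¹ * (‖w t‖ - l * ‖prim T w t‖) ^ 2 =
          l⁻¹ * ‖w t‖ ^ 2 - 2 * (‖w t‖ * ‖prim T w t‖) + l * ‖prim T w t‖ ^ 2 := by
          field_simp; ring
        linarith
      have h3 := (Real.exp_pos (-(2 * l) * t)).le
      nlinarith
  rw [← h, integral_sub (i1.const_mul _) (i2.const_mul _), integral_const_mul,
    integral_const_mul] at hle
  have h0 : 0 ≤ Real.exp (-(2 * l) * T) * ‖prim T w T‖ ^ 2 := by positivity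
  have h4 : l * ∫ t, Real.exp (-(2 * l) * t) * ‖prim T w t‖ ^ 2 ∂(timeMeasure T) ≤
      l⁻¹ * ∫ t, Real.exp (-(2 * l) * t) * ‖w t‖ ^ 2 ∂(timeMeasure T) := by
    rw [zero_pow two_ne_zero, sub_zero] at hle; linarith
  rw [inv_mul_eq_div, le_div_iff₀ hl] at h4
  linarith

/-- The term l‖ιz‖² pays for the defect C‖ιz‖² in the Gårding inequality. The memory term b∫z costs
at most ‖b‖/l times the weighted norm by `weighted_prim_le`, that is, at most α/2. -/
theorem weighted_coercive (hT : 0 < T) (a b : V →L[ℝ] StrongDual ℝ V) {α C l : ℝ}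
    (ha : ∀ v, α * ‖v‖ ^ 2 ≤ a v v + C * ‖ι v‖ ^ 2) (hl : 0 < l) (hC : C ≤ l)
    (hb : 2 * ‖b‖ ≤ α * l) {z : ℝ → V} (hz : MemLp z 2 (timeMeasure T)) :
    α / 2 * ∫ t, Real.exp (-(2 * l) * t) * ‖z t‖ ^ 2 ∂(timeMeasure T) ≤
      ∫ t, Real.exp (-(2 * l) * t) *
        (l * ‖ι (z t)‖ ^ 2 + a (z t) (z t) + b (prim T z t) (z t)) ∂(timeMeasure T) := by
  have hzi : Integrable z (timeMeasure T) := hz.integrable (by norm_num)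
  have i1 := integrable_exp_norm_sq (-(2 * l)) hz
  have i2 := integrable_exp_norm_sq (-(2 * l)) (memLp_prim hzi)
  have hle : ∫ t, ((α - ‖b‖ / (2 * l)) * (Real.exp (-(2 * l) * t) * ‖z t‖ ^ 2) -
      ‖b‖ * l / 2 * (Real.exp (-(2 * l) * t) * ‖prim T z t‖ ^ 2)) ∂(timeMeasure T) ≤
      ∫ t, Real.exp (-(2 * l) * t) *
        (l * ‖ι (z t)‖ ^ 2 + a (z t) (z t) + b (prim T z t) (z t)) ∂(timeMeasure T) := by
    refine integral_mono ((i1.const_mul _).sub (i2.const_mul _)) ?_ fun t => ?_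
    · refine integrable_exp_mul _ ((Integrable.add ?_ (integrable_bilin a hz hz)).add
        (integrable_bilin b (memLp_prim hzi) hz))
      exact ((memLp_two_iff_integrable_sq_norm (ι.comp_memLp' hz).1).1
        (ι.comp_memLp' hz)).const_mul l
    · have h1 := ha (z t)
      have h2 : C * ‖ι (z t)‖ ^ 2 ≤ l * ‖ι (z t)‖ ^ 2 := by gcongr
      have h3 : -(‖b‖ * ‖prim T z t‖ * ‖z t‖) ≤ b (prim T z t) (z t) :=
        neg_le_of_abs_le (b.le_opNorm₂ _ _)
      -- Young's inequality, balanced so that after `weighted_prim_le` both halves have the same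
      -- bound.
      have h4 : ‖prim T z t‖ * ‖z t‖ ≤ ‖z t‖ ^ 2 / (2 * l) + l / 2 * ‖prim T z t‖ ^ 2 := by
        have e : ‖z t‖ ^ 2 / (2 * l) + l / 2 * ‖prim T z t‖ ^ 2 - ‖prim T z t‖ * ‖z t‖ =
          (‖z t‖ - l * ‖prim T z t‖) ^ 2 / (2 * l) := by field_simp; ring
        have : 0 ≤ (‖z t‖ - l * ‖prim T z t‖) ^ 2 / (2 * l) := by positivity
        linarith
      have h5 := mul_le_mul_of_nonneg_left h4 (norm_nonneg b)
      have h6 := (Real.exp_pos (-(2 * l) * t)).le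
      have h7 : (α - ‖b‖ / (2 * l)) * ‖z t‖ ^ 2 - ‖b‖ * l / 2 * ‖prim T z t‖ ^ 2 ≤
          l * ‖ι (z t)‖ ^ 2 + a (z t) (z t) + b (prim T z t) (z t) := by
        have e : ‖b‖ * (‖z t‖ ^ 2 / (2 * l) + l / 2 * ‖prim T z t‖ ^ 2) =
          ‖b‖ / (2 * l) * ‖z t‖ ^ 2 + ‖b‖ * l / 2 * ‖prim T z t‖ ^ 2 := by ring
        linarith
      have h8 := mul_le_mul_of_nonneg_left h7 h6
      refine le_trans (le_of_eq ?_) h8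
      ring
  refine le_trans ?_ hle
  rw [integral_sub (i1.const_mul _) (i2.const_mul _), integral_const_mul, integral_const_mul]
  have hw := weighted_prim_le hT hl hz
  set P := ∫ t, Real.exp (-(2 * l) * t) * ‖prim T z t‖ ^ 2 ∂(timeMeasure T)
  set Q := ∫ t, Real.exp (-(2 * l) * t) * ‖z t‖ ^ 2 ∂(timeMeasure T) with hQ
  have hQ0 : 0 ≤ Q := integral_nonneg fun t => by positivity
  have h1 : ‖b‖ * l / 2 * P ≤ ‖b‖ / (2 * l) * Q := by
    have := mul_le_mul_of_nonneg_left hw (by positivity : 0 ≤ ‖b‖ / (2 * l))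
    refine le_trans (le_of_eq ?_) this
    field_simp
  have h2 : ‖b‖ / l ≤ α / 2 := by rw [div_le_iff₀ hl]; linarith
  have h3 := mul_le_mul_of_nonneg_right h2 hQ0
  have e : ‖b‖ / (2 * l) * Q = ‖b‖ / l * Q / 2 := by field_simp
  have e2 : (α - ‖b‖ / (2 * l)) * Q = α * Q - ‖b‖ / (2 * l) * Q := by ring
  rw [e2]
  linarith

/-- An operator between Hilbert spaces hits every `f` that is controlled by its adjoint. -/
theorem exists_apply_eq_of_inner_le {E F : Type} [NormedAddCommGroup E] [InnerProductSpace ℝ E]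
    [CompleteSpace E] [NormedAddCommGroup F] [InnerProductSpace ℝ F] [CompleteSpace F]
    (A : E →L[ℝ] F) (f : F) {C : ℝ}
    (h : ∀ ψ, |inner ℝ f ψ| ≤ C * ‖ContinuousLinearMap.adjoint A ψ‖) : ∃ v, A v = f := by
  set A' := ContinuousLinearMap.adjoint A with hA'
  have hker : LinearMap.ker A'.toLinearMap ≤ LinearMap.ker (innerSL ℝ f).toLinearMap := by
    intro ψ hψ
    have h1 := h ψ
    have h2 : A' ψ = 0 := hψ
    rw [h2, norm_zero, mul_zero] at h1
    exact abs_nonpos_iff.1 h1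
  let e := (A'.toLinearMap).quotKerEquivRange
  -- The functional A*ψ ↦ ⟨f, ψ⟩ is well defined and bounded on the range of A* by hypothesis. After
  -- a Hahn–Banach extension its Riesz representative is the preimage of f.
  let ℓ : LinearMap.range A'.toLinearMap →ₗ[ℝ] ℝ :=
    ((LinearMap.ker A'.toLinearMap).liftQ (innerSL ℝ f).toLinearMap hker).comp e.symm.toLinearMap
  have hℓ : ∀ ψ, ℓ ⟨A' ψ, ψ, rfl⟩ = inner ℝ f ψ := by
    intro ψ
    have : e.symm ⟨A' ψ, ψ, rfl⟩ = Submodule.Quotient.mk ψ := by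
      rw [LinearEquiv.symm_apply_eq]; rfl
    change ((LinearMap.ker A'.toLinearMap).liftQ (innerSL ℝ f).toLinearMap hker)
      (e.symm ⟨A' ψ, ψ, rfl⟩) = _
    rw [this]; rfl
  let ℓ' : StrongDual ℝ (LinearMap.range A'.toLinearMap) := ℓ.mkContinuous C (by
    rintro ⟨_, ψ, rfl⟩
    exact (hℓ ψ).symm ▸ h ψ)
  obtain ⟨g, hg, _⟩ := _root_.exists_extension_norm_eq _ ℓ'
  refine ⟨riesz E g, ext_inner_right ℝ fun ψ => ?_⟩
  rw [← ContinuousLinearMap.adjoint_inner_right, inner_riesz]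
  have := hg ⟨A' ψ, ψ, rfl⟩
  exact this.trans (hℓ ψ)

end LinearTheory

/-! ### The wave equation integrated in time, and bijectivity of the wave operator -/

section WaveOperator

variable {T : ℝ} {V H : Type} [NormedAddCommGroup V] [InnerProductSpace ℝ V] [CompleteSpace V]
  [NormedAddCommGroup H] [InnerProductSpace ℝ H] {ι : V →L[ℝ] H}

/-- The map `H → V'` of a Gelfand triple. -/
def dualEmb (ι : V →L[ℝ] H) : H →L[ℝ] StrongDual ℝ V :=
  (innerSL ℝ (E := H)).bilinearComp (ContinuousLinearMap.id ℝ H) ι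

theorem dualEmb_apply (ι : V →L[ℝ] H) (x : H) (v : V) : dualEmb ι x v = inner ℝ x (ι v) := rfl

/-- Density of V in H makes H a subspace of V'. It allows an initial velocity to be identified from
its image in V'. -/
theorem dualEmb_injective (hd : DenseRange ι) : Function.Injective (dualEmb ι) := by
  rw [injective_iff_map_eq_zero]
  intro x hx
  have h : ∀ y : H, inner ℝ x y = (0 : ℝ) := fun y => by
    refine hd.induction_on (p := fun y => inner ℝ x y = (0 : ℝ)) y
      (isClosed_eq (by fun_prop) continuous_const) fun v => ?_
    rw [← dualEmb_apply, hx]; rfl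
  exact inner_self_eq_zero.1 (h x)

theorem hasInitialValue_prim {X : Type} [NormedAddCommGroup X] [NormedSpace ℝ X] {w : ℝ → X}
    (hw : Integrable w (timeMeasure T)) {u : ℝ → X} {x₀ : X}
    (h : u =ᵐ[timeMeasure T] fun t => x₀ + prim T w t) : HasInitialValue T u x₀ :=
  ⟨_, (continuous_const.add (isPrimitive_prim hw).continuous).continuousOn, h, by simp⟩

/-- The adjoint of integration from 0 is integration up to T: this is integration by parts with the
function ∫_t^Tψ, which vanishes at T, while the primitive of h vanishes at 0. -/
theorem integral_prim_apply (hT : 0 < T) {h : ℝ → StrongDual ℝ V} {ψ : ℝ → V}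
    (hh : Integrable h (timeMeasure T)) (hψ : Integrable ψ (timeMeasure T)) :
    ∫ t, prim T h t (ψ t) ∂(timeMeasure T) =
      ∫ t, h t (prim T ψ T - prim T ψ t) ∂(timeMeasure T) := by
  have hφ : IsPrimitive (fun t => prim T ψ T - prim T ψ t)
      (fun t => 0 - (Ioo 0 T).indicator ψ t) := (isPrimitive_const _).sub (isPrimitive_prim hψ)
  have hp := isPrimitive_prim hh
  let B : StrongDual ℝ V →L[ℝ] V →L[ℝ] ℝ := ContinuousLinearMap.id ℝ _
  have hs := (hp.bilin B hφ).sub_eq 0 T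
  have i1 := (IsPrimitive.locallyIntegrable_bilin B hp.1 hφ.continuous).intervalIntegrable_real 0 T
  have i2 := (IsPrimitive.locallyIntegrable_bilin B.flip hφ.1
    hp.continuous).intervalIntegrable_real 0 T
  simp only [ContinuousLinearMap.flip_apply] at i2
  rw [intervalIntegral.integral_add i1 i2, ← timeMeasure_integral_eq hT.le,
    ← timeMeasure_integral_eq hT.le] at hs
  simp only [sub_self, map_zero, prim_zero, zero_apply, zero_sub, map_neg,
    integral_neg] at hs
  have e1 : ∫ t, B (prim T h t) ((Ioo 0 T).indicator ψ t) ∂(timeMeasure T) =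
      ∫ t, prim T h t (ψ t) ∂(timeMeasure T) := by
    apply integral_congr_ae
    filter_upwards [ae_restrict_mem measurableSet_Ioo] with t ht
    rw [Set.indicator_of_mem ht]; rfl
  have e2 : ∫ t, B ((Ioo 0 T).indicator h t) (prim T ψ T - prim T ψ t) ∂(timeMeasure T) =
      ∫ t, h t (prim T ψ T - prim T ψ t) ∂(timeMeasure T) := by
    apply integral_congr_ae
    filter_upwards [ae_restrict_mem measurableSet_Ioo] with t ht
    rw [Set.indicator_of_mem ht]; rfl
  rw [e1, e2] at hs
  linarith

theorem exists_weight {α C : ℝ} (hα : 0 < α) (b : V →L[ℝ] StrongDual ℝ V) :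
    ∃ l : ℝ, 0 < l ∧ C ≤ l ∧ 2 * ‖b‖ ≤ α * l := by
  refine ⟨max 1 (max C (2 * ‖b‖ / α)), by positivity, by simp, ?_⟩
  have h : 2 * ‖b‖ / α ≤ max 1 (max C (2 * ‖b‖ / α)) := by simp
  rw [div_le_iff₀ hα] at h
  linarith

/-- Uniqueness for the once integrated equation. Here v is the velocity and y = ∫₀ᵗv the solution
with zero data. Testing with y instead of v requires only that y be a primitive of an L²(0,T;V)
function, and `weighted_coercive` then forces y = 0. -/
theorem eq_zero_of_volterra_eq (hT : 0 < T) (a b : V →L[ℝ] StrongDual ℝ V) {α C : ℝ}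
    (hα : 0 < α) (ha : ∀ v, α * ‖v‖ ^ 2 ≤ a v v + C * ‖ι v‖ ^ 2) {v : ℝ → V}
    (hv : MemLp v 2 (timeMeasure T))
    (h : ∀ᵐ t ∂(timeMeasure T),
      gelfandMap ι (v t) = -(a (prim T v t) + b (prim T (prim T v) t))) :
    ∀ᵐ t ∂(timeMeasure T), prim T v t = 0 := by
  obtain ⟨l, hl, hC, hb⟩ := exists_weight (C := C) hα b
  have hvi : Integrable v (timeMeasure T) := hv.integrable (by norm_num)
  have hE := weighted_energy hT ι (-(2 * l)) (isPrimitive_prim hvi)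
  have hK := weighted_coercive hT a b ha hl hC hb (memLp_prim hvi)
  -- By the equation, the energy balance is −2 times the coercive integral, while its other side is
  -- nonnegative.
  have e : ∫ t, Real.exp (-(2 * l) * t) * (-(2 * l) * ‖ι (prim T v t)‖ ^ 2 +
      2 * inner ℝ (ι ((Ioo 0 T).indicator v t)) (ι (prim T v t))) ∂(timeMeasure T) =
      -2 * ∫ t, Real.exp (-(2 * l) * t) * (l * ‖ι (prim T v t)‖ ^ 2 +
        a (prim T v t) (prim T v t) + b (prim T (prim T v) t) (prim T v t)) ∂(timeMeasure T) := by
    rw [← integral_const_mul]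
    apply integral_congr_ae
    filter_upwards [h, ae_restrict_mem measurableSet_Ioo] with t h1 h2
    rw [Set.indicator_of_mem h2, ← gelfandMap_apply, h1]
    simp only [neg_apply, add_apply]
    ring
  rw [e, prim_zero, map_zero, norm_zero, zero_pow two_ne_zero, sub_zero] at hE
  have h0 : 0 ≤ Real.exp (-(2 * l) * T) * ‖ι (prim T v T)‖ ^ 2 := by positivity
  have i1 := integrable_exp_norm_sq (-(2 * l)) (memLp_prim hvi)
  have hnn : 0 ≤ fun t => Real.exp (-(2 * l) * t) * ‖prim T v t‖ ^ 2 := fun t => by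
    simp only [Pi.zero_apply]; positivity
  have hz : ∫ t, Real.exp (-(2 * l) * t) * ‖prim T v t‖ ^ 2 ∂(timeMeasure T) = 0 := by
    refine le_antisymm ?_ (integral_nonneg hnn)
    by_contra hcon
    have := mul_pos (half_pos hα) (not_le.1 hcon)
    linarith
  rw [integral_eq_zero_iff_of_nonneg hnn i1] at hz
  filter_upwards [hz] with t ht
  simpa [(Real.exp_pos _).ne'] using ht

theorem integrable_apply {f : ℝ → StrongDual ℝ V} {g : ℝ → V}
    (hf : MemLp f 2 (timeMeasure T)) (hg : MemLp g 2 (timeMeasure T)) :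
    Integrable (fun t => f t (g t)) (timeMeasure T) :=
  integrable_bilin (ContinuousLinearMap.id ℝ (StrongDual ℝ V)) hf hg

theorem memLp_volterra_terms (a b : V →L[ℝ] StrongDual ℝ V) {z : ℝ → V}
    (hz : MemLp z 2 (timeMeasure T)) :
    MemLp (fun s => a (z s) + b (prim T z s)) 2 (timeMeasure T) :=
  (a.comp_memLp' hz).add (b.comp_memLp' (memLp_prim (hz.integrable (by norm_num))))

/-- The lower bound for the adjoint of the Volterra operator, obtained by pairing ψ with the image
of z = e^{2lt}φ, where φ = ∫_t^Tψ. Since φ' = −ψ and φ(T) = 0, the first integral equals ‖ιφ(0)‖²/2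
+ l∫e^{2lt}‖ιφ‖². Writing φ = e^{-2lt}z, the two integrals together contain exactly the form of
`weighted_coercive`. -/
theorem volterra_adjoint_coercive (hT : 0 < T) (a b : V →L[ℝ] StrongDual ℝ V) {α C l : ℝ}
    (hα : 0 < α) (ha : ∀ v, α * ‖v‖ ^ 2 ≤ a v v + C * ‖ι v‖ ^ 2) (hl : 0 < l) (hC : C ≤ l)
    (hb : 2 * ‖b‖ ≤ α * l) {ψ φ z : ℝ → V} (hψ : MemLp ψ 2 (timeMeasure T))
    (hφ : φ = fun t => prim T ψ T - prim T ψ t) (hz : z = fun t => Real.exp (2 * l * t) • φ t) :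
    ‖ι (φ 0)‖ ^ 2 / 2 + α / 2 * ∫ t, ‖φ t‖ ^ 2 ∂(timeMeasure T) ≤
      ∫ t, gelfandMap ι (z t) (ψ t) ∂(timeMeasure T) +
        ∫ t, (a (z t) + b (prim T z t)) (φ t) ∂(timeMeasure T) := by
  have hψi : Integrable ψ (timeMeasure T) := hψ.integrable (by norm_num)
  have hφp : IsPrimitive φ (fun t => 0 - (Ioo 0 T).indicator ψ t) :=
    hφ ▸ (isPrimitive_const _).sub (isPrimitive_prim hψi)
  have hφL : MemLp φ 2 (timeMeasure T) := memLp_of_continuous hφp.continuous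
  have hzL : MemLp z 2 (timeMeasure T) := memLp_of_continuous (by
    have := hφp.continuous
    rw [hz]
    fun_prop)
  have hen := weighted_energy hT ι (2 * l) hφp
  have hφT : φ T = 0 := by rw [hφ]; exact sub_self _
  rw [hφT, map_zero, norm_zero, zero_pow two_ne_zero, mul_zero, zero_sub] at hen
  have i0 : Integrable (fun t => ‖ι (φ t)‖ ^ 2) (timeMeasure T) :=
    (memLp_two_iff_integrable_sq_norm (ι.comp_memLp' hφL).1).1 (ι.comp_memLp' hφL)
  have i1 := integrable_exp_mul (2 * l) i0
  have hfirst : ∫ t, gelfandMap ι (z t) (ψ t) ∂(timeMeasure T) = ‖ι (φ 0)‖ ^ 2 / 2 +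
      l * ∫ t, Real.exp (2 * l * t) * ‖ι (φ t)‖ ^ 2 ∂(timeMeasure T) := by
    have e : ∫ t, Real.exp (2 * l * t) * (2 * l * ‖ι (φ t)‖ ^ 2 +
        2 * inner ℝ (ι (0 - (Ioo 0 T).indicator ψ t)) (ι (φ t))) ∂(timeMeasure T) =
        ∫ t, ((2 * l) * (Real.exp (2 * l * t) * ‖ι (φ t)‖ ^ 2) -
          2 * gelfandMap ι (z t) (ψ t)) ∂(timeMeasure T) := by
      apply integral_congr_ae
      filter_upwards [ae_restrict_mem measurableSet_Ioo] with t k2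
      rw [hz, Set.indicator_of_mem k2, gelfandMap_apply, zero_sub, map_neg, inner_neg_left,
        map_smul, real_inner_smul_left, real_inner_comm]
      ring
    rw [e, integral_sub (i1.const_mul _) ((integrable_bilin (gelfandMap ι) hzL
      hψ).const_mul 2), integral_const_mul, integral_const_mul] at hen
    linarith
  have hcoer := weighted_coercive hT a b ha hl hC hb hzL
  have e1 : ∀ t, Real.exp (-(2 * l) * t) * Real.exp (2 * l * t) = 1 := fun t => by
    rw [← Real.exp_add]; simp
  -- The weights e^{-2lt} of the coercive form and e^{4lt} from the square of z leave e^{2lt}.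
  have e0 : ∀ t (r : ℝ), Real.exp (-(2 * l) * t) * (Real.exp (2 * l * t) * r) ^ 2 =
      Real.exp (2 * l * t) * r ^ 2 := fun t r => by
    rw [mul_pow, sq (Real.exp (2 * l * t)), ← mul_assoc, ← mul_assoc, e1, one_mul]
  have hs1 : ∫ t, Real.exp (-(2 * l) * t) * ‖z t‖ ^ 2 ∂(timeMeasure T) =
      ∫ t, Real.exp (2 * l * t) * ‖φ t‖ ^ 2 ∂(timeMeasure T) := by
    congr 1
    funext t
    rw [hz, norm_smul, Real.norm_of_nonneg (Real.exp_pos _).le, e0]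
  have hs2 : ∫ t, Real.exp (-(2 * l) * t) *
      (l * ‖ι (z t)‖ ^ 2 + a (z t) (z t) + b (prim T z t) (z t)) ∂(timeMeasure T) =
      l * ∫ t, Real.exp (2 * l * t) * ‖ι (φ t)‖ ^ 2 ∂(timeMeasure T) +
      ∫ t, (a (z t) + b (prim T z t)) (φ t) ∂(timeMeasure T) := by
    rw [← integral_const_mul, ← integral_add (i1.const_mul l)
      (integrable_apply (memLp_volterra_terms a b hzL) hφL)]
    congr 1
    funext t
    have e2 : Real.exp (-(2 * l) * t) * (‖ι (z t)‖ ^ 2) =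
        Real.exp (2 * l * t) * ‖ι (φ t)‖ ^ 2 := by
      rw [hz, map_smul, norm_smul, Real.norm_of_nonneg (Real.exp_pos _).le, e0]
    have e3 : ∀ g : StrongDual ℝ V, Real.exp (-(2 * l) * t) * g (z t) = g (φ t) := fun g => by
      rw [hz, map_smul, smul_eq_mul, ← mul_assoc, e1, one_mul]
    rw [mul_add, mul_add, e3, e3, mul_left_comm, e2, add_assoc, add_apply]
  have hlow : ∫ t, ‖φ t‖ ^ 2 ∂(timeMeasure T) ≤
      ∫ t, Real.exp (2 * l * t) * ‖φ t‖ ^ 2 ∂(timeMeasure T) := by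
    refine integral_mono_ae ((memLp_two_iff_integrable_sq_norm hφL.1).1 hφL)
      (integrable_exp_norm_sq (2 * l) hφL) ?_
    filter_upwards [ae_restrict_mem measurableSet_Ioo] with t k2
    have : 1 ≤ Real.exp (2 * l * t) := Real.one_le_exp (by nlinarith [k2.1])
    nlinarith [sq_nonneg ‖φ t‖]
  rw [hs1, hs2] at hcoer
  rw [hfirst]
  have h2 := mul_le_mul_of_nonneg_left hlow (half_pos hα).le
  linarith

/-- Existence for the velocity v of the integrated equation by `exists_apply_eq_of_inner_le`. The
right side paired with ψ is ∫F(φ) + ⟨u₁, ιφ(0)⟩ with φ = ∫_t^Tψ. The adjoint bound controls φ in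
L²(0,T;V) and ιφ(0) in H, which is why F may be V'-valued and u₁ merely in H. -/
theorem exists_volterra_eq (hT : 0 < T) (a b : V →L[ℝ] StrongDual ℝ V) {α C : ℝ}
    (hα : 0 < α) (ha : ∀ v, α * ‖v‖ ^ 2 ≤ a v v + C * ‖ι v‖ ^ 2)
    (u₁ : H) (F : L2T T (StrongDual ℝ V)) :
    ∃ v : L2T T V, ∀ᵐ t ∂(timeMeasure T), gelfandMap ι (v t) +
      prim T (fun s => a (v s) + b (prim T v s)) t = dualEmb ι u₁ + prim T F t := by
  obtain ⟨l, hl, hC, hb⟩ := exists_weight (C := C) hα b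
  let L := fun A : V →L[ℝ] StrongDual ℝ V => A.compLpL 2 (timeMeasure T)
  let N : L2T T V →L[ℝ] L2T T (StrongDual ℝ V) :=
    L a + (L b).comp (volterra hT V)
  let M : L2T T V →L[ℝ] L2T T (StrongDual ℝ V) :=
    L (gelfandMap ι) + (volterra hT (StrongDual ℝ V)).comp N
  have hN : ∀ z : L2T T V, N z =ᵐ[timeMeasure T] fun s => a (z s) + b (prim T z s) := by
    intro z
    filter_upwards [Lp.coeFn_add (L a z) (L b (volterra hT V z)),
      a.coeFn_compLpL (p := 2) (μ := timeMeasure T) z,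
      b.coeFn_compLpL (p := 2) (μ := timeMeasure T) (volterra hT V z), volterra_coe hT z]
      with t k1 k2 k3 k4
    change (L a z + L b (volterra hT V z) : L2T T (StrongDual ℝ V)) t = _
    rw [k1, Pi.add_apply, k2, k3, k4]
  have hM : ∀ z : L2T T V, M z =ᵐ[timeMeasure T] fun t => gelfandMap ι (z t) +
      prim T (fun s => a (z s) + b (prim T z s)) t := by
    intro z
    filter_upwards [Lp.coeFn_add (L (gelfandMap ι) z) (volterra hT _ (N z)),
      (gelfandMap ι).coeFn_compLpL (p := 2) (μ := timeMeasure T) z, volterra_coe hT (N z)]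
      with t k1 k2 k3
    change (L (gelfandMap ι) z + volterra hT _ (N z) : L2T T (StrongDual ℝ V)) t = _
    rw [k1, Pi.add_apply, k2, k3, prim_congr (hN z)]
  let R : L2T T (StrongDual ℝ V) →L[ℝ] L2T T V := (riesz V).compLpL 2 (timeMeasure T)
  have hR : ∀ (f : L2T T (StrongDual ℝ V)) (ψ : L2T T V),
      inner ℝ (R f) ψ = ∫ t, f t (ψ t) ∂(timeMeasure T) := by
    intro f ψ
    rw [L2.inner_def]
    apply integral_congr_ae
    filter_upwards [(riesz V).coeFn_compLpL (p := 2) (μ := timeMeasure T) f] with t ht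
    rw [ht, inner_riesz]
  have hRinj : Function.Injective R := by
    rw [injective_iff_map_eq_zero]
    intro f hf
    apply Lp.ext
    filter_upwards [(riesz V).coeFn_compLpL (p := 2) (μ := timeMeasure T) f,
      Lp.coeFn_zero V 2 (timeMeasure T), Lp.coeFn_zero (StrongDual ℝ V) 2 (timeMeasure T)]
      with t k1 k2 k3
    have h1 : R f t = riesz V (f t) := k1
    rw [hf, k2] at h1
    rw [k3, Pi.zero_apply, ← norm_eq_zero, ← norm_riesz, ← h1, Pi.zero_apply, norm_zero]
  have hconst : MemLp (fun _ : ℝ => dualEmb ι u₁) 2 (timeMeasure T) := memLp_const _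
  set f : L2T T (StrongDual ℝ V) := hconst.toLp _ + volterra hT _ F with hf
  have hfae : f =ᵐ[timeMeasure T] fun t => dualEmb ι u₁ + prim T F t := by
    filter_upwards [Lp.coeFn_add (hconst.toLp _) (volterra hT _ F), hconst.coeFn_toLp,
      volterra_coe hT F] with t k1 k2 k3
    rw [hf, k1, Pi.add_apply, k2, k3]
  set E := Real.exp (2 * l * T) with hE
  have hE0 : 0 < E := Real.exp_pos _
  -- The two summands come from ‖φ‖ ≤ (2E/α)n in L²(0,T;V) and ‖ιφ(0)‖ ≤ (2E/√α)n, where E = e^{2lT}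
  -- bounds the weight and n is the norm of the adjoint image.
  have key : ∀ ψ : L2T T V, |inner ℝ (R f) ψ| ≤
      (2 / α * E * ‖F‖ + ‖u₁‖ * (2 * E / √α)) * ‖ContinuousLinearMap.adjoint (R.comp M) ψ‖ := by
    intro ψ
    set n := ‖ContinuousLinearMap.adjoint (R.comp M) ψ‖ with hn
    have hn0 : 0 ≤ n := norm_nonneg _
    set φ : ℝ → V := fun t => prim T ψ T - prim T ψ t with hφdef
    have hψi := integrable_L2T ψ
    have hφ : IsPrimitive φ (fun t => 0 - (Ioo 0 T).indicator ψ t) :=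
      (isPrimitive_const _).sub (isPrimitive_prim hψi)
    have hφL : MemLp φ 2 (timeMeasure T) := memLp_of_continuous hφ.continuous
    have hzc : Continuous fun t => Real.exp (2 * l * t) • φ t := by
      have := hφ.continuous; fun_prop
    have hzL : MemLp (fun t => Real.exp (2 * l * t) • φ t) 2 (timeMeasure T) :=
      memLp_of_continuous hzc
    set Φ : L2T T V := hφL.toLp φ with hΦ
    have hΦae : Φ =ᵐ[timeMeasure T] φ := hφL.coeFn_toLp
    set z : L2T T V := hzL.toLp _ with hz
    have hzae : z =ᵐ[timeMeasure T] fun t => Real.exp (2 * l * t) • φ t := hzL.coeFn_toLp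
    have hznorm : ‖z‖ ≤ E * ‖Φ‖ := by
      refine Lp.norm_le_mul_norm_of_ae_le_mul ?_
      filter_upwards [hΦae, hzae, ae_restrict_mem measurableSet_Ioo] with t k1 k2 k3
      rw [k1, k2, norm_smul, Real.norm_of_nonneg (Real.exp_pos _).le]
      have := k3.2.le
      gcongr
      exact Real.exp_le_exp.2 (by gcongr)
    -- the pairing of `M z` with `ψ`
    have hpair : inner ℝ z (ContinuousLinearMap.adjoint (R.comp M) ψ) =
        ∫ t, gelfandMap ι (z t) (ψ t) ∂(timeMeasure T) +
        ∫ t, (a (z t) + b (prim T z t)) (φ t) ∂(timeMeasure T) := by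
      rw [ContinuousLinearMap.adjoint_inner_right, ContinuousLinearMap.comp_apply, hR]
      have hint : Integrable (fun s => a (z s) + b (prim T z s)) (timeMeasure T) :=
        (integrable_L2T (N z)).congr (hN z)
      rw [← integral_prim_apply hT hint hψi, ← integral_add]
      · apply integral_congr_ae
        filter_upwards [hM z] with t ht
        rw [ht]; rfl
      · exact integrable_bilin (gelfandMap ι) (Lp.memLp z) (Lp.memLp ψ)
      · exact integrable_apply (memLp_prim hint) (Lp.memLp ψ)
    have hmain : ‖ι (φ 0)‖ ^ 2 / 2 + α / 2 * ‖Φ‖ ^ 2 ≤ E * ‖Φ‖ * n := by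
      have h1 : inner ℝ z (ContinuousLinearMap.adjoint (R.comp M) ψ) ≤ E * ‖Φ‖ * n :=
        (real_inner_le_norm _ _).trans (by gcongr)
      have h2 := volterra_adjoint_coercive (ι := ι) hT a b hα ha hl hC hb (Lp.memLp ψ) hφdef rfl
      have h3 : ‖Φ‖ ^ 2 = ∫ t, ‖φ t‖ ^ 2 ∂(timeMeasure T) := by
        rw [norm_sq_Lp_two]
        apply integral_congr_ae
        filter_upwards [hΦae] with t ht
        rw [ht]
      have h4 : ∫ t, gelfandMap ι (z t) (ψ t) ∂(timeMeasure T) =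
          ∫ t, gelfandMap ι (Real.exp (2 * l * t) • φ t) (ψ t) ∂(timeMeasure T) := by
        apply integral_congr_ae
        filter_upwards [hzae] with t ht
        rw [ht]
      have h5 : ∫ t, (a (z t) + b (prim T z t)) (φ t) ∂(timeMeasure T) =
          ∫ t, (a (Real.exp (2 * l * t) • φ t) +
            b (prim T (fun t => Real.exp (2 * l * t) • φ t) t)) (φ t) ∂(timeMeasure T) := by
        apply integral_congr_ae
        filter_upwards [hzae] with t ht
        rw [ht, prim_congr hzae]
      rw [hpair, h4, h5] at h1
      rw [h3]
      exact h2.trans h1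
    have hNb : ‖Φ‖ ≤ 2 / α * E * n := by
      rcases (norm_nonneg Φ).eq_or_lt with h0 | h0
      · rw [← h0]; positivity
      · have h1 : α / 2 * ‖Φ‖ * ‖Φ‖ ≤ E * n * ‖Φ‖ := by nlinarith [sq_nonneg ‖ι (φ 0)‖]
        have h2 := le_of_mul_le_mul_right h1 h0
        rw [show 2 / α * E * n = (2 * (E * n)) / α by ring, le_div_iff₀ hα]
        linarith
    have hHb : ‖ι (φ 0)‖ ≤ 2 * E / √α * n := by
      refine abs_le_of_sq_le_sq' ?_ (by positivity) |>.2
      have h1 : ‖ι (φ 0)‖ ^ 2 ≤ 2 * (E * (2 / α * E * n) * n) := by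
        have : E * ‖Φ‖ * n ≤ E * (2 / α * E * n) * n := by gcongr
        nlinarith [mul_nonneg hα.le (sq_nonneg ‖Φ‖)]
      refine h1.trans (le_of_eq ?_)
      rw [mul_pow, div_pow, Real.sq_sqrt hα.le]
      ring
    -- The constant part of f meets ∫₀ᵀψ = φ(0), and the primitive of F is moved to the other side
    -- by `integral_prim_apply`.
    have hfin : inner ℝ (R f) ψ = ∫ t, F t (Φ t) ∂(timeMeasure T) + inner ℝ u₁ (ι (φ 0)) := by
      rw [hR]
      have e1 : ∫ t, f t (ψ t) ∂(timeMeasure T) = ∫ t, (dualEmb ι u₁ (ψ t) + prim T F t (ψ t))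
          ∂(timeMeasure T) := by
        apply integral_congr_ae
        filter_upwards [hfae] with t ht
        rw [ht]; rfl
      rw [e1, integral_add ((dualEmb ι u₁).integrable_comp hψi)
        (integrable_apply (memLp_prim (integrable_L2T F)) (Lp.memLp ψ)),
        integral_prim_apply hT (integrable_L2T F) hψi,
        (dualEmb ι u₁).integral_comp_comm hψi, dualEmb_apply, add_comm]
      congr 1
      · apply integral_congr_ae
        filter_upwards [hΦae] with t ht
        rw [ht]
      · congr 2
        simp only [hφdef, prim_zero, sub_zero]
        rw [timeMeasure_integral_eq hT.le, prim, intervalIntegral.integral_of_le hT.le,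
          intervalIntegral.integral_of_le hT.le, integral_Ioc_eq_integral_Ioo,
          integral_Ioc_eq_integral_Ioo]
        apply setIntegral_congr_fun measurableSet_Ioo
        intro t ht
        simp [ht]
    have hFΦ : |∫ t, F t (Φ t) ∂(timeMeasure T)| ≤ ‖F‖ * ‖Φ‖ := by
      rw [← hR]
      refine (abs_real_inner_le_norm _ _).trans ?_
      gcongr
      refine Lp.norm_le_norm_of_ae_le ?_
      filter_upwards [(riesz V).coeFn_compLpL (p := 2) (μ := timeMeasure T) F] with t ht
      exact (congrArg norm ht).trans_le (norm_riesz (F t)).le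
    rw [hfin]
    calc _ ≤ ‖F‖ * ‖Φ‖ + ‖u₁‖ * ‖ι (φ 0)‖ :=
          (abs_add_le _ _).trans (add_le_add hFΦ (abs_real_inner_le_norm _ _))
      _ ≤ ‖F‖ * (2 / α * E * n) + ‖u₁‖ * (2 * E / √α * n) := by gcongr
      _ = _ := by ring
  obtain ⟨v, hv⟩ := exists_apply_eq_of_inner_le (R.comp M) (R f) key
  refine ⟨v, ?_⟩
  have hMv : M v = f := hRinj hv
  have h1 := hM v
  rw [hMv] at h1
  filter_upwards [h1, hfae] with t k1 k2
  rw [← k1, k2]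

variable [CompleteSpace H]

/-- The operator `u ↦ (u(0), ∂ₜu(0), ∂ₜ²u + a ∂ₜu + b u)` of a strongly damped wave equation. -/
def waveOp (hT : 0 < T) (hι : Function.Injective ι) (a b : V →L[ℝ] StrongDual ℝ V) :
    WTilde T ι →L[ℝ] V × H × L2T T (StrongDual ℝ V) :=
  (WTilde.trace hT ι).prod ((WTilde.velTrace hT hι).prod
    (WTilde.dtt T ι + (a.compLpL 2 (timeMeasure T)).comp (WTilde.dt T ι) +
      (b.compLpL 2 (timeMeasure T)).comp (WTilde.fn T ι)))

theorem WTilde.fn_ae_eq (hT : 0 < T) (u : WTilde T ι) : WTilde.fn T ι u =ᵐ[timeMeasure T]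
    fun t => WTilde.trace hT ι u + prim T (WTilde.dt T ι u) t := by
  obtain ⟨x₀, h1, h2⟩ := repC_spec hT u.mem_fn_dt
  have h3 : WTilde.trace hT ι u = x₀ := by
    have := h2 ⟨0, left_mem_Icc.2 hT.le⟩
    rw [prim_zero, add_zero] at this
    exact this
  rw [h3]
  exact h1

/-- The constant of integration in V' and the image of the velocity trace are initial values of the
same V'-valued function, hence equal. -/
theorem WTilde.dt_ae_eq (hT : 0 < T) (hι : Function.Injective ι) (u : WTilde T ι) :
    ∀ᵐ t ∂(timeMeasure T), gelfandMap ι (WTilde.dt T ι u t) =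
      dualEmb ι (WTilde.velTrace hT hι u) + prim T (WTilde.dtt T ι u) t := by
  obtain ⟨h₀, hh⟩ := IsWeakTimeDeriv.exists_eq_prim hT
    (integrable_L2T ((gelfandMap ι).compLpL 2 (timeMeasure T) (WTilde.dt T ι u)))
    (integrable_L2T (WTilde.dtt T ι u)) u.mem_dt_dtt
  have h1 := hasInitialValue_prim (integrable_L2T _) hh
  have h2 := ((u.hasInitialValue_velocity hT hι).clm (dualEmb ι)).congr
    ((gelfandMap ι).coeFn_compLpL (p := 2) (μ := timeMeasure T) (WTilde.dt T ι u))
  rw [← h1.unique hT h2]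
  filter_upwards [hh, (gelfandMap ι).coeFn_compLpL (p := 2) (μ := timeMeasure T)
    (WTilde.dt T ι u)] with t k1 k2
  rw [← k2, k1]

/-- One time integration translates the equation into the Volterra equation for v = ∂ₜu, and the two
preceding results on that equation give uniqueness and existence. Conversely u = u₀ + ∫v, and ∂ₜ²u
is read off from the equation. -/
theorem waveOp_bijective (hT : 0 < T) (hι : Function.Injective ι) (hd : DenseRange ι)
    (a b : V →L[ℝ] StrongDual ℝ V) {α C : ℝ} (hα : 0 < α)
    (ha : ∀ v, α * ‖v‖ ^ 2 ≤ a v v + C * ‖ι v‖ ^ 2) :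
    Function.Bijective (waveOp hT hι a b) := by
  have hadd : ∀ u : WTilde T ι, (waveOp hT hι a b u).2.2 =ᵐ[timeMeasure T] fun t =>
      WTilde.dtt T ι u t + (a (WTilde.dt T ι u t) + b (WTilde.fn T ι u t)) := by
    intro u
    change (WTilde.dtt T ι u + a.compLpL 2 (timeMeasure T) (WTilde.dt T ι u) +
      b.compLpL 2 (timeMeasure T) (WTilde.fn T ι u) : L2T T (StrongDual ℝ V)) =ᵐ[timeMeasure T] _
    filter_upwards [Lp.coeFn_add (WTilde.dtt T ι u + a.compLpL 2 (timeMeasure T) (WTilde.dt T ι u))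
      (b.compLpL 2 (timeMeasure T) (WTilde.fn T ι u)),
      Lp.coeFn_add (WTilde.dtt T ι u) (a.compLpL 2 (timeMeasure T) (WTilde.dt T ι u)),
      a.coeFn_compLpL (p := 2) (μ := timeMeasure T) (WTilde.dt T ι u),
      b.coeFn_compLpL (p := 2) (μ := timeMeasure T) (WTilde.fn T ι u)] with t k1 k2 k3 k4
    rw [k1, Pi.add_apply, k2, Pi.add_apply, k3, k4, add_assoc]
  constructor
  · rw [injective_iff_map_eq_zero]
    intro u hu
    have h0 : WTilde.trace hT ι u = 0 := congrArg Prod.fst hu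
    have h1 : WTilde.velTrace hT hι u = 0 := congrArg (fun p => p.2.1) hu
    have h2 := hadd u
    rw [hu] at h2
    have hf := u.fn_ae_eq hT
    have hg := u.dt_ae_eq hT hι
    rw [h0] at hf
    rw [h1] at hg
    set v := WTilde.dt T ι u with hv
    have hvi := integrable_L2T v
    have hdtt : WTilde.dtt T ι u =ᵐ[timeMeasure T] fun t => -(a (v t) + b (prim T v t)) := by
      filter_upwards [h2, hf, Lp.coeFn_zero (StrongDual ℝ V) 2 (timeMeasure T)] with t k1 k2 k3
      rw [k2, zero_add] at k1
      have k4 : (0 : V × H × L2T T (StrongDual ℝ V)).2.2 t = 0 := k3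
      rw [k4] at k1
      exact eq_neg_of_add_eq_zero_left k1.symm
    have hpr : ∀ t, prim T (WTilde.dtt T ι u) t =
        -(a (prim T v t) + b (prim T (prim T v) t)) := by
      intro t
      have hpi := integrable_prim hvi
      rw [prim_congr hdtt]
      have := prim_smul (T := T) (-1) (fun t => a (v t) + b (prim T v t)) t
      simp only [neg_one_smul] at this
      rw [this, prim_add (a.integrable_comp hvi) (b.integrable_comp hpi), prim_clm a hvi,
        prim_clm b hpi]
    have hz := eq_zero_of_volterra_eq hT a b hα ha (Lp.memLp v) (by
      filter_upwards [hg] with t ht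
      rw [ht, hpr, map_zero, zero_add])
    refine WTilde.ext ?_
    rw [map_zero]
    apply Lp.ext
    filter_upwards [hf, hz, Lp.coeFn_zero V 2 (timeMeasure T)] with t k1 k2 k3
    rw [k1, k2, k3, add_zero]; rfl
  · rintro ⟨u₀, u₁, G⟩
    have hc : MemLp (fun _ : ℝ => u₀) 2 (timeMeasure T) := memLp_const _
    -- As u = u₀ + ∫v, the constant contribution bu₀ moves to the right side.
    obtain ⟨v, hv⟩ := exists_volterra_eq hT a b hα ha u₁
      (G - b.compLpL 2 (timeMeasure T) (hc.toLp _))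
    have hvi := integrable_L2T v
    set u : L2T T V := hc.toLp _ + volterra hT V v with hu
    have huae : u =ᵐ[timeMeasure T] fun t => u₀ + prim T v t := by
      filter_upwards [Lp.coeFn_add (hc.toLp _) (volterra hT V v), hc.coeFn_toLp,
        volterra_coe hT v] with t k1 k2 k3
      rw [hu, k1, Pi.add_apply, k2, k3]
    set g : L2T T (StrongDual ℝ V) := G - (a.compLpL 2 (timeMeasure T) v +
      b.compLpL 2 (timeMeasure T) u) with hg
    have hgae : g =ᵐ[timeMeasure T] fun t => (G - b.compLpL 2 (timeMeasure T) (hc.toLp _) :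
        L2T T (StrongDual ℝ V)) t + (-1 : ℝ) • (a (v t) + b (prim T v t)) := by
      filter_upwards [Lp.coeFn_sub G (a.compLpL 2 (timeMeasure T) v +
        b.compLpL 2 (timeMeasure T) u), Lp.coeFn_sub G (b.compLpL 2 (timeMeasure T) (hc.toLp _)),
        Lp.coeFn_add (a.compLpL 2 (timeMeasure T) v) (b.compLpL 2 (timeMeasure T) u),
        a.coeFn_compLpL (p := 2) (μ := timeMeasure T) v,
        b.coeFn_compLpL (p := 2) (μ := timeMeasure T) u,
        b.coeFn_compLpL (p := 2) (μ := timeMeasure T) (hc.toLp _), hc.coeFn_toLp, huae]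
        with t k1 k2 k3 k4 k5 k6 k7 k8
      rw [hg, k1, Pi.sub_apply, k2, Pi.sub_apply, k3, Pi.add_apply, k4, k5, k6, k7, k8, map_add]
      module
    have hab : Integrable (fun t => a (v t) + b (prim T v t)) (timeMeasure T) :=
      (a.integrable_comp hvi).add (b.integrable_comp (integrable_prim hvi))
    have hab' : Integrable (fun t => (-1 : ℝ) • (a (v t) + b (prim T v t))) (timeMeasure T) :=
      hab.smul (-1 : ℝ)
    have hp1 : (u, v) ∈ weakDerivPairs T V := mem_weakDerivPairs_of_ae_eq hT huae
    have hp2 : ((gelfandMap ι).compLpL 2 (timeMeasure T) v, g) ∈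
        weakDerivPairs T (StrongDual ℝ V) := by
      refine mem_weakDerivPairs_of_ae_eq (x₀ := dualEmb ι u₁) hT ?_
      filter_upwards [(gelfandMap ι).coeFn_compLpL (p := 2) (μ := timeMeasure T) v, hv]
        with t k1 k2
      rw [k1, prim_congr hgae, prim_add (integrable_L2T _) hab', prim_smul,
        ← add_assoc, ← k2]
      simp
    refine ⟨WTilde.mk hp1 hp2, Prod.ext ?_ (Prod.ext ?_ ?_)⟩
    · exact ((WTilde.mk hp1 hp2).hasInitialValue hT).unique hT
        (hasInitialValue_prim hvi huae)
    -- The Volterra equation gives the initial velocity only as an element of V'.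
    · apply dualEmb_injective hd
      have h1 := (((WTilde.mk hp1 hp2).hasInitialValue_velocity hT hι).clm (dualEmb ι))
      have h2 : HasInitialValue T (fun t => gelfandMap ι (v t)) (dualEmb ι u₁) := by
        refine hasInitialValue_prim (integrable_L2T g) ?_
        filter_upwards [hv] with t k2
        rw [prim_congr hgae, prim_add (integrable_L2T _) hab', prim_smul,
          ← add_assoc, ← k2]
        simp
      exact h1.unique hT h2
    · change g + a.compLpL 2 (timeMeasure T) v + b.compLpL 2 (timeMeasure T) u = G
      rw [hg]; abel

end WaveOperator

/-! ### Superposition operators -/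

section Superposition

variable {α : Type} [MeasurableSpace α] {μ : Measure α}

/-- Off one null set g is continuous in τ and agrees with measurable functions of x at all rational
τ. Set to zero on that null set, g is measurable in x for every τ by continuity, hence jointly
measurable. -/
theorem aestronglyMeasurable_superposition {g : α → ℝ → ℝ} (hc : ∀ᵐ x ∂μ, Continuous (g x))
    (hm : ∀ τ, AEMeasurable (fun x => g x τ) μ) {u : α → ℝ} (hu : AEStronglyMeasurable u μ) :
    AEStronglyMeasurable (fun x => g x (u x)) μ := by
  have hae : ∀ᵐ x ∂μ, Continuous (g x) ∧ ∀ τ : ℚ, g x τ = (hm τ).mk _ x :=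
    hc.and (ae_all_iff.2 fun τ => (hm τ).ae_eq_mk)
  obtain ⟨N, hN, hNm, hN0⟩ := exists_measurable_superset_of_null (ae_iff.1 hae)
  have hgood : ∀ x ∈ Nᶜ, Continuous (g x) ∧ ∀ τ : ℚ, g x τ = (hm τ).mk _ x := fun x hx => by
    by_contra h
    exact hx (hN h)
  let k : ℝ → α → ℝ := fun τ => Nᶜ.indicator fun x => g x τ
  have hkc : ∀ x, Continuous fun τ => k τ x := by
    intro x
    by_cases hx : x ∈ Nᶜ
    · simpa only [k, indicator_of_mem hx] using (hgood x hx).1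
    · simp only [k, indicator_of_notMem hx]
      exact continuous_const
  have hkq : ∀ τ : ℚ, Measurable (k τ) := by
    intro τ
    have h : k τ = Nᶜ.indicator ((hm τ).mk _) := by
      ext x
      by_cases hx : x ∈ Nᶜ
      · simp only [k, indicator_of_mem hx, (hgood x hx).2 τ]
      · simp only [k, indicator_of_notMem hx]
    rw [h]
    exact (hm τ).measurable_mk.indicator hNm.compl
  have hkm : ∀ τ, Measurable (k τ) := by
    intro τ
    have hd : τ ∈ closure (range ((↑) : ℚ → ℝ)) := Rat.denseRange_cast τ
    obtain ⟨y, hy, hlim⟩ := mem_closure_iff_seq_limit.1 hd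
    choose z hz using hy
    refine measurable_of_tendsto_metrizable (fun i => hkq (z i)) (tendsto_pi_nhds.2 fun x => ?_)
    have := ((hkc x).tendsto τ).comp hlim
    simpa only [Function.comp_def, ← hz] using this
  have hjoint : Measurable (Function.uncurry fun x τ => k τ x) :=
    (measurable_uncurry_of_continuous_of_measurable hkc hkm).comp measurable_swap
  have h1 : AEMeasurable (fun x => k (u x) x) μ :=
    hjoint.comp_aemeasurable (aemeasurable_id.prodMk hu.aemeasurable)
  refine (h1.congr ?_).aestronglyMeasurable
  have : ∀ᵐ x ∂μ, x ∈ Nᶜ := measure_eq_zero_iff_ae_notMem.1 hN0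
  filter_upwards [this] with x hx
  simp only [k, indicator_of_mem hx]

/-- Carathéodory functions with `|g(x,τ)| ≤ b(x) + K|τ|^r`, where `b ∈ L^q`. -/
structure PowerGrowth (μ : Measure α) (g : α → ℝ → ℝ) (q : ℝ≥0∞) (r : ℝ) : Prop where
  continuous : ∀ᵐ x ∂μ, Continuous (g x)
  measurable : ∀ τ, AEMeasurable (fun x => g x τ) μ
  bound : ∃ (b : α → ℝ) (K : ℝ), 0 ≤ K ∧ MemLp b q μ ∧ ∀ᵐ x ∂μ, ∀ τ, |g x τ| ≤ b x + K * |τ| ^ r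

variable {g : α → ℝ → ℝ} {p q : ℝ≥0∞} {r : ℝ}

theorem memLp_norm_rpow (hr : 0 < r) (hp : p = q * ENNReal.ofReal r) {u : α → ℝ}
    (hu : MemLp u p μ) : MemLp (fun x => |u x| ^ r) q μ := by
  refine ⟨((Real.continuous_rpow_const hr.le).comp continuous_abs).comp_aestronglyMeasurable hu.1,
    ?_⟩
  have := eLpNorm_norm_rpow (μ := μ) (p := q) u hr
  simp only [Real.norm_eq_abs] at this
  rw [this, ← hp]
  exact ENNReal.rpow_lt_top_of_nonneg hr.le hu.2.ne

theorem PowerGrowth.memLp (hg : PowerGrowth μ g q r) (hr : 0 < r) (hp : p = q * ENNReal.ofReal r)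
    {u : α → ℝ} (hu : MemLp u p μ) : MemLp (fun x => g x (u x)) q μ := by
  obtain ⟨b, K, hK, hb, h⟩ := hg.bound
  refine (hb.add ((memLp_norm_rpow hr hp hu).const_mul K)).mono
    (aestronglyMeasurable_superposition hg.continuous hg.measurable hu.1) ?_
  filter_upwards [h] with x hx
  exact (hx (u x)).trans (le_abs_self _)

/-- The superposition operator `u ↦ g(·, u)` as a map `L^p → L^q`, `p = qr`. -/
def superposition (hg : PowerGrowth μ g q r) (hr : 0 < r) (hp : p = q * ENNReal.ofReal r)
    (u : Lp ℝ p μ) : Lp ℝ q μ :=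
  (hg.memLp hr hp (Lp.memLp u)).toLp _

theorem coeFn_superposition (hg : PowerGrowth μ g q r) (hr : 0 < r)
    (hp : p = q * ENNReal.ofReal r) (u : Lp ℝ p μ) :
    superposition hg hr hp u =ᵐ[μ] fun x => g x (u x) :=
  MemLp.coeFn_toLp _

/-- On any set the L^q norm of |u|^r is the r-th power of the L^p norm of u, whence the tolerance
ε^{1/r}. -/
theorem unifIntegrable_norm_rpow (hr : 0 < r) (hp : p = q * ENNReal.ofReal r) {u : ℕ → α → ℝ}
    (hu : UnifIntegrable u p μ) : UnifIntegrable (fun k x => |u k x| ^ r) q μ := by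
  intro ε hε
  obtain ⟨δ, hδ, h⟩ := hu (ε := ε ^ r⁻¹) (by positivity)
  refine ⟨δ, hδ, fun k s hs hμ => ?_⟩
  have h1 : s.indicator (fun x => |u k x| ^ r) = fun x => ‖s.indicator (u k) x‖ ^ r := by
    ext x
    by_cases hx : x ∈ s
    · simp [indicator_of_mem hx]
    · simp [indicator_of_notMem hx, Real.zero_rpow hr.ne']
  rw [h1, eLpNorm_norm_rpow _ hr, ← hp]
  calc eLpNorm (s.indicator (u k)) p μ ^ r ≤ ENNReal.ofReal (ε ^ r⁻¹) ^ r :=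
        ENNReal.rpow_le_rpow (h k s hs hμ) hr.le
    _ = ENNReal.ofReal ε := by
        rw [ENNReal.ofReal_rpow_of_nonneg (by positivity) hr.le, ← Real.rpow_mul hε.le,
          inv_mul_cancel₀ hr.ne', Real.rpow_one]

/-- Vitali's theorem. An L^p convergent sequence is uniformly p-integrable, and the growth bound
carries this over to g(·,u_k) in L^q. Along a subsequence u_k converges almost everywhere, and so
does g(·,u_k) by continuity in τ. -/
theorem continuous_superposition [IsFiniteMeasure μ] [Fact (1 ≤ p)] [Fact (1 ≤ q)] (hpt : p ≠ (∞ : ℝ≥0∞))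
    (hqt : q ≠ (∞ : ℝ≥0∞)) (hg : PowerGrowth μ g q r) (hr : 0 < r) (hp : p = q * ENNReal.ofReal r) :
    Continuous (superposition hg hr hp) := by
  have hp1 : 1 ≤ p := Fact.out
  have hq1 : 1 ≤ q := Fact.out
  rw [continuous_iff_seqContinuous]
  intro u₀ u hu
  obtain ⟨b, K, hK, hb, hbd⟩ := hg.bound
  rw [Lp.tendsto_Lp_iff_tendsto_eLpNorm']
  have hcongr : ∀ k, eLpNorm (⇑((superposition hg hr hp ∘ u₀) k) - ⇑(superposition hg hr hp u)) q μ
      = eLpNorm ((fun x => g x (u₀ k x)) - fun x => g x (u x)) q μ := fun k =>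
    eLpNorm_congr_ae ((coeFn_superposition hg hr hp (u₀ k)).sub (coeFn_superposition hg hr hp u))
  simp_rw [hcongr]
  have hui : UnifIntegrable (fun k => (u₀ k : α → ℝ)) p μ :=
    unifIntegrable_of_tendsto_Lp hp1 hpt (fun k => Lp.memLp _) (Lp.memLp u)
      (Lp.tendsto_Lp_iff_tendsto_eLpNorm' _ _ |>.1 hu)
  have hmeas : ∀ k, AEStronglyMeasurable (fun x => g x (u₀ k x)) μ := fun k =>
    aestronglyMeasurable_superposition hg.continuous hg.measurable (Lp.aestronglyMeasurable _)
  have hdom : UnifIntegrable (fun k => b + K • fun x => |u₀ k x| ^ r) q μ := by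
    refine (unifIntegrable_const hq1 hqt hb).add (g := fun k => K • fun x => |u₀ k x| ^ r) ?_ hq1
      (fun _ => hb.1) fun k => ((memLp_norm_rpow hr hp (Lp.memLp (u₀ k))).const_smul K).1
    intro ε hε
    -- Dividing by K + 1 also covers K = 0.
    obtain ⟨δ, hδ, h⟩ := unifIntegrable_norm_rpow hr hp hui (ε := ε / (K + 1)) (by positivity)
    refine ⟨δ, hδ, fun k s hs hμ => ?_⟩
    change eLpNorm (s.indicator (K • fun x => |u₀ k x| ^ r)) q μ ≤ _
    have hind : s.indicator (K • fun x => |u₀ k x| ^ r) = K • s.indicator fun x => |u₀ k x| ^ r :=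
      indicator_const_smul s K _
    rw [hind, eLpNorm_const_smul]
    calc ‖K‖ₑ * eLpNorm (s.indicator fun x => |u₀ k x| ^ r) q μ
        ≤ ENNReal.ofReal K * ENNReal.ofReal (ε / (K + 1)) := by
          rw [Real.enorm_of_nonneg hK]
          gcongr
          exact h k s hs hμ
      _ = ENNReal.ofReal (K * (ε / (K + 1))) := (ENNReal.ofReal_mul hK).symm
      _ ≤ ENNReal.ofReal ε := by
          apply ENNReal.ofReal_le_ofReal
          rw [mul_div_assoc', div_le_iff₀ (by positivity)]
          nlinarith
  have hui' : UnifIntegrable (fun k x => g x (u₀ k x)) q μ := by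
    intro ε hε
    obtain ⟨δ, hδ, h⟩ := hdom hε
    refine ⟨δ, hδ, fun k s hs hμ => (eLpNorm_mono_ae ?_).trans (h k s hs hμ)⟩
    filter_upwards [hbd] with x hx
    by_cases hxs : x ∈ s
    · simp only [indicator_of_mem hxs, Pi.add_apply, Pi.smul_apply, smul_eq_mul, Real.norm_eq_abs]
      exact (hx _).trans (le_abs_self _)
    · simp [indicator_of_notMem hxs]
  -- Almost everywhere convergence is available only along subsequences; finding one in every
  -- subsequence is enough.
  refine Filter.tendsto_of_subseq_tendsto fun ns hns => ?_
  obtain ⟨ms, -, hms⟩ := TendstoInMeasure.exists_seq_tendsto_ae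
    (tendstoInMeasure_of_tendsto_Lp (hu.comp hns))
  refine ⟨ms, tendsto_Lp_finite_of_tendsto_ae hq1 hqt (fun k => hmeas _)
    (hg.memLp hr hp (Lp.memLp u)) (fun ε hε => ?_) ?_⟩
  · obtain ⟨δ, hδ, h⟩ := hui' hε
    exact ⟨δ, hδ, fun i s hs hμ => h _ s hs hμ⟩
  · filter_upwards [hms, hg.continuous] with x hx hc
    exact (hc.tendsto _).comp hx

end Superposition

/-! ### Differentiability of superposition operators -/

section Differentiability

variable {α : Type} [MeasurableSpace α] {μ : Measure α} {f : α → ℝ → ℝ} {r K : ℝ}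

theorem abs_add_rpow_le (hr : 0 < r) (a b : ℝ) :
    (|a| + |b|) ^ r ≤ 2 ^ r * |a| ^ r + 2 ^ r * |b| ^ r := by
  wlog h : |b| ≤ |a| generalizing a b
  · have := this b a (le_of_not_ge h)
    rw [add_comm |b| |a|] at this
    linarith
  · calc (|a| + |b|) ^ r ≤ (2 * |a|) ^ r :=
          Real.rpow_le_rpow (by positivity) (by linarith) hr.le
      _ = 2 ^ r * |a| ^ r := Real.mul_rpow (by norm_num) (abs_nonneg a)
      _ ≤ _ := le_add_of_nonneg_right (by positivity)

/-- The mean value inequality on the symmetric interval of radius |a| + |h|, which contains both a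
and a + h. -/
theorem abs_dslope_le {φ : ℝ → ℝ} (hd : Differentiable ℝ φ) (hr : 0 < r) (hK : 0 ≤ K)
    (hφ : ∀ τ, |deriv φ τ| ≤ K * (1 + |τ| ^ r)) (a h : ℝ) :
    |dslope φ a (a + h)| ≤ K * (1 + (|a| + |h|) ^ r) := by
  have hbound : ∀ τ, |τ| ≤ |a| + |h| → |deriv φ τ| ≤ K * (1 + (|a| + |h|) ^ r) := fun τ hτ =>
    (hφ τ).trans (by gcongr)
  rcases eq_or_ne h 0 with rfl | hh
  · rw [add_zero, dslope_same]
    exact hbound a (by simp)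
  · rw [dslope_of_ne _ (by simpa using hh), slope_def_field, add_sub_cancel_left, abs_div,
      div_le_iff₀ (abs_pos.2 hh)]
    have := (convex_Icc (-(|a| + |h|)) (|a| + |h|)).norm_image_sub_le_of_norm_deriv_le
      (f := φ) (C := K * (1 + (|a| + |h|) ^ r)) (x := a) (y := a + h)
      (fun τ _ => hd τ) (fun τ hτ => hbound τ (abs_le.2 hτ))
      (abs_le.1 (le_add_of_nonneg_right (abs_nonneg h))) (abs_le.1 (abs_add_le a h))
    simpa using this

/-- Functions `f(x,τ)` that are continuously differentiable in `τ` with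
`|∂_τ f(x,τ)| ≤ K(1+|τ|^r)` and `f(x,0) = 0`. -/
structure DerivGrowth (μ : Measure α) (f : α → ℝ → ℝ) (r K : ℝ) : Prop where
  differentiable : ∀ᵐ x ∂μ, Differentiable ℝ (f x)
  continuous_deriv : ∀ᵐ x ∂μ, Continuous (deriv (f x))
  measurable : ∀ τ, AEMeasurable (fun x => f x τ) μ
  measurable_deriv : ∀ τ, AEMeasurable (fun x => deriv (f x) τ) μ
  bound : ∀ᵐ x ∂μ, ∀ τ, |deriv (f x) τ| ≤ K * (1 + |τ| ^ r)
  apply_zero : ∀ᵐ x ∂μ, f x 0 = 0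

variable [IsFiniteMeasure μ] {q : ℝ≥0∞}

theorem DerivGrowth.powerGrowth_deriv (hf : DerivGrowth μ f r K) (hK : 0 ≤ K) :
    PowerGrowth μ (fun x => deriv (f x)) q r :=
  ⟨hf.continuous_deriv, hf.measurable_deriv, fun _ => K, K, hK, memLp_const K, by
    filter_upwards [hf.bound] with x hx τ
    linarith [hx τ]⟩

/-- As f(x,0) = 0, f(x,τ) is τ times a difference quotient bounded by K(1+|τ|^r), and |τ| ≤ 1 +
|τ|^{r+1}. -/
theorem DerivGrowth.powerGrowth (hf : DerivGrowth μ f r K) (hr : 0 < r) (hK : 0 ≤ K) :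
    PowerGrowth μ f 2 (r + 1) := by
  refine ⟨hf.differentiable.mono fun x hx => hx.continuous, hf.measurable, fun _ => 2 * K, 2 * K,
    by positivity, memLp_const _, ?_⟩
  filter_upwards [hf.bound, hf.differentiable, hf.apply_zero] with x hb hd h0 τ
  have h := abs_dslope_le hd hr hK hb 0 τ
  rw [zero_add, abs_zero, zero_add] at h
  have h1 : f x τ = dslope (f x) 0 τ * τ := by
    have := sub_smul_dslope (f x) 0 τ
    rw [smul_eq_mul, h0] at this
    linarith
  have h2 : |τ| ≤ 1 + |τ| ^ (r + 1) := by
    rcases le_total |τ| 1 with h | h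
    · linarith [Real.rpow_nonneg (abs_nonneg τ) (r + 1)]
    · have := Real.self_le_rpow_of_one_le h (by linarith : 1 ≤ r + 1)
      linarith
  have h3 : |τ| ^ r * |τ| = |τ| ^ (r + 1) := by
    rw [Real.rpow_add_one' (abs_nonneg τ) (by linarith)]
  rw [h1, abs_mul]
  calc |dslope (f x) 0 τ| * |τ| ≤ K * (1 + |τ| ^ r) * |τ| := by gcongr
    _ = K * |τ| + K * |τ| ^ (r + 1) := by rw [← h3]; ring
    _ ≤ K * (1 + |τ| ^ (r + 1)) + K * |τ| ^ (r + 1) := by gcongr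
    _ ≤ 2 * K + 2 * K * |τ| ^ (r + 1) := by
        have : 0 ≤ K * |τ| ^ (r + 1) := by positivity
        linarith

/-- For a fixed base function u the difference quotient of f, completed by ∂_τ f at h = 0, is again
a Carathéodory function of (x,h) with growth r. Continuity of its superposition operator at h = 0 is
what differentiability amounts to. -/
theorem DerivGrowth.powerGrowth_dslope (hf : DerivGrowth μ f r K) (hr : 0 < r) (hK : 0 ≤ K)
    {p : ℝ≥0∞} (hp : p = q * ENNReal.ofReal r) {u : α → ℝ} (hu : MemLp u p μ) :
    PowerGrowth μ (fun x h => dslope (f x) (u x) (u x + h)) q r := by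
  refine ⟨?_, fun h => ?_, fun x => K + K * 2 ^ r * |u x| ^ r, K * 2 ^ r, by positivity,
    (memLp_const K).add ((memLp_norm_rpow hr hp hu).const_mul _), ?_⟩
  · filter_upwards [hf.differentiable] with x hd
    refine Continuous.comp (g := dslope (f x) (u x)) ?_ (by fun_prop)
    rw [continuous_iff_continuousAt]
    intro y
    rcases eq_or_ne y (u x) with rfl | hy
    · exact continuousAt_dslope_same.2 (hd _)
    · exact (continuousAt_dslope_of_ne hy).2 hd.continuous.continuousAt
  · have hcont : ∀ᵐ x ∂μ, Continuous (f x) := hf.differentiable.mono fun x hx => hx.continuous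
    rcases eq_or_ne h 0 with rfl | hh
    · simp only [add_zero, dslope_same]
      exact (aestronglyMeasurable_superposition hf.continuous_deriv hf.measurable_deriv
        hu.1).aemeasurable
    · have : (fun x => dslope (f x) (u x) (u x + h)) = fun x => (f x (u x + h) - f x (u x)) / h := by
        ext x
        rw [dslope_of_ne _ (by simpa using hh), slope_def_field, add_sub_cancel_left]
      rw [this]
      exact ((aestronglyMeasurable_superposition hcont hf.measurable
        (hu.1.add aestronglyMeasurable_const)).aemeasurable.sub
        (aestronglyMeasurable_superposition hcont hf.measurable hu.1).aemeasurable).div_const h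
  · filter_upwards [hf.bound, hf.differentiable] with x hb hd h
    refine (abs_dslope_le hd hr hK hb (u x) h).trans ?_
    have := mul_le_mul_of_nonneg_left (abs_add_rpow_le hr (u x) h) hK
    linarith

variable {p : ℝ≥0∞}

/-- With D the superposition operator of the difference quotients at u, the Taylor remainder is the
product (D(h) − D(0))h. Hölder's inequality and continuity of D from L^p to L^q make it o(‖h‖) in
L². The derivative, multiplication by ∂_τ f(·,u) ∈ L^q, depends continuously on u for the same
reason. -/
theorem exists_contDiff_superposition [Fact (1 ≤ p)] [Fact (1 ≤ q)] [ENNReal.HolderTriple q p 2]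
    (hpt : p ≠ (∞ : ℝ≥0∞)) (hqt : q ≠ (∞ : ℝ≥0∞)) (hf : DerivGrowth μ f r K) (hr : 0 < r) (hK : 0 ≤ K)
    (hpq : p = q * ENNReal.ofReal r) (hp2 : p = 2 * ENNReal.ofReal (r + 1)) :
    ∃ F : Lp ℝ p μ → Lp ℝ 2 μ, ContDiff ℝ 1 F ∧ (∀ u, F u =ᵐ[μ] fun x => f x (u x)) ∧
      ∀ u h, fderiv ℝ F u h =ᵐ[μ] fun x => deriv (f x) (u x) * h x := by
  have hr1 : 0 < r + 1 := by linarith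
  let F := superposition (hf.powerGrowth hr hK) hr1 hp2
  let G := superposition (hf.powerGrowth_deriv (q := q) hK) hr hpq
  have hG : Continuous G := continuous_superposition hpt hqt _ hr hpq
  let B := (ContinuousLinearMap.mul ℝ ℝ).holderL μ q p 2
  have hB : ∀ (a : Lp ℝ q μ) (b : Lp ℝ p μ), B a b =ᵐ[μ] fun x => a x * b x := fun a b =>
    (ContinuousLinearMap.mul ℝ ℝ).coeFn_holder a b
  have hF : ∀ u, HasFDerivAt F (B (G u)) u := by
    intro u
    let D := superposition (hf.powerGrowth_dslope hr hK hpq (Lp.memLp u)) hr hpq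
    have hD : Continuous D := continuous_superposition hpt hqt _ hr hpq
    have hrem : ∀ h, F (u + h) - F u - B (G u) h = B (D h - D 0) h := by
      intro h
      apply Lp.ext
      have e1 := coeFn_superposition (hf.powerGrowth hr hK) hr1 hp2 (u + h)
      have e2 := coeFn_superposition (hf.powerGrowth hr hK) hr1 hp2 u
      have e3 := coeFn_superposition (hf.powerGrowth_deriv (q := q) hK) hr hpq u
      have e4 := coeFn_superposition (hf.powerGrowth_dslope hr hK hpq (Lp.memLp u)) hr hpq h
      have e5 := coeFn_superposition (hf.powerGrowth_dslope hr hK hpq (Lp.memLp u)) hr hpq 0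
      filter_upwards [Lp.coeFn_sub (F (u + h) - F u) (B (G u) h), Lp.coeFn_sub (F (u + h)) (F u),
        hB (G u) h, hB (D h - D 0) h, Lp.coeFn_sub (D h) (D 0), e1, e2, e3, e4, e5,
        Lp.coeFn_add u h, Lp.coeFn_zero ℝ p μ] with x h1 h2 h3 h4 h5 h6 h7 h8 h9 h10 h11 h12
      rw [h1, Pi.sub_apply, h2, Pi.sub_apply, h3, h4, h5, Pi.sub_apply, h6, h7, h8, h9, h10, h11,
        h12, Pi.add_apply, Pi.zero_apply, add_zero, dslope_same]
      have := sub_smul_dslope (f x) (u x) (u x + h x)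
      rw [smul_eq_mul, add_sub_cancel_left] at this
      linarith
    rw [hasFDerivAt_iff_isLittleO_nhds_zero]
    simp_rw [hrem]
    have hlim : Filter.Tendsto (fun h => ‖B‖ * ‖D h - D 0‖) (𝓝 0) (𝓝 0) := by
      have : Continuous fun h => ‖B‖ * ‖D h - D 0‖ := by fun_prop
      simpa using this.tendsto 0
    rw [Asymptotics.isLittleO_iff]
    intro c hc
    filter_upwards [hlim.eventually (gt_mem_nhds hc)] with h hh
    exact (B.le_opNorm₂ _ _).trans (mul_le_mul_of_nonneg_right hh.le (norm_nonneg _))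
  have hfd : fderiv ℝ F = fun u => B (G u) := funext fun u => (hF u).fderiv
  refine ⟨F, ?_, fun u => coeFn_superposition _ _ _ u, fun u h => ?_⟩
  · rw [contDiff_one_iff_fderiv]
    exact ⟨fun u => (hF u).differentiableAt, by rw [hfd]; exact B.continuous.comp hG⟩
  · rw [hfd]
    filter_upwards [hB (G u) h, coeFn_superposition (hf.powerGrowth_deriv (q := q) hK) hr hpq u]
      with x h1 h2
    rw [h1, h2]

end Differentiability

/-! ### Composition with a `C¹` map on spaces of continuous functions -/

section Postcomp

variable {K E Y : Type} [TopologicalSpace K] [CompactSpace K] [NormedAddCommGroup E]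
  [NormedSpace ℝ E] [NormedAddCommGroup Y] [NormedSpace ℝ Y]

/-- The pointwise action of `C(K, E →L Y)` on `C(K, E)`. -/
def pointwiseApply (K E Y : Type) [TopologicalSpace K] [CompactSpace K] [NormedAddCommGroup E]
    [NormedSpace ℝ E] [NormedAddCommGroup Y] [NormedSpace ℝ Y] :
    C(K, E →L[ℝ] Y) →L[ℝ] C(K, E) →L[ℝ] C(K, Y) :=
  LinearMap.mkContinuous₂
    (LinearMap.mk₂ ℝ (fun (A : C(K, E →L[ℝ] Y)) (c : C(K, E)) =>
        (⟨fun t => A t (c t), by fun_prop⟩ : C(K, Y)))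
      (fun _ _ _ => by ext; simp) (fun _ _ _ => by ext; simp) (fun _ _ _ => by ext; simp)
      (fun _ _ _ => by ext; simp)) 1 fun A c => by
    rw [one_mul, ContinuousMap.norm_le _ (by positivity)]
    intro t
    exact ((A t).le_opNorm (c t)).trans
      (mul_le_mul (A.norm_coe_le_norm t) (c.norm_coe_le_norm t) (norm_nonneg _) (by positivity))

/-- Uniformity in t is the point: c ↦ F'∘c is continuous for the sup norms because K is compact. The
mean value inequality then bounds the remainder by ε‖h‖ simultaneously for all t. -/
theorem hasFDerivAt_postcomp {F : E → Y} (hF : ContDiff ℝ 1 F) (c : C(K, E)) :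
    HasFDerivAt (fun c : C(K, E) => (⟨F, hF.continuous⟩ : C(E, Y)).comp c)
      (pointwiseApply K E Y
        ((⟨fderiv ℝ F, hF.continuous_fderiv one_ne_zero⟩ : C(E, E →L[ℝ] Y)).comp c)) c := by
  set G : C(E, E →L[ℝ] Y) := ⟨fderiv ℝ F, hF.continuous_fderiv one_ne_zero⟩
  have hG : Continuous fun c : C(K, E) => G.comp c := ContinuousMap.continuous_postcomp G
  rw [hasFDerivAt_iff_isLittleO_nhds_zero, Asymptotics.isLittleO_iff]
  intro ε hε
  obtain ⟨δ, hδ, hd⟩ := (Metric.tendsto_nhds_nhds (α := C(K, E)) (β := C(K, E →L[ℝ] Y))).1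
    (hG.tendsto c) ε hε
  filter_upwards [Metric.ball_mem_nhds (0 : C(K, E)) hδ] with h hh
  rw [mem_ball_zero_iff] at hh
  rw [ContinuousMap.norm_le _ (by positivity)]
  intro t
  have hest : ∀ x ∈ Metric.ball (c t) δ, ‖fderiv ℝ F x - fderiv ℝ F (c t)‖ ≤ ε := by
    intro x hx
    -- Shifting c by the constant x − c(t) turns sup-norm continuity of c ↦ F'∘c into an estimate of
    -- F' on a ball around c(t) whose radius does not depend on t.
    have hlt : dist (c + ContinuousMap.const K (x - c t)) c < δ := by
      rw [dist_eq_norm, add_sub_cancel_left, ContinuousMap.norm_lt_iff _ hδ]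
      intro _
      rw [ContinuousMap.const_apply, ← dist_eq_norm]
      exact hx
    have h1 := (hd hlt).le
    have h2 := (ContinuousMap.dist_apply_le_dist t).trans h1
    have h3 : (c + ContinuousMap.const K (x - c t)) t = x := by simp
    rw [ContinuousMap.comp_apply, ContinuousMap.comp_apply, h3, dist_eq_norm] at h2
    exact h2
  have hmem : c t + h t ∈ Metric.ball (c t) δ := by
    rw [Metric.mem_ball, dist_eq_norm, add_sub_cancel_left]
    exact (h.norm_coe_le_norm t).trans_lt hh
  have := (convex_ball (c t) δ).norm_image_sub_le_of_norm_hasFDerivWithin_le'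
    (f := F) (f' := fderiv ℝ F) (φ := fderiv ℝ F (c t)) (C := ε)
    (fun x _ => ((hF.differentiable one_ne_zero) x).hasFDerivAt.hasFDerivWithinAt) hest
    (Metric.mem_ball_self hδ) hmem
  rw [add_sub_cancel_left] at this
  exact this.trans (mul_le_mul_of_nonneg_left (h.norm_coe_le_norm t) hε.le)

theorem contDiff_postcomp {F : E → Y} (hF : ContDiff ℝ 1 F) :
    ContDiff ℝ 1 fun c : C(K, E) => (⟨F, hF.continuous⟩ : C(E, Y)).comp c := by
  rw [contDiff_one_iff_fderiv]
  refine ⟨fun c => (hasFDerivAt_postcomp hF c).differentiableAt, ?_⟩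
  rw [funext fun c => (hasFDerivAt_postcomp hF c).fderiv]
  exact (pointwiseApply K E Y).continuous.comp (ContinuousMap.continuous_postcomp _)

end Postcomp

/-! ### The Hilbert space `Hˢ(ℝⁿ)` -/

section Hilbert

variable {n : ℕ} {s : ℝ≥0}

/-- The real part of the complex product of Bessel potentials induces the norm already present. It
makes Riesz representation and orthogonal projection available. -/
instance : InnerProductSpace ℝ (Hs n s) where
  inner u v := (inner ℂ (bessel n s u) (bessel n s v)).re
  norm_sq_eq_re_inner u := by
    rw [Hs.norm_eq, ← inner_self_eq_norm_sq (𝕜 := ℂ)]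
    rfl
  conj_inner_symm u v := by
    simpa using inner_re_symm (𝕜 := ℂ) (bessel n s v) (bessel n s u)
  add_left u v w := by simp [inner_add_left]
  smul_left u v c := by
    have h : bessel n s (c • u) = (c : ℂ) • bessel n s u := by
      rw [map_smul]
      rfl
    rw [h, inner_smul_left]
    simp

/-- The Fourier transform of an element of `Hˢ(ℝⁿ)`. -/
abbrev Hs.hat (u : Hs n s) : L2C n := fourierR n (Hs.toL2 n s u)

theorem Hs.toL2_injective (n : ℕ) (s : ℝ≥0) : Function.Injective (Hs.toL2 n s) :=
  incl_injective n s

theorem norm_sq_multiplier {m : EuclideanSpace ℝ (Fin n) → ℝ} (hm : Continuous m)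
    (hle : ∀ ξ, |m ξ| ≤ besselSymbol n s ξ) (u : Hs n s) :
    ‖multiplier m hm hle u‖ ^ 2 = ∫ ξ, (m ξ) ^ 2 * ‖u.hat ξ‖ ^ 2 := by
  have h : ‖multiplier m hm hle u‖ = ‖(memLp_symbol hm hle u).toLp _‖ :=
    (fourierC n).symm.norm_map _
  rw [h, norm_sq_Lp_two]
  refine integral_congr_ae ?_
  filter_upwards [(memLp_symbol hm hle u).coeFn_toLp] with ξ hξ
  rw [hξ, norm_smul, mul_pow, Real.norm_eq_abs, sq_abs]
  rfl

theorem integrable_symbol {m : EuclideanSpace ℝ (Fin n) → ℝ} (hm : Continuous m)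
    (hle : ∀ ξ, |m ξ| ≤ besselSymbol n s ξ) (u : Hs n s) :
    Integrable fun ξ => (m ξ) ^ 2 * ‖u.hat ξ‖ ^ 2 := by
  refine ((memLp_symbol hm hle u).integrable_norm_pow two_ne_zero).congr ?_
  filter_upwards with ξ
  rw [norm_smul, mul_pow, Real.norm_eq_abs, sq_abs]
  rfl

theorem Hs.norm_sq_eq (u : Hs n s) : ‖u‖ ^ 2 = ∫ ξ, besselSymbol n s ξ ^ 2 * ‖u.hat ξ‖ ^ 2 :=
  norm_sq_multiplier _ _ u

theorem Hs.norm_sq_toL2 (u : Hs n s) : ‖Hs.toL2 n s u‖ ^ 2 = ∫ ξ, ‖u.hat ξ‖ ^ 2 := by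
  rw [← norm_fourierR, norm_sq_Lp_two]

/-- The element of `Hˢ(ℝⁿ)` given by an `L²` function with `⟨ξ⟩ˢ û ∈ L²`. -/
def Hs.ofL2 (u : L2R n) (hu : MemLp (fun ξ => besselSymbol n s ξ • fourierR n u ξ) 2 volume) :
    Hs n s :=
  (⟨u, hu⟩ : HsSubmodule n s)

theorem norm_fracLapHalf_le (u : Hs n s) : ‖fracLapHalf n s u‖ ≤ ‖u‖ := by
  refine le_of_sq_le_sq ?_ (norm_nonneg _)
  rw [Hs.norm_sq_eq]
  refine (norm_sq_multiplier _ _ u).le.trans (integral_mono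
    (integrable_symbol (continuous_fracSymbol n s) (abs_fracSymbol_le n s) u)
    (integrable_symbol (continuous_besselSymbol n s) (abs_besselSymbol_le n s) u) fun ξ => ?_)
  refine mul_le_mul_of_nonneg_right ?_ (by positivity)
  have := abs_fracSymbol_le n s ξ
  rw [← sq_abs (fracSymbol n s ξ)]
  exact pow_le_pow_left₀ (abs_nonneg _) this 2

/-- The bilinear form `fracForm` as a continuous bilinear map. -/
def fracFormL (n : ℕ) (s : ℝ≥0) : Hs n s →L[ℝ] StrongDual ℝ (Hs n s) :=
  LinearMap.mkContinuous₂
    (LinearMap.mk₂ ℝ (fun u v : Hs n s => fracForm u v)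
      (fun u v w => by simp [fracForm, inner_add_left])
      (fun c u v => by
        have h : fracLapHalf n s (c • u) = (c : ℂ) • fracLapHalf n s u := by
          rw [map_smul]
          rfl
        simp only [fracForm]
        rw [h, inner_smul_left]
        simp)
      (fun u v w => by simp [fracForm, inner_add_right])
      (fun c u v => by
        have h : fracLapHalf n s (c • v) = (c : ℂ) • fracLapHalf n s v := by
          rw [map_smul]
          rfl
        simp only [fracForm]
        rw [h, inner_smul_right]
        simp)) 1 fun u v => by
    rw [one_mul]
    refine (Complex.abs_re_le_norm _).trans ((norm_inner_le_norm _ _).trans ?_)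
    exact mul_le_mul (norm_fracLapHalf_le u) (norm_fracLapHalf_le v) (norm_nonneg _) (norm_nonneg _)

@[simp] theorem fracFormL_apply (u v : Hs n s) : fracFormL n s u v = fracForm u v := rfl

theorem fracForm_self (u : Hs n s) :
    fracForm u u = ∫ ξ, fracSymbol n s ξ ^ 2 * ‖u.hat ξ‖ ^ 2 := by
  rw [← norm_sq_multiplier (continuous_fracSymbol n s) (abs_fracSymbol_le n s) u]
  exact inner_self_eq_norm_sq (𝕜 := ℂ) (fracLapHalf n s u)

/-- With y the square of the scaled frequency this is (1+y)^s ≤ 2^s(y^s+1), since 1 + y ≤ 2max(1,y).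
-/
theorem besselSymbol_sq_le (ξ : EuclideanSpace ℝ (Fin n)) :
    besselSymbol n s ξ ^ 2 ≤ 2 ^ (s : ℝ) * (fracSymbol n s ξ ^ 2 + 1) := by
  set y := (2 * Real.pi * ‖ξ‖) ^ 2 with hy
  have h0 : 0 ≤ 2 * Real.pi * ‖ξ‖ := by positivity
  have h1 : besselSymbol n s ξ ^ 2 = (1 + y) ^ (s : ℝ) := by
    rw [besselSymbol, ← Real.rpow_natCast, ← Real.rpow_mul (by positivity)]
    congr 1
    push_cast
    ring
  have h2 : fracSymbol n s ξ ^ 2 = y ^ (s : ℝ) := by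
    rw [fracSymbol, hy, ← Real.rpow_natCast, ← Real.rpow_mul h0, ← Real.rpow_natCast,
      ← Real.rpow_mul h0, mul_comm (s : ℝ)]
  have hy0 : 0 ≤ y := by positivity
  rw [h1, h2]
  rcases le_total y 1 with h | h
  · calc (1 + y) ^ (s : ℝ) ≤ 2 ^ (s : ℝ) :=
          Real.rpow_le_rpow (by positivity) (by linarith) s.2
      _ ≤ 2 ^ (s : ℝ) * (y ^ (s : ℝ) + 1) :=
          le_mul_of_one_le_right (by positivity) (le_add_of_nonneg_left (by positivity))
  · calc (1 + y) ^ (s : ℝ) ≤ (2 * y) ^ (s : ℝ) :=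
          Real.rpow_le_rpow (by positivity) (by linarith) s.2
      _ = 2 ^ (s : ℝ) * y ^ (s : ℝ) := Real.mul_rpow (by norm_num) hy0
      _ ≤ 2 ^ (s : ℝ) * (y ^ (s : ℝ) + 1) := by gcongr; linarith

/-- The symbol inequality integrated against |û|²: the Gårding inequality that the linear theory
needs. -/
theorem Hs.norm_sq_le_fracForm (u : Hs n s) :
    ‖u‖ ^ 2 ≤ 2 ^ (s : ℝ) * (fracForm u u + ‖Hs.toL2 n s u‖ ^ 2) := by
  have hi := integrable_symbol (continuous_fracSymbol n s) (abs_fracSymbol_le n s) u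
  have hi' : Integrable fun ξ => ‖u.hat ξ‖ ^ 2 :=
    (Lp.memLp u.hat).integrable_norm_pow two_ne_zero
  rw [Hs.norm_sq_eq, Hs.norm_sq_toL2, fracForm_self, ← integral_add hi hi', ← integral_const_mul]
  refine integral_mono (integrable_symbol (continuous_besselSymbol n s) (abs_besselSymbol_le n s) u)
    ((hi.add hi').const_mul _) fun ξ => ?_
  refine (mul_le_mul_of_nonneg_right (besselSymbol_sq_le ξ) (by positivity)).trans_eq ?_
  ring

end Hilbert

/-! ### The Fourier transform of integrable functions in `L²` -/

section FourierIntegrable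

variable {n : ℕ}

local notation "𝔼" => EuclideanSpace ℝ (Fin n)

theorem norm_fourier_le (g : 𝔼 → ℂ) (ξ : 𝔼) : ‖𝓕 g ξ‖ ≤ ∫ x, ‖g x‖ :=
  VectorFourier.norm_fourierIntegral_le_integral_norm _ _ _ _ _

theorem norm_fourierInv_le (g : 𝔼 → ℂ) (x : 𝔼) : ‖𝓕⁻ g x‖ ≤ ∫ ξ, ‖g ξ‖ :=
  VectorFourier.norm_fourierIntegral_le_integral_norm _ _ _ _ _

theorem continuous_fourier {g : 𝔼 → ℂ} (hg : Integrable g) : Continuous (𝓕 g) :=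
  VectorFourier.fourierIntegral_continuous Real.continuous_fourierChar continuous_inner hg

/-- Both transforms, tested against C_c^∞ functions, shift onto the test function, so the L²
transform is given by the integral for integrable g. -/
theorem fourierC_ae_eq (g : L2C n) (hg : Integrable g) : fourierC n g =ᵐ[volume] 𝓕 (g : 𝔼 → ℂ) := by
  refine ae_eq_of_integral_contDiff_smul_eq ((Lp.memLp _).locallyIntegrable (by norm_num))
    (continuous_fourier hg).locallyIntegrable fun φ hφ hc => ?_
  have hc' : HasCompactSupport (Complex.ofRealCLM ∘ φ) := hc.comp_left rfl
  have hφ' : ContDiff ℝ ∞ (Complex.ofRealCLM ∘ φ) := Complex.ofRealCLM.contDiff.comp hφ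
  let ψ := hc'.toSchwartzMap hφ'
  have h1 := congrArg (fun D => D ψ) (Lp.fourier_toTemperedDistribution_eq g)
  have h2 : ∫ x, 𝓕 (ψ : 𝔼 → ℂ) x • g x = ∫ x, ψ x • 𝓕 (g : 𝔼 → ℂ) x := by
    have := VectorFourier.integral_fourierIntegral_smul_eq_flip (L := innerₗ 𝔼)
      (μ := volume) (ν := volume) Real.continuous_fourierChar continuous_inner ψ.integrable hg
    rwa [flip_innerₗ] at this
  simp only [TemperedDistribution.fourier_apply, Lp.toTemperedDistribution_apply,
    SchwartzMap.fourier_coe] at h1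
  rw [h2] at h1
  exact h1.symm

theorem fourierC_symm_ae_eq (g : L2C n) (hg : Integrable g) :
    (fourierC n).symm g =ᵐ[volume] 𝓕⁻ (g : 𝔼 → ℂ) := by
  have hc : Continuous (𝓕⁻ (g : 𝔼 → ℂ)) :=
    VectorFourier.fourierIntegral_continuous Real.continuous_fourierChar
      (continuous_inner (𝕜 := ℝ) (E := 𝔼)).neg hg
  refine ae_eq_of_integral_contDiff_smul_eq ((Lp.memLp _).locallyIntegrable (by norm_num))
    hc.locallyIntegrable fun φ hφ hc => ?_
  have hc' : HasCompactSupport (Complex.ofRealCLM ∘ φ) := hc.comp_left rfl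
  have hφ' : ContDiff ℝ ∞ (Complex.ofRealCLM ∘ φ) := Complex.ofRealCLM.contDiff.comp hφ
  let ψ := hc'.toSchwartzMap hφ'
  have h1 := congrArg (fun D => D ψ) (Lp.fourierInv_toTemperedDistribution_eq g)
  have h2 : ∫ x, 𝓕⁻ (ψ : 𝔼 → ℂ) x • g x = ∫ x, ψ x • 𝓕⁻ (g : 𝔼 → ℂ) x := by
    have := VectorFourier.integral_fourierIntegral_smul_eq_flip (L := -innerₗ 𝔼)
      (μ := volume) (ν := volume) Real.continuous_fourierChar
      (continuous_inner (𝕜 := ℝ) (E := 𝔼)).neg ψ.integrable hg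
    have hflip : (-innerₗ 𝔼).flip = -innerₗ 𝔼 := by
      ext x y
      simp [real_inner_comm]
    rwa [hflip] at this
  simp only [TemperedDistribution.fourierInv_apply, Lp.toTemperedDistribution_apply,
    SchwartzMap.fourierInv_coe] at h1
  rw [h2] at h1
  exact h1.symm

/-- The complexification of a real `L²` function. -/
abbrev complexify (n : ℕ) : L2R n →L[ℝ] L2C n := Complex.ofRealCLM.compLpL 2 volume

theorem coeFn_complexify (u : L2R n) : complexify n u =ᵐ[volume] fun x => ((u x : ℝ) : ℂ) :=
  Complex.ofRealCLM.coeFn_compLpL u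

theorem fourierR_eq (u : L2R n) : fourierR n u = fourierC n (complexify n u) := rfl

theorem fourierR_ae_eq {u : L2R n} {g : 𝔼 → ℂ} (hg : Integrable g)
    (h : (fun x => ((u x : ℝ) : ℂ)) =ᵐ[volume] g) : fourierR n u =ᵐ[volume] 𝓕 g := by
  have h1 : (complexify n u : 𝔼 → ℂ) =ᵐ[volume] g := (coeFn_complexify u).trans h
  have h2 : 𝓕 (complexify n u : 𝔼 → ℂ) = 𝓕 g := by
    ext ξ
    exact integral_congr_ae (by filter_upwards [h1] with x hx; rw [hx])
  rw [← h2, fourierR_eq]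
  exact fourierC_ae_eq _ (hg.congr h1.symm)

end FourierIntegrable

/-! ### Test functions -/

section TestFunctions

variable {n : ℕ} {s : ℝ≥0}

local notation "𝔼" => EuclideanSpace ℝ (Fin n)

theorem besselSymbol_le (ξ : 𝔼) :
    besselSymbol n s ξ ≤ (2 * Real.pi) ^ (s : ℝ) * (1 + ‖ξ‖ ^ 2) ^ ((s : ℝ) / 2) := by
  have hpi : 1 ≤ 2 * Real.pi := by linarith [Real.two_le_pi]
  have h : (2 * Real.pi) ^ (s : ℝ) = ((2 * Real.pi) ^ 2) ^ ((s : ℝ) / 2) := by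
    rw [← Real.rpow_natCast, ← Real.rpow_mul (by positivity)]
    congr 1
    push_cast
    ring
  rw [h, ← Real.mul_rpow (by positivity) (by positivity)]
  refine Real.rpow_le_rpow (by positivity) ?_ (by positivity)
  have : 1 ≤ (2 * Real.pi) ^ 2 := one_le_pow₀ hpi
  nlinarith

theorem memLp_besselSymbol_smul_schwartz (p : ℝ≥0∞) (g : SchwartzMap 𝔼 ℂ) :
    MemLp (fun ξ => besselSymbol n s ξ • g ξ) p volume := by
  have hgr := Function.hasTemperateGrowth_one_add_norm_sq_rpow 𝔼 ((s : ℝ) / 2)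
  have h := ((SchwartzMap.smulLeftCLM ℂ (fun x : 𝔼 => (1 + ‖x‖ ^ 2) ^ ((s : ℝ) / 2)) g).memLp p
    volume).const_smul ((2 * Real.pi) ^ (s : ℝ))
  refine h.mono ((continuous_besselSymbol n s).smul g.continuous).aestronglyMeasurable ?_
  filter_upwards with ξ
  simp only [Pi.smul_apply, SchwartzMap.smulLeftCLM_apply_apply hgr, norm_smul]
  rw [← mul_assoc]
  refine mul_le_mul_of_nonneg_right ?_ (norm_nonneg _)
  rw [Real.norm_eq_abs, Real.norm_eq_abs, Real.norm_eq_abs, ← abs_mul]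
  exact (abs_besselSymbol_le n s ξ).trans ((besselSymbol_le ξ).trans (le_abs_self _))

/-- The Schwartz function given by a real-valued test function. -/
def schwartzOfTest {φ : 𝔼 → ℝ} (hφ : ContDiff ℝ ∞ φ) (hc : HasCompactSupport φ) :
    SchwartzMap 𝔼 ℂ :=
  HasCompactSupport.toSchwartzMap (f := Complex.ofRealCLM ∘ φ) (hc.comp_left rfl)
    (Complex.ofRealCLM.contDiff.comp hφ)

@[simp] theorem schwartzOfTest_apply {φ : 𝔼 → ℝ} (hφ : ContDiff ℝ ∞ φ) (hc : HasCompactSupport φ)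
    (x : 𝔼) : schwartzOfTest hφ hc x = (φ x : ℂ) := rfl

theorem memLp_test {φ : 𝔼 → ℝ} (hφ : ContDiff ℝ ∞ φ) (hc : HasCompactSupport φ) (p : ℝ≥0∞) :
    MemLp φ p volume :=
  hφ.continuous.memLp_of_hasCompactSupport hc

theorem fourierR_test {φ : 𝔼 → ℝ} (hφ : ContDiff ℝ ∞ φ) (hc : HasCompactSupport φ) :
    fourierR n ((memLp_test hφ hc 2).toLp φ) =ᵐ[volume] 𝓕 (schwartzOfTest hφ hc : 𝔼 → ℂ) := by
  refine fourierR_ae_eq (schwartzOfTest hφ hc).integrable ?_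
  filter_upwards [(memLp_test hφ hc 2).coeFn_toLp] with x hx
  rw [hx, schwartzOfTest_apply]

/-- A test function as an element of `Hˢ(ℝⁿ)`. -/
def Hs.ofTest (s : ℝ≥0) {φ : 𝔼 → ℝ} (hφ : ContDiff ℝ ∞ φ) (hc : HasCompactSupport φ) : Hs n s :=
  Hs.ofL2 ((memLp_test hφ hc 2).toLp φ) <| by
    refine (memLp_congr_ae ?_).2 (memLp_besselSymbol_smul_schwartz (s := s) 2
      (𝓕 (schwartzOfTest hφ hc)))
    filter_upwards [fourierR_test hφ hc] with ξ hξ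
    rw [hξ, SchwartzMap.fourier_coe]

theorem Hs.coeFn_ofTest {φ : 𝔼 → ℝ} (hφ : ContDiff ℝ ∞ φ) (hc : HasCompactSupport φ) :
    Hs.toL2 n s (Hs.ofTest s hφ hc) =ᵐ[volume] φ :=
  (memLp_test hφ hc 2).coeFn_toLp

theorem Hs.ofTest_mem_HsTilde {Ω : Set 𝔼} {φ : 𝔼 → ℝ} (hφ : ContDiff ℝ ∞ φ)
    (hc : HasCompactSupport φ) (hs : tsupport φ ⊆ Ω) : Hs.ofTest s hφ hc ∈ HsTilde s Ω :=
  Submodule.le_topologicalClosure _ ⟨φ, hφ, hc, hs, Hs.coeFn_ofTest hφ hc⟩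

/-- Vanishing in L²(Ωᶜ) is a closed condition on Hˢ(ℝⁿ), and test functions in Ω satisfy it. -/
theorem HsTilde.ae_eq_zero {Ω : Set 𝔼} (hΩ : MeasurableSet Ω) (u : HsTilde s Ω) :
    ∀ᵐ x, x ∉ Ω → Hs.toL2 n s u x = 0 := by
  have hclosed : IsClosed {u : Hs n s | Hs.restrict s Ωᶜ u = 0} :=
    isClosed_eq (Hs.restrict s Ωᶜ).continuous continuous_const
  have hsub : (HsTilde s Ω : Set (Hs n s)) ⊆ {u : Hs n s | Hs.restrict s Ωᶜ u = 0} := by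
    refine closure_minimal ?_ hclosed
    rintro v ⟨φ, -, -, h3, h4⟩
    apply Lp.ext
    refine (LpToLpRestrictCLM_coeFn ℝ Ωᶜ _).trans ?_
    filter_upwards [ae_restrict_of_ae h4, Lp.coeFn_zero ℝ 2 (volume.restrict Ωᶜ),
      ae_restrict_mem hΩ.compl] with x h5 h6 h7
    refine h5.trans (Eq.trans ?_ h6.symm)
    exact image_eq_zero_of_notMem_tsupport fun h => h7 (h3 h)
  have h := hsub u.2
  have h1 : Hs.toL2 n s u =ᵐ[volume.restrict Ωᶜ] 0 := by
    have h2 := LpToLpRestrictCLM_coeFn ℝ Ωᶜ (Hs.toL2 n s u)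
    have h3 : LpToLpRestrictCLM 𝔼 ℝ ℝ volume 2 Ωᶜ (Hs.toL2 n s u) = 0 := h
    rw [h3] at h2
    exact h2.symm.trans (Lp.coeFn_zero _ _ _)
  exact (ae_restrict_iff' hΩ.compl).1 h1

theorem Hs.coeFn_restrict (A : Set 𝔼) (u : Hs n s) :
    Hs.restrict s A u =ᵐ[volume.restrict A] Hs.toL2 n s u :=
  LpToLpRestrictCLM_coeFn ℝ A _

theorem HsTilde.toL2_injective {Ω : Set 𝔼} (hΩ : MeasurableSet Ω) :
    Function.Injective (HsTilde.toL2 s Ω) := by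
  rw [injective_iff_map_eq_zero]
  intro u hu
  have h1 : Hs.toL2 n s u =ᵐ[volume.restrict Ω] 0 := by
    have h2 := Hs.coeFn_restrict Ω (u : Hs n s)
    have h3 : Hs.restrict s Ω u = 0 := hu
    rw [h3] at h2
    exact h2.symm.trans (Lp.coeFn_zero _ _ _)
  have h4 : Hs.toL2 n s u = 0 := by
    apply Lp.ext
    filter_upwards [HsTilde.ae_eq_zero hΩ u, (ae_restrict_iff' hΩ).1 h1,
      Lp.coeFn_zero ℝ 2 (volume : Measure 𝔼)] with x h5 h6 h7
    rw [h7]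
    by_cases hx : x ∈ Ω
    · exact h6 hx
    · exact h5 hx
  exact Subtype.ext (Hs.toL2_injective n s (h4.trans (map_zero _).symm))

/-- An element of L²(Ω) orthogonal to the range is orthogonal to C_c^∞(Ω), hence zero. -/
theorem HsTilde.denseRange_toL2 {Ω : Set 𝔼} (hΩ : IsOpen Ω) : DenseRange (HsTilde.toL2 s Ω) := by
  have hr : (range (HsTilde.toL2 s Ω)) = ((HsTilde.toL2 s Ω).range : Set (L2On Ω)) := rfl
  rw [DenseRange, hr, Submodule.dense_iff_topologicalClosure_eq_top,
    Submodule.topologicalClosure_eq_top_iff, Submodule.eq_bot_iff]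
  intro g hg
  have h0 : ∀ᵐ x, x ∈ Ω → (Ω.indicator g) x = 0 := by
    refine hΩ.ae_eq_zero_of_integral_contDiff_smul_eq_zero ?_ fun φ h1 h2 h3 => ?_
    · refine (MemLp.locallyIntegrable (p := 2) ?_ (by norm_num)).locallyIntegrableOn Ω
      exact (memLp_indicator_iff_restrict hΩ.measurableSet).2 (Lp.memLp g)
    · have h4 := hg (HsTilde.toL2 s Ω ⟨Hs.ofTest s h1 h2, Hs.ofTest_mem_HsTilde h1 h2 h3⟩) ⟨_, rfl⟩
      rw [L2.inner_def] at h4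
      rw [← h4, ← integral_indicator hΩ.measurableSet]
      refine integral_congr_ae ?_
      have h5 : HsTilde.toL2 s Ω ⟨Hs.ofTest s h1 h2, Hs.ofTest_mem_HsTilde h1 h2 h3⟩
          =ᵐ[volume.restrict Ω] φ :=
        (Hs.coeFn_restrict Ω _).trans (ae_restrict_of_ae (Hs.coeFn_ofTest h1 h2))
      filter_upwards [(ae_restrict_iff' hΩ.measurableSet).1 h5] with x hx
      by_cases hxΩ : x ∈ Ω
      · rw [indicator_of_mem hxΩ, indicator_of_mem hxΩ, hx hxΩ]
        simp [mul_comm]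
      · rw [indicator_of_notMem hxΩ, indicator_of_notMem hxΩ, smul_zero]
  apply Lp.ext
  filter_upwards [(ae_restrict_iff' hΩ.measurableSet).2 h0, ae_restrict_mem hΩ.measurableSet,
    Lp.coeFn_zero ℝ 2 (volume.restrict Ω)] with x hx hxΩ h0x
  rw [indicator_of_mem hxΩ] at hx
  rw [hx, h0x, Pi.zero_apply]

end TestFunctions

/-! ### Multiplication by test functions -/

section Multiplication

variable {n : ℕ} {s : ℝ≥0}

local notation "𝔼" => EuclideanSpace ℝ (Fin n)

/-- Cauchy–Schwarz for kg = k^{1/2} · k^{1/2}g. -/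
theorem sq_lintegral_mul_le {α : Type*} [MeasurableSpace α] {μ : Measure α} {k g : α → ℝ≥0∞}
    (hk : Measurable k) (hg : Measurable g) :
    (∫⁻ x, k x * g x ∂μ) ^ 2 ≤ (∫⁻ x, k x ∂μ) * ∫⁻ x, k x * g x ^ 2 ∂μ := by
  have h := ENNReal.lintegral_mul_le_Lp_mul_Lq μ Real.HolderConjugate.two_two
    (f := fun x => k x ^ (2⁻¹ : ℝ)) (g := fun x => k x ^ (2⁻¹ : ℝ) * g x)
    (by fun_prop) (by fun_prop)
  have hsq : ∀ y : ℝ≥0∞, (y ^ (2⁻¹ : ℝ)) * y ^ (2⁻¹ : ℝ) = y := fun y => by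
    rw [← ENNReal.rpow_add_of_nonneg _ _ (by norm_num) (by norm_num)]
    norm_num
  have hsq' : ∀ y : ℝ≥0∞, (y ^ (2⁻¹ : ℝ)) ^ 2 = y := fun y => by rw [sq, hsq]
  have h1 : ∀ x, ((fun x => k x ^ (2⁻¹ : ℝ)) * fun x => k x ^ (2⁻¹ : ℝ) * g x) x = k x * g x :=
    fun x => by rw [Pi.mul_apply, ← mul_assoc, hsq]
  simp only [h1, ENNReal.rpow_two, mul_pow, hsq', one_div] at h
  calc (∫⁻ x, k x * g x ∂μ) ^ 2
      ≤ ((∫⁻ x, k x ∂μ) ^ (2⁻¹ : ℝ) * (∫⁻ x, k x * g x ^ 2 ∂μ) ^ (2⁻¹ : ℝ)) ^ 2 :=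
        pow_le_pow_left₀ zero_le h 2
    _ = _ := by rw [mul_pow, hsq', hsq']

/-- Young's inequality for L¹ and L², from weighted Cauchy–Schwarz, Tonelli and translation
invariance. -/
theorem lintegral_sq_correlation_le {k g : 𝔼 → ℝ≥0∞} (hk : Measurable k) (hg : Measurable g) :
    ∫⁻ ξ, (∫⁻ η, k (η - ξ) * g η) ^ 2 ≤ (∫⁻ ξ, k ξ) ^ 2 * ∫⁻ η, g η ^ 2 := by
  calc ∫⁻ ξ, (∫⁻ η, k (η - ξ) * g η) ^ 2
      ≤ ∫⁻ ξ, (∫⁻ η, k η) * ∫⁻ η, k (η - ξ) * g η ^ 2 := by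
        refine lintegral_mono fun ξ => ?_
        refine (sq_lintegral_mul_le (by fun_prop) hg).trans_eq ?_
        rw [lintegral_sub_right_eq_self]
    _ = (∫⁻ η, k η) * ∫⁻ ξ, ∫⁻ η, k (η - ξ) * g η ^ 2 :=
        lintegral_const_mul _ (Measurable.lintegral_prod_right' (f := fun p : 𝔼 × 𝔼 =>
          k (p.2 - p.1) * g p.2 ^ 2) (by fun_prop))
    _ = (∫⁻ η, k η) * ∫⁻ η, ∫⁻ ξ, k (η - ξ) * g η ^ 2 := by
        rw [lintegral_lintegral_swap]
        exact Measurable.aemeasurable (by fun_prop)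
    _ = (∫⁻ η, k η) * ∫⁻ η, (∫⁻ ξ, k ξ) * g η ^ 2 := by
        congr 1
        refine lintegral_congr fun η => ?_
        rw [lintegral_mul_const _ (by fun_prop), lintegral_sub_left_eq_self]
    _ = _ := by
        rw [lintegral_const_mul _ (by fun_prop), ← mul_assoc, sq]

/-- Peetre's inequality, from the triangle inequality for ξ = η − (η − ξ). -/
theorem besselSymbol_le_mul (ξ η : 𝔼) :
    besselSymbol n s ξ ≤ 2 ^ ((s : ℝ) / 2) * (besselSymbol n s (η - ξ) * besselSymbol n s η) := by
  unfold besselSymbol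
  rw [← Real.mul_rpow (by positivity) (by positivity), ← Real.mul_rpow (by positivity)
    (by positivity)]
  refine Real.rpow_le_rpow (by positivity) ?_ (by positivity)
  have h : 2 * Real.pi * ‖ξ‖ ≤ 2 * Real.pi * ‖η - ξ‖ + 2 * Real.pi * ‖η‖ := by
    rw [← mul_add]
    gcongr
    calc ‖ξ‖ = ‖η - (η - ξ)‖ := by rw [sub_sub_cancel]
      _ ≤ ‖η‖ + ‖η - ξ‖ := norm_sub_le _ _
      _ = _ := add_comm _ _
  set a := 2 * Real.pi * ‖η - ξ‖
  set b := 2 * Real.pi * ‖η‖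
  have h0 : 0 ≤ 2 * Real.pi * ‖ξ‖ := by positivity
  have h1 := pow_le_pow_left₀ h0 h 2
  nlinarith [sq_nonneg (a - b), sq_nonneg (a * b)]

/-- The transform of χu at ξ is the L² product of the modulated function e^{2πix·ξ}χ with u.
Plancherel turns it into a correlation of the transforms. -/
theorem norm_fourier_test_mul_le {χ : 𝔼 → ℝ} (hχ : ContDiff ℝ ∞ χ) (hc : HasCompactSupport χ)
    (u : L2R n) (ξ : 𝔼) :
    ‖𝓕 (fun x => ((χ x * u x : ℝ) : ℂ)) ξ‖ ≤
      ∫ η, ‖𝓕 (schwartzOfTest hχ hc : 𝔼 → ℂ) (η - ξ)‖ * ‖fourierR n u η‖ := by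
  set X := schwartzOfTest hχ hc
  have hmeas : MemLp (fun x : 𝔼 => (𝐞 (inner ℝ x ξ) : ℂ) * X x) 2 volume := by
    refine (X.memLp 2 volume).mono ?_ ?_
    · exact (Continuous.mul (by fun_prop) X.continuous).aestronglyMeasurable
    · filter_upwards with x
      rw [norm_mul, Circle.norm_coe, one_mul]
  have hint : Integrable (fun x : 𝔼 => (𝐞 (inner ℝ x ξ) : ℂ) * X x) := by
    refine X.integrable.mono ?_ ?_
    · exact (Continuous.mul (by fun_prop) X.continuous).aestronglyMeasurable
    · filter_upwards with x
      rw [norm_mul, Circle.norm_coe, one_mul]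
  let G : L2C n := hmeas.toLp _
  have hG : (G : 𝔼 → ℂ) =ᵐ[volume] fun x => (𝐞 (inner ℝ x ξ) : ℂ) * X x := hmeas.coeFn_toLp
  have h1 : 𝓕 (fun x => ((χ x * u x : ℝ) : ℂ)) ξ = inner ℂ G (complexify n u) := by
    rw [L2.inner_def, Real.fourier_eq]
    refine integral_congr_ae ?_
    filter_upwards [hG, coeFn_complexify u] with x hx hu
    rw [hx, hu, RCLike.inner_apply, map_mul, Circle.smul_def, AddChar.map_neg_eq_inv,
      Circle.coe_inv_eq_conj]
    simp [X]
    ring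
  have h2 : 𝓕 (G : 𝔼 → ℂ) = fun η => 𝓕 (X : 𝔼 → ℂ) (η - ξ) := by
    ext η
    rw [Real.fourier_eq, Real.fourier_eq]
    refine integral_congr_ae ?_
    filter_upwards [hG] with x hx
    rw [hx, Circle.smul_def, Circle.smul_def, smul_eq_mul, smul_eq_mul, ← mul_assoc,
      ← Circle.coe_mul, ← AddChar.map_add_eq_mul]
    congr 3
    rw [inner_sub_right]
    ring
  rw [h1, ← (fourierC n).inner_map_map, ← fourierR_eq, L2.inner_def]
  refine (norm_integral_le_integral_norm _).trans_eq (integral_congr_ae ?_)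
  filter_upwards [fourierC_ae_eq G (hint.congr hG.symm)] with η hη
  rw [hη, h2, RCLike.inner_apply, norm_mul, RCLike.norm_conj, mul_comm]

theorem integrable_test_mul {χ : 𝔼 → ℝ} (hχ : ContDiff ℝ ∞ χ) (hc : HasCompactSupport χ)
    (u : L2R n) : Integrable fun x => χ x * u x :=
  (memLp_test hχ hc 2).integrable_mul (Lp.memLp u)

theorem memLp_test_mul {χ : 𝔼 → ℝ} (hχ : ContDiff ℝ ∞ χ) (hc : HasCompactSupport χ)
    (u : L2R n) : MemLp (fun x => χ x * u x) 2 volume := by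
  obtain ⟨C, hC⟩ := hχ.continuous.bounded_above_of_compact_support hc
  refine ((Lp.memLp u).const_mul C).mono
    (hχ.continuous.aestronglyMeasurable.mul (Lp.aestronglyMeasurable u)) ?_
  filter_upwards with x
  rw [norm_mul, norm_mul]
  exact mul_le_mul_of_nonneg_right ((hC x).trans (le_abs_self C)) (norm_nonneg _)

/-- Peetre's inequality distributes the weight over both factors of the correlation. The weighted
transform of χ is integrable and that of u is in L², so Young's inequality applies. -/
theorem memLp_besselSymbol_test_mul {χ : 𝔼 → ℝ} (hχ : ContDiff ℝ ∞ χ) (hc : HasCompactSupport χ)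
    (u : Hs n s) :
    MemLp (fun ξ => besselSymbol n s ξ •
      fourierR n ((memLp_test_mul hχ hc (Hs.toL2 n s u)).toLp _) ξ) 2 volume := by
  set w := (memLp_test_mul hχ hc (Hs.toL2 n s u)).toLp _
  set X := schwartzOfTest hχ hc
  have hw : fourierR n w =ᵐ[volume] 𝓕 (fun x => ((χ x * Hs.toL2 n s u x : ℝ) : ℂ)) := by
    refine fourierR_ae_eq (integrable_test_mul hχ hc _).ofReal ?_
    filter_upwards [(memLp_test_mul hχ hc (Hs.toL2 n s u)).coeFn_toLp] with x hx
    rw [hx]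
  let k : 𝔼 → ℝ≥0∞ := fun ξ => ‖besselSymbol n s ξ • 𝓕 X ξ‖ₑ
  let g : 𝔼 → ℝ≥0∞ := fun ξ => ‖besselSymbol n s ξ • u.hat ξ‖ₑ
  have hk : Measurable k :=
    ((continuous_besselSymbol n s).smul (𝓕 X).continuous).measurable.enorm
  have hg : Measurable g :=
    ((continuous_besselSymbol n s).measurable.smul (Lp.stronglyMeasurable u.hat).measurable).enorm
  have hki : ∫⁻ ξ, k ξ ≠ (∞ : ℝ≥0∞) := by
    have := memLp_besselSymbol_smul_schwartz (s := s) 1 (𝓕 X)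
    exact (memLp_one_iff_integrable.1 this).2.ne
  have hgi : ∫⁻ ξ, g ξ ^ 2 ≠ (∞ : ℝ≥0∞) := by
    have h := (show MemLp (fun ξ => besselSymbol n s ξ • u.hat ξ) 2 volume from u.2).2
    rw [eLpNorm_lt_top_iff_lintegral_rpow_enorm_lt_top (by norm_num) (by norm_num)] at h
    simpa only [ENNReal.toReal_ofNat, ENNReal.rpow_two] using h.ne
  refine ⟨(continuous_besselSymbol n s).aestronglyMeasurable.smul (Lp.aestronglyMeasurable _), ?_⟩
  rw [eLpNorm_lt_top_iff_lintegral_rpow_enorm_lt_top (by norm_num) (by norm_num)]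
  have hbound : ∀ᵐ ξ, ‖besselSymbol n s ξ • fourierR n w ξ‖ₑ ^ (2 : ℝ≥0∞).toReal ≤
      ENNReal.ofReal (2 ^ ((s : ℝ) / 2)) ^ 2 * (∫⁻ η, k (η - ξ) * g η) ^ 2 := by
    filter_upwards [hw] with ξ hξ
    rw [hξ, ENNReal.toReal_ofNat, ENNReal.rpow_two, ← mul_pow]
    refine pow_le_pow_left₀ zero_le ?_ 2
    have h1 := norm_fourier_test_mul_le hχ hc (Hs.toL2 n s u) ξ
    have hb := abs_besselSymbol_le n s ξ
    calc ‖besselSymbol n s ξ • 𝓕 (fun x => ((χ x * Hs.toL2 n s u x : ℝ) : ℂ)) ξ‖ₑ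
        = ENNReal.ofReal (‖besselSymbol n s ξ • 𝓕 (fun x => ((χ x * Hs.toL2 n s u x : ℝ) : ℂ)) ξ‖) :=
          (ofReal_norm _).symm
      _ ≤ ENNReal.ofReal (besselSymbol n s ξ * ∫ η, ‖𝓕 (X : 𝔼 → ℂ) (η - ξ)‖ * ‖u.hat η‖) := by
          refine ENNReal.ofReal_le_ofReal ?_
          rw [norm_smul, Real.norm_eq_abs]
          exact mul_le_mul hb h1 (norm_nonneg _) ((abs_nonneg _).trans hb)
      _ = ENNReal.ofReal (besselSymbol n s ξ) *
            ENNReal.ofReal (∫ η, ‖𝓕 (X : 𝔼 → ℂ) (η - ξ)‖ * ‖u.hat η‖) :=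
          ENNReal.ofReal_mul ((abs_nonneg _).trans hb)
      _ ≤ ENNReal.ofReal (besselSymbol n s ξ) *
            ∫⁻ η, ENNReal.ofReal (‖𝓕 (X : 𝔼 → ℂ) (η - ξ)‖ * ‖u.hat η‖) := by
          gcongr
          rw [← Real.enorm_of_nonneg (integral_nonneg fun η => by positivity)]
          refine (enorm_integral_le_lintegral_enorm _).trans_eq (lintegral_congr fun η => ?_)
          rw [Real.enorm_of_nonneg (by positivity)]
      _ = ∫⁻ η, ENNReal.ofReal (besselSymbol n s ξ) *
            ENNReal.ofReal (‖𝓕 (X : 𝔼 → ℂ) (η - ξ)‖ * ‖u.hat η‖) :=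
          (lintegral_const_mul' _ _ ENNReal.ofReal_ne_top).symm
      _ ≤ ∫⁻ η, ENNReal.ofReal (2 ^ ((s : ℝ) / 2)) * (k (η - ξ) * g η) := by
          refine lintegral_mono fun η => ?_
          have hb' : ∀ ζ : 𝔼, ‖besselSymbol n s ζ‖ = besselSymbol n s ζ := fun ζ =>
            abs_of_nonneg ((abs_nonneg _).trans (abs_besselSymbol_le n s ζ))
          simp only [k, g]
          rw [← ofReal_norm, ← ofReal_norm, ← ENNReal.ofReal_mul ((abs_nonneg _).trans hb),
            ← ENNReal.ofReal_mul (norm_nonneg _), ← ENNReal.ofReal_mul (by positivity), norm_smul,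
            norm_smul, hb', hb']
          refine ENNReal.ofReal_le_ofReal ?_
          have h2 := mul_le_mul_of_nonneg_right (besselSymbol_le_mul (s := s) ξ η)
            (show 0 ≤ ‖𝓕 (X : 𝔼 → ℂ) (η - ξ)‖ * ‖u.hat η‖ by positivity)
          refine h2.trans_eq ?_
          rw [SchwartzMap.fourier_coe]
          ring
      _ = _ := lintegral_const_mul' _ _ ENNReal.ofReal_ne_top
  refine (lintegral_mono_ae hbound).trans_lt ?_
  rw [lintegral_const_mul' _ _ (by simp)]
  refine ENNReal.mul_lt_top (by simp) ((lintegral_sq_correlation_le hk hg).trans_lt ?_)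
  exact ENNReal.mul_lt_top (ENNReal.pow_lt_top hki.lt_top) hgi.lt_top

/-- The product of an element of `Hˢ(ℝⁿ)` with a test function. -/
def Hs.testMul {χ : 𝔼 → ℝ} (hχ : ContDiff ℝ ∞ χ) (hc : HasCompactSupport χ) (u : Hs n s) : Hs n s :=
  Hs.ofL2 _ (memLp_besselSymbol_test_mul hχ hc u)

theorem Hs.coeFn_testMul {χ : 𝔼 → ℝ} (hχ : ContDiff ℝ ∞ χ) (hc : HasCompactSupport χ)
    (u : Hs n s) :
    Hs.toL2 n s (Hs.testMul hχ hc u) =ᵐ[volume] fun x => χ x * Hs.toL2 n s u x :=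
  (memLp_test_mul hχ hc (Hs.toL2 n s u)).coeFn_toLp

end Multiplication

/-! ### Mollification -/

section Mollification

variable {n : ℕ} {s : ℝ≥0}

local notation "𝔼" => EuclideanSpace ℝ (Fin n)

/-- The rescaled kernel `h⁻ⁿ ρ(x/h)`. -/
def scaled (ρ : 𝔼 → ℝ) (h : ℝ) (x : 𝔼) : ℝ := (h ^ n)⁻¹ * ρ (h⁻¹ • x)

theorem contDiff_scaled {ρ : 𝔼 → ℝ} (hρ : ContDiff ℝ ∞ ρ) (h : ℝ) : ContDiff ℝ ∞ (scaled ρ h) :=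
  contDiff_const.mul (hρ.comp (contDiff_const_smul _))

theorem tsupport_scaled_subset {ρ : 𝔼 → ℝ} (hc : HasCompactSupport ρ) {h : ℝ} (hh : 0 < h) :
    tsupport (scaled ρ h) ⊆ (fun x => h • x) '' tsupport ρ := by
  refine closure_minimal (fun x hx => ⟨h⁻¹ • x, subset_tsupport _ fun h0 => hx ?_, ?_⟩)
    (hc.isCompact.image (continuous_const_smul h)).isClosed
  · simp [scaled, h0]
  · simp only
    rw [smul_inv_smul₀ hh.ne']

theorem hasCompactSupport_scaled {ρ : 𝔼 → ℝ} (hc : HasCompactSupport ρ) {h : ℝ} (hh : 0 < h) :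
    HasCompactSupport (scaled ρ h) :=
  (hc.isCompact.image (continuous_const_smul h)).of_isClosed_subset (isClosed_tsupport _)
    (tsupport_scaled_subset hc hh)

theorem fourier_scaled (ρ : 𝔼 → ℝ) {h : ℝ} (hh : 0 < h) (ξ : 𝔼) :
    𝓕 (fun x => ((scaled ρ h x : ℝ) : ℂ)) ξ = 𝓕 (fun x => ((ρ x : ℝ) : ℂ)) (h • ξ) := by
  have hn : (h ^ n : ℝ) ≠ 0 := (pow_pos hh n).ne'
  rw [Real.fourier_eq, Real.fourier_eq]
  have h1 := Measure.integral_comp_inv_smul_of_nonneg (volume : Measure 𝔼)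
    (fun x => 𝐞 (-inner ℝ x (h • ξ)) • ((ρ x : ℝ) : ℂ)) hh.le
  rw [finrank_euclideanSpace_fin] at h1
  calc ∫ x, 𝐞 (-inner ℝ x ξ) • ((scaled ρ h x : ℝ) : ℂ)
      = ∫ x : 𝔼, (h ^ n)⁻¹ • (𝐞 (-inner ℝ (h⁻¹ • x) (h • ξ)) • ((ρ (h⁻¹ • x) : ℝ) : ℂ)) := by
        congr 1
        ext x
        rw [inner_smul_left, inner_smul_right, ← mul_assoc]
        simp only [scaled, Complex.ofReal_mul, Circle.smul_def, smul_eq_mul, Complex.real_smul,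
          conj_trivial, inv_mul_cancel₀ hh.ne', one_mul]
        ring
    _ = _ := by rw [integral_smul, h1, smul_smul, inv_mul_cancel₀ hn, one_smul]

open scoped Pointwise in
-- The mollifications of w with the rescaled kernels are smooth and supported in K + h supp ρ ⊆ Ω.
-- On the Fourier side mollification multiplies by ρ̂(hξ), which is bounded and tends to ρ̂(0) = 1,
-- so they converge in Hˢ by dominated convergence. The kernel need not be centred at 0, and its
-- displacement is what moves the support inwards.
theorem mem_HsTilde_of_kernel {Ω K : Set 𝔼} (hK : IsCompact K) (w : Hs n s)
    (hw : ∀ᵐ x, x ∉ K → Hs.toL2 n s w x = 0) {ρ : 𝔼 → ℝ} (hρ : ContDiff ℝ ∞ ρ)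
    (hc : HasCompactSupport ρ) (h1 : ∫ x, ρ x = 1)
    (hsub : ∀ᶠ h : ℝ in 𝓝[>] 0, ∀ x ∈ K, ∀ z ∈ tsupport ρ, x + h • z ∈ Ω) :
    w ∈ HsTilde s Ω := by
  let w₀ : 𝔼 → ℝ := K.indicator (Hs.toL2 n s w)
  have hw₀ : Hs.toL2 n s w =ᵐ[volume] w₀ := by
    filter_upwards [hw] with x hx
    by_cases hxK : x ∈ K
    · simp only [w₀, indicator_of_mem hxK]
    · simp only [w₀, indicator_of_notMem hxK, hx hxK]
  have hw₀s : Function.support w₀ ⊆ K := support_indicator_subset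
  have hw₀c : HasCompactSupport w₀ := hK.of_isClosed_subset isClosed_closure
    (closure_minimal hw₀s hK.isClosed)
  have hw₀i : Integrable w₀ := by
    rw [integrable_indicator_iff hK.measurableSet]
    have : IsFiniteMeasure (volume.restrict K) :=
      ⟨by rw [Measure.restrict_apply_univ]; exact hK.measure_lt_top⟩
    exact ((Lp.memLp (Hs.toL2 n s w)).restrict K).integrable (by norm_num)
  have hhatw : w.hat =ᵐ[volume] 𝓕 (fun x => ((w₀ x : ℝ) : ℂ)) := by
    refine fourierR_ae_eq hw₀i.ofReal ?_
    filter_upwards [hw₀] with x hx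
    rw [hx]
  set R : 𝔼 → ℂ := 𝓕 (fun x => ((ρ x : ℝ) : ℂ)) with hR
  have hρi : Integrable fun x => ((ρ x : ℝ) : ℂ) :=
    (hρ.continuous.integrable_of_hasCompactSupport hc).ofReal
  have hRc : Continuous R := continuous_fourier hρi
  have hR0 : R 0 = 1 := by
    rw [hR, Real.fourier_eq]
    simp only [inner_zero_right, neg_zero, AddChar.map_zero_eq_one, one_smul]
    rw [integral_complex_ofReal, h1, Complex.ofReal_one]
  have hRb : ∀ ξ, ‖R ξ - 1‖ ≤ (∫ x, ‖((ρ x : ℝ) : ℂ)‖) + 1 := fun ξ =>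
    (norm_sub_le _ _).trans (by rw [norm_one]; gcongr; exact norm_fourier_le _ _)
  -- This integral is the squared Hˢ distance between w and its mollification at scale h.
  have hlim : Filter.Tendsto (fun h : ℝ => ∫ ξ, ‖R (h • ξ) - 1‖ ^ 2 *
      (besselSymbol n s ξ ^ 2 * ‖w.hat ξ‖ ^ 2)) (𝓝[>] 0) (𝓝 0) := by
    have hint := integrable_symbol (continuous_besselSymbol n s) (abs_besselSymbol_le n s) w
    rw [← integral_zero 𝔼 ℝ]
    refine tendsto_integral_filter_of_dominated_convergence
      (fun ξ => ((∫ x, ‖((ρ x : ℝ) : ℂ)‖) + 1) ^ 2 * (besselSymbol n s ξ ^ 2 * ‖w.hat ξ‖ ^ 2))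
      (Filter.Eventually.of_forall fun h => ?_) (Filter.Eventually.of_forall fun h => ?_)
      (hint.const_mul _) ?_
    · exact (Continuous.aestronglyMeasurable (by fun_prop)).mul hint.aestronglyMeasurable
    · filter_upwards with ξ
      rw [Real.norm_of_nonneg (by positivity)]
      refine mul_le_mul_of_nonneg_right ?_ (by positivity)
      exact pow_le_pow_left₀ (norm_nonneg _) (hRb _) 2
    · filter_upwards with ξ
      have hcont : Continuous fun h : ℝ => ‖R (h • ξ) - 1‖ ^ 2 *
          (besselSymbol n s ξ ^ 2 * ‖w.hat ξ‖ ^ 2) := by fun_prop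
      have := (hcont.tendsto 0).mono_left (nhdsWithin_le_nhds (s := Ioi 0))
      simpa [hR0] using this
  refine Metric.mem_closure_iff.2 fun ε hε => ?_
  obtain ⟨h, ⟨hsubh, hlt⟩, hpos⟩ := ((hsub.and (hlim.eventually
    (gt_mem_nhds (show 0 < ε ^ 2 by positivity)))).and self_mem_nhdsWithin).exists
  replace hpos : 0 < h := hpos
  let c : 𝔼 → ℝ := convolution (scaled ρ h) w₀ (ContinuousLinearMap.mul ℝ ℝ) volume
  have hcc : HasCompactSupport c := (hasCompactSupport_scaled hc hpos).convolution _ hw₀c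
  have hcd : ContDiff ℝ ∞ c := (hasCompactSupport_scaled hc hpos).contDiff_convolution_left _
    (contDiff_scaled hρ h) hw₀i.locallyIntegrable
  have hcs : tsupport c ⊆ Ω := by
    have hcomp : IsCompact (tsupport (scaled ρ h) + K) :=
      IsCompact.add (hasCompactSupport_scaled hc hpos) hK
    refine (closure_minimal ((support_convolution_subset _).trans
      (add_subset_add (subset_tsupport _) hw₀s)) hcomp.isClosed).trans ?_
    rintro _ ⟨y, hy, x, hx, rfl⟩
    obtain ⟨z, hz, rfl⟩ := tsupport_scaled_subset hc hpos hy
    have := hsubh x hx z hz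
    simp only
    rwa [add_comm]
  refine ⟨Hs.ofTest s hcd hcc, ⟨c, hcd, hcc, hcs, Hs.coeFn_ofTest hcd hcc⟩, ?_⟩
  rw [dist_comm, dist_eq_norm]
  refine lt_of_pow_lt_pow_left₀ 2 hε.le (lt_of_le_of_lt (le_of_eq ?_) hlt)
  rw [Hs.norm_sq_eq]
  refine integral_congr_ae ?_
  have hhatc : (Hs.ofTest s hcd hcc).hat =ᵐ[volume] fun ξ => R (h • ξ) *
      𝓕 (fun x => ((w₀ x : ℝ) : ℂ)) ξ := by
    refine (fourierR_test hcd hcc).trans (Filter.Eventually.of_forall fun ξ => ?_)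
    have hcast : (schwartzOfTest hcd hcc : 𝔼 → ℂ) =
        convolution (fun x => ((scaled ρ h x : ℝ) : ℂ)) (fun x => ((w₀ x : ℝ) : ℂ))
          (ContinuousLinearMap.mul ℂ ℂ) volume := by
      ext x
      simp only [schwartzOfTest_apply, c, convolution, ContinuousLinearMap.mul_apply']
      rw [← integral_complex_ofReal]
      simp only [Complex.ofReal_mul]
    have hsi : Integrable fun x => ((scaled ρ h x : ℝ) : ℂ) :=
      ((contDiff_scaled hρ h).continuous.integrable_of_hasCompactSupport
        (hasCompactSupport_scaled hc hpos)).ofReal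
    simp only
    rw [hcast]
    refine (Real.fourier_bilin_convolution_eq (ContinuousLinearMap.mul ℂ ℂ) hsi hw₀i.ofReal ξ).trans ?_
    rw [fourier_scaled ρ hpos, ContinuousLinearMap.mul_apply']
    rfl
  have hsub' : (Hs.ofTest s hcd hcc - w).hat = (Hs.ofTest s hcd hcc).hat - w.hat := by
    simp only [Hs.hat, map_sub]
  filter_upwards [hhatc, hhatw, Lp.coeFn_sub (Hs.ofTest s hcd hcc).hat w.hat] with ξ e1 e2 e3
  rw [hsub', e3, Pi.sub_apply, e1, ← e2]
  have : R (h • ξ) * w.hat ξ - w.hat ξ = (R (h • ξ) - 1) * w.hat ξ := by ring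
  rw [this, norm_mul]
  ring

end Mollification

/-! ### Elements of `Hˢ(ℝⁿ)` that vanish in the exterior -/

section Exterior

variable {n : ℕ} {s : ℝ≥0} {Ω : Set (EuclideanSpace ℝ (Fin n))}

local notation "𝔼" => EuclideanSpace ℝ (Fin n)

theorem exists_kernel (z₀ : 𝔼) {κ : ℝ} (hκ : 0 < κ) :
    ∃ ρ : 𝔼 → ℝ, ContDiff ℝ ∞ ρ ∧ HasCompactSupport ρ ∧ ∫ x, ρ x = 1 ∧
      tsupport ρ ⊆ Metric.closedBall z₀ κ := by
  let b : ContDiffBump z₀ := ⟨κ / 2, κ, by positivity, by linarith⟩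
  refine ⟨b.normed volume, b.contDiff_normed, b.hasCompactSupport_normed, b.integral_normed, ?_⟩
  rw [b.tsupport_normed_eq]

/-- Near each point of the closure of a Lipschitz domain there is a cone of directions that lead
into the domain. -/
theorem IsBoundedLipschitzDomain.exists_cone (hΩ : IsBoundedLipschitzDomain Ω) {x₀ : 𝔼}
    (hx₀ : x₀ ∈ closure Ω) :
    ∃ δ > 0, ∃ (z₀ : 𝔼) (κ : ℝ), 0 < κ ∧ ∀ᶠ h : ℝ in 𝓝[>] 0,
      ∀ x ∈ closure Ω ∩ Metric.closedBall x₀ δ, ∀ z ∈ Metric.closedBall z₀ κ, x + h • z ∈ Ω := by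
  -- Small displacements do not leave the ball on which the boundary chart is valid.
  have hsmall : ∀ (z₀ : 𝔼) (κ δ : ℝ), 0 < δ → ∀ᶠ h : ℝ in 𝓝[>] 0,
      ∀ x ∈ Metric.closedBall x₀ δ, ∀ z ∈ Metric.closedBall z₀ κ,
        x + h • z ∈ Metric.ball x₀ (2 * δ) := by
    intro z₀ κ δ hδ
    have hlim : Filter.Tendsto (fun h : ℝ => h * (‖z₀‖ + κ)) (𝓝[>] 0) (𝓝 0) := by
      have hcont : Continuous fun h : ℝ => h * (‖z₀‖ + κ) := by fun_prop
      simpa using (hcont.tendsto 0).mono_left (nhdsWithin_le_nhds (s := Ioi 0))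
    filter_upwards [hlim.eventually (gt_mem_nhds hδ), self_mem_nhdsWithin] with h hh hpos x hx z hz
    rw [mem_closedBall_iff_norm] at hx hz
    rw [mem_ball_iff_norm]
    have hz' : ‖z‖ ≤ ‖z₀‖ + κ := by
      calc ‖z‖ = ‖z₀ + (z - z₀)‖ := by rw [add_sub_cancel]
        _ ≤ ‖z₀‖ + ‖z - z₀‖ := norm_add_le _ _
        _ ≤ _ := by gcongr
    calc ‖x + h • z - x₀‖ = ‖(x - x₀) + h • z‖ := by congr 1; abel
      _ ≤ ‖x - x₀‖ + h * ‖z‖ := by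
          refine (norm_add_le _ _).trans ?_
          rw [norm_smul, Real.norm_of_nonneg (le_of_lt hpos)]
      _ ≤ δ + h * (‖z₀‖ + κ) := by
          have : (0 : ℝ) < h := hpos
          gcongr
      _ < 2 * δ := by linarith
  by_cases hmem : x₀ ∈ Ω
  · obtain ⟨δ, hδ, hball⟩ := Metric.isOpen_iff.1 hΩ.isOpen x₀ hmem
    refine ⟨δ / 2, by positivity, 0, 1, one_pos, ?_⟩
    filter_upwards [hsmall 0 1 (δ / 2) (by positivity)] with h hh x hx z hz
    refine hball ?_
    have := hh x hx.2 z hz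
    rwa [mul_div_cancel₀ δ two_ne_zero] at this
  · have hfr : x₀ ∈ frontier Ω := by
      rw [frontier, hΩ.isOpen.interior_eq]
      exact ⟨hx₀, hmem⟩
    obtain ⟨ν, U, L, γ, hν, hU, hxU, hγ, hΩU⟩ := hΩ.lipschitz_boundary x₀ hfr
    obtain ⟨δ, hδ, hball⟩ := Metric.isOpen_iff.1 hU x₀ hxU
    let P := (ℝ ∙ ν)ᗮ.orthogonalProjectionOnto
    have hPν : P ν = 0 :=
      Submodule.orthogonalProjectionOnto_orthogonal_apply_eq_zero (Submodule.mem_span_singleton_self ν)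
    have hPle : ∀ y, ‖P y‖ ≤ ‖y‖ := fun y =>
      (P.le_of_opNorm_le (Submodule.orthogonalProjectionOnto_norm_le _) y).trans_eq (one_mul _)
    have hκ : (0 : ℝ) < 1 / (L + 2) := by positivity
    -- With κ = 1/(L+2), a step hz lowers the height by at least h(1−κ) and changes the graph by at
    -- most Lhκ. The net effect −1 + κ + Lκ = −κ is strictly negative.
    refine ⟨δ / 2, by positivity, -ν, 1 / (L + 2), hκ, ?_⟩
    filter_upwards [hsmall (-ν) (1 / (L + 2)) (δ / 2) (by positivity), self_mem_nhdsWithin]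
      with h hh hpos x hx z hz
    have hmemU : x + h • z ∈ U := hball (by
      have := hh x hx.2 z hz
      rwa [mul_div_cancel₀ δ two_ne_zero] at this)
    have hpos' : (0 : ℝ) < h := hpos
    have hxU' : x ∈ U := hball (Metric.closedBall_subset_ball (by linarith) hx.2)
    -- Points of the closure satisfy only the non-strict inequality; the step along the cone makes
    -- it strict.
    have hle : inner ℝ x ν ≤ γ (P x) := by
      have hcl : x ∈ closure (Ω ∩ U) := by
        rw [inter_comm]
        exact hU.inter_closure ⟨hxU', hx.1⟩
      have hclosed : IsClosed {y : 𝔼 | inner ℝ y ν ≤ γ (P y)} :=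
        isClosed_le (by fun_prop) (hγ.continuous.comp P.continuous)
      refine (closure_minimal ?_ hclosed) hcl
      rw [hΩU]
      exact fun y hy => hy.2.le
    have hzν : ‖z + ν‖ ≤ 1 / (L + 2) := by
      rw [mem_closedBall_iff_norm, sub_neg_eq_add] at hz
      exact hz
    have h1 : inner ℝ z ν ≤ -1 + 1 / (L + 2) := by
      have e : inner ℝ z ν = inner ℝ (z + ν) ν - 1 := by
        rw [inner_add_left, real_inner_self_eq_norm_sq, hν]
        ring
      have := real_inner_le_norm (z + ν) ν
      rw [hν, mul_one] at this
      linarith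
    have h2 : ‖P z‖ ≤ 1 / (L + 2) := by
      have e : P z = P (z + ν) := by rw [map_add, hPν, add_zero]
      rw [e]
      exact (hPle _).trans hzν
    have h3 : γ (P x) - L * (h * (1 / (L + 2))) ≤ γ (P (x + h • z)) := by
      have := hγ.dist_le_mul (P x) (P (x + h • z))
      rw [Real.dist_eq, dist_eq_norm, map_add, map_smul, sub_add_cancel_left, norm_neg, norm_smul,
        Real.norm_of_nonneg hpos'.le] at this
      have h4 := (abs_le.1 this).2
      have h5 : (L : ℝ) * (h * ‖P z‖) ≤ L * (h * (1 / (L + 2))) := by gcongr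
      rw [map_add, map_smul]
      linarith
    have hin : x + h • z ∈ Ω ∩ U := by
      rw [hΩU]
      refine ⟨hmemU, ?_⟩
      rw [inner_add_left, inner_smul_left, conj_trivial]
      have h6 : h * inner ℝ z ν ≤ h * (-1 + 1 / (L + 2)) := by gcongr
      have h7 : h * (-1 + 1 / (L + 2)) + L * (h * (1 / (L + 2))) < 0 := by
        have : (L : ℝ) + 2 ≠ 0 := by positivity
        have e : h * (-1 + 1 / (L + 2)) + L * (h * (1 / (L + 2))) = -(h * (1 / (L + 2))) := by
          field_simp
          ring
        rw [e]
        exact neg_lt_zero.2 (by positivity)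
      change inner ℝ x ν + h * inner ℝ z ν < γ (P (x + h • z))
      linarith
    exact hin.1

/-- A smooth partition of unity on the compact closure of Ω writes u as a sum of pieces, each
supported in the closure near one point. There a cone of inward directions exists, and a mollifier
supported in it approximates the piece by test functions in Ω. -/
theorem mem_HsTilde_of_ae_eq_zero (hΩ : IsBoundedLipschitzDomain Ω) (u : Hs n s)
    (hu : ∀ᵐ x, x ∈ exterior Ω → Hs.toL2 n s u x = 0) : u ∈ HsTilde s Ω := by
  have hcomp : IsCompact (closure Ω) := hΩ.isBounded.isCompact_closure
  choose! δ hδ z₀ κ hκ hcone using fun (x : 𝔼) (hx : x ∈ closure Ω) => hΩ.exists_cone hx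
  obtain ⟨t, ht, hcov⟩ := hcomp.elim_nhds_subcover (fun x => Metric.ball x (δ x))
    fun x hx => Metric.ball_mem_nhds x (hδ x hx)
  obtain ⟨f, hf⟩ := SmoothPartitionOfUnity.exists_isSubordinate (modelWithCornersSelf ℝ 𝔼)
    (isClosed_closure (s := Ω)) (fun x : t => Metric.ball (x : 𝔼) (δ x))
    (fun x => Metric.isOpen_ball) (by
      intro y hy
      obtain ⟨x, hx, hyx⟩ := mem_iUnion₂.1 (hcov hy)
      exact mem_iUnion.2 ⟨⟨x, hx⟩, hyx⟩)
  have hfd : ∀ i, ContDiff ℝ ∞ (f i) := fun i => (f i).contMDiff.contDiff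
  have hfs : ∀ i, tsupport (f i) ⊆ Metric.closedBall (i : 𝔼) (δ i) := fun i =>
    (hf i).trans Metric.ball_subset_closedBall
  have hfc : ∀ i, HasCompactSupport (f i) := fun i =>
    (isCompact_closedBall (i : 𝔼) (δ i)).of_isClosed_subset (isClosed_tsupport _) (hfs i)
  have hsum : u = ∑ i, Hs.testMul (hfd i) (hfc i) u := by
    apply Hs.toL2_injective
    rw [map_sum]
    apply Lp.ext
    have h1 : ∀ᵐ x, ∀ i, Hs.toL2 n s (Hs.testMul (hfd i) (hfc i) u) x = f i x * Hs.toL2 n s u x :=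
      ae_all_iff.2 fun i => Hs.coeFn_testMul (hfd i) (hfc i) u
    filter_upwards [hu, h1, Lp.coeFn_finsetSum Finset.univ fun i =>
      Hs.toL2 n s (Hs.testMul (hfd i) (hfc i) u)] with x hx h2 h3
    rw [h3, Finset.sum_apply, Finset.sum_congr rfl fun i _ => h2 i, ← Finset.sum_mul]
    by_cases hxΩ : x ∈ closure Ω
    · have := f.sum_eq_one hxΩ
      rw [finsum_eq_sum_of_fintype] at this
      rw [this, one_mul]
    · rw [hx hxΩ, mul_zero]
  rw [hsum]
  refine Submodule.sum_mem _ fun i _ => ?_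
  have hi : (i : 𝔼) ∈ closure Ω := ht i i.2
  obtain ⟨ρ, hρ, hc, h1, hs⟩ := exists_kernel (z₀ i) (hκ i hi)
  refine mem_HsTilde_of_kernel (K := closure Ω ∩ Metric.closedBall (i : 𝔼) (δ i))
    (hcomp.inter_right Metric.isClosed_closedBall) _ ?_ hρ hc h1 ?_
  · filter_upwards [hu, Hs.coeFn_testMul (hfd i) (hfc i) u] with x hx h2 hxK
    rw [h2]
    by_cases hxΩ : x ∈ closure Ω
    · have : x ∉ tsupport (f i) := fun h => hxK ⟨hxΩ, hfs i h⟩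
      rw [image_eq_zero_of_notMem_tsupport this, zero_mul]
    · rw [hx hxΩ, mul_zero]
  · filter_upwards [hcone i hi] with h hh x hx z hz
    exact hh x hx z (hs hz)

end Exterior

/-! ### Sobolev embedding -/

section Sobolev

variable {n : ℕ} {s : ℝ≥0}

local notation "𝔼" => EuclideanSpace ℝ (Fin n)

theorem setIntegral_ball_norm_rpow {A σ : ℝ} (hA : 0 < A) :
    ∫ ξ in Metric.ball (0 : 𝔼) A, ‖ξ‖ ^ (-(2 * σ)) =
      A ^ ((n : ℝ) - 2 * σ) * ∫ ξ in Metric.ball (0 : 𝔼) 1, ‖ξ‖ ^ (-(2 * σ)) := by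
  have h := Measure.setIntegral_comp_smul_of_pos (volume : Measure 𝔼)
    (fun ξ => ‖ξ‖ ^ (-(2 * σ))) (s := Metric.ball 0 1) hA
  rw [smul_unitBall_of_pos hA, finrank_euclideanSpace_fin] at h
  have h1 : ∀ ξ : 𝔼, ‖A • ξ‖ ^ (-(2 * σ)) = A ^ (-(2 * σ)) * ‖ξ‖ ^ (-(2 * σ)) := fun ξ => by
    rw [norm_smul, Real.norm_of_nonneg hA.le, Real.mul_rpow hA.le (norm_nonneg _)]
  simp only [h1, integral_const_mul, smul_eq_mul] at h
  have hn : (A ^ n : ℝ) ≠ 0 := (pow_pos hA n).ne'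
  rw [eq_inv_mul_iff_mul_eq₀ hn] at h
  rw [← h, sub_eq_add_neg, Real.rpow_add hA, Real.rpow_natCast, mul_assoc]

theorem integrableOn_ball_norm_rpow {A σ : ℝ} (hn : 1 ≤ n) (hσ : 2 * σ < n) :
    IntegrableOn (fun ξ : 𝔼 => ‖ξ‖ ^ (-(2 * σ))) (Metric.ball 0 A) := by
  refine integrableOn_ball_of_norm_le_rpow (C := 1) (α := 2 * σ)
    (by rwa [finrank_euclideanSpace_fin]) (by rwa [finrank_euclideanSpace_fin]) ?_
    (Measurable.aestronglyMeasurable (by fun_prop))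
  filter_upwards with ξ
  rw [one_mul, Real.norm_of_nonneg (by positivity)]

theorem norm_rpow_le_besselSymbol_sq {σ : ℝ} (hσ : 0 ≤ σ) (hs : σ ≤ s) (ξ : 𝔼) :
    ‖ξ‖ ^ (2 * σ) ≤ besselSymbol n s ξ ^ 2 := by
  have h1 : besselSymbol n s ξ ^ 2 = (1 + (2 * Real.pi * ‖ξ‖) ^ 2) ^ (s : ℝ) := by
    rw [besselSymbol, ← Real.rpow_natCast, ← Real.rpow_mul (by positivity)]
    congr 1
    push_cast
    ring
  have hpi : 1 ≤ 2 * Real.pi := by linarith [Real.two_le_pi]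
  have h2 : ‖ξ‖ ^ 2 ≤ (2 * Real.pi * ‖ξ‖) ^ 2 :=
    pow_le_pow_left₀ (norm_nonneg _) (le_mul_of_one_le_left (norm_nonneg _) hpi) 2
  rw [h1, Real.rpow_mul (norm_nonneg _), Real.rpow_two]
  calc (‖ξ‖ ^ 2) ^ σ ≤ (1 + (2 * Real.pi * ‖ξ‖) ^ 2) ^ σ :=
        Real.rpow_le_rpow (by positivity) (by linarith) hσ
    _ ≤ _ := Real.rpow_le_rpow_of_exponent_le (by linarith [sq_nonneg (2 * Real.pi * ‖ξ‖)]) hs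

theorem Hs.lintegral_norm_rpow_lt_top {σ : ℝ} (hσ : 0 ≤ σ) (hs : σ ≤ s) (u : Hs n s) :
    ∫⁻ ξ, ENNReal.ofReal (‖ξ‖ ^ (2 * σ)) * ‖u.hat ξ‖ₑ ^ 2 < (∞ : ℝ≥0∞) := by
  have h := (integrable_symbol (continuous_besselSymbol n s) (abs_besselSymbol_le n s) u).2
  refine lt_of_le_of_lt (lintegral_mono fun ξ => ?_) h
  rw [Real.enorm_of_nonneg (by positivity), ENNReal.ofReal_mul (by positivity),
    ENNReal.ofReal_pow (norm_nonneg _), ofReal_norm]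
  gcongr
  exact norm_rpow_le_besselSymbol_sq hσ hs ξ

/-- Cauchy–Schwarz with the weights |ξ|^{∓2σ}: the first is integrable over the ball as 2σ < n and
scales like A^{n−2σ}, the second gives the homogeneous Sobolev energy. The transform of this bounds
the low-frequency part of u in L^∞. -/
theorem Hs.exists_lintegral_ball_le (hn : 1 ≤ n) {σ : ℝ} (hσ : 0 ≤ σ) (hσn : 2 * σ < n)
    (hs : σ ≤ s) (u : Hs n s) : ∃ M : ℝ, 0 < M ∧ ∀ A : ℝ, 0 < A →
      ∫⁻ ξ in Metric.ball 0 A, ‖u.hat ξ‖ₑ ≤ ENNReal.ofReal (M * A ^ ((n : ℝ) / 2 - σ)) := by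
  set E := ∫⁻ ξ, ENNReal.ofReal (‖ξ‖ ^ (2 * σ)) * ‖u.hat ξ‖ₑ ^ 2 with hE
  have hEt : E < (∞ : ℝ≥0∞) := Hs.lintegral_norm_rpow_lt_top hσ hs u
  set c := ∫ ξ in Metric.ball (0 : 𝔼) 1, ‖ξ‖ ^ (-(2 * σ)) with hc
  have hc0 : 0 ≤ c := integral_nonneg fun ξ => by positivity
  have hmeas : Measurable u.hat := (Lp.stronglyMeasurable _).measurable
  -- The summand 1 keeps M positive even for u = 0.
  refine ⟨Real.sqrt (c * E.toReal) + 1, by positivity, fun A hA => ?_⟩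
  have h1 : (∫⁻ ξ in Metric.ball 0 A, ‖u.hat ξ‖ₑ) ^ 2 ≤
      ENNReal.ofReal (A ^ ((n : ℝ) - 2 * σ) * c) * E := by
    have hcs := sq_lintegral_mul_le (μ := volume.restrict (Metric.ball (0 : 𝔼) A))
      (k := fun ξ => ENNReal.ofReal (‖ξ‖ ^ (-(2 * σ))))
      (g := fun ξ => ENNReal.ofReal (‖ξ‖ ^ (2 * σ)) * ‖u.hat ξ‖ₑ) (by fun_prop) (by fun_prop)
    have hone : ∀ ξ : 𝔼, ξ ≠ 0 →
        ENNReal.ofReal (‖ξ‖ ^ (-(2 * σ))) * ENNReal.ofReal (‖ξ‖ ^ (2 * σ)) = 1 := fun ξ hξ => by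
      rw [← ENNReal.ofReal_mul (by positivity), ← Real.rpow_add (norm_pos_iff.2 hξ),
        neg_add_cancel, Real.rpow_zero, ENNReal.ofReal_one]
    have hnz : ∀ᵐ ξ : 𝔼 ∂(volume.restrict (Metric.ball (0 : 𝔼) A)), ξ ≠ 0 := by
      have : Nontrivial 𝔼 := Module.nontrivial_of_finrank_pos (R := ℝ)
        (by rw [finrank_euclideanSpace_fin]; omega)
      exact ae_restrict_of_ae (Measure.ae_ne volume 0)
    have e1 : ∫⁻ ξ in Metric.ball (0 : 𝔼) A, ENNReal.ofReal (‖ξ‖ ^ (-(2 * σ))) *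
        (ENNReal.ofReal (‖ξ‖ ^ (2 * σ)) * ‖u.hat ξ‖ₑ) = ∫⁻ ξ in Metric.ball 0 A, ‖u.hat ξ‖ₑ := by
      refine lintegral_congr_ae ?_
      filter_upwards [hnz] with ξ hξ
      rw [← mul_assoc, hone ξ hξ, one_mul]
    have e2 : ∫⁻ ξ in Metric.ball (0 : 𝔼) A, ENNReal.ofReal (‖ξ‖ ^ (-(2 * σ))) *
        (ENNReal.ofReal (‖ξ‖ ^ (2 * σ)) * ‖u.hat ξ‖ₑ) ^ 2 ≤ E := by
      refine le_trans (le_of_eq (lintegral_congr_ae ?_)) (setLIntegral_le_lintegral _ _)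
      filter_upwards [hnz] with ξ hξ
      rw [mul_pow, sq (ENNReal.ofReal _), ← mul_assoc, ← mul_assoc, hone ξ hξ, one_mul]
    have e3 : ∫⁻ ξ in Metric.ball (0 : 𝔼) A, ENNReal.ofReal (‖ξ‖ ^ (-(2 * σ))) =
        ENNReal.ofReal (A ^ ((n : ℝ) - 2 * σ) * c) := by
      rw [hc, ← setIntegral_ball_norm_rpow hA]
      exact (ofReal_integral_eq_lintegral_ofReal (integrableOn_ball_norm_rpow hn hσn)
        (Filter.Eventually.of_forall fun ξ => by positivity)).symm
    rw [e1, e3] at hcs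
    exact hcs.trans (by gcongr)
  have h2 : ENNReal.ofReal (A ^ ((n : ℝ) - 2 * σ) * c) * E ≤
      ENNReal.ofReal ((Real.sqrt (c * E.toReal) + 1) * A ^ ((n : ℝ) / 2 - σ)) ^ 2 := by
    rw [← ENNReal.ofReal_toReal hEt.ne, ← ENNReal.ofReal_mul (by positivity),
      ← ENNReal.ofReal_pow (by positivity)]
    refine ENNReal.ofReal_le_ofReal ?_
    have e4 : A ^ ((n : ℝ) - 2 * σ) = (A ^ ((n : ℝ) / 2 - σ)) ^ 2 := by
      rw [← Real.rpow_natCast, ← Real.rpow_mul hA.le]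
      congr 1
      push_cast
      ring
    have e5 : c * E.toReal ≤ (Real.sqrt (c * E.toReal) + 1) ^ 2 := by
      nlinarith [Real.sq_sqrt (show 0 ≤ c * E.toReal by positivity), Real.sqrt_nonneg (c * E.toReal)]
    rw [ENNReal.toReal_ofReal ENNReal.toReal_nonneg, mul_pow, e4]
    calc (A ^ ((n : ℝ) / 2 - σ)) ^ 2 * c * E.toReal
        = (c * E.toReal) * (A ^ ((n : ℝ) / 2 - σ)) ^ 2 := by ring
      _ ≤ _ := by gcongr
  exact (ENNReal.pow_le_pow_left_iff two_ne_zero).1 (h1.trans h2)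

/-- Frequencies are split at a radius A depending on the level l, chosen by MA^θ = l/2. The
low-frequency part is then at most l/2 almost everywhere, so where |u| > l the high-frequency part
is at least l/2. Chebyshev and Plancherel give the factor (l/2)^{-2}. -/
theorem Hs.measure_lt_norm_le (u : Hs n s) {M θ l : ℝ} (hM : 0 < M) (hθ : 0 < θ) (hl : 0 < l)
    (hu : ∀ A : ℝ, 0 < A →
      ∫⁻ ξ in Metric.ball 0 A, ‖u.hat ξ‖ₑ ≤ ENNReal.ofReal (M * A ^ θ)) :
    volume {x | l < |Hs.toL2 n s u x|} ≤ ENNReal.ofReal (4 * l ^ (-2 : ℝ)) *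
      ∫⁻ ξ in {ξ : 𝔼 | l ≤ 2 * M * ‖ξ‖ ^ θ}, ‖u.hat ξ‖ₑ ^ 2 := by
  set A := (l / (2 * M)) ^ θ⁻¹ with hA
  have hApos : 0 < A := by positivity
  have hAθ : M * A ^ θ = l / 2 := by
    rw [hA, ← Real.rpow_mul (by positivity), inv_mul_cancel₀ hθ.ne', Real.rpow_one]
    field_simp
  set S := {ξ : 𝔼 | l ≤ 2 * M * ‖ξ‖ ^ θ} with hS
  have hSm : MeasurableSet S := measurableSet_le measurable_const (by fun_prop)
  have hSc : Sᶜ = Metric.ball 0 A := by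
    ext ξ
    rw [hS, mem_compl_iff, mem_ofPred_eq, not_le, mem_ball_zero_iff,
      ← Real.rpow_lt_rpow_iff (norm_nonneg ξ) hApos.le hθ]
    constructor
    · intro h
      have : M * ‖ξ‖ ^ θ < M * A ^ θ := by rw [hAθ]; linarith
      exact lt_of_mul_lt_mul_left this hM.le
    · intro h
      have : M * ‖ξ‖ ^ θ < M * A ^ θ := mul_lt_mul_of_pos_left h hM
      rw [hAθ] at this
      linarith
  have hlow : MemLp (Sᶜ.indicator u.hat) 2 volume := (Lp.memLp u.hat).indicator hSm.compl
  have hhigh : MemLp (S.indicator u.hat) 2 volume := (Lp.memLp u.hat).indicator hSm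
  have hsum : u.hat = hlow.toLp _ + hhigh.toLp _ := by
    rw [← MemLp.toLp_add]
    apply Lp.ext
    filter_upwards [(hlow.add hhigh).coeFn_toLp] with ξ hξ
    rw [hξ, Pi.add_apply, add_comm]
    exact (congrFun (indicator_self_add_compl S (u.hat : 𝔼 → ℂ)) ξ).symm
  have hcu : complexify n (Hs.toL2 n s u) = (fourierC n).symm (hlow.toLp _) +
      (fourierC n).symm (hhigh.toLp _) := by
    rw [← map_add, ← hsum]
    exact ((fourierC n).symm_apply_apply _).symm
  have hbd : ∫⁻ ξ, ‖Sᶜ.indicator u.hat ξ‖ₑ ≤ ENNReal.ofReal (l / 2) := by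
    have : ∫⁻ ξ, ‖Sᶜ.indicator u.hat ξ‖ₑ = ∫⁻ ξ in Sᶜ, ‖u.hat ξ‖ₑ := by
      rw [← lintegral_indicator hSm.compl]
      simp only [enorm_indicator_eq_indicator_enorm]
    rw [this, hSc, ← hAθ]
    exact hu A hApos
  have hlowi : Integrable (Sᶜ.indicator u.hat) :=
    ⟨hlow.1, hbd.trans_lt ENNReal.ofReal_lt_top⟩
  have hlowi' : Integrable (hlow.toLp _) := hlowi.congr hlow.coeFn_toLp.symm
  have hsup : ∀ᵐ x, ‖(fourierC n).symm (hlow.toLp _) x‖ ≤ l / 2 := by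
    filter_upwards [fourierC_symm_ae_eq _ hlowi'] with x hx
    rw [hx]
    refine (norm_fourierInv_le _ x).trans ?_
    rw [integral_congr_ae (g := fun ξ => ‖Sᶜ.indicator u.hat ξ‖)
      (by filter_upwards [hlow.coeFn_toLp] with ξ hξ; rw [hξ]), integral_norm_eq_lintegral_enorm hlow.1]
    exact ENNReal.toReal_le_of_le_ofReal (by positivity) hbd
  have hsubset : volume {x | l < |Hs.toL2 n s u x|} ≤
      volume {x | ENNReal.ofReal (l / 2) ≤ ‖(fourierC n).symm (hhigh.toLp _) x‖ₑ} := by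
    refine measure_mono_ae ?_
    filter_upwards [hsup, coeFn_complexify (Hs.toL2 n s u),
      Lp.coeFn_add ((fourierC n).symm (hlow.toLp _)) ((fourierC n).symm (hhigh.toLp _))]
      with x h1 h2 h3 (h4 : l < |Hs.toL2 n s u x|)
    change ENNReal.ofReal (l / 2) ≤ ‖(fourierC n).symm (hhigh.toLp _) x‖ₑ
    rw [← ofReal_norm]
    refine ENNReal.ofReal_le_ofReal ?_
    rw [hcu, h3, Pi.add_apply] at h2
    have h5 : |Hs.toL2 n s u x| ≤ ‖(fourierC n).symm (hlow.toLp _) x‖ +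
        ‖(fourierC n).symm (hhigh.toLp _) x‖ := by
      refine le_trans (le_of_eq ?_) (norm_add_le _ _)
      rw [h2, Complex.norm_real, Real.norm_eq_abs]
    linarith
  have hcheb := mul_meas_ge_le_pow_eLpNorm' volume (p := 2) two_ne_zero ENNReal.ofNat_ne_top
    (Lp.aestronglyMeasurable ((fourierC n).symm (hhigh.toLp _))) (ENNReal.ofReal (l / 2))
  have hpl : eLpNorm ((fourierC n).symm (hhigh.toLp _)) 2 volume ^ (2 : ℝ≥0∞).toReal =
      ∫⁻ ξ in S, ‖u.hat ξ‖ₑ ^ 2 := by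
    have e1 : eLpNorm ((fourierC n).symm (hhigh.toLp _)) 2 volume =
        eLpNorm (S.indicator u.hat) 2 volume := by
      rw [← Lp.enorm_def, ← eLpNorm_congr_ae hhigh.coeFn_toLp, ← Lp.enorm_def, ← ofReal_norm,
        ← ofReal_norm, (fourierC n).symm.norm_map]
    rw [e1, eLpNorm_eq_lintegral_rpow_enorm_toReal two_ne_zero ENNReal.ofNat_ne_top,
      ← ENNReal.rpow_mul, ENNReal.toReal_ofNat, one_div, inv_mul_cancel₀ two_ne_zero,
      ENNReal.rpow_one, ← lintegral_indicator hSm]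
    refine lintegral_congr fun ξ => ?_
    by_cases hξ : ξ ∈ S
    · simp [indicator_of_mem hξ]
    · simp [indicator_of_notMem hξ]
  rw [hpl, ENNReal.toReal_ofNat, ENNReal.rpow_two, ← ENNReal.ofReal_pow (by positivity)] at hcheb
  refine hsubset.trans ?_
  have e2 : ENNReal.ofReal (4 * l ^ (-2 : ℝ)) * ENNReal.ofReal ((l / 2) ^ 2) = 1 := by
    rw [← ENNReal.ofReal_mul (by positivity), Real.rpow_neg hl.le, Real.rpow_two]
    have : 4 * (l ^ 2)⁻¹ * (l / 2) ^ 2 = 1 := by field_simp; norm_num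
    rw [this, ENNReal.ofReal_one]
  calc volume {x | ENNReal.ofReal (l / 2) ≤ ‖(fourierC n).symm (hhigh.toLp _) x‖ₑ}
      = ENNReal.ofReal (4 * l ^ (-2 : ℝ)) * (ENNReal.ofReal ((l / 2) ^ 2) *
          volume {x | ENNReal.ofReal (l / 2) ≤ ‖(fourierC n).symm (hhigh.toLp _) x‖ₑ}) := by
        rw [← mul_assoc, e2, one_mul]
    _ ≤ _ := by gcongr

theorem setLIntegral_rpow_Ioc {a L : ℝ} (ha : -1 < a) (hL : 0 ≤ L) :
    ∫⁻ l in Ioc 0 L, ENNReal.ofReal (l ^ a) = ENNReal.ofReal (L ^ (a + 1) / (a + 1)) := by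
  have h1 : IntegrableOn (fun l : ℝ => l ^ a) (Ioc 0 L) :=
    (intervalIntegrable_iff_integrableOn_Ioc_of_le hL).1 (intervalIntegral.intervalIntegrable_rpow' ha)
  rw [← ofReal_integral_eq_lintegral_ofReal h1, ← intervalIntegral.integral_of_le hL,
    integral_rpow (Or.inl ha), Real.zero_rpow (by linarith), sub_zero]
  filter_upwards [ae_restrict_mem measurableSet_Ioc] with l hl
  exact Real.rpow_nonneg hl.1.le a

/-- The Sobolev embedding, critical exponent included. Insert the level-set bound into the
layer-cake formula and exchange the integrals. For fixed ξ the integral over l ≤ 2M|ξ|^θ is a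
multiple of |ξ|^{2rθ} = |ξ|^{2σ}, so the homogeneous Sobolev energy of order σ remains. -/
theorem Hs.memLp_of_le (hn : 1 ≤ n) {r : ℝ} (hr : 0 < r) (hs : n * r / (2 * (r + 1)) ≤ s)
    (u : Hs n s) : MemLp (Hs.toL2 n s u) (ENNReal.ofReal (2 * (r + 1))) volume := by
  set σ := n * r / (2 * (r + 1)) with hσ
  set θ := (n : ℝ) / 2 - σ with hθ
  have hn' : (1 : ℝ) ≤ n := by exact_mod_cast hn
  have hθ' : θ = n / (2 * (r + 1)) := by
    rw [hθ, hσ]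
    field_simp
    ring
  have hθ0 : 0 < θ := by rw [hθ']; positivity
  have hσ0 : 0 ≤ σ := by positivity
  have hσn : 2 * σ < n := by linarith
  obtain ⟨M, hM, hball⟩ := Hs.exists_lintegral_ball_le hn hσ0 hσn hs u
  have hp0 : 0 < 2 * (r + 1) := by positivity
  refine ⟨Lp.aestronglyMeasurable _, ?_⟩
  rw [eLpNorm_lt_top_iff_lintegral_rpow_enorm_lt_top (by simpa using hp0) ENNReal.ofReal_ne_top,
    ENNReal.toReal_ofReal hp0.le]
  have hmu : Measurable (Hs.toL2 n s u) := (Lp.stronglyMeasurable _).measurable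
  have hmh : Measurable u.hat := (Lp.stronglyMeasurable _).measurable
  have e1 : ∫⁻ x, ‖Hs.toL2 n s u x‖ₑ ^ (2 * (r + 1)) =
      ∫⁻ x, ENNReal.ofReal (|Hs.toL2 n s u x| ^ (2 * (r + 1))) := by
    refine lintegral_congr fun x => ?_
    rw [← ENNReal.ofReal_rpow_of_nonneg (abs_nonneg _) hp0.le, ← Real.norm_eq_abs, ofReal_norm]
  rw [e1, lintegral_rpow_eq_lintegral_meas_lt_mul volume
    (Filter.Eventually.of_forall fun x => abs_nonneg _) (by fun_prop) hp0]
  refine ENNReal.mul_lt_top ENNReal.ofReal_lt_top ?_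
  let G : ℝ → 𝔼 → ℝ≥0∞ := fun l ξ => {p : ℝ × 𝔼 | p.1 ≤ 2 * M * ‖p.2‖ ^ θ}.indicator
    (fun p => ENNReal.ofReal 4 * (ENNReal.ofReal (p.1 ^ (2 * r - 1)) * ‖u.hat p.2‖ₑ ^ 2)) (l, ξ)
  have hG : Measurable (Function.uncurry G) :=
    Measurable.indicator (by fun_prop) (measurableSet_le (by fun_prop) (by fun_prop))
  have hle : ∀ l ∈ Ioi (0 : ℝ), volume {x | l < |Hs.toL2 n s u x|} *
      ENNReal.ofReal (l ^ (2 * (r + 1) - 1)) ≤ ∫⁻ ξ, G l ξ := by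
    intro l hl
    replace hl : 0 < l := hl
    have hSm : MeasurableSet {ξ : 𝔼 | l ≤ 2 * M * ‖ξ‖ ^ θ} :=
      measurableSet_le measurable_const (by fun_prop)
    have h := Hs.measure_lt_norm_le u hM hθ0 hl hball
    have hG' : ∫⁻ ξ, G l ξ = ENNReal.ofReal 4 * (ENNReal.ofReal (l ^ (2 * r - 1)) *
        ∫⁻ ξ in {ξ : 𝔼 | l ≤ 2 * M * ‖ξ‖ ^ θ}, ‖u.hat ξ‖ₑ ^ 2) := by
      rw [← lintegral_const_mul _ (by fun_prop), ← lintegral_const_mul _ (by fun_prop),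
        ← lintegral_indicator hSm]
      rfl
    rw [hG']
    calc volume {x | l < |Hs.toL2 n s u x|} * ENNReal.ofReal (l ^ (2 * (r + 1) - 1))
        ≤ ENNReal.ofReal (4 * l ^ (-2 : ℝ)) *
            (∫⁻ ξ in {ξ : 𝔼 | l ≤ 2 * M * ‖ξ‖ ^ θ}, ‖u.hat ξ‖ₑ ^ 2) *
            ENNReal.ofReal (l ^ (2 * (r + 1) - 1)) := by gcongr
      _ = (ENNReal.ofReal (4 * l ^ (-2 : ℝ)) * ENNReal.ofReal (l ^ (2 * (r + 1) - 1))) *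
            ∫⁻ ξ in {ξ : 𝔼 | l ≤ 2 * M * ‖ξ‖ ^ θ}, ‖u.hat ξ‖ₑ ^ 2 := by ring
      _ = _ := by
          rw [← ENNReal.ofReal_mul (by positivity), ← mul_assoc,
            ← ENNReal.ofReal_mul (by norm_num), mul_assoc 4, ← Real.rpow_add hl]
          ring_nf
  have hswap : ∫⁻ l in Ioi (0 : ℝ), ∫⁻ ξ, G l ξ = ∫⁻ ξ, ∫⁻ l in Ioi (0 : ℝ), G l ξ :=
    lintegral_lintegral_swap hG.aemeasurable
  have hin : ∀ ξ, ∫⁻ l in Ioi (0 : ℝ), G l ξ = ENNReal.ofReal (4 * ((2 * M) ^ (2 * r) / (2 * r))) *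
      (ENNReal.ofReal (‖ξ‖ ^ (2 * σ)) * ‖u.hat ξ‖ₑ ^ 2) := by
    intro ξ
    have hL : 0 ≤ 2 * M * ‖ξ‖ ^ θ := by positivity
    have e2 : ∀ l : ℝ, G l ξ = (Iic (2 * M * ‖ξ‖ ^ θ)).indicator (fun l =>
        ENNReal.ofReal (l ^ (2 * r - 1)) * (ENNReal.ofReal 4 * ‖u.hat ξ‖ₑ ^ 2)) l := by
      intro l
      by_cases hl : l ≤ 2 * M * ‖ξ‖ ^ θ
      · rw [indicator_of_mem (show l ∈ Iic (2 * M * ‖ξ‖ ^ θ) from hl)]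
        refine (indicator_of_mem (s := {p : ℝ × 𝔼 | p.1 ≤ 2 * M * ‖p.2‖ ^ θ}) (a := (l, ξ)) hl _).trans
          ?_
        ring
      · rw [indicator_of_notMem (show l ∉ Iic (2 * M * ‖ξ‖ ^ θ) from hl)]
        exact indicator_of_notMem (s := {p : ℝ × 𝔼 | p.1 ≤ 2 * M * ‖p.2‖ ^ θ}) (a := (l, ξ)) hl _
    simp only [e2]
    rw [setLIntegral_indicator measurableSet_Iic, inter_comm, Ioi_inter_Iic,
      lintegral_mul_const _ (by fun_prop), setLIntegral_rpow_Ioc (by linarith) hL, sub_add_cancel,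
      Real.mul_rpow (by positivity) (by positivity), ← Real.rpow_mul (norm_nonneg _)]
    -- This identity is the critical relation p = 2n/(n−2σ) in terms of r.
    have e3 : θ * (2 * r) = 2 * σ := by
      rw [hθ', hσ]
      field_simp
    rw [e3, ← mul_assoc, ← mul_assoc, ← ENNReal.ofReal_mul (by positivity),
      ← ENNReal.ofReal_mul (by positivity)]
    congr 2
    ring
  calc ∫⁻ l in Ioi (0 : ℝ), volume {x | l < |Hs.toL2 n s u x|} *
        ENNReal.ofReal (l ^ (2 * (r + 1) - 1))
      ≤ ∫⁻ l in Ioi (0 : ℝ), ∫⁻ ξ, G l ξ := setLIntegral_mono' measurableSet_Ioi hle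
    _ = ENNReal.ofReal (4 * ((2 * M) ^ (2 * r) / (2 * r))) *
        ∫⁻ ξ, ENNReal.ofReal (‖ξ‖ ^ (2 * σ)) * ‖u.hat ξ‖ₑ ^ 2 := by
          rw [hswap, lintegral_congr hin, lintegral_const_mul _ (by fun_prop)]
    _ < (∞ : ℝ≥0∞) :=
        ENNReal.mul_lt_top ENNReal.ofReal_lt_top (Hs.lintegral_norm_rpow_lt_top hσ0 hs u)

end Sobolev

/-! ### The nonlinearity on `Hˢ(ℝⁿ)` -/

section Nonlinearity

variable {n : ℕ} {s : ℝ≥0} {Ω : Set (EuclideanSpace ℝ (Fin n))}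

local notation "𝔼" => EuclideanSpace ℝ (Fin n)

/-- If all elements of `Hˢ(ℝⁿ)` lie in `L^p`, then the restriction `Hˢ(ℝⁿ) → L^p(A)` is
continuous. -/
theorem Hs.exists_restrict_Lp {p : ℝ≥0∞} [Fact (1 ≤ p)]
    (hp : ∀ u : Hs n s, MemLp (Hs.toL2 n s u) p volume) (A : Set 𝔼) :
    ∃ S : Hs n s →L[ℝ] Lp ℝ p (volume.restrict A),
      ∀ u, S u =ᵐ[volume.restrict A] Hs.toL2 n s u := by
  let S₀ : Hs n s →ₗ[ℝ] Lp ℝ p (volume.restrict A) :=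
    { toFun := fun u => ((hp u).restrict A).toLp _
      map_add' := fun u v => by
        rw [← MemLp.toLp_add, MemLp.toLp_eq_toLp_iff, map_add]
        exact ae_restrict_of_ae (Lp.coeFn_add _ _)
      map_smul' := fun c u => by
        rw [RingHom.id_apply, ← MemLp.toLp_const_smul, MemLp.toLp_eq_toLp_iff, map_smul]
        exact ae_restrict_of_ae (Lp.coeFn_smul _ _) }
  have hS₀ : ∀ u, S₀ u =ᵐ[volume.restrict A] Hs.toL2 n s u := fun u =>
    MemLp.coeFn_toLp ((hp u).restrict A)
  -- Closed graph theorem: limits in L^p and in L² agree, since both are limits in measure.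
  refine ⟨ContinuousLinearMap.ofSeqClosedGraph (g := S₀) fun u x y hu hy => ?_, hS₀⟩
  have h1 : TendstoInMeasure (volume.restrict A) (fun k => (S₀ (u k) : 𝔼 → ℝ)) Filter.atTop y :=
    tendstoInMeasure_of_tendsto_Lp hy
  have h2 : TendstoInMeasure (volume.restrict A) (fun k => (Hs.restrict s A (u k) : 𝔼 → ℝ))
      Filter.atTop (Hs.restrict s A x) :=
    tendstoInMeasure_of_tendsto_Lp (((Hs.restrict s A).continuous.tendsto x).comp hu)
  have h3 : TendstoInMeasure (volume.restrict A) (fun k => (S₀ (u k) : 𝔼 → ℝ)) Filter.atTop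
      (S₀ x) :=
    h2.congr (fun k => (Hs.coeFn_restrict A (u k)).trans (hS₀ (u k)).symm)
      ((Hs.coeFn_restrict A x).trans (hS₀ x).symm)
  exact Lp.ext (tendstoInMeasure_ae_unique h1 h3)

/-- For 2s < n the growth restriction on r rearranges to this. For 2s ≥ n it holds for every r,
since r/(r+1) < 1. -/
theorem GrowthAssumption.exponent_le' {f : 𝔼 → ℝ → ℝ} {a : 𝔼 → ℝ} {r : ℝ} (hr : 0 < r)
    (hf : GrowthAssumption s Ω f a r) : n * r / (2 * (r + 1)) ≤ s := by
  rw [div_le_iff₀ (by positivity)]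
  rcases lt_or_ge (2 * (s : ℝ)) n with h | h
  · have h1 := hf.exponent_le h
    rw [le_div_iff₀ (by linarith)] at h1
    nlinarith
  · have : (0 : ℝ) ≤ s := s.2
    nlinarith

theorem GrowthAssumption.exists_derivGrowth {f : 𝔼 → ℝ → ℝ} {a : 𝔼 → ℝ} {r : ℝ}
    (hf : GrowthAssumption s Ω f a r) (hf0 : ∀ᵐ x ∂(volume.restrict Ω), f x 0 = 0) :
    ∃ K : ℝ, 0 ≤ K ∧ DerivGrowth (volume.restrict Ω) f r K := by
  obtain ⟨C, hC, h⟩ := hf.growth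
  obtain ⟨A, hA0, hA⟩ : ∃ A : ℝ, 0 ≤ A ∧ ∀ᵐ x ∂(volume.restrict Ω), |a x| ≤ A := by
    refine ⟨(eLpNorm a (∞ : ℝ≥0∞) (volume.restrict Ω)).toReal, ENNReal.toReal_nonneg, ?_⟩
    have h1 := hf.memLp.2
    rw [eLpNorm_exponent_top] at h1 ⊢
    filter_upwards [ae_le_eLpNormEssSup (f := a) (μ := volume.restrict Ω)] with x hx
    rw [← Real.norm_eq_abs, ← toReal_enorm]
    exact ENNReal.toReal_mono h1.ne hx
  refine ⟨C * (A + 1), by positivity, hf.differentiable, hf.caratheodory_deriv.continuous,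
    hf.caratheodory.measurable, hf.caratheodory_deriv.measurable, ?_, hf0⟩
  filter_upwards [h, hA] with x hx ha τ
  refine (hx τ).trans ?_
  rw [mul_assoc]
  refine mul_le_mul_of_nonneg_left ?_ hC.le
  have h1 : 0 ≤ |τ| ^ r := by positivity
  have h2 := (le_abs_self (a x)).trans ha
  nlinarith

/-- The splitting of `f` into its linearization `Q` at `0` and a remainder that vanishes to first
order. -/
theorem exists_nonlinearity (hn : 1 ≤ n) (hΩ : Bornology.IsBounded Ω) {f : 𝔼 → ℝ → ℝ} {a : 𝔼 → ℝ}
    {r : ℝ} (hr : 0 < r) (hf : GrowthAssumption s Ω f a r)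
    (hf0 : ∀ᵐ x ∂(volume.restrict Ω), f x 0 = 0) :
    ∃ (Q : L2On Ω →L[ℝ] L2On Ω) (N : Hs n s → L2On Ω), ContDiff ℝ 1 N ∧ N 0 = 0 ∧
      fderiv ℝ N 0 = 0 ∧ ∀ u, (Q (Hs.restrict s Ω u) + N u : L2On Ω) =ᵐ[volume.restrict Ω]
        fun x => f x (Hs.toL2 n s u x) := by
  have hfin : IsFiniteMeasure (volume.restrict Ω) :=
    ⟨by rw [Measure.restrict_apply_univ]; exact hΩ.measure_lt_top⟩
  obtain ⟨K, hK, hg⟩ := hf.exists_derivGrowth hf0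
  -- The exponents satisfy p = qr and 1/q + 1/p = 1/2. So ∂_τ f maps L^p to L^q, and multiplication
  -- by an L^q function maps L^p to L².
  set p := ENNReal.ofReal (2 * (r + 1)) with hp
  set q := ENNReal.ofReal (2 * (r + 1) / r) with hq
  have hpF : Fact (1 ≤ p) := ⟨by rw [hp, ENNReal.one_le_ofReal]; linarith⟩
  have hqF : Fact (1 ≤ q) := ⟨by
    rw [hq, ENNReal.one_le_ofReal, le_div_iff₀ hr]; linarith⟩
  have hpq : p = q * ENNReal.ofReal r := by
    rw [hp, hq, ← ENNReal.ofReal_mul (by positivity), div_mul_cancel₀ _ hr.ne']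
  have hp2 : p = 2 * ENNReal.ofReal (r + 1) := by
    rw [hp, ENNReal.ofReal_mul (by norm_num), ENNReal.ofReal_ofNat]
  have hH : ENNReal.HolderTriple q p 2 := ⟨by
    have h2 : (2 : ℝ≥0∞) = ENNReal.ofReal 2 := by simp
    rw [hp, hq, h2, ← ENNReal.ofReal_inv_of_pos (by positivity),
      ← ENNReal.ofReal_inv_of_pos (by positivity), ← ENNReal.ofReal_inv_of_pos (by norm_num),
      ← ENNReal.ofReal_add (by positivity) (by positivity)]
    congr 1
    field_simp⟩
  obtain ⟨F, hF, hFc, hFd⟩ := exists_contDiff_superposition (p := p) (q := q)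
    ENNReal.ofReal_ne_top ENNReal.ofReal_ne_top hg hr hK hpq hp2
  obtain ⟨S, hS⟩ := Hs.exists_restrict_Lp (p := p)
    (fun u : Hs n s => Hs.memLp_of_le hn hr (hf.exponent_le' hr) u) Ω
  have hql : MemLp (fun x => deriv (f x) 0) (∞ : ℝ≥0∞) (volume.restrict Ω) := by
    refine memLp_top_of_bound (hg.measurable_deriv 0).aestronglyMeasurable K ?_
    filter_upwards [hg.bound] with x hx
    simpa [Real.zero_rpow hr.ne'] using hx 0
  let Q : L2On Ω →L[ℝ] L2On Ω := (ContinuousLinearMap.mul ℝ ℝ).holderL (volume.restrict Ω)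
    (∞ : ℝ≥0∞) 2 2 (hql.toLp _)
  have hQ : ∀ g : L2On Ω, Q g =ᵐ[volume.restrict Ω] fun x => deriv (f x) 0 * g x := by
    intro g
    have h1 : Q g =ᵐ[volume.restrict Ω] fun x => hql.toLp _ x * g x :=
      (ContinuousLinearMap.mul ℝ ℝ).coeFn_holder (hql.toLp _) g
    filter_upwards [h1, hql.coeFn_toLp] with x h2 h3
    rw [h2, h3]
  let N : Hs n s → L2On Ω := fun u => F (S u) - Q (Hs.restrict s Ω u)
  have hNf : ContDiff ℝ 1 N := (hF.comp S.contDiff).sub (Q.comp (Hs.restrict s Ω)).contDiff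
  refine ⟨Q, N, hNf, ?_, ?_, fun u => ?_⟩
  · have hF0 : F 0 = 0 := by
      apply Lp.ext
      filter_upwards [hFc 0, hf0, Lp.coeFn_zero ℝ p (volume.restrict Ω),
        Lp.coeFn_zero ℝ 2 (volume.restrict Ω)] with x h1 h2 h3 h4
      rw [h1, h3, h4, Pi.zero_apply, h2]
    simp only [N, map_zero, hF0, sub_zero]
  · have hd : HasFDerivAt N ((fderiv ℝ F (S 0)).comp S - Q.comp (Hs.restrict s Ω)) 0 :=
      (((hF.differentiable one_ne_zero) (S 0)).hasFDerivAt.comp 0 S.hasFDerivAt).sub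
        (Q.comp (Hs.restrict s Ω)).hasFDerivAt
    rw [hd.fderiv]
    ext1 h
    rw [map_zero, sub_apply, ContinuousLinearMap.comp_apply, ContinuousLinearMap.comp_apply,
      zero_apply, sub_eq_zero]
    apply Lp.ext
    filter_upwards [hFd 0 (S h), hQ (Hs.restrict s Ω h), Hs.coeFn_restrict Ω h, hS h,
      Lp.coeFn_zero ℝ p (volume.restrict Ω)] with x h1 h2 h3 h4 h5
    rw [h1, h2, h3, h4, h5, Pi.zero_apply]
  · have : Q (Hs.restrict s Ω u) + N u = F (S u) := by
      simp only [N]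
      abel
    rw [this]
    filter_upwards [hFc (S u), hS u] with x h1 h2
    rw [h1, h2]

end Nonlinearity

/-! ### A local solution map from the inverse function theorem -/

/-- Because N has derivative zero at 0, u ↦ u + KN(u) has the identity as derivative there. The
inverse function theorem supplies a local inverse, and composing it with L gives S. -/
theorem exists_local_solution_map {E R Y : Type} [NormedAddCommGroup E] [NormedSpace ℝ E]
    [CompleteSpace E] [NormedAddCommGroup R] [NormedSpace ℝ R] [NormedAddCommGroup Y]
    [NormedSpace ℝ Y] {N : E → Y} (hN : ContDiff ℝ 1 N) (hN0 : N 0 = 0)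
    (hN' : HasFDerivAt N (0 : E →L[ℝ] Y) 0) (K : Y →L[ℝ] E) (L : R →L[ℝ] E) :
    ∃ (U₀ : Set R) (U₁ : Set E) (S : R → E), IsOpen U₀ ∧ 0 ∈ U₀ ∧ IsOpen U₁ ∧ 0 ∈ U₁ ∧
      (∀ φ ∈ U₀, S φ ∈ U₁ ∧ S φ + K (N (S φ)) = L φ ∧
        ∀ u ∈ U₁, u + K (N u) = L φ → u = S φ) ∧ ContDiffOn ℝ 1 S U₀ := by
  set Ψ : E → E := fun u => u + K (N u) with hΨ
  have hΨ0 : Ψ 0 = 0 := by simp [hΨ, hN0]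
  have hc : ContDiff ℝ 1 Ψ := contDiff_id.add (K.contDiff.comp hN)
  have hd : HasFDerivAt Ψ ((ContinuousLinearEquiv.refl ℝ E : E ≃L[ℝ] E) : E →L[ℝ] E) 0 := by
    have h := (hasFDerivAt_id (𝕜 := ℝ) (0 : E)).add (K.hasFDerivAt.comp 0 hN')
    rw [ContinuousLinearMap.comp_zero, add_zero] at h
    exact h
  let e := hc.contDiffAt.toOpenPartialHomeomorph Ψ hd one_ne_zero
  have hs : (0 : E) ∈ e.source := hc.contDiffAt.mem_toOpenPartialHomeomorph_source hd one_ne_zero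
  have ht : (0 : E) ∈ e.target := by
    have := hc.contDiffAt.image_mem_toOpenPartialHomeomorph_target hd one_ne_zero
    rwa [hΨ0] at this
  have hsymm : ContDiffAt ℝ 1 e.symm 0 := by
    have := hc.contDiffAt.to_localInverse hd one_ne_zero
    rwa [hΨ0] at this
  -- Being C¹ at a point is an open condition, so O is a neighborhood in the target on which the
  -- inverse is C¹ throughout.
  obtain ⟨O, hO, hO1, hO2⟩ := eventually_nhds_iff.1
    ((hsymm.eventually (by simp)).and (e.open_target.eventually_mem ht))
  refine ⟨L ⁻¹' O, e.source, fun φ => e.symm (L φ), hO1.preimage L.continuous, by simpa using hO2,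
    e.open_source, hs, fun φ hφ => ?_, ?_⟩
  · have hφt : L φ ∈ e.target := (hO _ hφ).2
    refine ⟨e.map_target hφt, e.right_inv hφt, fun u hu h => ?_⟩
    exact (e.left_inv hu).symm.trans (congrArg e.symm h)
  · intro φ hφ
    exact ((hO _ hφ).1.comp φ L.contDiff.contDiffAt).contDiffWithinAt

/-! ### Linear maps on image spaces -/

section ImageSpace

variable {X Y Z : Type} [NormedAddCommGroup X] [NormedSpace ℝ X] [NormedAddCommGroup Y]
  [NormedSpace ℝ Y] [NormedAddCommGroup Z] [NormedSpace ℝ Z] (A : X →L[ℝ] Y)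

instance [CompleteSpace X] : CompleteSpace (ImageSpace A) :=
  haveI : IsClosed (LinearMap.ker A.toLinearMap : Set X) := A.isClosed_ker
  inferInstanceAs (CompleteSpace (X ⧸ LinearMap.ker A.toLinearMap))

/-- `ImageSpace.mk` as a continuous linear map. -/
def ImageSpace.mkL : X →L[ℝ] ImageSpace A :=
  haveI : IsClosed (LinearMap.ker A.toLinearMap : Set X) := A.isClosed_ker
  (LinearMap.ker A.toLinearMap).mkQL

theorem ImageSpace.mkL_surjective : Function.Surjective (ImageSpace.mkL A) :=
  Submodule.mkQ_surjective _

variable {A} in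
/-- The continuous linear map on the image of `A` that is induced by a map vanishing on the kernel
of `A`. -/
def ImageSpace.lift (f : X →L[ℝ] Z) (h : ∀ x, A x = 0 → f x = 0) : ImageSpace A →L[ℝ] Z :=
  haveI : IsClosed (LinearMap.ker A.toLinearMap : Set X) := A.isClosed_ker
  (LinearMap.ker A.toLinearMap).liftQL f h

/-- `ImageSpace.val` as a continuous linear map. -/
def ImageSpace.valL : ImageSpace A →L[ℝ] Y := ImageSpace.lift A fun _ h => h

end ImageSpace

/-! ### Functionals on `H̃ˢ(Ω)` -/

theorem compLpL_compLpL {X Y Z : Type} [NormedAddCommGroup X] [NormedSpace ℝ X]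
    [NormedAddCommGroup Y] [NormedSpace ℝ Y] [NormedAddCommGroup Z] [NormedSpace ℝ Z] {T : ℝ}
    (A : Y →L[ℝ] Z) (B : X →L[ℝ] Y) (u : L2T T X) :
    A.compLpL 2 (timeMeasure T) (B.compLpL 2 (timeMeasure T) u) =
      (A.comp B).compLpL 2 (timeMeasure T) u := by
  apply Lp.ext
  filter_upwards [A.coeFn_compLpL (B.compLpL 2 (timeMeasure T) u), B.coeFn_compLpL u,
    (A.comp B).coeFn_compLpL u] with t h1 h2 h3
  rw [h1, h2, h3, ContinuousLinearMap.comp_apply]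

theorem weakDerivPairs_clm {X Y : Type} [NormedAddCommGroup X] [NormedSpace ℝ X]
    [CompleteSpace X] [NormedAddCommGroup Y] [NormedSpace ℝ Y] [CompleteSpace Y] {T : ℝ}
    (A : X →L[ℝ] Y) {u w : L2T T X} (h : (u, w) ∈ weakDerivPairs T X) :
    (A.compLpL 2 (timeMeasure T) u, A.compLpL 2 (timeMeasure T) w) ∈ weakDerivPairs T Y :=
  (IsWeakTimeDeriv.clm A (integrable_L2T u) (integrable_L2T w) h).congr (A.coeFn_compLpL u)
    (A.coeFn_compLpL w)

section Functionals

variable {n : ℕ} {s : ℝ≥0} {Ω : Set (EuclideanSpace ℝ (Fin n))}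

theorem inner_restrict_restrict {g h : L2R n}
    (hg : ∀ᵐ x, x ∉ Ω → g x = 0) :
    inner ℝ (LpToLpRestrictCLM (EuclideanSpace ℝ (Fin n)) ℝ ℝ volume 2 Ω g)
      (LpToLpRestrictCLM (EuclideanSpace ℝ (Fin n)) ℝ ℝ volume 2 Ω h) = inner ℝ g h := by
  rw [L2.inner_def, L2.inner_def]
  refine Eq.trans ?_ (setIntegral_eq_integral_of_ae_compl_eq_zero (s := Ω) ?_)
  · apply integral_congr_ae
    filter_upwards [LpToLpRestrictCLM_coeFn ℝ Ω g, LpToLpRestrictCLM_coeFn ℝ Ω h] with x h1 h2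
    rw [h1, h2]
  · filter_upwards [hg] with x hx h
    rw [hx h, inner_zero_left]

theorem inner_toL2_HsTilde (hΩ : MeasurableSet Ω) (u : Hs n s) (v : HsTilde s Ω) :
    inner ℝ (Hs.toL2 n s u) (Hs.toL2 n s v) =
      inner ℝ (Hs.restrict s Ω u) (HsTilde.toL2 s Ω v) := by
  rw [real_inner_comm, real_inner_comm (HsTilde.toL2 s Ω v)]
  exact (inner_restrict_restrict (HsTilde.ae_eq_zero hΩ v)).symm

/-- The zero extension `L²(Ω) → L²(ℝⁿ)`. -/
def extZero (Ω : Set (EuclideanSpace ℝ (Fin n))) : L2On Ω →L[ℝ] L2R n :=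
  ContinuousLinearMap.adjoint
    (LpToLpRestrictCLM (EuclideanSpace ℝ (Fin n)) ℝ ℝ volume 2 Ω : L2R n →L[ℝ] L2On Ω)

theorem extZero_restrict {g : L2R n} (hg : ∀ᵐ x, x ∉ Ω → g x = 0) :
    extZero Ω (LpToLpRestrictCLM (EuclideanSpace ℝ (Fin n)) ℝ ℝ volume 2 Ω g) = g := by
  refine ext_inner_right ℝ fun h => ?_
  rw [extZero, ContinuousLinearMap.adjoint_inner_left, inner_restrict_restrict hg]

theorem extZero_toL2 (hΩ : MeasurableSet Ω) (v : HsTilde s Ω) :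
    extZero Ω (HsTilde.toL2 s Ω v) = Hs.toL2 n s v :=
  extZero_restrict (HsTilde.ae_eq_zero hΩ v)

theorem ae_eq_zero_of_mem_L2Supported (hΩ : MeasurableSet Ω) {g : L2R n}
    (hg : g ∈ L2Supported Ω) : ∀ᵐ x, x ∉ Ω → g x = 0 := by
  have h0 : LpToLpRestrictCLM (EuclideanSpace ℝ (Fin n)) ℝ ℝ volume 2 Ωᶜ g = 0 := hg
  have h := LpToLpRestrictCLM_coeFn ℝ Ωᶜ g
  rw [h0] at h
  refine (ae_restrict_iff' hΩ.compl).1 ?_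
  filter_upwards [h, Lp.coeFn_zero ℝ 2 (volume.restrict Ωᶜ)] with x h1 h2
  rw [← h1, h2, Pi.zero_apply]

/-- The restriction of functionals from `Hˢ(ℝⁿ)` to `H̃ˢ(Ω)`. -/
def resDual (s : ℝ≥0) (Ω : Set (EuclideanSpace ℝ (Fin n))) :
    StrongDual ℝ (Hs n s) →L[ℝ] StrongDual ℝ (HsTilde s Ω) :=
  ContinuousLinearMap.precomp ℝ (HsTilde s Ω).subtypeL

theorem resDual_apply (f : StrongDual ℝ (Hs n s)) (v : HsTilde s Ω) :
    resDual s Ω f v = f v := rfl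

/-- The map `Hˢ(ℝⁿ) → H⁻ˢ(Ω)`, `u ↦ ⟨u, ·⟩_{L²(Ω)}`. -/
def pairing (s : ℝ≥0) (Ω : Set (EuclideanSpace ℝ (Fin n))) :
    Hs n s →L[ℝ] StrongDual ℝ (HsTilde s Ω) :=
  (dualEmb (HsTilde.toL2 s Ω)).comp (Hs.restrict s Ω)

theorem pairing_apply (u : Hs n s) (v : HsTilde s Ω) :
    pairing s Ω u v = inner ℝ (Hs.restrict s Ω u) (HsTilde.toL2 s Ω v) := rfl

/-- Elements of H̃ˢ(Ω) vanish outside Ω, so the L²(ℝⁿ) product with them is an L²(Ω) product. This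
makes the second time derivatives of the two Gelfand triples compatible. -/
theorem resDual_gelfandMap (hΩ : MeasurableSet Ω) (u : Hs n s) :
    resDual s Ω (gelfandMap (Hs.toL2 n s) u) = pairing s Ω u :=
  ContinuousLinearMap.ext fun v => inner_toL2_HsTilde hΩ u v

/-- The operator `(-Δ)ˢ : Hˢ(ℝⁿ) → H⁻ˢ(Ω)`. -/
def fracLap (s : ℝ≥0) (Ω : Set (EuclideanSpace ℝ (Fin n))) :
    Hs n s →L[ℝ] StrongDual ℝ (HsTilde s Ω) :=
  (resDual s Ω).comp (fracFormL n s)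

theorem fracLap_apply (u : Hs n s) (v : HsTilde s Ω) :
    fracLap s Ω u v = fracForm u v := by
  rw [fracLap, ContinuousLinearMap.comp_apply, resDual_apply, fracFormL_apply]

theorem fracLap_coercive (hΩ : MeasurableSet Ω) (v : HsTilde s Ω) :
    ((2 : ℝ) ^ (s : ℝ))⁻¹ * ‖v‖ ^ 2 ≤
      (fracLap s Ω).comp (HsTilde s Ω).subtypeL v v + 1 * ‖HsTilde.toL2 s Ω v‖ ^ 2 := by
  have h := Hs.norm_sq_le_fracForm (v : Hs n s)
  have h1 : ‖Hs.toL2 n s v‖ ^ 2 = ‖HsTilde.toL2 s Ω v‖ ^ 2 := by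
    rw [← real_inner_self_eq_norm_sq, ← real_inner_self_eq_norm_sq, inner_toL2_HsTilde hΩ]
    rfl
  rw [ContinuousLinearMap.comp_apply, Submodule.subtypeL_apply, fracLap_apply, one_mul, ← h1,
    inv_mul_le_iff₀ (by positivity)]
  exact h

end Functionals

/-! ### Traces and second time derivatives on `W̃_ext` -/

section Ext

variable {T : ℝ} {n : ℕ} {s : ℝ≥0} {Ω : Set (EuclideanSpace ℝ (Fin n))}

theorem hasInitialValue_zero {X : Type} [NormedAddCommGroup X] [NormedSpace ℝ X] {x : X} (hT : 0 < T)
    {u : L2T T X} (h : HasInitialValue T u x) (hu : u = 0) : x = 0 := by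
  subst hu
  exact h.unique hT ⟨0, continuousOn_const, Lp.coeFn_zero _ _ _, rfl⟩

theorem WStar.trace_mem (hT : 0 < T) (ψ : WStar T s Ω) :
    WTilde.trace hT (Hs.toL2 n s) (WStar.incl T s Ω ψ) ∈ HsTilde s Ω := by
  obtain ⟨x, hx, h⟩ : ∃ x ∈ HsTilde s Ω,
      HasInitialValue T (WTilde.fn T (Hs.toL2 n s) (WStar.incl T s Ω ψ)) x := ψ.2.1
  rwa [WTilde.hasInitialValue hT _ |>.unique hT h]

theorem WStar.velTrace_mem (hT : 0 < T) (ψ : WStar T s Ω) :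
    WTilde.velTrace hT (Hs.toL2_injective n s) (WStar.incl T s Ω ψ) ∈ L2Supported Ω := by
  obtain ⟨x, hx, h⟩ : ∃ x ∈ L2Supported Ω, HasInitialValue T ((Hs.toL2 n s).compLpL 2
      (timeMeasure T) (WTilde.dt T (Hs.toL2 n s) (WStar.incl T s Ω ψ))) x := ψ.2.2
  have h' := h.congr ((Hs.toL2 n s).coeFn_compLpL
    (WTilde.dt T (Hs.toL2 n s) (WStar.incl T s Ω ψ))).symm
  rwa [(WTilde.hasInitialValue_velocity hT (Hs.toL2_injective n s) _).unique hT h']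

/-- Initial values are unique, so membership is expressed by continuous trace maps. Hence the
subspace is closed and W̃_* is complete. -/
theorem mem_WStarSubmodule_iff (hT : 0 < T) (ψ : WRn T n s) : ψ ∈ WStarSubmodule T s Ω ↔
    WTilde.trace hT (Hs.toL2 n s) ψ ∈ HsTilde s Ω ∧
      WTilde.velTrace hT (Hs.toL2_injective n s) ψ ∈ L2Supported Ω := by
  refine ⟨fun h => ⟨WStar.trace_mem hT (⟨ψ, h⟩ : WStarSubmodule T s Ω),
    WStar.velTrace_mem hT (⟨ψ, h⟩ : WStarSubmodule T s Ω)⟩, fun h => ⟨?_, ?_⟩⟩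
  · exact ⟨_, h.1, WTilde.hasInitialValue hT ψ⟩
  · exact ⟨_, h.2, (WTilde.hasInitialValue_velocity hT (Hs.toL2_injective n s) ψ).congr
      ((Hs.toL2 n s).coeFn_compLpL _)⟩

theorem completeSpace_WStar (hT : 0 < T) : CompleteSpace (WStar T s Ω) := by
  have hcl : IsClosed (WStarSubmodule T s Ω : Set (WRn T n s)) := by
    have h : (WStarSubmodule T s Ω : Set (WRn T n s)) =
        WTilde.trace hT (Hs.toL2 n s) ⁻¹' (HsTilde s Ω) ∩
          WTilde.velTrace hT (Hs.toL2_injective n s) ⁻¹' (L2Supported Ω) := by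
      ext ψ
      exact mem_WStarSubmodule_iff hT ψ
    rw [h]
    exact ((Submodule.isClosed_topologicalClosure _).preimage
      (WTilde.trace hT (Hs.toL2 n s)).continuous).inter
      ((ContinuousLinearMap.isClosed_ker _).preimage
        (WTilde.velTrace hT (Hs.toL2_injective n s)).continuous)
  exact hcl.completeSpace_coe

theorem completeSpace_WExt (hT : 0 < T) : CompleteSpace (WExt T s Ω) :=
  haveI := completeSpace_WStar (s := s) (Ω := Ω) hT
  inferInstance

/-- The embedding of `W̃(0,T;H̃ˢ(Ω))` into `W̃_ext`. -/
def WOmega.toExt (T : ℝ) (s : ℝ≥0) (Ω : Set (EuclideanSpace ℝ (Fin n))) :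
    WOmega T s Ω →L[ℝ] WExt T s Ω :=
  (ImageSpace.mkL (sumMap T s Ω)).comp
    ((WithLp.prodContinuousLinearEquiv 1 ℝ _ _).symm.toContinuousLinearMap.comp
      (ContinuousLinearMap.inl ℝ _ _))

/-- The embedding of `W̃_*(0,T;Hˢ(ℝⁿ))` into `W̃_ext`. -/
def WStar.toExt (T : ℝ) (s : ℝ≥0) (Ω : Set (EuclideanSpace ℝ (Fin n))) :
    WStar T s Ω →L[ℝ] WExt T s Ω :=
  (ImageSpace.mkL (sumMap T s Ω)).comp
    ((WithLp.prodContinuousLinearEquiv 1 ℝ _ _).symm.toContinuousLinearMap.comp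
      (ContinuousLinearMap.inr ℝ _ _))

theorem WExt.mk_eq_add (x : WithLp 1 (WOmega T s Ω × WStar T s Ω)) :
    ImageSpace.mkL (sumMap T s Ω) x = WOmega.toExt T s Ω x.fst + WStar.toExt T s Ω x.snd := by
  change _ = ImageSpace.mkL _ (WithLp.toLp 1 (x.fst, 0)) + ImageSpace.mkL _ (WithLp.toLp 1 (0, x.snd))
  rw [← map_add]
  exact congrArg _ (WithLp.ofLp_injective 1 (Prod.ext (add_zero _).symm (zero_add _).symm))

theorem WExt.exists_eq_add (u : WExt T s Ω) : ∃ v ψ,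
    u = WOmega.toExt T s Ω v + WStar.toExt T s Ω ψ := by
  obtain ⟨x, rfl⟩ := ImageSpace.mkL_surjective _ u
  exact ⟨x.fst, x.snd, WExt.mk_eq_add x⟩

/-- `WExt.fn` as a continuous linear map. -/
def WExt.fnL (T : ℝ) (s : ℝ≥0) (Ω : Set (EuclideanSpace ℝ (Fin n))) :
    WExt T s Ω →L[ℝ] L2T T (Hs n s) :=
  (ContinuousLinearMap.fst ℝ _ _).comp (ImageSpace.valL (sumMap T s Ω))

/-- `WExt.dt` as a continuous linear map. -/
def WExt.dtL (T : ℝ) (s : ℝ≥0) (Ω : Set (EuclideanSpace ℝ (Fin n))) :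
    WExt T s Ω →L[ℝ] L2T T (Hs n s) :=
  (ContinuousLinearMap.snd ℝ _ _).comp (ImageSpace.valL (sumMap T s Ω))

theorem WExt.fnL_apply (u : WExt T s Ω) : WExt.fnL T s Ω u = WExt.fn u := rfl

theorem WExt.dtL_apply (u : WExt T s Ω) : WExt.dtL T s Ω u = WExt.dt u := rfl

theorem WExt.ext {u w : WExt T s Ω} (h1 : WExt.fn u = WExt.fn w) (h2 : WExt.dt u = WExt.dt w) :
    u = w :=
  ImageSpace.val_injective _ (Prod.ext h1 h2)

theorem WOmega.fn_toExt (v : WOmega T s Ω) : WExt.fn (WOmega.toExt T s Ω v) =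
    inclT T s Ω (WTilde.fn T (HsTilde.toL2 s Ω) v) := by
  change inclT T s Ω (WTilde.fn T (HsTilde.toL2 s Ω) v) +
    WTilde.fn T (Hs.toL2 n s) (WStar.incl T s Ω 0) = _
  rw [map_zero, map_zero, add_zero]

theorem WOmega.dt_toExt (v : WOmega T s Ω) : WExt.dt (WOmega.toExt T s Ω v) =
    inclT T s Ω (WTilde.dt T (HsTilde.toL2 s Ω) v) := by
  change inclT T s Ω (WTilde.dt T (HsTilde.toL2 s Ω) v) +
    WTilde.dt T (Hs.toL2 n s) (WStar.incl T s Ω 0) = _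
  rw [map_zero, map_zero, add_zero]

theorem WStar.fn_toExt (ψ : WStar T s Ω) : WExt.fn (WStar.toExt T s Ω ψ) =
    WTilde.fn T (Hs.toL2 n s) (WStar.incl T s Ω ψ) := by
  change inclT T s Ω (WTilde.fn T (HsTilde.toL2 s Ω) 0) +
    WTilde.fn T (Hs.toL2 n s) (WStar.incl T s Ω ψ) = _
  rw [map_zero, map_zero, zero_add]

theorem WStar.dt_toExt (ψ : WStar T s Ω) : WExt.dt (WStar.toExt T s Ω ψ) =
    WTilde.dt T (Hs.toL2 n s) (WStar.incl T s Ω ψ) := by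
  change inclT T s Ω (WTilde.dt T (HsTilde.toL2 s Ω) 0) +
    WTilde.dt T (Hs.toL2 n s) (WStar.incl T s Ω ψ) = _
  rw [map_zero, map_zero, zero_add]

theorem WExt.mem_weakDerivPairs (u : WExt T s Ω) :
    (WExt.fn u, WExt.dt u) ∈ weakDerivPairs T (Hs n s) := by
  obtain ⟨v, ψ, rfl⟩ := u.exists_eq_add
  have h1 := weakDerivPairs_clm (HsTilde s Ω).subtypeL (WTilde.mem_fn_dt v)
  have h2 := WTilde.mem_fn_dt (WStar.incl T s Ω ψ)
  have h := (weakDerivPairs T (Hs n s)).add_mem h1 h2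
  rw [← WExt.fnL_apply, ← WExt.dtL_apply, map_add, map_add, WExt.fnL_apply, WExt.dtL_apply,
    WExt.fnL_apply, WExt.dtL_apply, WOmega.fn_toExt, WOmega.dt_toExt, WStar.fn_toExt,
    WStar.dt_toExt]
  exact h

/-- A pair of compatible linear maps on `W̃(0,T;H̃ˢ(Ω))` and `W̃_*(0,T;Hˢ(ℝⁿ))` induces one on
the sum. -/
theorem WExt.exists_lift {Z : Type} [NormedAddCommGroup Z] [NormedSpace ℝ Z]
    (f : WOmega T s Ω →L[ℝ] Z) (g : WStar T s Ω →L[ℝ] Z)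
    (h : ∀ v ψ, WOmega.toExt T s Ω v + WStar.toExt T s Ω ψ = 0 → f v + g ψ = 0) :
    ∃ F : WExt T s Ω →L[ℝ] Z, (∀ v, F (WOmega.toExt T s Ω v) = f v) ∧
      ∀ ψ, F (WStar.toExt T s Ω ψ) = g ψ := by
  let k : WithLp 1 (WOmega T s Ω × WStar T s Ω) →L[ℝ] Z :=
    f.comp (WithLp.fstL 1 ℝ _ _) + g.comp (WithLp.sndL 1 ℝ _ _)
  have hk : ∀ x, sumMap T s Ω x = 0 → k x = 0 := by
    intro x hx
    apply h x.fst x.snd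
    have hx' : ImageSpace.mkL (sumMap T s Ω) x = 0 :=
      ImageSpace.val_injective _ (hx.trans (map_zero _).symm)
    rw [← WExt.mk_eq_add, hx']
  refine ⟨ImageSpace.lift k hk, fun v => ?_, fun ψ => ?_⟩
  · change f v + g 0 = f v
    rw [map_zero, add_zero]
  · change f 0 + g ψ = g ψ
    rw [map_zero, zero_add]

end Ext

/-! ### Initial data, second derivatives and exterior values on the sum space -/

section Ext

variable {T : ℝ} {n : ℕ} {s : ℝ≥0} {Ω : Set (EuclideanSpace ℝ (Fin n))}

theorem WExt.fn_add (u w : WExt T s Ω) : WExt.fn (u + w) = WExt.fn u + WExt.fn w :=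
  map_add (WExt.fnL T s Ω) u w

theorem WExt.dt_add (u w : WExt T s Ω) : WExt.dt (u + w) = WExt.dt u + WExt.dt w :=
  map_add (WExt.dtL T s Ω) u w

theorem inclT_coe (y : L2T T (HsTilde s Ω)) :
    inclT T s Ω y =ᵐ[timeMeasure T] fun t => (y t : Hs n s) :=
  (HsTilde s Ω).subtypeL.coeFn_compLpL y

/-- The traces of the two summands add up to the initial value of u itself, which does not depend on
the decomposition. It lies in H̃ˢ(Ω) by the definition of W̃_*. -/
theorem WExt.exists_trace (hT : 0 < T) : ∃ F : WExt T s Ω →L[ℝ] HsTilde s Ω,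
    (∀ v, F (WOmega.toExt T s Ω v) = WTilde.trace hT (HsTilde.toL2 s Ω) v) ∧
    ∀ u, HasInitialValue T (WExt.fn u) (F u : Hs n s) := by
  have key : ∀ (v : WOmega T s Ω) (ψ : WStar T s Ω),
      HasInitialValue T (WExt.fn (WOmega.toExt T s Ω v + WStar.toExt T s Ω ψ))
        ((WTilde.trace hT (HsTilde.toL2 s Ω) v : Hs n s) +
          WTilde.trace hT (Hs.toL2 n s) (WStar.incl T s Ω ψ)) := by
    intro v ψ
    have h1 := (WTilde.hasInitialValue hT v).clm (HsTilde s Ω).subtypeL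
    have h2 := WTilde.hasInitialValue hT (WStar.incl T s Ω ψ)
    refine (h1.add h2).congr ?_
    rw [WExt.fn_add, WOmega.fn_toExt, WStar.fn_toExt]
    filter_upwards [Lp.coeFn_add (inclT T s Ω (WTilde.fn T (HsTilde.toL2 s Ω) v))
      (WTilde.fn T (Hs.toL2 n s) (WStar.incl T s Ω ψ)),
      inclT_coe (WTilde.fn T (HsTilde.toL2 s Ω) v)] with t k1 k2
    rw [k1, Pi.add_apply, k2]
    rfl
  obtain ⟨F, hF1, hF2⟩ := WExt.exists_lift (WTilde.trace hT (HsTilde.toL2 s Ω))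
    (((WTilde.trace hT (Hs.toL2 n s)).comp (WStar.incl T s Ω)).codRestrict (HsTilde s Ω)
      (WStar.trace_mem hT)) fun v ψ h => by
      apply Subtype.ext
      refine hasInitialValue_zero hT (key v ψ) ?_
      rw [h]
      exact map_zero (WExt.fnL T s Ω)
  refine ⟨F, hF1, fun u => ?_⟩
  obtain ⟨v, ψ, rfl⟩ := u.exists_eq_add
  rw [map_add, hF1, hF2]
  exact key v ψ

/-- Uniqueness of initial values in L²(Ω) again gives independence of the decomposition. As ∂ₜψ(0)
vanishes outside Ω, zero extension recovers the initial velocity in L²(ℝⁿ). -/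
theorem WExt.exists_velTrace (hΩ : MeasurableSet Ω) (hT : 0 < T) :
    ∃ F : WExt T s Ω →L[ℝ] L2On Ω,
      (∀ v, F (WOmega.toExt T s Ω v) = WTilde.velTrace hT (HsTilde.toL2_injective hΩ) v) ∧
      (∀ u, HasInitialValue T (fun t => Hs.restrict s Ω (WExt.dt u t)) (F u)) ∧
      ∀ u, HasInitialValue T (fun t => Hs.toL2 n s (WExt.dt u t)) (extZero Ω (F u)) := by
  let R : L2R n →L[ℝ] L2On Ω := LpToLpRestrictCLM (EuclideanSpace ℝ (Fin n)) ℝ ℝ volume 2 Ω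
  have hdt : ∀ (v : WOmega T s Ω) (ψ : WStar T s Ω),
      WExt.dt (WOmega.toExt T s Ω v + WStar.toExt T s Ω ψ) =ᵐ[timeMeasure T] fun t =>
        (WTilde.dt T (HsTilde.toL2 s Ω) v t : Hs n s) +
          WTilde.dt T (Hs.toL2 n s) (WStar.incl T s Ω ψ) t := by
    intro v ψ
    rw [WExt.dt_add, WOmega.dt_toExt, WStar.dt_toExt]
    filter_upwards [Lp.coeFn_add (inclT T s Ω (WTilde.dt T (HsTilde.toL2 s Ω) v))
      (WTilde.dt T (Hs.toL2 n s) (WStar.incl T s Ω ψ)),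
      inclT_coe (WTilde.dt T (HsTilde.toL2 s Ω) v)] with t k1 k2
    rw [k1, Pi.add_apply, k2]
  have key : ∀ (v : WOmega T s Ω) (ψ : WStar T s Ω),
      HasInitialValue T (fun t => Hs.restrict s Ω
        (WExt.dt (WOmega.toExt T s Ω v + WStar.toExt T s Ω ψ) t))
        (WTilde.velTrace hT (HsTilde.toL2_injective hΩ) v +
          R (WTilde.velTrace hT (Hs.toL2_injective n s) (WStar.incl T s Ω ψ))) := by
    intro v ψ
    have h1 := WTilde.hasInitialValue_velocity hT (HsTilde.toL2_injective hΩ) v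
    have h2 := (WTilde.hasInitialValue_velocity hT (Hs.toL2_injective n s)
      (WStar.incl T s Ω ψ)).clm R
    refine (h1.add h2).congr ?_
    filter_upwards [hdt v ψ] with t k1
    rw [k1, map_add]
    rfl
  have key' : ∀ (v : WOmega T s Ω) (ψ : WStar T s Ω),
      HasInitialValue T (fun t => Hs.toL2 n s
        (WExt.dt (WOmega.toExt T s Ω v + WStar.toExt T s Ω ψ) t))
        (extZero Ω (WTilde.velTrace hT (HsTilde.toL2_injective hΩ) v) +
          WTilde.velTrace hT (Hs.toL2_injective n s) (WStar.incl T s Ω ψ)) := by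
    intro v ψ
    have h1 := (WTilde.hasInitialValue_velocity hT (HsTilde.toL2_injective hΩ) v).clm (extZero Ω)
    have h2 := WTilde.hasInitialValue_velocity hT (Hs.toL2_injective n s) (WStar.incl T s Ω ψ)
    refine (h1.add h2).congr ?_
    filter_upwards [hdt v ψ] with t k1
    rw [k1, map_add, extZero_toL2 hΩ]
  obtain ⟨F, hF1, hF2⟩ := WExt.exists_lift (WTilde.velTrace hT (HsTilde.toL2_injective hΩ))
    (R.comp ((WTilde.velTrace hT (Hs.toL2_injective n s)).comp (WStar.incl T s Ω))) fun v ψ h => by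
      have h0 := key v ψ
      refine h0.unique hT ⟨0, continuousOn_const, ?_, rfl⟩
      rw [h]
      have h1 : WExt.dt (0 : WExt T s Ω) = 0 := map_zero (WExt.dtL T s Ω)
      rw [h1]
      filter_upwards [Lp.coeFn_zero (Hs n s) 2 (timeMeasure T)] with t k1
      rw [k1, Pi.zero_apply, map_zero, Pi.zero_apply]
  refine ⟨F, hF1, fun u => ?_, fun u => ?_⟩
  · obtain ⟨v, ψ, rfl⟩ := u.exists_eq_add
    rw [map_add, hF1, hF2]
    exact key v ψ
  · obtain ⟨v, ψ, rfl⟩ := u.exists_eq_add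
    rw [map_add, hF1, hF2, map_add]
    have h : extZero Ω (R (WTilde.velTrace hT (Hs.toL2_injective n s) (WStar.incl T s Ω ψ))) =
        WTilde.velTrace hT (Hs.toL2_injective n s) (WStar.incl T s Ω ψ) :=
      extZero_restrict (ae_eq_zero_of_mem_L2Supported hΩ (WStar.velTrace_mem hT ψ))
    change HasInitialValue T _ (_ + extZero Ω (R (WTilde.velTrace hT (Hs.toL2_injective n s)
      (WStar.incl T s Ω ψ))))
    rw [h]
    exact key' v ψ

/-- The map `u ↦ ⟨u(t), ·⟩_{L²(Ω)}` from `L²(0,T;Hˢ(ℝⁿ))` to `L²(0,T;H⁻ˢ(Ω))`. -/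
def pairingT (T : ℝ) (s : ℝ≥0) (Ω : Set (EuclideanSpace ℝ (Fin n))) :
    L2T T (Hs n s) →L[ℝ] L2T T (StrongDual ℝ (HsTilde s Ω)) :=
  (pairing s Ω).compLpL 2 (timeMeasure T)

theorem weakDerivPairs_add (X : Type) [NormedAddCommGroup X] [NormedSpace ℝ X]
    {u w u' w' : L2T T X} (h : (u, w) ∈ weakDerivPairs T X) (h' : (u', w') ∈ weakDerivPairs T X) :
    (u + u', w + w') ∈ weakDerivPairs T X :=
  (weakDerivPairs T X).add_mem h h'

theorem coeFn_compL2T (X Y : Type) [NormedAddCommGroup X] [NormedSpace ℝ X]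
    [NormedAddCommGroup Y] [NormedSpace ℝ Y] (A : X →L[ℝ] Y) (u : L2T T X) :
    A.compLpL 2 (timeMeasure T) u =ᵐ[timeMeasure T] fun t => A (u t) :=
  A.coeFn_compLpL u

/-- The map `L²(0,T;H⁻ˢ(ℝⁿ)) → L²(0,T;H⁻ˢ(Ω))` given by the restriction of functionals. -/
def resDualT (T : ℝ) (s : ℝ≥0) (Ω : Set (EuclideanSpace ℝ (Fin n))) :
    L2T T (StrongDual ℝ (Hs n s)) →L[ℝ] L2T T (StrongDual ℝ (HsTilde s Ω)) :=
  (resDual s Ω).compLpL 2 (timeMeasure T)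

theorem resDualT_gelfandMap (hΩ : MeasurableSet Ω) (w : L2T T (Hs n s)) :
    resDualT T s Ω ((gelfandMap (Hs.toL2 n s)).compLpL 2 (timeMeasure T) w) =
      pairingT T s Ω w := by
  have h1 := coeFn_compL2T (StrongDual ℝ (Hs n s)) (StrongDual ℝ (HsTilde s Ω)) (resDual s Ω)
    ((gelfandMap (Hs.toL2 n s)).compLpL 2 (timeMeasure T) w)
  have h2 := coeFn_compL2T (Hs n s) (StrongDual ℝ (Hs n s)) (gelfandMap (Hs.toL2 n s)) w
  have h3 := coeFn_compL2T (Hs n s) (StrongDual ℝ (HsTilde s Ω)) (pairing s Ω) w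
  apply Lp.ext
  filter_upwards [h1, h2, h3] with t k1 k2 k3
  exact k1.trans ((congrArg _ k2).trans ((resDual_gelfandMap hΩ (w t)).trans k3.symm))

theorem pairingT_inclT (y : L2T T (HsTilde s Ω)) :
    pairingT T s Ω (inclT T s Ω y) =
      ((gelfandMap (HsTilde.toL2 s Ω)).compLpL 2 (timeMeasure T) :
        L2T T (HsTilde s Ω) →L[ℝ] L2T T (StrongDual ℝ (HsTilde s Ω))) y := by
  have h1 := coeFn_compL2T (Hs n s) (StrongDual ℝ (HsTilde s Ω)) (pairing s Ω) (inclT T s Ω y)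
  have h2 := coeFn_compL2T (HsTilde s Ω) (StrongDual ℝ (HsTilde s Ω))
    (gelfandMap (HsTilde.toL2 s Ω)) y
  apply Lp.ext
  filter_upwards [h1, h2, inclT_coe y] with t k1 k2 k3
  exact k1.trans ((congrArg _ k3).trans k2.symm)

theorem WStar.mem_weakDerivPairs (hΩ : MeasurableSet Ω) (ψ : WRn T n s) :
    (pairingT T s Ω (WTilde.dt T (Hs.toL2 n s) ψ),
      resDualT T s Ω (WTilde.dtt T (Hs.toL2 n s) ψ)) ∈
      weakDerivPairs T (StrongDual ℝ (HsTilde s Ω)) := by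
  have h := weakDerivPairs_clm (X := StrongDual ℝ (Hs n s))
    (Y := StrongDual ℝ (HsTilde s Ω)) (resDual s Ω) ψ.mem_dt_dtt
  rw [← resDualT_gelfandMap hΩ]
  exact h

/-- Restricted to H̃ˢ(Ω), the second derivatives of both summands are weak derivatives of ⟨∂ₜu,
·⟩_{L²(Ω)} parts in the same dual space. Uniqueness of weak derivatives makes the sum independent of
the decomposition. -/
theorem WExt.exists_dtt (hΩ : MeasurableSet Ω) :
    ∃ F : WExt T s Ω →L[ℝ] L2T T (StrongDual ℝ (HsTilde s Ω)),
      (∀ v, F (WOmega.toExt T s Ω v) = WTilde.dtt T (HsTilde.toL2 s Ω) v) ∧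
      ∀ u : WExt T s Ω, (pairingT T s Ω (WExt.dt u), F u) ∈
        weakDerivPairs T (StrongDual ℝ (HsTilde s Ω)) := by
  have key : ∀ (v : WOmega T s Ω) (ψ : WStar T s Ω),
      (pairingT T s Ω (WExt.dt (WOmega.toExt T s Ω v + WStar.toExt T s Ω ψ)),
        WTilde.dtt T (HsTilde.toL2 s Ω) v +
          resDualT T s Ω (WTilde.dtt T (Hs.toL2 n s) (WStar.incl T s Ω ψ))) ∈
        weakDerivPairs T (StrongDual ℝ (HsTilde s Ω)) := by
    intro v ψ
    rw [WExt.dt_add, WOmega.dt_toExt, WStar.dt_toExt, map_add, pairingT_inclT]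
    exact weakDerivPairs_add (StrongDual ℝ (HsTilde s Ω)) (WTilde.mem_dt_dtt v)
      (WStar.mem_weakDerivPairs hΩ (WStar.incl T s Ω ψ))
  obtain ⟨F, hF1, hF2⟩ := WExt.exists_lift (WTilde.dtt T (HsTilde.toL2 s Ω))
    ((resDualT T s Ω).comp ((WTilde.dtt T (Hs.toL2 n s)).comp (WStar.incl T s Ω))) fun v ψ h => by
      have h1 : WExt.dt (0 : WExt T s Ω) = 0 := map_zero (WExt.dtL T s Ω)
      have h0 := key v ψ
      rw [h, h1, map_zero] at h0
      exact weakDerivPairs_unique h0 (weakDerivPairs T (StrongDual ℝ (HsTilde s Ω))).zero_mem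
  refine ⟨F, hF1, fun u => ?_⟩
  obtain ⟨v, ψ, rfl⟩ := u.exists_eq_add
  rw [map_add, hF1, hF2]
  exact key v ψ

theorem restrictExt_toExt (hΩ : MeasurableSet Ω) (v : WOmega T s Ω) :
    restrictExt T s Ω (WExt.fn (WOmega.toExt T s Ω v)) = 0 := by
  rw [WOmega.fn_toExt, restrictExt, inclT, compLpL_compLpL]
  have h : (Hs.restrict s (exterior Ω)).comp (HsTilde s Ω).subtypeL = 0 := by
    ext1 v
    rw [zero_apply, ContinuousLinearMap.comp_apply]
    apply Lp.ext
    have h1 : ∀ᵐ x ∂(volume.restrict (exterior Ω)), x ∉ Ω := by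
      filter_upwards [ae_restrict_mem isClosed_closure.isOpen_compl.measurableSet] with x hx hx'
      exact hx (subset_closure hx')
    filter_upwards [Hs.coeFn_restrict (exterior Ω) (v : Hs n s),
      ae_restrict_of_ae (HsTilde.ae_eq_zero hΩ v), h1,
      Lp.coeFn_zero ℝ 2 (volume.restrict (exterior Ω))] with x h2 h3 h4 h5
    rw [Submodule.subtypeL_apply, h2, h3 h4, h5, Pi.zero_apply]
  rw [h]
  apply Lp.ext
  filter_upwards [ContinuousLinearMap.coeFn_compLpL (p := 2) (μ := timeMeasure T)
    (0 : HsTilde s Ω →L[ℝ] L2On (exterior Ω)) (WTilde.fn T (HsTilde.toL2 s Ω) v),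
    Lp.coeFn_zero (L2On (exterior Ω)) 2 (timeMeasure T)] with t h1 h2
  rw [h1, h2, zero_apply, Pi.zero_apply]

/-- At almost every time u(t) vanishes in the exterior, hence lies in H̃ˢ(Ω) by
`mem_HsTilde_of_ae_eq_zero`. The orthogonal projection onto H̃ˢ(Ω) commutes with ∂ₜ and fixes u, so
∂ₜu also takes values there. The second derivative comes from `WExt.exists_dtt`. -/
theorem WExt.exists_eq_toExt (hΩ : IsBoundedLipschitzDomain Ω) {u : WExt T s Ω}
    (hu : restrictExt T s Ω (WExt.fn u) = 0) : ∃ v, u = WOmega.toExt T s Ω v := by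
  obtain ⟨F, -, hF⟩ := WExt.exists_dtt (T := T) (s := s) hΩ.isOpen.measurableSet
  have hmem : ∀ᵐ t ∂(timeMeasure T), WExt.fn u t ∈ HsTilde s Ω := by
    have h1 : restrictExt T s Ω (WExt.fn u) =ᵐ[timeMeasure T] fun t =>
        Hs.restrict s (exterior Ω) (WExt.fn u t) :=
      (Hs.restrict s (exterior Ω)).coeFn_compLpL (WExt.fn u)
    rw [hu] at h1
    filter_upwards [h1, Lp.coeFn_zero (L2On (exterior Ω)) 2 (timeMeasure T)] with t h2 h3
    apply mem_HsTilde_of_ae_eq_zero hΩ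
    refine (ae_restrict_iff' isClosed_closure.isOpen_compl.measurableSet).1 ?_
    have h4 := Hs.coeFn_restrict (exterior Ω) (WExt.fn u t)
    rw [← h2, h3] at h4
    filter_upwards [h4, Lp.coeFn_zero ℝ 2 (volume.restrict (exterior Ω))] with x h5 h6
    rw [← h5, Pi.zero_apply, h6, Pi.zero_apply]
  let P : Hs n s →L[ℝ] HsTilde s Ω := (HsTilde s Ω).orthogonalProjectionOnto
  have hp := weakDerivPairs_clm P u.mem_weakDerivPairs
  have h1 : inclT T s Ω (P.compLpL 2 (timeMeasure T) (WExt.fn u)) = WExt.fn u := by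
    apply Lp.ext
    filter_upwards [inclT_coe (P.compLpL 2 (timeMeasure T) (WExt.fn u)),
      P.coeFn_compLpL (WExt.fn u), hmem] with t k1 k2 k3
    rw [k1, k2]
    exact Submodule.starProjection_eq_self_iff.2 k3
  have h2 : inclT T s Ω (P.compLpL 2 (timeMeasure T) (WExt.dt u)) = WExt.dt u := by
    refine weakDerivPairs_unique ?_ u.mem_weakDerivPairs
    have := weakDerivPairs_clm (HsTilde s Ω).subtypeL hp
    rw [← h1]
    exact this
  have h3 : (((gelfandMap (HsTilde.toL2 s Ω)).compLpL 2 (timeMeasure T) :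
      L2T T (HsTilde s Ω) →L[ℝ] L2T T (StrongDual ℝ (HsTilde s Ω)))
      (P.compLpL 2 (timeMeasure T) (WExt.dt u)), F u) ∈
      weakDerivPairs T (StrongDual ℝ (HsTilde s Ω)) := by
    rw [← pairingT_inclT, h2]
    exact hF u
  refine ⟨WTilde.mk hp h3, WExt.ext ?_ ?_⟩
  · rw [WOmega.fn_toExt, WTilde.fn_mk, h1]
  · rw [WOmega.dt_toExt, WTilde.dt_mk, h2]

end Ext

/-! ### The linear problem with exterior values and the superposition operator on `WExt` -/

theorem waveOp_snd_snd {T : ℝ} {V H : Type} [NormedAddCommGroup V] [InnerProductSpace ℝ V]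
    [CompleteSpace V] [NormedAddCommGroup H] [InnerProductSpace ℝ H] [CompleteSpace H]
    {ι : V →L[ℝ] H} (hT : 0 < T) (hι : Function.Injective ι) (a b : V →L[ℝ] StrongDual ℝ V)
    (u : WTilde T ι) : (waveOp hT hι a b u).2.2 = WTilde.dtt T ι u +
      a.compLpL 2 (timeMeasure T) (WTilde.dt T ι u) +
        b.compLpL 2 (timeMeasure T) (WTilde.fn T ι u) := rfl

theorem exists_waveOp_inverse {T : ℝ} {V H : Type} [NormedAddCommGroup V]
    [InnerProductSpace ℝ V] [CompleteSpace V] [NormedAddCommGroup H] [InnerProductSpace ℝ H]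
    [CompleteSpace H] {ι : V →L[ℝ] H} (hT : 0 < T) (hι : Function.Injective ι)
    (hd : DenseRange ι) (a b : V →L[ℝ] StrongDual ℝ V) {α C : ℝ} (hα : 0 < α)
    (ha : ∀ v, α * ‖v‖ ^ 2 ≤ a v v + C * ‖ι v‖ ^ 2) :
    ∃ K : V × H × L2T T (StrongDual ℝ V) →L[ℝ] WTilde T ι,
      (∀ y, waveOp hT hι a b (K y) = y) ∧ ∀ u, waveOp hT hι a b u = 0 → u = 0 := by
  have hW := waveOp_bijective hT hι hd a b hα ha
  let e := ContinuousLinearEquiv.ofBijective (waveOp hT hι a b)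
    (LinearMap.ker_eq_bot.2 hW.1) (LinearMap.range_eq_top.2 hW.2)
  exact ⟨e.symm.toContinuousLinearMap, e.apply_symm_apply,
    fun u hu => hW.1 (hu.trans (map_zero _).symm)⟩

section Ext

variable {T : ℝ} {n : ℕ} {s : ℝ≥0} {Ω : Set (EuclideanSpace ℝ (Fin n))}

theorem compLpL_inclT (A : Hs n s →L[ℝ] StrongDual ℝ (HsTilde s Ω)) (y : L2T T (HsTilde s Ω)) :
    (A.compLpL 2 (timeMeasure T) :
        L2T T (Hs n s) →L[ℝ] L2T T (StrongDual ℝ (HsTilde s Ω))) (inclT T s Ω y) =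
      ((A.comp (HsTilde s Ω).subtypeL).compLpL 2 (timeMeasure T) :
        L2T T (HsTilde s Ω) →L[ℝ] L2T T (StrongDual ℝ (HsTilde s Ω))) y := by
  have h1 := coeFn_compL2T (Hs n s) (StrongDual ℝ (HsTilde s Ω)) A (inclT T s Ω y)
  have h2 := coeFn_compL2T (HsTilde s Ω) (StrongDual ℝ (HsTilde s Ω))
    (A.comp (HsTilde s Ω).subtypeL) y
  apply Lp.ext
  filter_upwards [h1, h2, inclT_coe y] with t k1 k2 k3
  exact k1.trans ((congrArg _ k3).trans k2.symm)

/-- `∂ₜ²u + (-Δ)ˢ∂ₜu + B u` on `W̃_ext` together with the initial values, its right inverse with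
zero exterior values, and the solution operator for given exterior values. -/
theorem WExt.exists_waveOp (hΩ : IsBoundedLipschitzDomain Ω) (hT : 0 < T)
    (B : Hs n s →L[ℝ] StrongDual ℝ (HsTilde s Ω))
    (AT BT : L2T T (Hs n s) →L[ℝ] L2T T (StrongDual ℝ (HsTilde s Ω)))
    (hAT : AT = (fracLap s Ω).compLpL 2 (timeMeasure T))
    (hBT : BT = B.compLpL 2 (timeMeasure T)) :
    ∃ (Φ : WExt T s Ω →L[ℝ] HsTilde s Ω × L2On Ω × L2T T (StrongDual ℝ (HsTilde s Ω)))
      (K : HsTilde s Ω × L2On Ω × L2T T (StrongDual ℝ (HsTilde s Ω)) →L[ℝ] WExt T s Ω)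
      (L : WRest T s Ω →L[ℝ] WExt T s Ω),
      (∀ u, HasInitialValue T (WExt.fn u) ((Φ u).1 : Hs n s)) ∧
      (∀ u, HasInitialValue T (fun t => Hs.restrict s Ω (WExt.dt u t)) (Φ u).2.1) ∧
      (∀ u, HasInitialValue T (fun t => Hs.toL2 n s (WExt.dt u t)) (extZero Ω (Φ u).2.1)) ∧
      (∀ u : WExt T s Ω, (pairingT T s Ω (WExt.dt u),
        (Φ u).2.2 - (AT (WExt.dt u) + BT (WExt.fn u))) ∈
        weakDerivPairs T (StrongDual ℝ (HsTilde s Ω))) ∧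
      (∀ y, Φ (K y) = y ∧ restrictExt T s Ω (WExt.fn (K y)) = 0) ∧
      (∀ φ, Φ (L φ) = 0 ∧ restrictExt T s Ω (WExt.fn (L φ)) = WRest.fn φ) ∧
      ∀ u, restrictExt T s Ω (WExt.fn u) = 0 → Φ u = 0 → u = 0 := by
  have hm := hΩ.isOpen.measurableSet
  obtain ⟨F₀, hF₀, hF₀'⟩ := WExt.exists_trace (T := T) (s := s) (Ω := Ω) hT
  obtain ⟨F₁, hF₁, hF₁', hF₁''⟩ := WExt.exists_velTrace (T := T) (s := s) hm hT
  obtain ⟨F₂, hF₂, hF₂'⟩ := WExt.exists_dtt (T := T) (s := s) hm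
  let W := waveOp hT (HsTilde.toL2_injective (s := s) hm)
    ((fracLap s Ω).comp (HsTilde s Ω).subtypeL) (B.comp (HsTilde s Ω).subtypeL)
  obtain ⟨K₀, hK₀, hW⟩ : ∃ K₀ : HsTilde s Ω × L2On Ω × L2T T (StrongDual ℝ (HsTilde s Ω)) →L[ℝ]
      WOmega T s Ω, (∀ y, W (K₀ y) = y) ∧ ∀ v, W v = 0 → v = 0 :=
    exists_waveOp_inverse hT (HsTilde.toL2_injective hm)
      (HsTilde.denseRange_toL2 hΩ.isOpen) _ _ (by positivity) (fracLap_coercive hm)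
  let Φ : WExt T s Ω →L[ℝ] HsTilde s Ω × L2On Ω × L2T T (StrongDual ℝ (HsTilde s Ω)) :=
    F₀.prod (F₁.prod (F₂ + (AT.comp (WExt.dtL T s Ω) + BT.comp (WExt.fnL T s Ω))))
  have hΦ : ∀ v, Φ (WOmega.toExt T s Ω v) = W v := by
    intro v
    refine Prod.ext (hF₀ v) (Prod.ext (hF₁ v) ?_)
    change F₂ (WOmega.toExt T s Ω v) + (AT (WExt.dt (WOmega.toExt T s Ω v)) +
      BT (WExt.fn (WOmega.toExt T s Ω v))) = _
    rw [hF₂, WOmega.dt_toExt, WOmega.fn_toExt, hAT, hBT, compLpL_inclT, compLpL_inclT, ← add_assoc]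
    exact (waveOp_snd_snd hT _ _ _ v).symm
  let K := (WOmega.toExt T s Ω).comp K₀
  have hK : ∀ y, Φ (K y) = y ∧ restrictExt T s Ω (WExt.fn (K y)) = 0 := fun y =>
    ⟨(hΦ _).trans (hK₀ y), restrictExt_toExt hm _⟩
  -- Zero exterior values bring u back to W̃(0,T;H̃ˢ(Ω)), where the wave operator is injective.
  have huniq : ∀ u, restrictExt T s Ω (WExt.fn u) = 0 → Φ u = 0 → u = 0 := by
    intro u hu h
    obtain ⟨v, rfl⟩ := WExt.exists_eq_toExt hΩ hu
    have hv : v = 0 := hW v ((hΦ v).symm.trans h)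
    rw [hv, map_zero]
  let ρ : WExt T s Ω →L[ℝ] L2T T (L2On (exterior Ω)) :=
    (restrictExt T s Ω).comp (WExt.fnL T s Ω)
  -- Subtracting KΦψ from an extension ψ removes all data and forces without changing the exterior
  -- values.
  let L₀ : WStar T s Ω →L[ℝ] WExt T s Ω :=
    WStar.toExt T s Ω - K.comp (Φ.comp (WStar.toExt T s Ω))
  have hL₀ : ∀ ψ, Φ (L₀ ψ) = 0 := by
    intro ψ
    change Φ (WStar.toExt T s Ω ψ - K (Φ (WStar.toExt T s Ω ψ))) = 0
    rw [map_sub, (hK _).1, sub_self]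
  have hL₀' : ∀ ψ, ρ (L₀ ψ) = WStar.restrictExt T s Ω ψ := by
    intro ψ
    change ρ (WStar.toExt T s Ω ψ - K (Φ (WStar.toExt T s Ω ψ))) = _
    have h : ρ (K (Φ (WStar.toExt T s Ω ψ))) = 0 := (hK _).2
    rw [map_sub, h, sub_zero]
    exact congrArg (restrictExt T s Ω) (WStar.fn_toExt ψ)
  -- By uniqueness the result depends only on the exterior values of ψ, so it descends to the
  -- quotient.
  let L : WRest T s Ω →L[ℝ] WExt T s Ω :=
    ImageSpace.lift L₀ fun ψ hψ => huniq _ ((hL₀' ψ).trans hψ) (hL₀ ψ)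
  refine ⟨Φ, K, L, hF₀', hF₁', hF₁'', fun u => ?_, hK, fun φ => ?_, huniq⟩
  · have : (Φ u).2.2 - (AT (WExt.dt u) + BT (WExt.fn u)) = F₂ u := add_sub_cancel_right _ _
    rw [this]
    exact hF₂' u
  · obtain ⟨ψ, rfl⟩ := ImageSpace.mkL_surjective _ φ
    exact ⟨hL₀ ψ, hL₀' ψ⟩

/-- The superposition operator of a `C¹` map `N : Hˢ(ℝⁿ) → L²(Ω)` on `W̃_ext`. -/
theorem WExt.exists_superposition (hT : 0 < T) {N : Hs n s → L2On Ω} (hN : ContDiff ℝ 1 N)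
    (hN0 : N 0 = 0) (hN' : fderiv ℝ N 0 = 0) :
    ∃ M : WExt T s Ω → L2T T (StrongDual ℝ (HsTilde s Ω)), ContDiff ℝ 1 M ∧ M 0 = 0 ∧
      HasFDerivAt M (0 : WExt T s Ω →L[ℝ] L2T T (StrongDual ℝ (HsTilde s Ω))) 0 ∧
      ∀ u, M u =ᵐ[timeMeasure T] fun t => dualEmb (HsTilde.toL2 s Ω) (N (WExt.fn u t)) := by
  let G : C(Icc 0 T, Hs n s) → C(Icc 0 T, L2On Ω) := fun c =>
    (⟨N, hN.continuous⟩ : C(Hs n s, L2On Ω)).comp c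
  let D : L2T T (L2On Ω) →L[ℝ] L2T T (StrongDual ℝ (HsTilde s Ω)) :=
    (dualEmb (HsTilde.toL2 s Ω)).compLpL 2 (timeMeasure T)
  -- Continuous representatives in time are used because composition with a C¹ map is C¹ for the sup
  -- norm, with no growth condition on N.
  let R : WExt T s Ω →L[ℝ] C(Icc 0 T, Hs n s) :=
    (repC hT (Hs n s)).comp (ImageSpace.valL (sumMap T s Ω))
  let D' : C(Icc 0 T, L2On Ω) →L[ℝ] L2T T (StrongDual ℝ (HsTilde s Ω)) := D.comp (toL2T hT (L2On Ω))
  have hG : ContDiff ℝ 1 G := contDiff_postcomp hN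
  have hG0 : G 0 = 0 := by
    ext1 t
    exact hN0
  have hG' : HasFDerivAt G (0 : C(Icc 0 T, Hs n s) →L[ℝ] C(Icc 0 T, L2On Ω)) 0 := by
    have h := hasFDerivAt_postcomp (K := Icc 0 T) hN 0
    convert! h using 1
    ext1 c
    ext1 t
    change (0 : L2On Ω) = fderiv ℝ N 0 (c t)
    rw [hN', zero_apply]
  refine ⟨fun u => D' (G (R u)), D'.contDiff.comp (hG.comp R.contDiff), ?_, ?_, fun u => ?_⟩
  · simp only [map_zero, hG0]
  · have h1 : HasFDerivAt G (0 : C(Icc 0 T, Hs n s) →L[ℝ] C(Icc 0 T, L2On Ω)) (R 0) := by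
      rwa [map_zero]
    have h := D'.hasFDerivAt.comp (0 : WExt T s Ω) (h1.comp (0 : WExt T s Ω) R.hasFDerivAt)
    rw [ContinuousLinearMap.zero_comp, ContinuousLinearMap.comp_zero] at h
    exact h
  · have hR : toL2T hT (Hs n s) (R u) = WExt.fn u := toL2T_repC hT u.mem_weakDerivPairs
    have h1 := coeFn_compL2T (L2On Ω) (StrongDual ℝ (HsTilde s Ω)) (dualEmb (HsTilde.toL2 s Ω))
      (toL2T hT (L2On Ω) (G (R u)))
    have h2 := toL2T_coe hT (R u)
    rw [hR] at h2
    filter_upwards [h1, h2, toL2T_coe hT (G (R u))] with t k1 k2 k3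
    refine k1.trans ?_
    rw [k2, k3]
    rfl

end Ext

/-! ### The weak formulation as an operator equation -/

/-- Since q = ∂ₜp, the left side for v and η is ∫η(q+g) evaluated at v. Letting v and then η vary
gives q + g = 0 in L²(0,T;V'). -/
theorem forall_weak_iff {T : ℝ} {V : Type} [NormedAddCommGroup V] [NormedSpace ℝ V]
    {p q g : L2T T (StrongDual ℝ V)} (hpq : (p, q) ∈ weakDerivPairs T (StrongDual ℝ V)) :
    (∀ v : V, ∀ η : ℝ → ℝ, IsTimeTest T η → -(∫ t, deriv η t * p t v ∂(timeMeasure T)) +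
      ∫ t, η t * g t v ∂(timeMeasure T) = 0) ↔ q + g = 0 := by
  have key : ∀ v : V, ∀ η : ℝ → ℝ, IsTimeTest T η →
      -(∫ t, deriv η t * p t v ∂(timeMeasure T)) + ∫ t, η t * g t v ∂(timeMeasure T) =
        (∫ t, η t • (q + g) t ∂(timeMeasure T)) v := by
    intro v η hη
    have h1 : ∫ t, deriv η t * p t v ∂(timeMeasure T) =
        (∫ t, deriv η t • p t ∂(timeMeasure T)) v :=
      (ContinuousLinearMap.integral_apply (hη.integrable_deriv_smul p) v).symm
    have h2 : ∫ t, η t * g t v ∂(timeMeasure T) = (∫ t, η t • g t ∂(timeMeasure T)) v :=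
      (ContinuousLinearMap.integral_apply (hη.integrable_smul g) v).symm
    have h3 : ∫ t, η t • (q + g) t ∂(timeMeasure T) =
        ∫ t, η t • q t ∂(timeMeasure T) + ∫ t, η t • g t ∂(timeMeasure T) := by
      rw [← integral_add (hη.integrable_smul q) (hη.integrable_smul g)]
      apply integral_congr_ae
      filter_upwards [Lp.coeFn_add q g] with t ht
      rw [ht, Pi.add_apply, smul_add]
    have h4 : ∫ t, deriv η t • p t ∂(timeMeasure T) = -∫ t, η t • q t ∂(timeMeasure T) := hpq η hη
    rw [h1, h2, h3, h4, neg_apply, neg_neg, add_apply]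
  constructor
  · intro h
    apply Lp.ext
    refine (ae_eq_zero_of_forall_timeTest (integrable_L2T _) fun η hη => ?_).trans
      (Lp.coeFn_zero _ _ _).symm
    ext1 v
    rw [← key v η hη, h v η hη, zero_apply]
  · intro h v η hη
    rw [key v η hη, h]
    have h0 : ∫ t, η t • ((0 : L2T T (StrongDual ℝ V)) : ℝ → StrongDual ℝ V) t ∂(timeMeasure T) =
        0 := by
      refine integral_eq_zero_of_ae ?_
      filter_upwards [Lp.coeFn_zero (StrongDual ℝ V) 2 (timeMeasure T)] with t ht
      rw [ht, Pi.zero_apply, smul_zero]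
    rw [h0, zero_apply]

section Main

variable {T : ℝ} {n : ℕ} {s : ℝ≥0} {Ω : Set (EuclideanSpace ℝ (Fin n))}

theorem inner_toL2_eq_integral {h : L2On Ω} {g : EuclideanSpace ℝ (Fin n) → ℝ}
    (hg : h =ᵐ[volume.restrict Ω] g) (v : HsTilde s Ω) :
    inner ℝ h (HsTilde.toL2 s Ω v) = ∫ x in Ω, g x * Hs.toL2 n s v x := by
  rw [L2.inner_def]
  apply integral_congr_ae
  filter_upwards [hg, Hs.coeFn_restrict Ω (v : Hs n s)] with x h1 h2
  change inner ℝ (h x) (Hs.restrict s Ω v x) = _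
  rw [h1, h2]
  exact mul_comm _ _

theorem equation_iff {f : EuclideanSpace ℝ (Fin n) → ℝ → ℝ} {u : WExt T s Ω}
    {q g : L2T T (StrongDual ℝ (HsTilde s Ω))}
    (hq : (pairingT T s Ω (WExt.dt u), q) ∈ weakDerivPairs T (StrongDual ℝ (HsTilde s Ω)))
    {F : Hs n s → L2On Ω}
    (hF : ∀ w, F w =ᵐ[volume.restrict Ω] fun x => f x (Hs.toL2 n s w x))
    (hg : ∀ᵐ t ∂(timeMeasure T), g t = fracLap s Ω (WExt.dt u t) + fracLap s Ω (WExt.fn u t) +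
      dualEmb (HsTilde.toL2 s Ω) (F (WExt.fn u t))) :
    (∀ v ∈ HsTilde s Ω, ∀ η : ℝ → ℝ, IsTimeTest T η →
      -(∫ t in Ioo 0 T, deriv η t * ∫ x in Ω, Hs.toL2 n s (WExt.dt u t) x * Hs.toL2 n s v x) +
        ∫ t in Ioo 0 T, η t * (fracForm (WExt.dt u t) v + fracForm (WExt.fn u t) v +
          ∫ x in Ω, f x (Hs.toL2 n s (WExt.fn u t) x) * Hs.toL2 n s v x) = 0) ↔ q + g = 0 := by
  rw [← forall_weak_iff hq]
  have h1 : ∀ (v : HsTilde s Ω) (η : ℝ → ℝ),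
      ∫ t in Ioo 0 T, deriv η t * ∫ x in Ω, Hs.toL2 n s (WExt.dt u t) x * Hs.toL2 n s v x =
        ∫ t, deriv η t * pairingT T s Ω (WExt.dt u) t v ∂(timeMeasure T) := by
    intro v η
    apply integral_congr_ae
    filter_upwards [coeFn_compL2T (Hs n s) (StrongDual ℝ (HsTilde s Ω)) (pairing s Ω)
      (WExt.dt u)] with t ht
    have ht' : pairingT T s Ω (WExt.dt u) t = pairing s Ω (WExt.dt u t) := ht
    simp only [ht', pairing_apply]
    rw [inner_toL2_eq_integral (Hs.coeFn_restrict Ω (WExt.dt u t)) v]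
  have h2 : ∀ (v : HsTilde s Ω) (η : ℝ → ℝ),
      ∫ t in Ioo 0 T, η t * (fracForm (WExt.dt u t) v + fracForm (WExt.fn u t) v +
          ∫ x in Ω, f x (Hs.toL2 n s (WExt.fn u t) x) * Hs.toL2 n s v x) =
        ∫ t, η t * g t v ∂(timeMeasure T) := by
    intro v η
    apply integral_congr_ae
    filter_upwards [hg] with t ht
    simp only [ht, add_apply, fracLap_apply, dualEmb_apply]
    rw [inner_toL2_eq_integral (hF (WExt.fn u t)) v]
  constructor
  · intro h v η hη
    rw [← h1, ← h2]
    exact h v v.2 η hη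
  · intro h v hv η hη
    have := h ⟨v, hv⟩ η hη
    rw [← h1, ← h2] at this
    exact this

theorem exists_solution_map (hn : 1 ≤ n) (hΩ : IsBoundedLipschitzDomain Ω) (hT : 0 < T)
    {f : EuclideanSpace ℝ (Fin n) → ℝ → ℝ} {a : EuclideanSpace ℝ (Fin n) → ℝ} {r : ℝ} (hr : 0 < r)
    (hf : GrowthAssumption s Ω f a r) (hf0 : ∀ᵐ x ∂(volume.restrict Ω), f x 0 = 0) :
    ∃ (U₀ : Set (WRest T s Ω)) (U₁ : Set (WExt T s Ω)) (S : WRest T s Ω → WExt T s Ω),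
      IsOpen U₀ ∧ 0 ∈ U₀ ∧ IsOpen U₁ ∧ 0 ∈ U₁ ∧
      (∀ φ ∈ U₀, S φ ∈ U₁ ∧ IsSolution f φ (S φ) ∧ ∀ u ∈ U₁, IsSolution f φ u → u = S φ) ∧
      ContDiffOn ℝ 1 S U₀ := by
  obtain ⟨Q, N, hN, hN0, hN', hQN⟩ := exists_nonlinearity hn hΩ.isBounded hr hf hf0
  obtain ⟨M, hM, hM0, hM', hMN⟩ := WExt.exists_superposition hT hN hN0 hN'
  let B : Hs n s →L[ℝ] StrongDual ℝ (HsTilde s Ω) :=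
    fracLap s Ω + (dualEmb (HsTilde.toL2 s Ω)).comp (Q.comp (Hs.restrict s Ω))
  obtain ⟨AT, hAT⟩ : ∃ AT : L2T T (Hs n s) →L[ℝ] L2T T (StrongDual ℝ (HsTilde s Ω)),
    AT = (fracLap s Ω).compLpL 2 (timeMeasure T) := ⟨_, rfl⟩
  obtain ⟨BT, hBT⟩ : ∃ BT : L2T T (Hs n s) →L[ℝ] L2T T (StrongDual ℝ (HsTilde s Ω)),
    BT = B.compLpL 2 (timeMeasure T) := ⟨_, rfl⟩
  obtain ⟨Φ, K, L, h0, h1, h1', h2, hK, hL, huniq⟩ := WExt.exists_waveOp hΩ hT B AT BT hAT hBT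
  -- J places the nonlinear term in the force component, with zero initial data.
  let J : L2T T (StrongDual ℝ (HsTilde s Ω)) →L[ℝ]
      HsTilde s Ω × L2On Ω × L2T T (StrongDual ℝ (HsTilde s Ω)) :=
    (ContinuousLinearMap.inr ℝ _ _).comp (ContinuousLinearMap.inr ℝ _ _)
  have heq : ∀ u : WExt T s Ω, (∀ v ∈ HsTilde s Ω, ∀ η : ℝ → ℝ, IsTimeTest T η →
      -(∫ t in Ioo 0 T, deriv η t * ∫ x in Ω, Hs.toL2 n s (WExt.dt u t) x * Hs.toL2 n s v x) +
        ∫ t in Ioo 0 T, η t * (fracForm (WExt.dt u t) v + fracForm (WExt.fn u t) v +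
          ∫ x in Ω, f x (Hs.toL2 n s (WExt.fn u t) x) * Hs.toL2 n s v x) = 0) ↔
      (Φ u).2.2 + M u = 0 := by
    intro u
    have hg : ∀ᵐ t ∂(timeMeasure T), (AT (WExt.dt u) + BT (WExt.fn u) + M u) t =
        fracLap s Ω (WExt.dt u t) + fracLap s Ω (WExt.fn u t) + dualEmb (HsTilde.toL2 s Ω)
          (Q (Hs.restrict s Ω (WExt.fn u t)) + N (WExt.fn u t)) := by
      have k1 := coeFn_compL2T (Hs n s) (StrongDual ℝ (HsTilde s Ω)) (fracLap s Ω) (WExt.dt u)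
      have k2 := coeFn_compL2T (Hs n s) (StrongDual ℝ (HsTilde s Ω)) B (WExt.fn u)
      rw [← hAT] at k1
      rw [← hBT] at k2
      filter_upwards [k1, k2, hMN u, Lp.coeFn_add (AT (WExt.dt u) + BT (WExt.fn u)) (M u),
        Lp.coeFn_add (AT (WExt.dt u)) (BT (WExt.fn u))] with t m1 m2 m3 m4 m5
      rw [m4, Pi.add_apply, m5, Pi.add_apply, m1, m2, m3, map_add]
      change _ + (fracLap s Ω (WExt.fn u t) + dualEmb (HsTilde.toL2 s Ω)
        (Q (Hs.restrict s Ω (WExt.fn u t)))) + _ = _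
      abel
    refine (equation_iff (h2 u) hQN hg).trans ?_
    rw [show (Φ u).2.2 - (AT (WExt.dt u) + BT (WExt.fn u)) +
      (AT (WExt.dt u) + BT (WExt.fn u) + M u) = (Φ u).2.2 + M u by abel]
  -- The initial conditions of a solution are the vanishing of the first two components of Φu. The
  -- velocity condition passes between L²(ℝⁿ) and L²(Ω) by restriction and zero extension.
  have hsol : ∀ φ u, IsSolution f φ u ↔
      restrictExt T s Ω (WExt.fn u) = WRest.fn φ ∧ Φ u + J (M u) = 0 := by
    intro φ u
    have e : Φ u + J (M u) = 0 ↔ (Φ u).1 = 0 ∧ (Φ u).2.1 = 0 ∧ (Φ u).2.2 + M u = 0 := by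
      have : Φ u + J (M u) = ((Φ u).1 + 0, (Φ u).2.1 + 0, (Φ u).2.2 + M u) := rfl
      rw [this, Prod.mk_eq_zero, Prod.mk_eq_zero, add_zero, add_zero]
    rw [e, ← heq u]
    constructor
    · rintro ⟨k1, k2, k3, k4⟩
      refine ⟨k2, Subtype.ext ((h0 u).unique hT k3), (h1 u).unique hT ?_, k1⟩
      have := k4.clm (LpToLpRestrictCLM (EuclideanSpace ℝ (Fin n)) ℝ ℝ volume 2 Ω)
      rw [map_zero] at this
      exact this
    · rintro ⟨k1, k2, k3, k4⟩
      refine ⟨k4, k1, ?_, ?_⟩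
      · have := h0 u
        rwa [k2] at this
      · have := h1' u
        rwa [k3, map_zero] at this
  have := completeSpace_WExt (s := s) (Ω := Ω) hT
  -- The element u + KJ(M u) − Lφ has image Φu + J(M u) under Φ, and its exterior value is that of u
  -- minus φ. By uniqueness it is zero exactly when both vanish, that is, when u is a solution.
  have hiff : ∀ φ u, IsSolution f φ u ↔ u + (K.comp J) (M u) = L φ := by
    intro φ u
    rw [hsol, ← sub_eq_zero (b := L φ)]
    have e1 : Φ (u + (K.comp J) (M u) - L φ) = Φ u + J (M u) := by
      rw [map_sub, map_add, (hL φ).1, sub_zero, ContinuousLinearMap.comp_apply, (hK _).1]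
    have e2 : restrictExt T s Ω (WExt.fn (u + (K.comp J) (M u) - L φ)) =
        restrictExt T s Ω (WExt.fn u) - WRest.fn φ := by
      have h : WExt.fn (u + (K.comp J) (M u) - L φ) =
          WExt.fn u + WExt.fn (K (J (M u))) - WExt.fn (L φ) := by
        simp only [← WExt.fnL_apply, map_sub, map_add, ContinuousLinearMap.comp_apply]
      rw [h, map_sub, map_add, (hK _).2, (hL φ).2, add_zero]
    constructor
    · rintro ⟨k1, k2⟩
      exact huniq _ (by rw [e2, k1, sub_self]) (by rw [e1, k2])
    · intro h
      have h3 : WExt.fn (0 : WExt T s Ω) = 0 := map_zero (WExt.fnL T s Ω)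
      rw [h, map_zero] at e1
      rw [h, h3, map_zero] at e2
      exact ⟨sub_eq_zero.1 e2.symm, e1.symm⟩
  obtain ⟨U₀, U₁, S, g1, g2, g3, g4, g5, g6⟩ :=
    exists_local_solution_map hM hM0 hM' (K.comp J) L
  refine ⟨U₀, U₁, S, g1, g2, g3, g4, fun φ hφ => ?_, g6⟩
  obtain ⟨k1, k2, k3⟩ := g5 φ hφ
  exact ⟨k1, (hiff φ _).2 k2, fun u hu h => k3 u hu ((hiff φ u).1 h)⟩

end Main

end ViscousWave

end

/-! ### The theorem -/

open ViscousWave in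
theorem theorem3p6 {n : ℕ} (hn : 1 ≤ n) {Ω : Set (EuclideanSpace ℝ (Fin n))}
    (hΩ : IsBoundedLipschitzDomain Ω) {T : ℝ} (hT : 0 < T) {s : ℝ≥0} (hs : 0 < s)
    {f : EuclideanSpace ℝ (Fin n) → ℝ → ℝ} {a : EuclideanSpace ℝ (Fin n) → ℝ} {r : ℝ} (hr : 0 < r)
    (hf : GrowthAssumption s Ω f a r) (hf0 : ∀ᵐ x ∂(volume.restrict Ω), f x 0 = 0) :
    ∃ (U₀ : Set (WRest T s Ω)) (U₁ : Set (WExt T s Ω)) (S : WRest T s Ω → WExt T s Ω),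
      IsOpen U₀ ∧ 0 ∈ U₀ ∧ IsOpen U₁ ∧ 0 ∈ U₁ ∧
      (∀ φ ∈ U₀, S φ ∈ U₁ ∧ IsSolution f φ (S φ) ∧ ∀ u ∈ U₁, IsSolution f φ u → u = S φ) ∧
      ContDiffOn ℝ 1 S U₀ := by
  exact exists_solution_map hn hΩ hT hr hf hf0
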